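/- For a prime $q$, let $\mathbb{F}_q^n$ be the $n$-dimensional vector space over $\mathbb{F}_q$. A $q$-Steiner system $\mathcal{S}_q[t,k,n]$ is a set $\mathcal{S}$ of $k$-dimensional subspaces of $\mathbb{F}_q^n$ such that every $t$-dimensional subspace of $\mathbb{F}_q^n$ is contained in exactly one element of $\mathcal{S}$. The group $\mathrm{GL}(n,q)$ acts on subspaces, and hence on sets of subspaces; a subgroup $A\le \mathrm{GL}(n,q)$ is a group of automorphisms of $\mathcal{S}$ if $\mathcal{S}^g=\mathcal{S}$ for all $g\in A$. A Singer subgroup of $\mathrm{GL}(n,q)$ is a cyclic subgroup generated by an element of order $q^n-1$ (a Singer cycle). The Galois group $\mathrm{Gal}(\mathbb{F}_{q^n}/\mathbb{F}_q)$ is regarded as a subgroup of $\mathrm{GL}(n,q)$ through an $\mathbb{F}_q$-linear identification of $\mathbb{F}_q^n$ with $\mathbb{F}_{q^n}$. Then $q$-Steiner systems with the following parameters and groups of automorphisms do not exist (for any choice of the identification, respectively of the Singer subgroup): 1. $\mathcal{S}_2[2,3,7]$ with the Galois group $\mathrm{Gal}(\mathbb{F}_{2^7}/\mathbb{F}_2)$;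 2. $\mathcal{S}_2[3,4,8]$ with a Singer subgroup of $\mathrm{GL}(8,2)$; 3. $\mathcal{S}_2[2,4,10]$ with the normalizer in $\mathrm{GL}(10,2)$ of a Singer subgroup; 4. $\mathcal{S}_2[2,4,13]$ with the normalizer in $\mathrm{GL}(13,2)$ of a Singer subgroup; 5. $\mathcal{S}_2[3,4,10]$ with the normalizer in $\mathrm{GL}(10,2)$ of a Singer subgroup; 6. $\mathcal{S}_3[2,3,7]$ with a Singer subgroup of $\mathrm{GL}(7,3)$; 7. $\mathcal{S}_5[2,3,7]$ with the normalizer in $\mathrm{GL}(7,5)$ of a Singer subgroup. -/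

import Mathlib

/-- The field `ZMod 5` needs the primality of `5` to be visible to instance search
(Mathlib provides this for `2` and `3`). -/
instance instFactPrimeFive : Fact (Nat.Prime 5) := ⟨Nat.prime_five⟩

namespace QSteiner

section

variable {K V : Type*} [Field K] [AddCommGroup V] [Module K V]

/-- A `t`-`(n, k, l)` design over the field `K`, in the vector space `V` of dimension `n`: a set
`S` of `k`-dimensional subspaces of `V` (the blocks) such that every `t`-dimensional subspace of
`V` is contained in exactly `l` blocks. -/
def IsDesign (t k l : ℕ) (S : Set (Submodule K V)) : Prop :=
  (∀ B ∈ S, Module.finrank K B = k) ∧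
    ∀ T : Submodule K V, Module.finrank K T = t → {B ∈ S | T ≤ B}.encard = l

/-- The image `S^g` of a set `S` of subspaces under a linear automorphism `g` of `V`. -/
def image (g : V ≃ₗ[K] V) (S : Set (Submodule K V)) : Set (Submodule K V) :=
  (fun B : Submodule K V => B.map (g : V →ₗ[K] V)) '' S

theorem image_one (S : Set (Submodule K V)) : image (1 : V ≃ₗ[K] V) S = S := by
  have h : (fun B : Submodule K V => B.map ((1 : V ≃ₗ[K] V) : V →ₗ[K] V)) = id := by
    funext B
    exact Submodule.map_id B
  rw [image, h, Set.image_id]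

theorem image_mul (g h : V ≃ₗ[K] V) (S : Set (Submodule K V)) :
    image (g * h) S = image g (image h S) := by
  rw [image, image, image, Set.image_image]
  refine Set.image_congr fun B _ => ?_
  exact Submodule.map_comp (h : V →ₗ[K] V) (g : V →ₗ[K] V) B

/-- The automorphism group `Aut(S)` of a set `S` of subspaces of `V`: the subgroup of `GL(V)`
consisting of all `g` with `S^g = S`. -/
def autGroup (S : Set (Submodule K V)) : Subgroup (V ≃ₗ[K] V) where
  carrier := {g | image g S = S}
  one_mem' := image_one S
  mul_mem' := by
    intro g h hg hh
    simp only [Set.mem_ofPred_eq] at hg hh ⊢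
    rw [image_mul, hh, hg]
  inv_mem' := by
    intro g hg
    simp only [Set.mem_ofPred_eq] at hg ⊢
    conv_lhs => rw [← hg]
    rw [← image_mul, inv_mul_cancel, image_one]

/-- The copy in `GL(V)` of the Galois group of an extension field `L` of `K`, for a given
`K`-linear identification `e` of `V` with `L`. -/
def galoisSubgroup {L : Type*} [Field L] [Algebra K L] (e : V ≃ₗ[K] L) :
    Subgroup (V ≃ₗ[K] V) where
  carrier := {g | ∃ s : L ≃ₐ[K] L, ∀ v, e (g v) = s (e v)}
  one_mem' := ⟨1, fun _ => rfl⟩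
  mul_mem' := by
    rintro g h ⟨s, hs⟩ ⟨r, hr⟩
    refine ⟨s * r, fun v => ?_⟩
    rw [LinearEquiv.mul_apply, hs, hr, AlgEquiv.mul_apply]
  inv_mem' := by
    rintro g ⟨s, hs⟩
    refine ⟨s⁻¹, fun v => ?_⟩
    have h : g (g⁻¹ v) = v := by
      rw [← LinearEquiv.mul_apply, mul_inv_cancel]; rfl
    apply s.injective
    rw [← hs, h, ← AlgEquiv.mul_apply, mul_inv_cancel, AlgEquiv.one_apply]

end

/-- A `q`-Steiner system `S_q[t, k, n]` for a prime `q`: a `t`-`(n, k, 1)` design over `F_q`. -/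
def IsSteinerSystem (q : ℕ) [Fact q.Prime] (t k n : ℕ)
    (S : Set (Submodule (ZMod q) (Fin n → ZMod q))) : Prop :=
  IsDesign t k 1 S

/-- The group `GL(n, q)` for a prime `q`, as the group of linear automorphisms of `F_q ^ n`. -/
abbrev GLin (n q : ℕ) : Type := (Fin n → ZMod q) ≃ₗ[ZMod q] (Fin n → ZMod q)

/-- A Singer cycle of `GL(n, q)`: an element of order `q ^ n - 1`. -/
def IsSingerCycle {n q : ℕ} (g : GLin n q) : Prop :=
  orderOf g = q ^ n - 1

/-- A Singer subgroup of `GL(n, q)`: the cyclic subgroup generated by a Singer cycle. -/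
def IsSingerSubgroup {n q : ℕ} (C : Subgroup (GLin n q)) : Prop :=
  ∃ g : GLin n q, IsSingerCycle g ∧ C = Subgroup.zpowers g

/-- There is a `q`-Steiner system `S_q[t, k, n]` admitting `A` as a group of automorphisms. -/
def Admits (q : ℕ) [Fact q.Prime] (t k n : ℕ) (A : Subgroup (GLin n q)) : Prop :=
  ∃ S : Set (Submodule (ZMod q) (Fin n → ZMod q)),
    IsSteinerSystem q t k n S ∧ A ≤ autGroup S

end QSteiner

/-!
The theorem collects seven nonexistence results, for which the following reasons are responsible.

For `S_2[2, 4, 10]` no group is needed: by `IsDesign.ncard_mul`, the number of blocks would not be an integer.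

For the other parameters, the vector space is identified with the field `L` with `q ^ n` elements. For the Galois
group this is part of the hypothesis. For a Singer cycle `g`, the algebra `F_q[g]` has at most `q ^ n` elements and
contains the `q ^ n - 1` powers of `g`, so it is a field, over which the vector space has dimension one
(`exists_field_design`). Invariance under the Singer subgroup becomes invariance under multiplication by nonzero
elements of `L`; the normalizer also contains the Frobenius map `x ↦ x ^ q`.

* `S_2[2, 3, 7]` with the Galois group: the number `381` of blocks is `3` modulo `7`, so at least three blocks are
  invariant under the Frobenius map. The nonzero elements of such a block form one orbit, and `v + v ^ 2` is in the
  orbit of `v`, which makes `v` a root of a certain polynomial of degree `14` (`fano_fixed_block`). But three blocks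
  have `21` nonzero elements.

* For `t = 2` and prime `n`, two different lines of a block are never equivalent under a map `x ↦ d x ^ (q ^ i)` of
  the group: the map would stabilize the block, hence have too many fixed points up to scalars
  (`TwistInvariant.scalar_of_pair`). For `S_5[2, 3, 7]` this contradicts the existence of a block through one given
  line: each of the `781` planes containing it contains two equivalent lines, as is shown by a witness for each of
  them (`check57_false`).

* Consequently, if the lines are coloured by their orbits (`IsColouring`), then the lines of a block have different
  colours (`IsColouring.line_unique`), and blocks with a common colour have the same colours
  (`IsColouring.coloursOf_subset`). So the sets of colours of the blocks form a partition of the set of all colours.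
  For `S_3[2, 3, 7]`, a search through the blocks containing certain lines shows that there is no such partition
  (`coverSearch_sound`). For `S_2[2, 4, 13]`, it is enough to consider two blocks: for all candidates for the block
  through one given line, there is another line, whose colour is not among the colours of the candidate, such that
  no candidate for a block through this line has only new colours (`searchB213_spec`, `exists_row213`).

* For `S_2[3, 4, 8]`, the same search is carried out with orbits of three-dimensional subspaces `T`. They are
  distinguished by quotients of the coefficients of the polynomial of degree eight whose set of roots is `T`
  (`tripleKey`).

* For `S_2[3, 4, 10]`, let `F` be the subfield with `32` elements, generated by `y`. A block containing a
  three-dimensional subspace and its image under `u ↦ u ^ 32` is invariant under this involution; in particular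
  this holds for the block through `1`, `y`, `y ^ 2`, which therefore depends on two parameters `m` and `b` only
  (`exists_base_block`). The blocks meeting `F` in dimension three are images of it under the group. All other
  blocks through `1`, `y` and an element `u + v w` with `u ∈ F`, `v ∈ {1, y, 1 + y}`, where `w` is a primitive third
  root of unity, have a basis `1`, `y`, `u + w`, `u' + y w` (`IsGood.exists_cell`). They would group the spaces
  `⟨1, y, u + v w⟩` that are not contained in images of the first block into triples with one space for each value
  of `v`, where the three values of `u` have sum zero modulo `⟨1, y⟩`. For all values of the two parameters,
  this contradicts the numbers of these spaces or a parity (`typeTwo_check`).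

The finite searches are evaluated by the kernel. Elements of `L` are written as numbers, the codes, whose digits
in base `q` are their coordinates (`evc`); products and colours are found in tables of discrete logarithms. No
table has to be trusted: logarithms are checked by following the powers of the generator (`walkB`), colourings by
their invariance and by paths to representatives (`colourCheck`). Definitions that are meant for
evaluation are written in terms of recursors and of operations on numbers that the kernel evaluates directly.
-/


namespace QSteiner

section Design

variable {K V : Type*} [Field K] [AddCommGroup V] [Module K V]

/-! ### Blocks of a design -/

theorem IsDesign.exists_block {t k : ℕ} {S : Set (Submodule K V)} (hS : IsDesign t k 1 S)
    {T : Submodule K V} (hT : Module.finrank K T = t) : ∃ B ∈ S, T ≤ B := by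
  have h := hS.2 T hT
  rw [Nat.cast_one, Set.encard_eq_one] at h
  obtain ⟨B, hB⟩ := h
  have : B ∈ {B ∈ S | T ≤ B} := by rw [hB]; rfl
  exact ⟨B, this.1, this.2⟩

theorem IsDesign.block_unique {t k : ℕ} {S : Set (Submodule K V)} (hS : IsDesign t k 1 S)
    {T B B' : Submodule K V} (hT : Module.finrank K T = t) (hB : B ∈ S) (hB' : B' ∈ S)
    (h : T ≤ B) (h' : T ≤ B') : B = B' := by
  have h1 := hS.2 T hT
  rw [Nat.cast_one, Set.encard_eq_one] at h1
  obtain ⟨C, hC⟩ := h1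
  have e : B ∈ {B ∈ S | T ≤ B} := ⟨hB, h⟩
  have e' : B' ∈ {B ∈ S | T ≤ B} := ⟨hB', h'⟩
  rw [hC] at e e'
  exact e.trans e'.symm

/-- Transport of a design along a linear isomorphism. -/
theorem IsDesign.map {W : Type*} [AddCommGroup W] [Module K W] {t k l : ℕ}
    {S : Set (Submodule K V)} (hS : IsDesign t k l S) (e : V ≃ₗ[K] W) :
    IsDesign t k l ((fun B : Submodule K V => B.map (e : V →ₗ[K] W)) '' S) := by
  refine ⟨?_, fun T hT => ?_⟩
  · rintro _ ⟨B, hB, rfl⟩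
    rw [← hS.1 B hB]
    exact (e.submoduleMap B).finrank_eq.symm
  · have hT' : Module.finrank K (T.map (e.symm : W →ₗ[K] V)) = t := by
      rw [← hT]
      exact (e.symm.submoduleMap T).finrank_eq.symm
    rw [← hS.2 _ hT']
    have hinj : Function.Injective (fun B : Submodule K V => B.map (e : V →ₗ[K] W)) :=
      Submodule.map_injective_of_injective e.injective
    rw [← hinj.encard_image]
    congr 1
    ext C
    simp only [Set.mem_image, Set.mem_ofPred_eq]
    constructor
    · rintro ⟨⟨B, hB, rfl⟩, hle⟩
      refine ⟨B, ⟨hB, ?_⟩, rfl⟩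
      rw [Submodule.map_le_iff_le_comap]
      intro w hw
      obtain ⟨v, hv, hvw⟩ := hle hw
      simp only [Submodule.mem_comap, LinearEquiv.coe_coe]
      have : e.symm w = v := by rw [← hvw]; simp
      rw [this]; exact hv
    · rintro ⟨B, ⟨hB, hle⟩, rfl⟩
      refine ⟨⟨B, hB, rfl⟩, fun w hw => ?_⟩
      exact ⟨e.symm w, hle ⟨w, hw, rfl⟩, by simp⟩

/-- A vector and a non-multiple of it span a plane. -/
theorem finrank_span_pair {x y : V} (hx : x ≠ 0) (hy : ∀ c : K, y ≠ c • x) :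
    Module.finrank K (Submodule.span K {x, y}) = 2 := by
  have h : LinearIndependent K ![x, y] := by
    rw [LinearIndependent.pair_iff' hx]
    intro a h
    exact hy a h.symm
  have := finrank_span_eq_card h
  rw [show Set.range ![x, y] = {x, y} by simp [Matrix.range_cons, Matrix.range_empty, Set.pair_comm]] at this
  simpa using this

/-- In a `2`-design any two independent vectors lie in a unique block. -/
theorem IsDesign.exists_block_pair {k : ℕ} {S : Set (Submodule K V)} (hS : IsDesign 2 k 1 S)
    {x y : V} (hx : x ≠ 0) (hy : ∀ c : K, y ≠ c • x) : ∃ B ∈ S, x ∈ B ∧ y ∈ B := by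
  obtain ⟨B, hB, hle⟩ := hS.exists_block (finrank_span_pair hx hy)
  exact ⟨B, hB, hle (Submodule.subset_span (by simp)), hle (Submodule.subset_span (by simp))⟩

theorem IsDesign.block_unique_pair {k : ℕ} {S : Set (Submodule K V)} (hS : IsDesign 2 k 1 S)
    {x y : V} (hx : x ≠ 0) (hy : ∀ c : K, y ≠ c • x) {B B' : Submodule K V}
    (hB : B ∈ S) (hB' : B' ∈ S) (h1 : x ∈ B) (h2 : y ∈ B) (h1' : x ∈ B') (h2' : y ∈ B') :
    B = B' := by
  refine hS.block_unique (finrank_span_pair hx hy) hB hB' ?_ ?_ <;>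
  · rw [Submodule.span_le]
    rintro z (rfl | rfl) <;> assumption

/-- The number `b` of blocks of a `2`-`(n, k, 1)` design over `F_q` satisfies
`b (q ^ k - 1) (q ^ k - q) = (q ^ n - 1) (q ^ n - q)`: count ordered pairs of independent vectors. -/
theorem IsDesign.ncard_mul [Fintype K] [Finite V] {k : ℕ} {S : Set (Submodule K V)}
    (hS : IsDesign 2 k 1 S) (hk : 2 ≤ k) (hn : 2 ≤ Module.finrank K V) :
    S.ncard * ((Fintype.card K ^ k - 1) * (Fintype.card K ^ k - Fintype.card K)) =
      (Fintype.card K ^ Module.finrank K V - 1) *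
        (Fintype.card K ^ Module.finrank K V - Fintype.card K) := by
  classical
  have : Finite S := Set.toFinite S
  let P (W : Type _) [AddCommGroup W] [Module K W] := {s : Fin 2 → W // LinearIndependent K s}
  have hcard : ∀ (W : Type _) [AddCommGroup W] [Module K W] [Finite W],
      2 ≤ Module.finrank K W → Nat.card (P W) = (Fintype.card K ^ Module.finrank K W - 1) *
        (Fintype.card K ^ Module.finrank K W - Fintype.card K) := by
    intro W _ _ _ h
    have := card_linearIndependent (K := K) (V := W) h
    rw [this, Fin.prod_univ_two]
    simp
  have e : (Σ B : S, P B.1) ≃ P V := by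
    refine Equiv.ofBijective (fun p => ⟨fun i => (p.2.1 i : V),
      p.2.2.map' p.1.1.subtype (Submodule.ker_subtype _)⟩) ⟨?_, ?_⟩
    · rintro ⟨⟨B, hB⟩, ⟨s, hs⟩⟩ ⟨⟨B', hB'⟩, ⟨s', hs'⟩⟩ h
      have h : ∀ i, (s i : V) = s' i := fun i => congrFun (congrArg Subtype.val h) i
      have hli : LinearIndependent K (fun i => (s i : V)) :=
        hs.map' B.subtype (Submodule.ker_subtype _)
      have hT := finrank_span_eq_card hli
      have hBB : B = B' := by
        refine hS.block_unique hT hB hB' ?_ ?_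
        · rw [Submodule.span_le]; rintro _ ⟨i, rfl⟩; exact (s i).2
        · rw [Submodule.span_le]; rintro _ ⟨i, rfl⟩
          show (s i : V) ∈ B'
          rw [h i]; exact (s' i).2
      subst hBB
      have : s = s' := funext fun i => Subtype.ext (h i)
      subst this
      rfl
    · rintro ⟨s, hs⟩
      have hT := finrank_span_eq_card hs
      obtain ⟨B, hB, hle⟩ := hS.exists_block hT
      have hm : ∀ i, s i ∈ B := fun i => hle (Submodule.subset_span ⟨i, rfl⟩)
      refine ⟨⟨⟨B, hB⟩, ⟨fun i => ⟨s i, hm i⟩, ?_⟩⟩, rfl⟩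
      exact LinearIndependent.of_comp B.subtype hs
  have h1 := Nat.card_congr e
  have : Fintype S := Fintype.ofFinite S
  rw [Nat.card_sigma, hcard V hn] at h1
  rw [← h1, Finset.sum_congr rfl (fun B _ => by
    rw [hcard B.1 (by rw [hS.1 B.1 B.2]; exact hk), hS.1 B.1 B.2])]
  simp only [Finset.sum_const, smul_eq_mul, Finset.card_univ, ← Nat.card_coe_set_eq S,
    Nat.card_eq_fintype_card]

end Design

/-- The number of blocks of an `S_2[2, 4, 10]` would not be an integer. -/
theorem not_isSteinerSystem_2_2_4_10 (S : Set (Submodule (ZMod 2) (Fin 10 → ZMod 2))) :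
    ¬ IsSteinerSystem 2 2 4 10 S := by
  intro h
  have := IsDesign.ncard_mul h (by norm_num) (by simp)
  simp only [ZMod.card, Module.finrank_fin_fun] at this
  omega

/-! ### From Singer subgroups to finite fields -/

section Invariance

variable {K L : Type*} [Field K] [Field L] [Algebra K L]

/-- A set of `K`-subspaces of the field `L` is invariant under multiplication by nonzero elements
of `L`. Since multiplication preserves dimensions, it is enough to ask for an inclusion. -/
def ScaleInvariant (S : Set (Submodule K L)) : Prop :=
  ∀ c : L, c ≠ 0 → ∀ B ∈ S, ∃ B' ∈ S, ∀ x ∈ B, c * x ∈ B'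

/-- A set of `K`-subspaces of the field `L` is invariant under `x ↦ x ^ q`. -/
def FrobInvariant (q : ℕ) (S : Set (Submodule K L)) : Prop :=
  ∀ B ∈ S, ∃ B' ∈ S, ∀ x ∈ B, x ^ q ∈ B'

end Invariance

section Singer

open Polynomial

variable {q n : ℕ} [Fact q.Prime]

/-- Evaluation at `f`, as an algebra homomorphism `K[X] / (minpoly f) → End V`. -/
noncomputable def adjoinRootEval {K V : Type*} [Field K] [AddCommGroup V] [Module K V]
    (f : Module.End K V) : AdjoinRoot (minpoly K f) →ₐ[K] Module.End K V :=
  Ideal.Quotient.liftₐ (Ideal.span {minpoly K f}) (aeval f) fun a ha => by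
    obtain ⟨b, rfl⟩ := Ideal.mem_span_singleton.1 ha
    rw [map_mul, minpoly.aeval, zero_mul]

theorem adjoinRootEval_mk {K V : Type*} [Field K] [AddCommGroup V] [Module K V]
    (f : Module.End K V) (p : K[X]) :
    adjoinRootEval f (AdjoinRoot.mk (minpoly K f) p) = aeval f p := rfl

theorem adjoinRootEval_root {K V : Type*} [Field K] [AddCommGroup V] [Module K V]
    (f : Module.End K V) : adjoinRootEval f (AdjoinRoot.root (minpoly K f)) = f := by
  rw [← AdjoinRoot.mk_X, adjoinRootEval_mk, aeval_X]

/-- The algebra `F_q[g]` generated by a Singer cycle `g` has at most `q ^ n` elements by the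
Cayley–Hamilton theorem, and contains the `q ^ n - 1` powers of `g`; hence it is a field, it has
`q ^ n` elements, and `g` generates its multiplicative group. -/
theorem IsSingerCycle.exists_pow_root (hn : n ≠ 0) {g : GLin n q} (hg : IsSingerCycle g) :
    Nat.card (AdjoinRoot (minpoly (ZMod q) (g : (Fin n → ZMod q) →ₗ[ZMod q] (Fin n → ZMod q))))
        = q ^ n ∧
      AdjoinRoot.root (minpoly (ZMod q) (g : (Fin n → ZMod q) →ₗ[ZMod q] (Fin n → ZMod q)))
        ^ (q ^ n - 1) = 1 ∧
      ∀ x : AdjoinRoot (minpoly (ZMod q) (g : (Fin n → ZMod q) →ₗ[ZMod q] (Fin n → ZMod q))),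
        x ≠ 0 → ∃ i : ℕ, x = AdjoinRoot.root _ ^ i := by
  classical
  set f : Module.End (ZMod q) (Fin n → ZMod q) := (g : (Fin n → ZMod q) →ₗ[ZMod q] (Fin n → ZMod q)) with hf
  set m := minpoly (ZMod q) f with hm
  have hq : 1 < q := (Fact.out : q.Prime).one_lt
  have hint : IsIntegral (ZMod q) f := Algebra.IsIntegral.isIntegral f
  have hmonic : m.Monic := minpoly.monic hint
  have hdeg : m.natDegree ≤ n := by
    have h1 : m ∣ f.charpoly := LinearMap.minpoly_dvd_charpoly f
    have h2 := natDegree_le_of_dvd h1 (LinearMap.charpoly_monic f).ne_zero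
    rwa [LinearMap.charpoly_natDegree, Module.finrank_fin_fun] at h2
  have : Module.Finite (ZMod q) (AdjoinRoot m) := hmonic.finite_adjoinRoot
  have : Finite (AdjoinRoot m) := Module.finite_of_finite (ZMod q)
  have hcard : Nat.card (AdjoinRoot m) = q ^ m.natDegree := by
    rw [Module.natCard_eq_pow_finrank (K := ZMod q), (AdjoinRoot.powerBasis' hmonic).finrank,
      AdjoinRoot.powerBasis'_dim, Nat.card_eq_fintype_card, ZMod.card]
  -- evaluation at `g`
  let ev : AdjoinRoot m →ₐ[ZMod q] Module.End (ZMod q) (Fin n → ZMod q) := adjoinRootEval f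
  have hev : ∀ i : ℕ, ev (AdjoinRoot.root m ^ i) = ((g ^ i : GLin n q) : _ →ₗ[ZMod q] _) := by
    intro i
    rw [map_pow]
    have : ev (AdjoinRoot.root m) = f := adjoinRootEval_root f
    rw [this]
    induction i with
    | zero => rfl
    | succ i ih => rw [pow_succ, ih, pow_succ]; rfl
  have hne : Nontrivial (Fin n → ZMod q) := by
    have : Nonempty (Fin n) := ⟨⟨0, Nat.pos_of_ne_zero hn⟩⟩
    infer_instance
  let F : Fin (q ^ n - 1) → {x : AdjoinRoot m // x ≠ 0} := fun i =>
    ⟨AdjoinRoot.root m ^ (i : ℕ), fun h => by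
      have h1 := hev i
      rw [h, map_zero] at h1
      obtain ⟨v, hv⟩ := exists_ne (0 : Fin n → ZMod q)
      have h2 := LinearMap.congr_fun h1 v
      have h3 : (g ^ (i : ℕ) : GLin n q) v = 0 := h2.symm
      exact hv ((LinearEquiv.map_eq_zero_iff _).1 h3)⟩
  have hFinj : Function.Injective F := by
    intro i j h
    have h1 : AdjoinRoot.root m ^ (i : ℕ) = AdjoinRoot.root m ^ (j : ℕ) := congrArg Subtype.val h
    have h2 : (g ^ (i : ℕ) : GLin n q) = g ^ (j : ℕ) := by
      apply LinearEquiv.toLinearMap_injective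
      rw [← hev, ← hev, h1]
    have hi : (i : ℕ) < orderOf g := i.2.trans_eq hg.symm
    have hj : (j : ℕ) < orderOf g := j.2.trans_eq hg.symm
    exact Fin.ext (pow_injOn_Iio_orderOf hi hj h2)
  have hc2 : Nat.card {x : AdjoinRoot m // x ≠ 0} = q ^ m.natDegree - 1 := by
    have := Fintype.ofFinite (AdjoinRoot m)
    rw [Nat.card_eq_fintype_card, Fintype.card_subtype_compl, Fintype.card_subtype_eq,
      ← Nat.card_eq_fintype_card, hcard]
  have hle := Nat.card_le_card_of_injective F hFinj
  rw [Nat.card_fin, hc2] at hle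
  have hpos : 0 < q ^ n := by positivity
  have hpos' : 0 < q ^ m.natDegree := by positivity
  have h1 : q ^ n ≤ q ^ m.natDegree := by omega
  have h2 : n ≤ m.natDegree := (Nat.pow_le_pow_iff_right hq).1 h1
  have hdn : m.natDegree = n := le_antisymm hdeg h2
  have hevinj : Function.Injective ev := by
    rw [injective_iff_map_eq_zero]
    intro x hx
    obtain ⟨p, rfl⟩ := AdjoinRoot.mk_surjective x
    have h1 : aeval f p = 0 := by
      rw [← hx]
      rfl
    exact AdjoinRoot.mk_eq_zero.2 (minpoly.dvd _ _ h1)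
  refine ⟨by rw [hcard, hdn], ?_, fun x hx => ?_⟩
  · apply hevinj
    rw [hev, map_one, ← hg, pow_orderOf_eq_one]
    rfl
  have hbij : Function.Bijective F := by
    refine (Nat.bijective_iff_injective_and_card F).2 ⟨hFinj, ?_⟩
    rw [hc2, hdn, Nat.card_fin]
  obtain ⟨i, hi⟩ := hbij.2 ⟨x, hx⟩
  exact ⟨i, (congrArg Subtype.val hi).symm⟩

theorem exists_mem_of_mem_autGroup {V : Type*} {K : Type*} [Field K] [AddCommGroup V] [Module K V]
    {S : Set (Submodule K V)} {g : V ≃ₗ[K] V} (hg : g ∈ autGroup S) {B : Submodule K V}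
    (hB : B ∈ S) : B.map (g : V →ₗ[K] V) ∈ S := by
  have h : image g S = S := hg
  rw [← h]
  exact ⟨B, hB, rfl⟩

/-- A design on `F_q ^ n` that is invariant under a Singer subgroup is a design on the field with
`q ^ n` elements that is invariant under scaling; under the normalizer of the Singer subgroup, it is
also invariant under the Frobenius map. -/
theorem exists_field_design (hn : n ≠ 0) {t k : ℕ} {C A : Subgroup (GLin n q)}
    (hC : IsSingerSubgroup C) (hCA : C ≤ A) (h : Admits q t k n A) :
    ∃ (L : Type) (_ : Field L) (_ : Algebra (ZMod q) L), Nat.card L = q ^ n ∧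
      ∃ S : Set (Submodule (ZMod q) L), IsDesign t k 1 S ∧ ScaleInvariant S ∧
        (Subgroup.normalizer (C : Set (GLin n q)) ≤ A → FrobInvariant q S) := by
  classical
  obtain ⟨g, hg, rfl⟩ := hC
  obtain ⟨S, hS, hA⟩ := h
  obtain ⟨hcard, hone, hpow⟩ := hg.exists_pow_root hn
  set f : Module.End (ZMod q) (Fin n → ZMod q) := (g : (Fin n → ZMod q) →ₗ[ZMod q] (Fin n → ZMod q)) with hf
  set m := minpoly (ZMod q) f with hm
  have hq : 1 < q := (Fact.out : q.Prime).one_lt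
  have hfin : Finite (AdjoinRoot m) := Nat.finite_of_card_ne_zero (by rw [hcard]; positivity)
  have hnt : Nontrivial (AdjoinRoot m) := by
    rw [← Finite.one_lt_card_iff_nontrivial, hcard]
    exact Nat.one_lt_pow hn hq
  have hroot : IsUnit (AdjoinRoot.root m) := by
    refine IsUnit.of_pow_eq_one hone ?_
    have := Nat.one_lt_pow hn hq
    omega
  let iF : IsField (AdjoinRoot m) :=
    { exists_pair_ne := exists_pair_ne _
      mul_comm := mul_comm
      mul_inv_cancel := fun {a} ha => by
        obtain ⟨i, hi⟩ := hpow a ha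
        obtain ⟨b, hb⟩ := (hroot.pow i).exists_right_inv
        exact ⟨b, by rw [hi, hb]⟩ }
  let iL : Field (AdjoinRoot m) := iF.toField
  -- the field acts on `F_q ^ n`, the root of `m` acting as `g`
  let ev : AdjoinRoot m →ₐ[ZMod q] Module.End (ZMod q) (Fin n → ZMod q) := adjoinRootEval f
  have hevroot : ev (AdjoinRoot.root m) = f := adjoinRootEval_root f
  have hne : Nontrivial (Fin n → ZMod q) := by
    have : Nonempty (Fin n) := ⟨⟨0, Nat.pos_of_ne_zero hn⟩⟩
    infer_instance
  obtain ⟨v, hv⟩ := exists_ne (0 : Fin n → ZMod q)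
  let ψ : AdjoinRoot m →ₗ[ZMod q] (Fin n → ZMod q) := (LinearMap.applyₗ v).comp ev.toLinearMap
  have hψ : ∀ x, ψ x = ev x v := fun _ => rfl
  have hψmul : ∀ x y, ψ (x * y) = ev x (ψ y) := fun x y => by
    rw [hψ, hψ, map_mul]; rfl
  have hψinj : Function.Injective ψ := by
    rw [injective_iff_map_eq_zero]
    intro x hx
    by_contra hx0
    obtain ⟨y, hy⟩ := iF.mul_inv_cancel hx0
    apply hv
    have h1 : ψ (y * x) = 0 := by rw [hψmul, hx, map_zero]
    rw [mul_comm, hy, hψ, map_one] at h1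
    exact h1
  have hψbij : Function.Bijective ψ := by
    refine (Nat.bijective_iff_injective_and_card ψ).2 ⟨hψinj, ?_⟩
    rw [hcard]; simp
  let θ : AdjoinRoot m ≃ₗ[ZMod q] (Fin n → ZMod q) := LinearEquiv.ofBijective ψ hψbij
  have hθ : ∀ x, θ x = ψ x := fun _ => rfl
  have hθg : ∀ (i : ℕ) x, (g ^ i : GLin n q) (θ x) = θ (AdjoinRoot.root m ^ i * x) := by
    intro i
    induction i with
    | zero => intro x; rw [pow_zero, pow_zero, one_mul]; rfl
    | succ i ih =>
      intro x
      have h1 : (g ^ (i + 1) : GLin n q) (θ x) = (g ^ i : GLin n q) (g (θ x)) := by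
        rw [pow_succ]; rfl
      have h2 : g (θ x) = θ (AdjoinRoot.root m * x) := by
        rw [hθ, hθ, hψmul, hevroot]; rfl
      rw [h1, h2, ih, ← mul_assoc, ← pow_succ]
  refine ⟨AdjoinRoot m, iL, inferInstance, hcard,
    (fun B : Submodule (ZMod q) (Fin n → ZMod q) => B.map (θ.symm : _ →ₗ[ZMod q] AdjoinRoot m)) '' S,
    hS.map θ.symm, ?_, ?_⟩
  · rintro c hc _ ⟨B, hB, rfl⟩
    obtain ⟨i, hi⟩ := hpow c hc
    have hgi : (g ^ i : GLin n q) ∈ autGroup S := hA (hCA ⟨i, by simp⟩)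
    refine ⟨_, ⟨_, exists_mem_of_mem_autGroup hgi hB, rfl⟩, ?_⟩
    rintro _ ⟨w, hw, rfl⟩
    refine ⟨_, ⟨w, hw, rfl⟩, ?_⟩
    apply θ.injective
    simp only [LinearEquiv.coe_coe, LinearEquiv.apply_symm_apply]
    have h1 := hθg i (θ.symm w)
    rw [LinearEquiv.apply_symm_apply] at h1
    rw [h1, ← hi]
  · intro hN
    have : Fintype (ZMod q) := ZMod.fintype q
    have : Algebra.IsAlgebraic (ZMod q) (AdjoinRoot m) := Algebra.IsAlgebraic.of_finite _ _
    let fr : AdjoinRoot m ≃ₗ[ZMod q] AdjoinRoot m :=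
      (FiniteField.frobeniusAlgEquivOfAlgebraic (ZMod q) (AdjoinRoot m)).toLinearEquiv
    have hfr : ∀ x, fr x = x ^ q := fun x => by
      have := congrFun (FiniteField.coe_frobeniusAlgEquivOfAlgebraic (ZMod q) (AdjoinRoot m)) x
      rw [ZMod.card] at this
      exact this
    let φ : GLin n q := (θ.symm.trans fr).trans θ
    have hφ : ∀ x, φ (θ x) = θ (x ^ q) := fun x => by
      show θ (fr (θ.symm (θ x))) = _
      rw [LinearEquiv.symm_apply_apply, hfr]
    have hconj : ∀ i : ℕ, φ * g ^ i * φ⁻¹ = g ^ (q * i) := by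
      intro i
      rw [mul_inv_eq_iff_eq_mul]
      ext1 w
      obtain ⟨x, rfl⟩ := θ.surjective w
      show φ ((g ^ i : GLin n q) (θ x)) = (g ^ (q * i) : GLin n q) (φ (θ x))
      rw [hθg, hφ, hφ, hθg, mul_pow, ← pow_mul, mul_comm i q]
    have hmem : φ ∈ Subgroup.normalizer ((Subgroup.zpowers g : Subgroup (GLin n q)) : Set _) := by
      have : Finite (GLin n q) := DFunLike.finite _
      have : Finite ((Subgroup.zpowers g : Subgroup (GLin n q)) : Set (GLin n q)) := Subtype.finite
      apply Subgroup.mem_normalizer_fintype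
      intro h hh
      obtain ⟨i, rfl⟩ := (Submonoid.mem_powers_iff _ _).1 (mem_powers_iff_mem_zpowers.2 hh)
      rw [hconj]
      exact Subgroup.npow_mem_zpowers g _
    have hφS := hA (hN hmem)
    rintro _ ⟨B, hB, rfl⟩
    refine ⟨_, ⟨_, exists_mem_of_mem_autGroup hφS hB, rfl⟩, ?_⟩
    rintro _ ⟨w, hw, rfl⟩
    refine ⟨_, ⟨w, hw, rfl⟩, ?_⟩
    apply θ.injective
    simp only [LinearEquiv.coe_coe, LinearEquiv.apply_symm_apply]
    have h1 := hφ (θ.symm w)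
    rw [LinearEquiv.apply_symm_apply] at h1
    exact h1

end Singer

/-! ### Binary `q`-Fano planes with a Galois group -/

section Fano

variable {L : Type*} [Field L] [CharP L 2]

/-- If `v` and `v + v ^ 2` are in the same orbit under `x ↦ x ^ 2` in the field with `2 ^ 7`
elements, and `v` is not in the prime field, then `v` is a root of one of two polynomials. -/
theorem fano_relation (h7 : ∀ x : L, x ^ 128 = x) {v : L} (h0 : v ≠ 0) (h1 : v ≠ 1)
    {i : ℕ} (hi : i < 7) (h : v ^ 2 + v = v ^ 2 ^ i) :
    v ^ 7 + v + 1 = 0 ∨ v ^ 7 + v ^ 3 + 1 = 0 := by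
  have h2 : (2 : L) = 0 := CharTwo.two_eq_zero
  have sq : ∀ a b : L, (a + b) ^ 2 = a ^ 2 + b ^ 2 := fun a b => CharTwo.add_sq a b
  -- the relation `v ^ 4 = v ^ 2 + v` would put `v` in the fields with `8` and with `2 ^ 7` elements
  have key : v ^ 4 = v ^ 2 + v → False := by
    intro h4
    have h8 : v ^ 8 = v := by
      have : v ^ 8 = (v ^ 4) ^ 2 := by ring
      rw [this, h4, sq]
      linear_combination h4 + v ^ 2 * h2
    have h128 : v ^ 128 = v ^ 2 := by
      have e1 : v ^ 128 = (v ^ 8) ^ 16 := by ring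
      have e2 : v ^ 16 = (v ^ 8) ^ 2 := by ring
      rw [e1, h8, e2, h8]
    rw [h7] at h128
    have : v * (v - 1) = 0 := by linear_combination -h128
    rcases mul_eq_zero.1 this with h | h
    · exact h0 h
    · exact h1 (sub_eq_zero.1 h)
  interval_cases i
  · exact absurd (pow_eq_zero_iff (two_ne_zero)|>.1 (by linear_combination h : v ^ 2 = 0)) h0
  · exact absurd (by linear_combination h) h0
  · exact (key (by linear_combination -h)).elim
  · left
    have : v * (v ^ 7 + v + 1) = 0 := by linear_combination -h + (v ^ 2 + v) * h2
    exact (mul_eq_zero.1 this).resolve_left h0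
  · exfalso
    have h16 : v ^ 16 = v ^ 2 + v := by linear_combination -h
    have h32 : v ^ 32 = v ^ 4 + v ^ 2 := by
      have e1 : v ^ 32 = (v ^ 16) ^ 2 := by ring
      rw [e1, h16, sq]; ring
    have h64 : v ^ 64 = v ^ 8 + v ^ 4 := by
      have e1 : v ^ 64 = (v ^ 32) ^ 2 := by ring
      rw [e1, h32, sq]; ring
    have h128 : v ^ 128 = v ^ 16 + v ^ 8 := by
      have e1 : v ^ 128 = (v ^ 64) ^ 2 := by ring
      rw [e1, h64, sq]; ring
    rw [h7, h16] at h128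
    have h8 : v ^ 8 = v ^ 2 := by linear_combination -h128 - v ^ 2 * h2
    apply key
    have : (v ^ 4 - v) ^ 2 = 0 := by
      linear_combination h8 - v ^ 5 * h2 + v ^ 2 * h2
    have h4 : v ^ 4 = v := sub_eq_zero.1 (pow_eq_zero_iff two_ne_zero |>.1 this)
    have e : v ^ 16 = v := by
      have e1 : v ^ 16 = (v ^ 4) ^ 4 := by ring
      rw [e1, h4, h4]
    rw [e] at h16
    exact absurd (pow_eq_zero_iff (two_ne_zero)|>.1 (by linear_combination -h16 : v ^ 2 = 0)) h0
  · right
    have h32 : v ^ 32 = v ^ 2 + v := by linear_combination -h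
    have h64 : v ^ 64 = v ^ 4 + v ^ 2 := by
      have e1 : v ^ 64 = (v ^ 32) ^ 2 := by ring
      rw [e1, h32, sq]; ring
    have h128 : v ^ 128 = v ^ 8 + v ^ 4 := by
      have e1 : v ^ 128 = (v ^ 64) ^ 2 := by ring
      rw [e1, h64, sq]; ring
    rw [h7] at h128
    have : v * (v ^ 7 + v ^ 3 + 1) = 0 := by linear_combination -h128 + v * h2
    exact (mul_eq_zero.1 this).resolve_left h0
  · exfalso
    have h64 : v ^ 64 = v ^ 2 + v := by linear_combination -h
    have h128 : v ^ 128 = v ^ 4 + v ^ 2 := by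
      have e1 : v ^ 128 = (v ^ 64) ^ 2 := by ring
      rw [e1, h64, sq]; ring
    rw [h7] at h128
    exact key (by linear_combination -h128 - v ^ 2 * h2)

end Fano

section FanoDesign

open Polynomial

variable {L : Type*} [Field L] [Algebra (ZMod 2) L]

/-- A Frobenius-invariant plane in the field with `2 ^ 7` elements consists of `0` and of a single
Frobenius orbit, contained in the roots of a polynomial of degree `14`. -/
theorem fano_fixed_block (hL : Nat.card L = 2 ^ 7) {B : Submodule (ZMod 2) L}
    (hB : Module.finrank (ZMod 2) B = 3) (hinv : ∀ x ∈ B, x ^ 2 ∈ B) {v : L} (hv : v ∈ B)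
    (h0 : v ≠ 0) :
    (v ^ 7 + v + 1 = 0 ∨ v ^ 7 + v ^ 3 + 1 = 0) ∧
      ∀ w ∈ B, w ≠ 0 → ∃ i : ℕ, w = v ^ 2 ^ i := by
  classical
  have hfin : Finite L := Nat.finite_of_card_ne_zero (by rw [hL]; norm_num)
  have : Fact (Nat.Prime 7) := ⟨by norm_num⟩
  have : Fintype L := Fintype.ofFinite L
  have hchar : CharP L 2 := charP_of_injective_algebraMap' (ZMod 2) 2
  have h7 : ∀ x : L, x ^ 128 = x := fun x => by
    have := FiniteField.pow_card x
    rwa [← Nat.card_eq_fintype_card, hL] at this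
  have hcardB : Nat.card B = 8 := by
    rw [Module.natCard_eq_pow_finrank (K := ZMod 2), hB]; simp
  let N := {x : B // (x : L) ≠ 0}
  have hcardN : Nat.card N = 7 := by
    have e : N ≃ {x : B // x ≠ 0} := Equiv.subtypeEquivRight fun x => by simp
    rw [Nat.card_congr e, Nat.card_eq_fintype_card, Fintype.card_subtype_compl,
      Fintype.card_subtype_eq, ← Nat.card_eq_fintype_card, hcardB]
  let φ : Function.End N := fun x => ⟨⟨(x.1 : L) ^ 2, hinv _ x.1.2⟩, pow_ne_zero 2 x.2⟩
  have hφ : ∀ (i : ℕ) (x : N), (((φ ^ i : Function.End N) x).1 : L) = (x.1 : L) ^ 2 ^ i := by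
    intro i
    induction i with
    | zero => intro x; simp; rfl
    | succ i ih =>
      intro x
      rw [pow_succ']
      show ((((φ ^ i : Function.End N) x).1 : L)) ^ 2 = _
      rw [ih, ← pow_mul, pow_succ]
  have hφ7 : φ ^ 7 ^ 1 = 1 := by
    funext x
    apply Subtype.ext; apply Subtype.ext
    rw [hφ]
    exact h7 _
  have hfix : Fintype.card N ≡ Fintype.card φ.fixedPoints [MOD 7] :=
    Equiv.Perm.card_fixedPoints_modEq hφ7
  -- the only fixed point of the Frobenius map is `1`
  have hone : (1 : L) ∉ B := by
    intro h1
    have hc : Fintype.card φ.fixedPoints = 1 := by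
      rw [Fintype.card_eq_one_iff]
      refine ⟨⟨⟨⟨1, h1⟩, one_ne_zero⟩, ?_⟩, ?_⟩
      · show φ _ = _
        apply Subtype.ext; apply Subtype.ext
        show (1 : L) ^ 2 = 1
        rw [one_pow]
      · rintro ⟨⟨⟨x, hx⟩, hx0⟩, hfx⟩
        apply Subtype.ext; apply Subtype.ext; apply Subtype.ext
        show x = 1
        have h2 : x ^ 2 = x := congrArg (fun y : N => (y.1 : L)) hfx
        have h3 : x * (x - 1) = 0 := by linear_combination h2
        exact sub_eq_zero.1 ((mul_eq_zero.1 h3).resolve_left hx0)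
    rw [hc, ← Nat.card_eq_fintype_card, hcardN] at hfix
    exact absurd hfix (by decide)
  have hv1 : v ≠ 1 := fun h => hone (h ▸ hv)
  let v' : N := ⟨⟨v, hv⟩, h0⟩
  -- the orbit of `v` has seven elements
  have hper : Function.minimalPeriod φ v' = 7 := by
    have hp : Function.IsPeriodicPt φ 7 v' := by
      have := congrFun hφ7 v'
      exact this
    have hd := hp.minimalPeriod_dvd
    rcases (Nat.dvd_prime (by norm_num)).1 hd with h | h
    · exfalso
      have hf := Function.minimalPeriod_eq_one_iff_isFixedPt.1 h
      have h2 : v ^ 2 = v := congrArg (fun y : N => (y.1 : L)) hf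
      have h3 : v * (v - 1) = 0 := by linear_combination h2
      rcases mul_eq_zero.1 h3 with h | h
      · exact h0 h
      · exact hv1 (sub_eq_zero.1 h)
    · exact h
  have horb : ∀ w : N, ∃ i : ℕ, i < 7 ∧ (w.1 : L) = v ^ 2 ^ i := by
    let F : Fin 7 → N := fun i => (φ ^ (i : ℕ) : Function.End N) v'
    have hF : Function.Injective F := by
      intro i j hij
      have := (Function.iterate_eq_iterate_iff_of_lt_minimalPeriod (f := φ) (x := v')
        (by rw [hper]; exact i.2) (by rw [hper]; exact j.2)).1 hij
      exact Fin.ext this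
    have hbij := (Nat.bijective_iff_injective_and_card F).2 ⟨hF, by rw [hcardN, Nat.card_fin]⟩
    intro w
    obtain ⟨i, rfl⟩ := hbij.2 w
    exact ⟨i, i.2, hφ i v'⟩
  refine ⟨?_, fun w hw hw0 => ?_⟩
  · have hsum : v ^ 2 + v ≠ 0 := by
      intro h
      have h3 : v * (v + 1) = 0 := by linear_combination h
      rcases mul_eq_zero.1 h3 with h | h
      · exact h0 h
      · exact hv1 (by rw [← CharTwo.neg_eq (1 : L)]; exact eq_neg_of_add_eq_zero_left h)
    obtain ⟨i, hi, h⟩ := horb ⟨⟨v ^ 2 + v, B.add_mem (hinv v hv) hv⟩, hsum⟩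
    exact fano_relation h7 h0 hv1 hi h
  · obtain ⟨i, -, h⟩ := horb ⟨⟨w, hw⟩, hw0⟩
    exact ⟨i, h⟩

/-- There is no Frobenius-invariant `S_2[2, 3, 7]`: it has `381` blocks, so at least three of them
are fixed, but there are only two Frobenius-invariant planes. -/
theorem no_frobenius_fano (hL : Nat.card L = 2 ^ 7) {S : Set (Submodule (ZMod 2) L)}
    (hS : IsDesign 2 3 1 S) (hF : FrobInvariant 2 S) : False := by
  classical
  have hfin : Finite L := Nat.finite_of_card_ne_zero (by rw [hL]; norm_num)
  have : Fact (Nat.Prime 7) := ⟨by norm_num⟩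
  have : Fintype L := Fintype.ofFinite L
  have hchar : CharP L 2 := charP_of_injective_algebraMap' (ZMod 2) 2
  have h7 : ∀ x : L, x ^ 128 = x := fun x => by
    have := FiniteField.pow_card x
    rwa [← Nat.card_eq_fintype_card, hL] at this
  have hrank : Module.finrank (ZMod 2) L = 7 := by
    have := Module.natCard_eq_pow_finrank (K := ZMod 2) (V := L)
    rw [hL, Nat.card_eq_fintype_card, ZMod.card] at this
    exact (Nat.pow_right_injective le_rfl this).symm
  have hcard := hS.ncard_mul (by norm_num) (by rw [hrank]; norm_num)
  rw [hrank, ZMod.card] at hcard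
  have hS381 : S.ncard = 381 := by omega
  let f : L →ₗ[ZMod 2] L := (FiniteField.frobeniusAlgHom (ZMod 2) L).toLinearMap
  have hf : ∀ x, f x = x ^ 2 := fun x => by
    have := congrFun (FiniteField.coe_frobeniusAlgHom (ZMod 2) L) x
    rw [ZMod.card] at this
    exact this
  have hfinj : Function.Injective f := (FiniteField.frobeniusAlgHom (ZMod 2) L).injective
  have hmap : ∀ B ∈ S, B.map f ∈ S := by
    intro B hB
    obtain ⟨B', hB', h⟩ := hF B hB
    have hle : B.map f ≤ B' := by
      rintro _ ⟨x, hx, rfl⟩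
      rw [hf]; exact h x hx
    have : B.map f = B' := by
      apply Submodule.eq_of_le_of_finrank_eq hle
      rw [hS.1 B' hB', ← hS.1 B hB]
      exact (Submodule.equivMapOfInjective f hfinj B).finrank_eq.symm
    rw [this]; exact hB'
  let φ : Function.End S := fun B => ⟨B.1.map f, hmap B.1 B.2⟩
  have hφ : ∀ (i : ℕ) (B : S), ((φ ^ i : Function.End S) B).1 = B.1.map (f ^ i) := by
    intro i
    induction i with
    | zero => intro B; exact (Submodule.map_id _).symm
    | succ i ih =>
      intro B
      rw [pow_succ', pow_succ']
      show ((φ ^ i : Function.End S) B).1.map f = _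
      rw [ih, ← Submodule.map_comp]
      rfl
  have hf7 : f ^ 7 = LinearMap.id := by
    ext x
    have : ∀ i : ℕ, (f ^ i) x = x ^ 2 ^ i := by
      intro i
      induction i with
      | zero => simp
      | succ i ih => rw [pow_succ', Module.End.mul_apply, ih, hf, ← pow_mul, pow_succ]
    rw [this]; exact h7 x
  have hφ7 : φ ^ 7 ^ 1 = 1 := by
    funext B
    apply Subtype.ext
    rw [hφ, pow_one, hf7, Submodule.map_id]
    rfl
  have : Fintype S := Fintype.ofFinite S
  have hmod : Fintype.card S ≡ Fintype.card φ.fixedPoints [MOD 7] :=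
    Equiv.Perm.card_fixedPoints_modEq hφ7
  rw [← Nat.card_eq_fintype_card, Nat.card_coe_set_eq, hS381] at hmod
  have hinv : ∀ B : φ.fixedPoints, ∀ x ∈ B.1.1, x ^ 2 ∈ B.1.1 := by
    intro B x hx
    have h1 : B.1.1.map f = B.1.1 := congrArg Subtype.val B.2
    rw [← h1, ← hf]
    exact ⟨x, hx, rfl⟩
  let P : L[X] := (X ^ 7 + X + 1) * (X ^ 7 + X ^ 3 + 1)
  have hP1 : (X ^ 7 + X + 1 : L[X]).natDegree = 7 := by compute_degree!
  have hP2 : (X ^ 7 + X ^ 3 + 1 : L[X]).natDegree = 7 := by compute_degree!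
  have hP1' : (X ^ 7 + X + 1 : L[X]) ≠ 0 := fun h => by rw [h] at hP1; simp at hP1
  have hP2' : (X ^ 7 + X ^ 3 + 1 : L[X]) ≠ 0 := fun h => by rw [h] at hP2; simp at hP2
  have hPdeg : P.natDegree = 14 := by rw [natDegree_mul hP1' hP2', hP1, hP2]
  have hP0 : P ≠ 0 := mul_ne_zero hP1' hP2'
  -- nonzero vectors of fixed blocks inject into the roots of `P`
  let G : (Σ B : φ.fixedPoints, {x : B.1.1 // x ≠ 0}) → P.roots.toFinset := fun p =>
    ⟨(p.2.1 : L), by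
      rw [Multiset.mem_toFinset, mem_roots hP0, IsRoot.def, eval_mul, mul_eq_zero]
      have h0 : (p.2.1 : L) ≠ 0 := fun h => p.2.2 (Subtype.ext h)
      have := (fano_fixed_block hL (hS.1 _ p.1.1.2) (hinv p.1) p.2.1.2 h0).1
      simpa using this⟩
  have hG : Function.Injective G := by
    rintro ⟨B, ⟨⟨x, hx⟩, hx0⟩⟩ ⟨B', ⟨⟨x', hx'⟩, hx0'⟩⟩ h
    have hxx : x = x' := congrArg Subtype.val h
    subst hxx
    have h0 : x ≠ 0 := fun h => hx0 (Subtype.ext h)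
    have hsub : ∀ B B' : φ.fixedPoints, x ∈ B.1.1 → x ∈ B'.1.1 → B.1.1 ≤ B'.1.1 := by
      intro B B' hB hB' w hw
      by_cases hw0 : w = 0
      · rw [hw0]; exact B'.1.1.zero_mem
      · obtain ⟨i, rfl⟩ := (fano_fixed_block hL (hS.1 _ B.1.2) (hinv B) hB h0).2 w hw hw0
        clear hw hw0
        induction i with
        | zero => simpa using hB'
        | succ i ih =>
          rw [pow_succ, pow_mul]
          exact hinv B' _ ih
    have hBB : B = B' := Subtype.ext (Subtype.ext
      (le_antisymm (hsub B B' hx hx') (hsub B' B hx' hx)))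
    subst hBB
    rfl
  have hle := Nat.card_le_card_of_injective G hG
  have hle2 : Nat.card P.roots.toFinset ≤ 14 := by
    rw [Nat.card_eq_fintype_card, Fintype.card_coe, ← hPdeg]
    exact (Multiset.toFinset_card_le _).trans (card_roots' P)
  have hsum : Nat.card (Σ B : φ.fixedPoints, {x : B.1.1 // x ≠ 0}) =
      Fintype.card φ.fixedPoints * 7 := by
    rw [Nat.card_sigma, Finset.sum_congr rfl (fun B _ => ?_), Finset.sum_const, smul_eq_mul,
      Finset.card_univ]
    have hcardB : Nat.card B.1.1 = 8 := by
      rw [Module.natCard_eq_pow_finrank (K := ZMod 2), hS.1 _ B.1.2]; simp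
    rw [Nat.card_eq_fintype_card, Fintype.card_subtype_compl,
      Fintype.card_subtype_eq, ← Nat.card_eq_fintype_card, hcardB]
  rw [hsum] at hle
  have : Fintype.card φ.fixedPoints ≤ 2 := by omega
  have h3 := hmod
  unfold Nat.ModEq at h3
  omega

end FanoDesign

/-- The Galois group of `F_{2 ^ 7}` is not a group of automorphisms of an `S_2[2, 3, 7]`. -/
theorem not_admits_2_2_3_7 (e : (Fin 7 → ZMod 2) ≃ₗ[ZMod 2] GaloisField 2 7) :
    ¬ Admits 2 2 3 7 (galoisSubgroup e) := by
  rintro ⟨S, hS, hA⟩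
  refine no_frobenius_fano (GaloisField.card 2 7 (by norm_num)) (IsDesign.map hS e) ?_
  rintro _ ⟨B, hB, rfl⟩
  have : Fintype (ZMod 2) := ZMod.fintype 2
  let s : GaloisField 2 7 ≃ₐ[ZMod 2] GaloisField 2 7 :=
    FiniteField.frobeniusAlgEquivOfAlgebraic (ZMod 2) (GaloisField 2 7)
  have hs : ∀ x, s x = x ^ 2 := fun x => by
    have := congrFun (FiniteField.coe_frobeniusAlgEquivOfAlgebraic (ZMod 2) (GaloisField 2 7)) x
    rw [ZMod.card] at this
    exact this
  let g : GLin 7 2 := (e.trans s.toLinearEquiv).trans e.symm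
  have hg : ∀ v, e (g v) = s (e v) := fun v => by
    show e (e.symm (s (e v))) = _
    rw [LinearEquiv.apply_symm_apply]
  have hgS : g ∈ autGroup S := hA ⟨s, hg⟩
  refine ⟨_, ⟨_, exists_mem_of_mem_autGroup hgS hB, rfl⟩, ?_⟩
  rintro _ ⟨v, hv, rfl⟩
  refine ⟨_, ⟨v, hv, rfl⟩, ?_⟩
  show e (g v) = (e v) ^ 2
  rw [hg, hs]

/-! ### Stabilizers of blocks -/

section Field

variable {q : ℕ} [Fact q.Prime] {L : Type*} [Field L] [Algebra (ZMod q) L]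

theorem mem_range_of_pow_eq {x : L} (hx : x ^ q = x) : ∃ a : ZMod q, algebraMap (ZMod q) L a = x := by
  classical
  open Polynomial in
  have hq : 1 < q := (Fact.out : q.Prime).one_lt
  have hdeg : (X ^ q - X : L[X]).natDegree = q := FiniteField.X_pow_card_sub_X_natDegree_eq L hq
  have hne : (X ^ q - X : L[X]) ≠ 0 := FiniteField.X_pow_card_sub_X_ne_zero L hq
  by_contra hcon
  push Not at hcon
  let s : Finset L := Finset.univ.image (algebraMap (ZMod q) L)
  have hs : s.card = q := by
    rw [Finset.card_image_of_injective _ (algebraMap (ZMod q) L).injective, Finset.card_univ,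
      ZMod.card]
  have hxs : x ∉ s := by simpa [s] using hcon
  have hsub : (insert x s).val ⊆ (X ^ q - X : L[X]).roots := by
    intro y hy
    rw [mem_roots hne, IsRoot.def, eval_sub, eval_pow, eval_X, sub_eq_zero]
    rcases Finset.mem_insert.1 (show y ∈ insert x s from hy) with rfl | hy
    · exact hx
    · obtain ⟨a, -, rfl⟩ := Finset.mem_image.1 hy
      rw [← map_pow, ZMod.pow_card]
  have h1 := Multiset.card_le_card ((Multiset.le_iff_subset (insert x s).nodup).2 hsub)
  have h2 := card_roots' (X ^ q - X : L[X])
  rw [hdeg] at h2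
  have h3 : (insert x s).val.card = q + 1 := by
    rw [Finset.card_val, Finset.card_insert_of_notMem hxs, hs]
  omega

theorem pow_q_algebraMap (a : ZMod q) (i : ℕ) :
    algebraMap (ZMod q) L a ^ q ^ i = algebraMap (ZMod q) L a := by
  induction i with
  | zero => simp
  | succ i ih => rw [pow_succ, pow_mul, ih, ← map_pow, ZMod.pow_card]

theorem add_pow_q_pow (x y : L) (i : ℕ) : (x + y) ^ q ^ i = x ^ q ^ i + y ^ q ^ i := by
  have : CharP L q := charP_of_injective_algebraMap' (ZMod q) q
  exact add_pow_char_pow x y q i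

/-- An element fixed by two powers of the Frobenius map with coprime exponents is in the prime
field. -/
theorem mem_range_of_pow_pow_eq {x : L} {i n : ℕ} (hin : Nat.Coprime i n) (hi : x ^ q ^ i = x)
    (hn : x ^ q ^ n = x) : ∃ a : ZMod q, algebraMap (ZMod q) L a = x := by
  have hit : ∀ j : ℕ, (fun y : L => y ^ q)^[j] x = x ^ q ^ j := fun j => by
    rw [pow_iterate]
  have h1 : Function.IsPeriodicPt (fun y : L => y ^ q) i x := by
    rw [Function.IsPeriodicPt, Function.IsFixedPt, hit, hi]
  have h2 : Function.IsPeriodicPt (fun y : L => y ^ q) n x := by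
    rw [Function.IsPeriodicPt, Function.IsFixedPt, hit, hn]
  have h3 := h1.gcd h2
  rw [hin, Function.IsPeriodicPt, Function.IsFixedPt, hit, pow_one] at h3
  exact mem_range_of_pow_eq h3

variable {n : ℕ}

theorem pow_q_pow_card {q : ℕ} [Fact q.Prime] {L : Type*} [Field L] {n : ℕ} (hL : Nat.card L = q ^ n) (x : L) : x ^ q ^ n = x := by
  have hq := (Fact.out : q.Prime).pos
  have : Finite L := Nat.finite_of_card_ne_zero (by rw [hL]; positivity)
  have : Fintype L := Fintype.ofFinite L
  have h := FiniteField.pow_card x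
  rwa [← Nat.card_eq_fintype_card, hL] at h

theorem finrank_of_card (hL : Nat.card L = q ^ n) : Module.finrank (ZMod q) L = n := by
  have hq := (Fact.out : q.Prime)
  have : Finite L := Nat.finite_of_card_ne_zero (by rw [hL]; have := hq.pos; positivity)
  have := Module.natCard_eq_pow_finrank (K := ZMod q) (V := L)
  rw [hL, Nat.card_eq_fintype_card, ZMod.card] at this
  exact (Nat.pow_right_injective hq.two_le this).symm

theorem iterate_twist {L : Type*} [Field L] {q : ℕ} (d : L) (i j : ℕ) :
    ∃ e : L, (d ≠ 0 → e ≠ 0) ∧ (∀ x, (fun w : L => d * w ^ q ^ i)^[j] x = e * x ^ q ^ (i * j)) ∧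
      e ^ q ^ i * d = e * d ^ q ^ (i * j) := by
  induction j with
  | zero => exact ⟨1, fun _ => one_ne_zero, by simp, by simp⟩
  | succ j ih =>
    obtain ⟨e, he0, he, hed⟩ := ih
    refine ⟨d * e ^ q ^ i, fun hd => mul_ne_zero hd (pow_ne_zero _ (he0 hd)), fun x => ?_, ?_⟩
    · rw [Function.iterate_succ_apply', he, mul_pow, ← pow_mul, ← pow_add, Nat.mul_succ, mul_assoc]
    · rw [mul_pow]
      have h2 : (e ^ q ^ i * d) ^ q ^ i = (e * d ^ q ^ (i * j)) ^ q ^ i := by rw [hed]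
      rw [mul_pow, mul_pow, ← pow_mul d, ← pow_add] at h2
      rw [Nat.mul_succ]
      linear_combination d * h2

/-- Let `n` be a prime. A subspace `B` of dimension `k` of the field with `q ^ n` elements that is
mapped into itself by `w ↦ d w ^ (q ^ i)` forces this map to be a scalar: if `n ∤ i` then a power of
the map has order `n`, and it has more than `q` fixed points in `B` because `|B| = q ^ k`. -/
theorem twist_scalar_of_stable (hL : Nat.card L = q ^ n) (hn : n.Prime) {k : ℕ} (hk : 0 < k)
    (hkn : k < n) (hqn : q ≤ n) (hmod : q < q ^ k % n) {B : Submodule (ZMod q) L}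
    (hB : Module.finrank (ZMod q) B = k) {d : L} (hd : d ≠ 0) {i : ℕ}
    (h : ∀ w ∈ B, d * w ^ q ^ i ∈ B) :
    ∃ a : ZMod q, ∀ w : L, d * w ^ q ^ i = a • w := by
  classical
  have hq := (Fact.out : q.Prime)
  have hfin : Finite L := Nat.finite_of_card_ne_zero (by rw [hL]; have := hq.pos; positivity)
  have hfr := finrank_of_card hL
  by_cases hi : n ∣ i
  · obtain ⟨m, rfl⟩ := hi
    have hfix : ∀ w : L, w ^ q ^ (n * m) = w := by
      intro w
      clear h
      induction m with
      | zero => simp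
      | succ m ih => rw [Nat.mul_succ, pow_add, pow_mul, ih, pow_q_pow_card hL]
    simp only [hfix] at h ⊢
    by_cases hdK : ∃ a : ZMod q, algebraMap (ZMod q) L a = d
    · obtain ⟨a, rfl⟩ := hdK
      exact ⟨a, fun w => (Algebra.smul_def a w).symm⟩
    · exfalso
      have := Subalgebra.isSimpleOrder_of_finrank_prime (ZMod q) L (hfr ▸ hn)
      have htop : Algebra.adjoin (ZMod q) {d} = ⊤ := by
        refine (eq_bot_or_eq_top _).resolve_left fun hbot => hdK ?_
        have : d ∈ (⊥ : Subalgebra (ZMod q) L) := by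
          rw [← hbot]; exact Algebra.subset_adjoin rfl
        exact Algebra.mem_bot.1 this
      have hall : ∀ c : L, ∀ w ∈ B, c * w ∈ B := by
        intro c
        have hc : c ∈ Algebra.adjoin (ZMod q) {d} := by rw [htop]; trivial
        induction hc using Algebra.adjoin_induction with
        | mem x hx => rw [Set.mem_singleton_iff.1 hx]; exact h
        | algebraMap r => intro w hw; rw [← Algebra.smul_def]; exact B.smul_mem r hw
        | add x y _ _ hx hy => intro w hw; rw [add_mul]; exact B.add_mem (hx w hw) (hy w hw)
        | mul x y _ _ hx hy => intro w hw; rw [mul_assoc]; exact hx _ (hy w hw)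
      have hBne : B ≠ ⊥ := by
        rintro rfl
        rw [finrank_bot] at hB
        omega
      obtain ⟨w, hw, hw0⟩ := B.ne_bot_iff.1 hBne
      have hBtop : B = ⊤ := by
        rw [eq_top_iff]
        intro x _
        have := hall (x * w⁻¹) w hw
        rwa [inv_mul_cancel_right₀ hw0] at this
      rw [hBtop, finrank_top, hfr] at hB
      omega
  · exfalso
    have hcop : Nat.Coprime i n := ((Nat.Prime.coprime_iff_not_dvd hn).2 hi).symm
    let g : L → L := fun w => d * w ^ q ^ i
    obtain ⟨N, hN0, hN, hNd⟩ := iterate_twist (q := q) d i n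
    have hfix : ∀ (w : L) (m : ℕ), w ^ q ^ (m * n) = w := by
      intro w m
      induction m with
      | zero => simp
      | succ m ih => rw [Nat.succ_mul, pow_add, pow_mul, ih, pow_q_pow_card hL]
    simp only [hfix] at hN hNd
    obtain ⟨a, ha⟩ := mem_range_of_pow_pow_eq hcop (mul_right_cancel₀ hd hNd) (pow_q_pow_card hL N)
    have ha0 : a ≠ 0 := by
      rintro rfl
      rw [map_zero] at ha
      exact hN0 hd ha.symm
    have hNq : N ^ (q - 1) = 1 := by
      rw [← ha, ← map_pow, ZMod.pow_card_sub_one_eq_one ha0, map_one]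
    have hgN : g^[n * (q - 1)] = id := by
      have : g^[n] = fun w => N * w := funext hN
      rw [Function.iterate_mul, this, mul_left_iterate, hNq]
      funext w; simp
    obtain ⟨e, he0, he, -⟩ := iterate_twist (q := q) d i (q - 1)
    -- the action of `g ^ (q - 1)` on `B`
    have hgB : ∀ (j : ℕ), ∀ w ∈ B, g^[j] w ∈ B := by
      intro j
      induction j with
      | zero => exact fun w hw => hw
      | succ j ih => intro w hw; rw [Function.iterate_succ_apply']; exact h _ (ih w hw)
    let f : Function.End B := fun w => ⟨g^[q - 1] w, hgB _ _ w.2⟩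
    have hf : ∀ (j : ℕ) (w : B), (((f ^ j : Function.End B) w : B) : L) = g^[(q - 1) * j] w := by
      intro j
      induction j with
      | zero => intro w; rfl
      | succ j ih =>
        intro w
        rw [pow_succ']
        show g^[q - 1] ((f ^ j : Function.End B) w : L) = _
        rw [ih, ← Function.iterate_add_apply, Nat.mul_succ, add_comm]
    have : Fact n.Prime := ⟨hn⟩
    have hfn : f ^ n ^ 1 = 1 := by
      funext w
      apply Subtype.ext
      rw [pow_one, hf, mul_comm, hgN]
      rfl
    have : Fintype B := Fintype.ofFinite B
    have hcm : Fintype.card B ≡ Fintype.card f.fixedPoints [MOD n] :=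
      Equiv.Perm.card_fixedPoints_modEq hfn
    have hcardB : Fintype.card B = q ^ k := by
      rw [← Nat.card_eq_fintype_card, Module.natCard_eq_pow_finrank (K := ZMod q), hB,
        Nat.card_eq_fintype_card, ZMod.card]
    rw [hcardB] at hcm
    have hge : q < Fintype.card f.fixedPoints :=
      hmod.trans_le (hcm ▸ Nat.mod_le _ _)
    have hne : ∃ p : f.fixedPoints, (p.1 : L) ≠ 0 := by
      by_contra hcon
      push Not at hcon
      have : Fintype.card f.fixedPoints ≤ 1 :=
        Fintype.card_le_one_iff.2 fun p p' =>
          Subtype.ext (Subtype.ext ((hcon p).trans (hcon p').symm))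
      have := hq.two_le
      omega
    obtain ⟨p, hp⟩ := hne
    have hfp : ∀ p : f.fixedPoints, e * (p.1 : L) ^ q ^ (i * (q - 1)) = p.1 := fun p => by
      have := congrArg (fun w : B => (w : L)) p.2
      rw [← he]
      exact this
    have hcop2 : Nat.Coprime (i * (q - 1)) n := by
      refine Nat.Coprime.mul_left hcop (Nat.Coprime.symm ?_)
      refine (Nat.Prime.coprime_iff_not_dvd hn).2 fun hdv => ?_
      have := Nat.le_of_dvd (by have := hq.two_le; omega) hdv
      have := hq.two_le
      omega
    have hquot : ∀ p' : f.fixedPoints, ∃ a : ZMod q, algebraMap (ZMod q) L a = p'.1 / p.1 := by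
      intro p'
      refine mem_range_of_pow_pow_eq hcop2 ?_ (pow_q_pow_card hL _)
      have h1 := hfp p
      have h2 := hfp p'
      have hpp : (p.1 : L) ^ q ^ (i * (q - 1)) ≠ 0 := pow_ne_zero _ hp
      rw [div_pow, div_eq_div_iff hpp hp]
      have he' := he0 hd
      apply mul_left_cancel₀ he'
      linear_combination (p.1 : L) * h2 - (p'.1 : L) * h1
    choose F hF using hquot
    have hFinj : Function.Injective F := by
      intro p1 p2 h12
      have h1 := hF p1
      rw [h12, hF p2, div_left_inj' hp] at h1
      exact Subtype.ext (Subtype.ext h1.symm)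
    have := Fintype.card_le_of_injective F hFinj
    rw [ZMod.card] at this
    omega

end Field

/-! ### Twisted invariance of designs on finite fields -/

section Twist

variable {q : ℕ} [Fact q.Prime] {L : Type*} [Field L] [Algebra (ZMod q) L]

/-- A set of subspaces of the field `L` of characteristic `q` is invariant under all the maps
`x ↦ d x ^ (q ^ i)` with `d ≠ 0` and `i ∈ I`. The cases of interest are `I = ⊥` (scaling only)
and `I = ⊤` (scaling and the Galois group). -/
def TwistInvariant (I : AddSubmonoid ℕ) (S : Set (Submodule (ZMod q) L)) : Prop :=
  ∀ i ∈ I, ∀ d : L, d ≠ 0 → ∀ B ∈ S, ∃ B' ∈ S, ∀ x ∈ B, d * x ^ q ^ i ∈ B'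

theorem ScaleInvariant.twistInvariant_bot {S : Set (Submodule (ZMod q) L)}
    (hS : ScaleInvariant S) : TwistInvariant ⊥ S := by
  intro i hi d hd B hB
  rw [AddSubmonoid.mem_bot] at hi
  subst hi
  simpa using hS d hd B hB

theorem ScaleInvariant.twistInvariant_top {S : Set (Submodule (ZMod q) L)}
    (hS : ScaleInvariant S) (hF : FrobInvariant q S) : TwistInvariant ⊤ S := by
  intro i _ d hd B hB
  have h : ∃ B' ∈ S, ∀ x ∈ B, x ^ q ^ i ∈ B' := by
    induction i with
    | zero => exact ⟨B, hB, by simp⟩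
    | succ i ih =>
      obtain ⟨B', hB', h'⟩ := ih trivial
      obtain ⟨B'', hB'', h''⟩ := hF B' hB'
      exact ⟨B'', hB'', fun x hx => by rw [pow_succ, pow_mul]; exact h'' _ (h' x hx)⟩
  obtain ⟨B', hB', h'⟩ := h
  obtain ⟨B'', hB'', h''⟩ := hS d hd B' hB'
  exact ⟨B'', hB'', fun x hx => h'' _ (h' x hx)⟩

theorem ne_smul_twist {x y d : L} (hd : d ≠ 0) (hy : ∀ c : ZMod q, y ≠ c • x) (i : ℕ) (c : ZMod q) :
    d * y ^ q ^ i ≠ c • (d * x ^ q ^ i) := by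
  intro h
  apply hy c
  have h1 : y ^ q ^ i = (c • x) ^ q ^ i := by
    apply mul_left_cancel₀ hd
    rw [h, Algebra.smul_def, Algebra.smul_def, mul_pow, pow_q_algebraMap]
    ring
  have : CharP L q := charP_of_injective_algebraMap' (ZMod q) q
  exact iterateFrobenius_inj L q i (by simpa [iterateFrobenius_def] using h1)

/-- If a map `x ↦ d x ^ (q ^ i)` preserving a `2`-design sends two independent vectors of a
block `B` into a block `B'`, then it sends `B` into `B'`. -/
theorem TwistInvariant.mem_of_pair {I : AddSubmonoid ℕ} {S : Set (Submodule (ZMod q) L)} {k : ℕ}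
    (hI : TwistInvariant I S) (hS : IsDesign 2 k 1 S) {B B' : Submodule (ZMod q) L} (hB : B ∈ S)
    (hB' : B' ∈ S) {x y : L} (hx : x ≠ 0) (hy : ∀ c : ZMod q, y ≠ c • x) (hxB : x ∈ B) (hyB : y ∈ B)
    {i : ℕ} (hi : i ∈ I) {d : L} (hd : d ≠ 0) (h1 : d * x ^ q ^ i ∈ B') (h2 : d * y ^ q ^ i ∈ B') :
    ∀ w ∈ B, d * w ^ q ^ i ∈ B' := by
  obtain ⟨C, hC, h⟩ := hI i hi d hd B hB
  have : C = B' := hS.block_unique_pair (mul_ne_zero hd (pow_ne_zero _ hx))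
    (ne_smul_twist hd hy i) hC hB' (h x hxB) (h y hyB) h1 h2
  exact this ▸ h

/-- In a twist-invariant `2`-design, no block contains two different equivalent lines: a map
`x ↦ d x ^ (q ^ i)` sending two independent vectors of a block into that block is a scalar. -/
theorem TwistInvariant.scalar_of_pair {I : AddSubmonoid ℕ} {S : Set (Submodule (ZMod q) L)}
    {n k : ℕ} (hI : TwistInvariant I S) (hS : IsDesign 2 k 1 S) (hL : Nat.card L = q ^ n)
    (hn : n.Prime) (hk : 0 < k) (hkn : k < n) (hqn : q ≤ n) (hmod : q < q ^ k % n)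
    {B : Submodule (ZMod q) L} (hB : B ∈ S) {x y : L} (hx : x ≠ 0) (hy : ∀ c : ZMod q, y ≠ c • x)
    (hxB : x ∈ B) (hyB : y ∈ B) {i : ℕ} (hi : i ∈ I) {d : L} (hd : d ≠ 0)
    (h1 : d * x ^ q ^ i ∈ B) (h2 : d * y ^ q ^ i ∈ B) :
    ∃ a : ZMod q, ∀ w : L, d * w ^ q ^ i = a • w :=
  twist_scalar_of_stable hL hn hk hkn hqn hmod (hS.1 B hB) hd
    (hI.mem_of_pair hS hB hB hx hy hxB hyB hi hd h1 h2)

end Twist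

/-! ### Roots of polynomials in finite fields -/

section Lists

/-- The value at `x` of the polynomial with the given list of coefficients, constant term first. -/
def ev {R : Type*} [CommSemiring R] (x : R) : List ℕ → R
  | [] => 0
  | c :: l => c + x * ev x l

theorem map_ev {R R' : Type*} [CommSemiring R] [CommSemiring R'] (f : R →+* R') (x : R)
    (l : List ℕ) : f (ev x l) = ev (f x) l := by
  induction l with
  | nil => simp [ev]
  | cons a l ih => simp [ev, ih]

theorem cast_mod {q : ℕ} {R : Type*} [CommRing R] [CharP R q] (a : ℕ) : ((a % q : ℕ) : R) = a := by
  rw [CharP.cast_eq_iff_mod_eq R q, Nat.mod_mod]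

open Polynomial in
theorem degree_ev_X_lt {R : Type*} [CommRing R] [Nontrivial R] (l : List ℕ) :
    (ev (X : R[X]) l).degree < l.length := by
  induction l with
  | nil => simp [ev]
  | cons a l ih =>
    rw [ev]
    refine (degree_add_le _ _).trans_lt (max_lt ?_ ?_)
    · rw [← C_eq_natCast]
      exact degree_C_le.trans_lt (by simp only [List.length_cons, Nat.cast_succ]; positivity)
    · rw [X_mul, degree_mul_X, List.length_cons, Nat.cast_succ]
      exact (WithBot.add_lt_add_iff_right (by simp)).2 ih

end Lists

section Roots

open Polynomial

variable {q : ℕ} [Fact q.Prime] {L : Type*} [Field L] [Algebra (ZMod q) L] {n : ℕ}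

/-- If every root `x` of `x ^ m = r` in every ring of characteristic `q` satisfies
`x ^ (q ^ n) = x`, then `X ^ m - r` divides `X ^ (q ^ n) - X` and hence has a root in the field with
`q ^ n` elements. -/
theorem exists_root_of_card (hL : Nat.card L = q ^ n) (hn : n ≠ 0) {m : ℕ} (hm : m ≠ 0)
    {r : List ℕ} (hr : r.length ≤ m)
    (h : ∀ (R : Type) [CommRing R] [CharP R q] (x : R), x ^ m = ev x r → x ^ q ^ n = x) :
    ∃ x : L, x ^ m = ev x r := by
  classical
  have hq := (Fact.out : q.Prime)
  have hfin : Finite L := Nat.finite_of_card_ne_zero (by rw [hL]; have := hq.pos; positivity)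
  have : Fintype L := Fintype.ofFinite L
  set p : (ZMod q)[X] := X ^ m - ev X r with hp
  have hdeg : (ev (X : (ZMod q)[X]) r).degree < m :=
    (degree_ev_X_lt r).trans_le (by exact_mod_cast hr)
  have hpm : p.Monic := monic_X_pow_sub hdeg
  have hpd : p.degree = m := by
    rw [hp, degree_sub_eq_left_of_degree_lt (by rwa [degree_X_pow]), degree_X_pow]
  have hp0 : p.degree ≠ 0 := by
    rw [hpd]
    exact_mod_cast hm
  have hnt : Nontrivial (AdjoinRoot p) := AdjoinRoot.nontrivial p hp0
  have hch : CharP (AdjoinRoot p) q := charP_of_injective_algebraMap' (ZMod q) q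
  have hroot : AdjoinRoot.root p ^ m = ev (AdjoinRoot.root p) r := by
    have h1 : AdjoinRoot.mk p (X ^ m - ev X r) = 0 := AdjoinRoot.mk_self
    rw [map_sub, map_pow, map_ev, AdjoinRoot.mk_X, sub_eq_zero] at h1
    exact h1
  have hdvd : p ∣ X ^ q ^ n - X := by
    rw [← AdjoinRoot.mk_eq_zero, map_sub, map_pow, AdjoinRoot.mk_X, h _ _ hroot, sub_self]
  have hsp : (p.map (algebraMap (ZMod q) L)).Splits := by
    have h1 : (X ^ q ^ n - X : L[X]) ≠ 0 :=
      FiniteField.X_pow_card_sub_X_ne_zero L (Nat.one_lt_pow hn hq.one_lt)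
    have h2 := FiniteField.splits_X_pow_nat_card_sub_X (p := q) (K := L)
    rw [hL] at h2
    refine Splits.of_dvd (g := X ^ q ^ n - X) (by simpa using h2) h1 ?_
    have h3 := Polynomial.map_dvd (algebraMap (ZMod q) L) hdvd
    simpa using h3
  obtain ⟨x, hx⟩ := hsp.exists_eval_eq_zero (by rwa [degree_map])
  refine ⟨x, ?_⟩
  rw [eval_map_algebraMap, hp, map_sub, map_pow, aeval_X, sub_eq_zero] at hx
  rw [hx]
  have := map_ev (aeval x : (ZMod q)[X] →ₐ[ZMod q] L).toRingHom (X : (ZMod q)[X]) r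
  simpa using this

/-- An element outside the prime field of a field of prime degree `n` generates it. -/
theorem exists_eq_sum_pow (hL : Nat.card L = q ^ n) (hn : n.Prime) {x : L}
    (hx : ∀ a : ZMod q, algebraMap (ZMod q) L a ≠ x) (y : L) :
    ∃ c : Fin n → ZMod q, y = ∑ i, c i • x ^ (i : ℕ) := by
  have hq := (Fact.out : q.Prime)
  have hfin : Finite L := Nat.finite_of_card_ne_zero (by rw [hL]; have := hq.pos; positivity)
  have hfr := finrank_of_card hL
  have hint : IsIntegral (ZMod q) x := Algebra.IsIntegral.isIntegral x
  have h1 : (minpoly (ZMod q) x).natDegree = n := by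
    have h2 : (minpoly (ZMod q) x).natDegree ∣ n := hfr ▸ minpoly.degree_dvd hint
    refine ((Nat.dvd_prime hn).1 h2).resolve_left fun h3 => ?_
    obtain ⟨a, ha⟩ := minpoly.natDegree_eq_one_iff.1 h3
    exact hx a ha
  have hli := linearIndependent_pow (K := ZMod q) x
  rw [h1] at hli
  have htop := hli.span_eq_top_of_card_eq_finrank' (by simp [hfr])
  have hy : y ∈ Submodule.span (ZMod q) (Set.range fun i : Fin n => x ^ (i : ℕ)) := by
    rw [htop]; trivial
  obtain ⟨c, hc⟩ := (Submodule.mem_span_range_iff_exists_fun _).1 hy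
  exact ⟨c, hc.symm⟩

end Roots

/-! ### The parameters `q = 5`, `t = 2`, `k = 3`, `n = 7` -/

/-- A polynomial of degree less than `7` with natural coefficients. -/
structure Poly7 where
  /-- The coefficient of `x ^ 0`. -/
  c0 : ℕ
  /-- The coefficient of `x ^ 1`. -/
  c1 : ℕ
  /-- The coefficient of `x ^ 2`. -/
  c2 : ℕ
  /-- The coefficient of `x ^ 3`. -/
  c3 : ℕ
  /-- The coefficient of `x ^ 4`. -/
  c4 : ℕ
  /-- The coefficient of `x ^ 5`. -/
  c5 : ℕ
  /-- The coefficient of `x ^ 6`. -/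
  c6 : ℕ

/-- The value of a polynomial at `x`. -/
def Poly7.eval {R : Type*} [CommSemiring R] (x : R) (u : Poly7) : R :=
  u.c0 + u.c1 * x + u.c2 * x ^ 2 + u.c3 * x ^ 3 + u.c4 * x ^ 4 + u.c5 * x ^ 5 + u.c6 * x ^ 6

/-- The coefficient of `x ^ 0` in the product of two polynomials. -/
def conv57_0 (u v : Poly7) : ℕ :=
  u.c0 * v.c0

/-- The coefficient of `x ^ 1` in the product of two polynomials. -/
def conv57_1 (u v : Poly7) : ℕ :=
  u.c0 * v.c1 + u.c1 * v.c0

/-- The coefficient of `x ^ 2` in the product of two polynomials. -/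
def conv57_2 (u v : Poly7) : ℕ :=
  u.c0 * v.c2 + u.c1 * v.c1 + u.c2 * v.c0

/-- The coefficient of `x ^ 3` in the product of two polynomials. -/
def conv57_3 (u v : Poly7) : ℕ :=
  u.c0 * v.c3 + u.c1 * v.c2 + u.c2 * v.c1 + u.c3 * v.c0

/-- The coefficient of `x ^ 4` in the product of two polynomials. -/
def conv57_4 (u v : Poly7) : ℕ :=
  u.c0 * v.c4 + u.c1 * v.c3 + u.c2 * v.c2 + u.c3 * v.c1 + u.c4 * v.c0

/-- The coefficient of `x ^ 5` in the product of two polynomials. -/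
def conv57_5 (u v : Poly7) : ℕ :=
  u.c0 * v.c5 + u.c1 * v.c4 + u.c2 * v.c3 + u.c3 * v.c2 + u.c4 * v.c1 + u.c5 * v.c0

/-- The coefficient of `x ^ 6` in the product of two polynomials. -/
def conv57_6 (u v : Poly7) : ℕ :=
  u.c0 * v.c6 + u.c1 * v.c5 + u.c2 * v.c4 + u.c3 * v.c3 + u.c4 * v.c2 + u.c5 * v.c1 + u.c6 * v.c0

/-- The coefficient of `x ^ 7` in the product of two polynomials. -/
def conv57_7 (u v : Poly7) : ℕ :=
  u.c1 * v.c6 + u.c2 * v.c5 + u.c3 * v.c4 + u.c4 * v.c3 + u.c5 * v.c2 + u.c6 * v.c1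

/-- The coefficient of `x ^ 8` in the product of two polynomials. -/
def conv57_8 (u v : Poly7) : ℕ :=
  u.c2 * v.c6 + u.c3 * v.c5 + u.c4 * v.c4 + u.c5 * v.c3 + u.c6 * v.c2

/-- The coefficient of `x ^ 9` in the product of two polynomials. -/
def conv57_9 (u v : Poly7) : ℕ :=
  u.c3 * v.c6 + u.c4 * v.c5 + u.c5 * v.c4 + u.c6 * v.c3

/-- The coefficient of `x ^ 10` in the product of two polynomials. -/
def conv57_10 (u v : Poly7) : ℕ :=
  u.c4 * v.c6 + u.c5 * v.c5 + u.c6 * v.c4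

/-- The coefficient of `x ^ 11` in the product of two polynomials. -/
def conv57_11 (u v : Poly7) : ℕ :=
  u.c5 * v.c6 + u.c6 * v.c5

/-- The coefficient of `x ^ 12` in the product of two polynomials. -/
def conv57_12 (u v : Poly7) : ℕ :=
  u.c6 * v.c6

/-- The product modulo `5` and `x ^ 7 = 1 + 4 x ^ 2 + 3 x ^ 3 + x ^ 4`. -/
def Poly7.mul (u v : Poly7) : Poly7 :=
  ⟨(conv57_0 u v + conv57_7 u v + conv57_10 u v + 3 * conv57_11 u v + 4 * conv57_12 u v) % 5,
    (conv57_1 u v + conv57_8 u v + conv57_11 u v + 3 * conv57_12 u v) % 5,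
    (conv57_2 u v + 4 * conv57_7 u v + conv57_9 u v + 4 * conv57_10 u v + 2 * conv57_11 u v + 2 * conv57_12 u v) % 5,
    (conv57_3 u v + 3 * conv57_7 u v + 4 * conv57_8 u v + 4 * conv57_10 u v + 3 * conv57_11 u v + 4 * conv57_12 u v) % 5,
    (conv57_4 u v + conv57_7 u v + 3 * conv57_8 u v + 4 * conv57_9 u v + conv57_10 u v + 2 * conv57_11 u v + 2 * conv57_12 u v) % 5,
    (conv57_5 u v + conv57_8 u v + 3 * conv57_9 u v + 4 * conv57_10 u v + conv57_11 u v + 2 * conv57_12 u v) % 5,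
    (conv57_6 u v + conv57_9 u v + 3 * conv57_10 u v + 4 * conv57_11 u v + conv57_12 u v) % 5⟩

/-- The fifth power modulo `5` and `x ^ 7 = 1 + 4 x ^ 2 + 3 x ^ 3 + x ^ 4`. -/
def Poly7.frob (u : Poly7) : Poly7 :=
  ⟨(u.c0 + u.c2 + 2 * u.c3 + u.c4 + u.c5 + 4 * u.c6) % 5,
    (2 * u.c3 + 3 * u.c4) % 5,
    (4 * u.c2 + 4 * u.c3 + 4 * u.c4 + 4 * u.c5) % 5,
    (4 * u.c2 + 3 * u.c3 + 2 * u.c4 + u.c5) % 5,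
    (u.c2 + 4 * u.c5 + 4 * u.c6) % 5,
    (u.c1 + 4 * u.c2 + 2 * u.c3 + 3 * u.c4 + 3 * u.c5) % 5,
    (3 * u.c2 + 3 * u.c4 + 4 * u.c5 + 4 * u.c6) % 5⟩

/-- Congruence modulo `5`. -/
def Poly7.eqv (u v : Poly7) : Bool :=
  Nat.beq (u.c0 % 5) (v.c0 % 5) &&
    Nat.beq (u.c1 % 5) (v.c1 % 5) &&
    Nat.beq (u.c2 % 5) (v.c2 % 5) &&
    Nat.beq (u.c3 % 5) (v.c3 % 5) &&
    Nat.beq (u.c4 % 5) (v.c4 % 5) &&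
    Nat.beq (u.c5 % 5) (v.c5 % 5) &&
    Nat.beq (u.c6 % 5) (v.c6 % 5)

/-- The `i`-th iterate of `Poly7.frob`. -/
def Poly7.frobIter : ℕ → Poly7 → Poly7
  | 0, u => u
  | i + 1, u => Poly7.frobIter i u.frob

section Eval

variable {R : Type*} [CommRing R] [CharP R 5] {x : R}

theorem Poly7.eval_eq_of_eqv {u v : Poly7} (h : u.eqv v = true) : u.eval x = v.eval x := by
  simp only [eqv, Bool.and_eq_true, Nat.beq_eq] at h
  have key : ∀ a b : ℕ, a % 5 = b % 5 → (a : R) = b := fun a b hab => by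
    rw [← cast_mod (q := 5) a, hab, cast_mod]
  obtain ⟨⟨⟨⟨⟨⟨h0, h1⟩, h2⟩, h3⟩, h4⟩, h5⟩, h6⟩ := h
  rw [eval, eval, key _ _ h0, key _ _ h1, key _ _ h2, key _ _ h3, key _ _ h4, key _ _ h5,
    key _ _ h6]

/-- The generator of the field with `5 ^ 7` elements that is used for the computation. -/
def IsRoot57 (x : R) : Prop := x ^ 7 = 1 + 4 * x ^ 2 + 3 * x ^ 3 + x ^ 4

theorem Poly7.eval_mul (hx : IsRoot57 x) (u v : Poly7) : (u.mul v).eval x = u.eval x * v.eval x := by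
  have h5 : (5 : R) = 0 := by exact_mod_cast CharP.cast_eq_zero R 5
  have h7 : x ^ 7 = 1 + 4 * x ^ 2 + 3 * x ^ 3 + x ^ 4 := hx
  have h8 : x ^ 8 = x + 4 * x ^ 3 + 3 * x ^ 4 + x ^ 5 := by linear_combination x * h7
  have h9 : x ^ 9 = x ^ 2 + 4 * x ^ 4 + 3 * x ^ 5 + x ^ 6 := by linear_combination x * h8
  have h10 : x ^ 10 = 1 + 4 * x ^ 2 + 4 * x ^ 3 + x ^ 4 + 4 * x ^ 5 + 3 * x ^ 6 := by
    linear_combination x * h9 + h7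
  have h11 : x ^ 11 = 3 + x + 2 * x ^ 2 + 3 * x ^ 3 + 2 * x ^ 4 + x ^ 5 + 4 * x ^ 6 := by
    linear_combination x * h10 + 3 * h7 + (2 * x ^ 2 + 2 * x ^ 3 + x ^ 4) * h5
  have h12 : x ^ 12 = 4 + 3 * x + 2 * x ^ 2 + 4 * x ^ 3 + 2 * x ^ 4 + 2 * x ^ 5 + x ^ 6 := by
    linear_combination x * h11 + 4 * h7 + (3 * x ^ 2 + 2 * x ^ 3 + x ^ 4) * h5
  have hconv : u.eval x * v.eval x = (conv57_0 u v : R) + (conv57_1 u v : R) * x + (conv57_2 u v : R) * x ^ 2 + (conv57_3 u v : R) * x ^ 3 + (conv57_4 u v : R) * x ^ 4 + (conv57_5 u v : R) * x ^ 5 + (conv57_6 u v : R) * x ^ 6 + (conv57_7 u v : R) * x ^ 7 + (conv57_8 u v : R) * x ^ 8 + (conv57_9 u v : R) * x ^ 9 + (conv57_10 u v : R) * x ^ 10 + (conv57_11 u v : R) * x ^ 11 + (conv57_12 u v : R) * x ^ 12 := by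
    simp only [eval, conv57_0, conv57_1, conv57_2, conv57_3, conv57_4, conv57_5, conv57_6, conv57_7, conv57_8, conv57_9, conv57_10, conv57_11, conv57_12]
    push_cast
    ring
  rw [hconv, h7, h8, h9, h10, h11, h12]
  simp only [mul, eval, cast_mod]
  push_cast
  ring

theorem Poly7.eval_frob (hx : IsRoot57 x) (u : Poly7) : u.frob.eval x = u.eval x ^ 5 := by
  have h2 : x ^ 10 = 1 + 4 * x ^ 2 + 4 * x ^ 3 + x ^ 4 + 4 * x ^ 5 + 3 * x ^ 6 := by
    have h := eval_eq_of_eqv (x := x) (u := Poly7.mul (⟨0, 0, 0, 0, 0, 1, 0⟩ : Poly7) (⟨0, 0, 0, 0, 0, 1, 0⟩ : Poly7))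
      (v := (⟨1, 0, 4, 4, 1, 4, 3⟩ : Poly7)) (by decide)
    rw [eval_mul hx] at h
    simp only [eval] at h
    push_cast at h
    linear_combination h
  have h3 : x ^ 15 = 2 + 2 * x + 4 * x ^ 2 + 3 * x ^ 3 + 2 * x ^ 5 := by
    have h := eval_eq_of_eqv (x := x) (u := Poly7.mul (⟨1, 0, 4, 4, 1, 4, 3⟩ : Poly7) (⟨0, 0, 0, 0, 0, 1, 0⟩ : Poly7))
      (v := (⟨2, 2, 4, 3, 0, 2, 0⟩ : Poly7)) (by decide)
    rw [eval_mul hx] at h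
    simp only [eval] at h
    push_cast at h
    linear_combination h + x ^ 5 * h2
  have h4 : x ^ 20 = 1 + 3 * x + 4 * x ^ 2 + 2 * x ^ 3 + 3 * x ^ 5 + 3 * x ^ 6 := by
    have h := eval_eq_of_eqv (x := x) (u := Poly7.mul (⟨2, 2, 4, 3, 0, 2, 0⟩ : Poly7) (⟨0, 0, 0, 0, 0, 1, 0⟩ : Poly7))
      (v := (⟨1, 3, 4, 2, 0, 3, 3⟩ : Poly7)) (by decide)
    rw [eval_mul hx] at h
    simp only [eval] at h
    push_cast at h
    linear_combination h + x ^ 5 * h3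
  have h5 : x ^ 25 = 1 + 4 * x ^ 2 + x ^ 3 + 4 * x ^ 4 + 3 * x ^ 5 + 4 * x ^ 6 := by
    have h := eval_eq_of_eqv (x := x) (u := Poly7.mul (⟨1, 3, 4, 2, 0, 3, 3⟩ : Poly7) (⟨0, 0, 0, 0, 0, 1, 0⟩ : Poly7))
      (v := (⟨1, 0, 4, 1, 4, 3, 4⟩ : Poly7)) (by decide)
    rw [eval_mul hx] at h
    simp only [eval] at h
    push_cast at h
    linear_combination h + x ^ 5 * h4
  have h6 : x ^ 30 = 4 + 4 * x ^ 4 + 4 * x ^ 6 := by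
    have h := eval_eq_of_eqv (x := x) (u := Poly7.mul (⟨1, 0, 4, 1, 4, 3, 4⟩ : Poly7) (⟨0, 0, 0, 0, 0, 1, 0⟩ : Poly7))
      (v := (⟨4, 0, 0, 0, 4, 0, 4⟩ : Poly7)) (by decide)
    rw [eval_mul hx] at h
    simp only [eval] at h
    push_cast at h
    linear_combination h + x ^ 5 * h5
  have hf : u.eval x ^ 5 = u.c0 + u.c1 * x ^ 5 + u.c2 * x ^ 10 + u.c3 * x ^ 15 + u.c4 * x ^ 20 + u.c5 * x ^ 25 + u.c6 * x ^ 30 := by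
    have hc : ∀ a : ℕ, (a : R) ^ 5 = a := fun a => by
      have := map_natCast (frobenius R 5) a
      rwa [frobenius_def] at this
    have hp : ∀ a b : R, (a + b) ^ 5 = a ^ 5 + b ^ 5 := fun a b => add_pow_char a b 5
    simp only [eval, hp, mul_pow, hc, ← pow_mul]
  rw [hf, h2, h3, h4, h5, h6]
  simp only [frob, eval, cast_mod]
  push_cast
  ring

theorem Poly7.eval_frobIter (hx : IsRoot57 x) (i : ℕ) (u : Poly7) :
    (frobIter i u).eval x = u.eval x ^ 5 ^ i := by
  induction i generalizing u with
  | zero => simp [frobIter]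
  | succ i ih => rw [frobIter, ih, eval_frob hx, ← pow_mul, ← pow_succ']

theorem IsRoot57.pow_card (hx : IsRoot57 x) : x ^ 5 ^ 7 = x := by
  have h := Poly7.eval_eq_of_eqv (x := x) (u := Poly7.frobIter 7 ⟨0, 1, 0, 0, 0, 0, 0⟩)
    (v := ⟨0, 1, 0, 0, 0, 0, 0⟩) (by decide +kernel)
  rw [Poly7.eval_frobIter hx] at h
  simpa [Poly7.eval] using h

end Eval

/-- For each of the `781` planes `⟨1, x, b⟩`, where `b` is a monic combination of `x ^ 2, …, x ^ 6`,
thirteen octal digits: an exponent `i` and the coordinates of four elements `u, v, w₁, w₂` of the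
plane with `u ^ (5 ^ i) w₁ = v ^ (5 ^ i) w₂`. -/
def witness57 : ℕ :=
  0x301c2c88098d421100120180b2002410892008490d92880098102410c13027090022416c820084c22224800922100910131a2022102542404420512e42884092e320110124c2882002936e120020b64a2400414da6410c1c1c24b2002902c904205c11910800909b44100150288900328a8d90440498e42c880931304100125420020024880924004b8e42400890422010412482c900129064064404a2832c880a4d42080092604ca2182942c920004b05930800a80b21104132448c2182816592002120922400098d40610410244c820828986120064a8cc2884094dc45104124c4c82182444c824305088b2c80098cc21908129468900025a68984104c8482080090cb25108150804120026090804204a2913088094500610414db2ca2082428c924104a6a23086098620590014104412082431010420480e32884094400610412e024421025250820024c91424000a24124800120a04100129024884105028c20880a4c48410c14a16ca22029a2402410520ca20880945b64108128108900104170824304942020800849b2610012d26cb21825a8082008492182c82090922190814c488900124110924005a2010c880924901900122008900104231164104a2432c84094988490812cb24900024482124204b2c028860960a2490012c000a20828368924004945c2482096500590c129b90b22026360864204968a24010e4422611017196082102189114430532892c80098da6490814630c900125a2418400508d130820a0a101908121384920026049124104851028800a6632010412638c900104030844204c4832082092214480085045090002516c92002083080080096632591012d924900025432144004b1233080094cb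04908110864120025868124004911320860969b66108128a50900105911164004840b2c880944804910151c2422002541216430492c23080099184480015016c822024412124204921820800821b2010816dc40a2002830d14410486c11082092d00590812e484320029c8c104104224904004951b05108101384922025191164004b4db28800a81b8411012d16c82202646414430548c92484090082090014a360a2082648c144205224b24800a72366100121390821824a5212440492012400404906510c121404a2202422518420540cb2400415088410412e36c900025411124005c91230860930901900130884c2102a08a120044c4d100800948885900129448921024300984305070a30840931b0590013238882002542c984104a5022400414d42190412639082102816094400491182c82094a305104108b20900225188184104864224820980004800850860c20820808924204871020820929b85110129170c22024a30120044b4dc24000985b8590812192092002624094440500902888098616510c131980b20029c25124204b4cb2c86096980410414c364a21829449144404a25a28800b04a2590013036892182594d944004944900840909c84800849300822024288864204906120800905204801129920c21829a48164004380808880d6c285100130904220026132184404b1112c840a45004910124b64920026248804104c2d824840980885100124850822025961904304a72104840a45b20908124060920824b25164104b4a32c820950344908121c2022102434d984004c7012400090590010012dc84920026191120004c70924000965c8410412d228900024181124004a9222c820944946104124880c2002582d18430510e10400c982025900120b40c22024b08104004101824008949366110121a0422082549116440480a32400092a48591014a26c900025131104004a8422400414c10590812d410900020a4816410488a124820a2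8924801129b40c20020a12184004a8c80488090a244904131404920824c6a104004c04b2484098118411014c00890010a22892000494e42488097100410c12d050c2202a22416440548d908800940125100131284a2182603092002130590882092a205100132204821024b48944204b7202400414586480080ca4c82182595092400490c02c86090c12210012092002102640c80410522c220860945b2610414dc2022082526612400496a224000b0824510412920c90002204d904004c8191086090094510413100cc20824382104204a90b2482090d84611012c448c2182dc4410420494dc2486096a38490c120328c20029b84104004806020800a8188610c14a460921029c61964304b0da24000a2004410412e068a20824a61920020c8cb28820a8d821100124104a2082602d144104845330820968484908128180b2082512c904204b8e330880a0ca4610c12804882002648c920004a2591086096da2090012640090010137194420519032886096094480082440ca2102da80144105410930820925344900125224822025a61964004a8da2c86090120490413010c92082900d144204a8610080096d844800849970820024468924304a8822c860928a0590012e110c2082a00082002536542400418c885104164c08900021890924104b0802084092942510c148260c2082422e124204a48030820a25344800120a88821024041144404a8a22c8009514848001a5288820825c89924104a2190080093102080192cc3090032648212430590592c84094910110c14082032202512c92410483022c820b81346108122104921028252164104a89a20840a49024800101130822024181964404970908820a31c44108124950c20025b31984004941328800924325110152484c20834a01944205c65c20820a08204800832040820825081164104c5102c80092c00610c121384920829b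86124104c70b2484090a344800826200a2202547092420520890c880a89c2090412d04c921025089904105c8cb24004181844800828c00b2102622516420542012c820928a85100125024422026268964205488c24004111c6480082e480c2082ca8a12000491190088096892190412a170a20825360964004b6810c880944a04110125b2402082445094410498080c800905304904101a24100025b8406440492e104004942320801125a8cc20825b0a120004889124800d6142110c121244c20024b64964104b70024820964a85104120a84a21824952164304b84904010988066100128000b20828b7190420488e104004b91b2610413236490010524c964304960820800870065104121c80b20029c8a120065421a30820901320800132468900024164964004b6542400896a34410012e364820826240964004c8d930860911a24801931170c20824950184304c4a10c840968a8490812943082002598d92004482d12c840989c21108131408900028390984105910420820981900110120150b22024124004004b81b24004991a2010414102890002928c184204a0143088097142510012d00c900025022164205a89030800885444108146170c2002494c80430482d93086097242490014c064a2182a248104404964a2080096642491014a448900025360820004b0632080092c305100101024a2082dc46124304c26104820924904110121230a2082922c124105a88b2484096180590812c94882002530c80410484d82880093230480113142490002612d124404b80808800a0806510814606cb20825c0092410520242400898db04900128490a2202a108124104b5212c840925826100129144020824c4810410408190400890814590412c46410022426918420495081084090cc4410812e064c21825424124204a40810820950025900128168a20025b0916430546e42400413142591012d44882082c48d1841049464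3080092d264908130b30900225c09964404b0c12400414988480010dc8890002500e124004b2182c800988c6510413221090002642198410506d12400094594510c12d30ca20824c40984004b81924010931a04800821324a2182402116400480c10886096936490c145344a2082a184924104a6a22400418ca2010414a128c2082440a184404b0cb2c80090516410c128388900324265184104a2ca30800a0c12510016820490002404886400514ca2484098a32090012c880b20821b40864204b6142400412008491012c348820825165904005020430860911c8410816192c900108880820005302228840904b05104130c8c90010592512420488832c86093230590816232c821026151920084920a2c880965984100151380b2002886e164004820800800990a22104129840922025b8e16400488802082092888490c131808c22026292164104951424800b0e46410015008ca22029c49144004981030820884125100128004221824b0498430528882400c98d444910151b0cc21024101184004b0a10c800929121900152428c20826450164004b2832488098c22610014c430b20824b24864104b3090084097136510c12644482182d344120024a0c110880a09c65904121a88900324368184004c0922400c951824108182484120825221920020309c2c88098e42191015214432082426916400490c810820981184800951a48a2002c80994430514ca3088096882490c144910900021a01164104a0442400088046610413124ca2002546e164004b08c2888099112490413126cb21825c85944104909930860989a25104168188900324c8416440513212c800908c4590012206892182820a12000503193082098dc24800829a44100226472184104824320860968c2490814115090012436404430480cc2488094a48510812916c82002492a144105089830800a1220410414d204421026469164404b7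0804860a2480591012cb44900024c04844204b20804820982345100144a28820025104864204b6a13086092630591014dc50c2102490c904004a4c328840a4d345904169020900425b80824204c8880c80090418410c120920420026461124004a7182882096a284904126368922024a71984004c6222400c96d946104128204921825a04124204a8d32486098c92210412da00b22028045104204c71928840921424800820c2490010a120120021c6a104004990464802124420122025c25924405425320860900900100129944020825141944005360330840a28022100141160920029c4c804104b48430800a1122091014dc4cb2082548a144005148a20860a8412480014d024820025a69964104c80430840a8d40480212e188921824480124304a41220820910c21104126060822024a8c844204c44b24800a3190610c14dc0ca21024020904304a24804860a283049081202644208262048641048208008008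

/-- The `k`-th octal digit of `w`. -/
def octal (w k : ℕ) : ℕ := w / 8 ^ k % 8

/-- The combination of `x ^ 2, …, x ^ 6` whose coefficients are the digits of `m` in base `5`. -/
def digits57 (m : ℕ) : Poly7 :=
  ⟨0, 0, m % 5, m / 5 % 5, m / 25 % 5, m / 125 % 5, m / 625 % 5⟩

/-- The element `c₀ + c₁ x + c₂ b`, with coordinates given by the octal digits of `w` at `k`, where
`b` is a combination of `x ^ 2, …, x ^ 6`. -/
def vec57 (w k : ℕ) (b : Poly7) : Poly7 :=
  ⟨octal w k, octal w (k + 1), octal w (k + 2) * b.c2, octal w (k + 2) * b.c3,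
    octal w (k + 2) * b.c4, octal w (k + 2) * b.c5, octal w (k + 2) * b.c6⟩

/-- The determinant of the matrix with rows `u, v, w₁` is nonzero modulo `5`. -/
def det57 (w : ℕ) : Bool :=
  !(Nat.beq ((octal w 1 * (octal w 5 * octal w 9) + octal w 2 * (octal w 6 * octal w 7) +
      octal w 3 * (octal w 4 * octal w 8)) % 5)
    ((octal w 1 * (octal w 6 * octal w 8) + octal w 2 * (octal w 4 * octal w 9) +
      octal w 3 * (octal w 5 * octal w 7)) % 5))

/-- The relation claimed by the witness `w` holds in the plane `⟨1, x, b⟩`. -/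
def check57 (b : Poly7) (w : ℕ) : Bool :=
  det57 w &&
  Poly7.eqv (Poly7.mul (Poly7.frobIter (octal w 0) (vec57 w 1 b)) (vec57 w 7 b))
    (Poly7.mul (Poly7.frobIter (octal w 0) (vec57 w 4 b)) (vec57 w 10 b))

/-- The witnesses number `s, …, s + n - 1` are valid for the planes number `m, …, m + n - 1`. -/
def checkAll57 (m s : ℕ) : ℕ → Bool
  | 0 => true
  | n + 1 => check57 (digits57 (m + n)) (witness57 / 2 ^ (39 * (s + n)) % 2 ^ 39) && checkAll57 m s n

theorem checkAll57_1 : checkAll57 1 0 1 = true := by decide +kernel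
theorem checkAll57_5 : checkAll57 5 1 5 = true := by decide +kernel
theorem checkAll57_25 : checkAll57 25 6 25 = true := by decide +kernel
theorem checkAll57_125 : checkAll57 125 31 125 = true := by decide +kernel
theorem checkAll57_625 : checkAll57 625 156 625 = true := by decide +kernel

section

variable {L : Type} [Field L] [Algebra (ZMod 5) L]

theorem octal_cast_mul (w k : ℕ) (a : L) : (octal w k : L) * a = (octal w k : ZMod 5) • a := by
  rw [Algebra.smul_def, map_natCast]

/-- A block through `1` and the generator `x` cannot contain an element `b` for which there is a
valid witness. -/
theorem check57_false (hL : Nat.card L = 5 ^ 7) {S : Set (Submodule (ZMod 5) L)}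
    (hS : IsDesign 2 3 1 S) (hI : TwistInvariant ⊤ S) {x : L} (hx : IsRoot57 x)
    {B : Submodule (ZMod 5) L} (hB : B ∈ S) (h1 : (1 : L) ∈ B) (hxB : x ∈ B) {b : Poly7}
    (hb0 : b.c0 = 0) (hb1 : b.c1 = 0) (hb : b.eval x ∈ B)
    (hind : ∀ c0 c1 c2 : ZMod 5, c0 • (1 : L) + c1 • x + c2 • b.eval x = 0 →
      c0 = 0 ∧ c1 = 0 ∧ c2 = 0) {w : ℕ} (hw : check57 b w = true) : False := by
  have : CharP L 5 := charP_of_injective_algebraMap' (ZMod 5) 5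
  rw [check57, Bool.and_eq_true] at hw
  obtain ⟨hdet, hrel⟩ := hw
  have hvec : ∀ k, (vec57 w k b).eval x = (octal w k : ZMod 5) • (1 : L) +
      (octal w (k + 1) : ZMod 5) • x + (octal w (k + 2) : ZMod 5) • b.eval x := by
    intro k
    simp only [← octal_cast_mul, Poly7.eval, vec57, hb0, hb1]
    push_cast
    ring
  have hmem : ∀ k, (vec57 w k b).eval x ∈ B := fun k => by
    rw [hvec]
    exact B.add_mem (B.add_mem (B.smul_mem _ h1) (B.smul_mem _ hxB)) (B.smul_mem _ hb)
  have hdet' : (octal w 1 * (octal w 5 * octal w 9) + octal w 2 * (octal w 6 * octal w 7) +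
      octal w 3 * (octal w 4 * octal w 8) : ZMod 5) ≠ octal w 1 * (octal w 6 * octal w 8) +
      octal w 2 * (octal w 4 * octal w 9) + octal w 3 * (octal w 5 * octal w 7) := by
    intro h
    have h' : ((octal w 1 * (octal w 5 * octal w 9) + octal w 2 * (octal w 6 * octal w 7) +
        octal w 3 * (octal w 4 * octal w 8) : ℕ) : ZMod 5) = ((octal w 1 * (octal w 6 * octal w 8) +
        octal w 2 * (octal w 4 * octal w 9) + octal w 3 * (octal w 5 * octal w 7) : ℕ) : ZMod 5) := by
      push_cast
      exact h
    have h2 := (ZMod.natCast_eq_natCast_iff' _ _ 5).1 h'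
    rw [det57, h2, Nat.beq_refl] at hdet
    exact absurd hdet (by decide)
  -- the three elements `u, v, w₁` are linearly independent
  have hli : ∀ a b' c : ZMod 5, a • (vec57 w 1 b).eval x + b' • (vec57 w 4 b).eval x +
      c • (vec57 w 7 b).eval x = 0 → a = 0 ∧ b' = 0 ∧ c = 0 := by
    intro a b' c h
    simp only [hvec] at h
    obtain ⟨e0, e1, e2⟩ := hind
      (a * octal w 1 + b' * octal w 4 + c * octal w 7)
      (a * octal w 2 + b' * octal w 5 + c * octal w 8)
      (a * octal w 3 + b' * octal w 6 + c * octal w 9) (by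
        rw [← h]; module)
    have hd := sub_ne_zero.2 hdet'
    refine ⟨(mul_eq_zero.1 ?_).resolve_right hd, (mul_eq_zero.1 ?_).resolve_right hd,
      (mul_eq_zero.1 ?_).resolve_right hd⟩
    · linear_combination (octal w 5 * octal w 9 - octal w 6 * octal w 8 : ZMod 5) * e0 +
        (octal w 6 * octal w 7 - octal w 4 * octal w 9 : ZMod 5) * e1 +
        (octal w 4 * octal w 8 - octal w 5 * octal w 7 : ZMod 5) * e2
    · linear_combination (octal w 3 * octal w 8 - octal w 2 * octal w 9 : ZMod 5) * e0 +
        (octal w 1 * octal w 9 - octal w 3 * octal w 7 : ZMod 5) * e1 +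
        (octal w 2 * octal w 7 - octal w 1 * octal w 8 : ZMod 5) * e2
    · linear_combination (octal w 2 * octal w 6 - octal w 3 * octal w 5 : ZMod 5) * e0 +
        (octal w 3 * octal w 4 - octal w 1 * octal w 6 : ZMod 5) * e1 +
        (octal w 1 * octal w 5 - octal w 2 * octal w 4 : ZMod 5) * e2
  have hrel' := Poly7.eval_eq_of_eqv (x := x) hrel
  rw [Poly7.eval_mul hx, Poly7.eval_mul hx, Poly7.eval_frobIter hx, Poly7.eval_frobIter hx] at hrel'
  set u := (vec57 w 1 b).eval x with hu
  set v := (vec57 w 4 b).eval x with hv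
  set w₁ := (vec57 w 7 b).eval x with hw1
  set w₂ := (vec57 w 10 b).eval x with hw2
  set i := octal w 0
  have hv0 : v ≠ 0 := by
    intro h
    have := hli 0 1 0 (by simp [h])
    exact one_ne_zero this.2.1
  have hw0 : w₁ ≠ 0 := by
    intro h
    have := hli 0 0 1 (by simp [h])
    exact one_ne_zero this.2.2
  have huv : ∀ c : ZMod 5, u ≠ c • v := by
    intro c h
    have := hli 1 (-c) 0 (by simp [h])
    exact one_ne_zero this.1
  have hvi : v ^ 5 ^ i ≠ 0 := pow_ne_zero _ hv0
  have e1 : w₁ / v ^ 5 ^ i * v ^ 5 ^ i = w₁ := div_mul_cancel₀ _ hvi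
  have e2 : w₁ / v ^ 5 ^ i * u ^ 5 ^ i = w₂ := by
    rw [div_mul_eq_mul_div, div_eq_iff hvi]
    linear_combination hrel'
  obtain ⟨a, ha⟩ := hI.scalar_of_pair hS hL (by norm_num) (by norm_num) (by norm_num)
    (by norm_num) (by norm_num) hB hv0 huv (hmem 4) (hmem 1) (i := i) trivial
    (div_ne_zero hw0 hvi) (by rw [e1]; exact hmem 7) (by rw [e2]; exact hmem 10)
  have := hli 0 (-a) 1 (by
    rw [← e1, ha v]; module)
  exact one_ne_zero this.2.2

theorem checkAll57_spec {m s : ℕ} : ∀ {n : ℕ}, checkAll57 m s n = true → ∀ j < n,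
    ∃ w, check57 (digits57 (m + j)) w = true
  | 0, _, j, hj => by omega
  | n + 1, h, j, hj => by
    rw [checkAll57, Bool.and_eq_true] at h
    rcases Nat.lt_succ_iff_lt_or_eq.1 hj with h' | rfl
    · exact checkAll57_spec h.2 j h'
    · exact ⟨_, h.1⟩

end

/-- Every monic combination `b` of `x ^ 2, …, x ^ 6` has a valid witness. -/
theorem exists_check57 {v : Fin 5 → ℕ} (hv : ∀ i, v i < 5)
    (htop : ∃ i, v i = 1 ∧ ∀ j, i < j → v j = 0) :
    ∃ w, check57 ⟨0, 0, v 0, v 1, v 2, v 3, v 4⟩ w = true := by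
  have h0 := hv 0
  have h1 := hv 1
  have h2 := hv 2
  have h3 := hv 3
  have h4 := hv 4
  have hd : ∀ m, m = v 0 + 5 * v 1 + 25 * v 2 + 125 * v 3 + 625 * v 4 →
      digits57 m = ⟨0, 0, v 0, v 1, v 2, v 3, v 4⟩ := by
    intro m hm
    rw [digits57, Poly7.mk.injEq]
    refine ⟨rfl, rfl, ?_, ?_, ?_, ?_, ?_⟩ <;> omega
  obtain ⟨i, hi, hj⟩ := htop
  fin_cases i
  · have e1 := hj 1 (by decide)
    have e2 := hj 2 (by decide)
    have e3 := hj 3 (by decide)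
    have e4 := hj 4 (by decide)
    obtain ⟨w, hw⟩ := checkAll57_spec checkAll57_1 0 (by omega)
    rw [hd _ (by simp at hi; omega)] at hw
    exact ⟨w, hw⟩
  · have e2 := hj 2 (by decide)
    have e3 := hj 3 (by decide)
    have e4 := hj 4 (by decide)
    obtain ⟨w, hw⟩ := checkAll57_spec checkAll57_5 (v 0) (by omega)
    rw [hd _ (by simp at hi; omega)] at hw
    exact ⟨w, hw⟩
  · have e3 := hj 3 (by decide)
    have e4 := hj 4 (by decide)
    obtain ⟨w, hw⟩ := checkAll57_spec checkAll57_25 (v 0 + 5 * v 1) (by omega)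
    rw [hd _ (by simp at hi; omega)] at hw
    exact ⟨w, hw⟩
  · have e4 := hj 4 (by decide)
    obtain ⟨w, hw⟩ := checkAll57_spec checkAll57_125 (v 0 + 5 * v 1 + 25 * v 2) (by omega)
    rw [hd _ (by simp at hi; omega)] at hw
    exact ⟨w, hw⟩
  · obtain ⟨w, hw⟩ := checkAll57_spec checkAll57_625 (v 0 + 5 * v 1 + 25 * v 2 + 125 * v 3) (by omega)
    rw [hd _ (by simp at hi; omega)] at hw
    exact ⟨w, hw⟩

theorem not_admits_5_2_3_7 (C : Subgroup (GLin 7 5)) (hC : IsSingerSubgroup C) :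
    ¬ Admits 5 2 3 7 (Subgroup.normalizer (C : Set (GLin 7 5))) := by
  intro hA
  obtain ⟨L, _, _, hL, S, hS, hscale, hfrob⟩ :=
    exists_field_design (by norm_num) hC Subgroup.le_normalizer hA
  have hI := hscale.twistInvariant_top (hfrob le_rfl)
  have hch : CharP L 5 := charP_of_injective_algebraMap' (ZMod 5) 5
  have hroot : ∀ (R : Type) [CommRing R] (x : R), x ^ 7 = ev x [1, 0, 4, 3, 1] → IsRoot57 x := by
    intro R _ x h
    rw [IsRoot57, h]
    simp only [ev]
    push_cast
    ring
  obtain ⟨x, hx⟩ := exists_root_of_card (q := 5) hL (by norm_num) (m := 7) (by norm_num)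
    (r := [1, 0, 4, 3, 1]) (by simp) fun R _ _ x h => (hroot R x h).pow_card
  replace hx := hroot L x hx
  have hxK : ∀ a : ZMod 5, algebraMap (ZMod 5) L a ≠ x := by
    rintro a rfl
    have h : a ^ 7 = 1 + 4 * a ^ 2 + 3 * a ^ 3 + a ^ 4 := by
      apply (algebraMap (ZMod 5) L).injective
      have e3 : algebraMap (ZMod 5) L 3 = 3 := map_ofNat _ 3
      have e4 : algebraMap (ZMod 5) L 4 = 4 := map_ofNat _ 4
      simpa [IsRoot57, e3, e4] using hx
    have hno : ∀ a : ZMod 5, ¬ a ^ 7 = 1 + 4 * a ^ 2 + 3 * a ^ 3 + a ^ 4 := by decide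
    exact hno a h
  have hx1 : ∀ c : ZMod 5, x ≠ c • (1 : L) := fun c h => hxK c (by rw [h, Algebra.smul_def, mul_one])
  obtain ⟨B, hB, h1, hxB⟩ := hS.exists_block_pair one_ne_zero hx1
  have hfr := finrank_of_card hL
  have hfin : FiniteDimensional (ZMod 5) L := FiniteDimensional.of_finrank_pos (by omega)
  -- an element of the block outside the line
  obtain ⟨y, hyB, hy⟩ : ∃ y ∈ B, y ∉ Submodule.span (ZMod 5) {1, x} := by
    by_contra hcon
    push Not at hcon
    have h2 := Submodule.finrank_mono (show B ≤ Submodule.span (ZMod 5) {1, x} from hcon)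
    rw [hS.1 B hB, finrank_span_pair one_ne_zero hx1] at h2
    omega
  obtain ⟨c, hc⟩ := exists_eq_sum_pow hL (by norm_num) hxK y
  rw [Fin.sum_univ_seven] at hc
  simp only [Fin.isValue, Fin.val_zero, pow_zero, Fin.val_one, pow_one] at hc
  let d : Fin 5 → ZMod 5 := fun i => c (i.addNat 2)
  have hd0 : ∃ i, d i ≠ 0 := by
    by_contra hcon
    push Not at hcon
    apply hy
    have e : ∀ i : Fin 5, c (i.addNat 2) = 0 := hcon
    have e2 : c 2 = 0 := e 0
    have e3 : c 3 = 0 := e 1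
    have e4 : c 4 = 0 := e 2
    have e5 : c 5 = 0 := e 3
    have e6 : c 6 = 0 := e 4
    rw [hc, e2, e3, e4, e5, e6, Submodule.mem_span_pair]
    exact ⟨c 0, c 1, by simp⟩
  -- the last nonzero coefficient is normalized to one
  obtain ⟨i, hi, hmax⟩ : ∃ i, d i ≠ 0 ∧ ∀ j, i < j → d j = 0 := by
    have hne : (Finset.univ.filter fun i => d i ≠ 0).Nonempty := by
      obtain ⟨i, hi⟩ := hd0
      exact ⟨i, by simpa using hi⟩
    refine ⟨_, (Finset.mem_filter.1 (Finset.max'_mem _ hne)).2, fun j hj => ?_⟩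
    by_contra h0
    exact absurd (Finset.le_max' _ j (by simpa using h0)) (not_le.2 hj)
  let v : Fin 5 → ℕ := fun j => ((d i)⁻¹ * d j).val
  obtain ⟨w, hw⟩ := exists_check57 (v := v) (fun j => ZMod.val_lt _) ⟨i, by
    simp only [v]
    rw [inv_mul_cancel₀ hi]
    rfl, fun j hj => by simp [v, hmax j hj]⟩
  have hb : Poly7.eval x ⟨0, 0, v 0, v 1, v 2, v 3, v 4⟩ =
      (d i)⁻¹ • (y - c 0 • (1 : L) - c 1 • x) := by
    have hv : ∀ j, (v j : L) = algebraMap (ZMod 5) L ((d i)⁻¹ * c (j.addNat 2)) := fun j => by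
      rw [← map_natCast (algebraMap (ZMod 5) L), ZMod.natCast_zmod_val]
    simp only [Poly7.eval, hv, hc]
    simp only [Algebra.smul_def, map_mul, Nat.cast_zero]
    have e2 : (Fin.addNat (0 : Fin 5) 2 : Fin 7) = 2 := rfl
    have e3 : (Fin.addNat (1 : Fin 5) 2 : Fin 7) = 3 := rfl
    have e4 : (Fin.addNat (2 : Fin 5) 2 : Fin 7) = 4 := rfl
    have e5 : (Fin.addNat (3 : Fin 5) 2 : Fin 7) = 5 := rfl
    have e6 : (Fin.addNat (4 : Fin 5) 2 : Fin 7) = 6 := rfl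
    have p2 : ((2 : Fin 7) : ℕ) = 2 := rfl
    have p3 : ((3 : Fin 7) : ℕ) = 3 := rfl
    have p4 : ((4 : Fin 7) : ℕ) = 4 := rfl
    have p5 : ((5 : Fin 7) : ℕ) = 5 := rfl
    have p6 : ((6 : Fin 7) : ℕ) = 6 := rfl
    rw [e2, e3, e4, e5, e6, p2, p3, p4, p5, p6]
    ring
  refine check57_false hL hS hI hx hB h1 hxB (b := ⟨0, 0, v 0, v 1, v 2, v 3, v 4⟩) rfl rfl ?_ ?_ hw
  · rw [hb]
    exact B.smul_mem _ (B.sub_mem (B.sub_mem hyB (B.smul_mem _ h1)) (B.smul_mem _ hxB))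
  · intro c0 c1 c2 h
    rw [hb] at h
    have h2 : c2 = 0 := by
      by_contra h2
      apply hy
      rw [Submodule.mem_span_pair]
      refine ⟨c 0 - d i * c2⁻¹ * c0, c 1 - d i * c2⁻¹ * c1, ?_⟩
      have h3 : (d i * c2⁻¹) • (c0 • (1 : L) + c1 • x + c2 • (d i)⁻¹ • (y - c 0 • (1 : L) - c 1 • x))
          = 0 := by rw [h, smul_zero]
      have h4 : (d i * c2⁻¹) • c2 • (d i)⁻¹ • (y - c 0 • (1 : L) - c 1 • x) =
          y - c 0 • (1 : L) - c 1 • x := by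
        rw [smul_smul, smul_smul, show d i * c2⁻¹ * c2 * (d i)⁻¹ = 1 by field_simp, one_smul]
      rw [smul_add, h4] at h3
      rw [← sub_eq_zero, ← neg_eq_zero, ← h3]
      module
    subst h2
    rw [zero_smul, add_zero] at h
    have hc1 : c1 = 0 := by
      by_contra hc1
      apply hx1 (-(c1⁻¹ * c0))
      have h3 : c1⁻¹ • (c0 • (1 : L) + c1 • x) = 0 := by rw [h, smul_zero]
      rw [smul_add, smul_smul, smul_smul, inv_mul_cancel₀ hc1, one_smul] at h3
      rw [neg_smul]
      exact eq_neg_of_add_eq_zero_right h3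
    subst hc1
    rw [zero_smul, add_zero] at h
    exact ⟨(smul_eq_zero.1 h).resolve_right one_ne_zero, rfl, rfl⟩

/-! ### Colours of lines -/

section Colour

variable {q : ℕ} [Fact q.Prime] {L : Type*} [Field L] [Algebra (ZMod q) L]

/-- Some map `x ↦ d x ^ (q ^ i)` with `d ≠ 0` and `i ∈ I` sends `U` into `W`. -/
def TwistLE (I : AddSubmonoid ℕ) (U W : Submodule (ZMod q) L) : Prop :=
  ∃ i ∈ I, ∃ d : L, d ≠ 0 ∧ ∀ x ∈ U, d * x ^ q ^ i ∈ W

theorem TwistLE.trans {I : AddSubmonoid ℕ} {U V W : Submodule (ZMod q) L} (h : TwistLE I U V)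
    (h' : TwistLE I V W) : TwistLE I U W := by
  obtain ⟨i, hi, d, hd, hU⟩ := h
  obtain ⟨j, hj, e, he, hV⟩ := h'
  refine ⟨i + j, I.add_mem hi hj, e * d ^ q ^ j, mul_ne_zero he (pow_ne_zero _ hd), fun x hx => ?_⟩
  have := hV _ (hU x hx)
  rwa [mul_pow, ← pow_mul, ← pow_add, ← mul_assoc] at this

theorem TwistLE.of_mul {I : AddSubmonoid ℕ} {U W : Submodule (ZMod q) L} {d : L} (hd : d ≠ 0)
    (h : ∀ x ∈ U, d * x ∈ W) : TwistLE I U W :=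
  ⟨0, I.zero_mem, d, hd, by simpa using h⟩

theorem TwistLE.of_le {I : AddSubmonoid ℕ} {U W : Submodule (ZMod q) L} (h : U ≤ W) :
    TwistLE I U W :=
  TwistLE.of_mul one_ne_zero fun x hx => by simpa using h hx

/-- The inverse of a map `x ↦ d x ^ (q ^ i)` has the same form. -/
theorem TwistLE.symm {I : AddSubmonoid ℕ} {n : ℕ} (hn : n ≠ 0) (hL : Nat.card L = q ^ n)
    {U W : Submodule (ZMod q) L} (h : TwistLE I U W)
    (hUW : Module.finrank (ZMod q) U = Module.finrank (ZMod q) W) : TwistLE I W U := by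
  have hq := (Fact.out : q.Prime)
  have hfin : Finite L := Nat.finite_of_card_ne_zero (by rw [hL]; have := hq.pos; positivity)
  obtain ⟨i, hi, d, hd, hU⟩ := h
  have hch : CharP L q := charP_of_injective_algebraMap' (ZMod q) q
  let f : U → W := fun x => ⟨d * (x : L) ^ q ^ i, hU x x.2⟩
  have hf : Function.Injective f := by
    intro x y hxy
    have h1 : d * (x : L) ^ q ^ i = d * (y : L) ^ q ^ i := congrArg Subtype.val hxy
    have h2 := mul_left_cancel₀ hd h1
    exact Subtype.ext (iterateFrobenius_inj L q i (by simpa [iterateFrobenius_def] using h2))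
  have hbij : Function.Bijective f := by
    refine (Nat.bijective_iff_injective_and_card f).2 ⟨hf, ?_⟩
    rw [Module.natCard_eq_pow_finrank (K := ZMod q), Module.natCard_eq_pow_finrank (K := ZMod q)
      (V := W), hUW]
  have hper : ∀ (m : ℕ) (x : L), x ^ q ^ (n * m) = x := by
    intro m x
    induction m with
    | zero => simp
    | succ m ih => rw [Nat.mul_succ, pow_add, pow_mul, ih, pow_q_pow_card hL]
  refine ⟨(n - 1) * i, by simpa using I.nsmul_mem hi (n - 1), (d ^ q ^ ((n - 1) * i))⁻¹,
    inv_ne_zero (pow_ne_zero _ hd), fun y hy => ?_⟩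
  obtain ⟨x, hx⟩ := hbij.2 ⟨y, hy⟩
  have hxy : d * (x : L) ^ q ^ i = y := congrArg Subtype.val hx
  rw [← hxy, mul_pow, ← pow_mul, ← pow_add, inv_mul_cancel_left₀ (pow_ne_zero _ hd),
    show i + (n - 1) * i = n * i by
      obtain ⟨m, rfl⟩ := Nat.exists_eq_succ_of_ne_zero hn
      simp only [Nat.succ_eq_add_one, Nat.add_sub_cancel]
      ring, hper]
  exact x.2

/-- The elements outside the prime field: the ratios of independent pairs. -/
def IsRatio (q : ℕ) [Fact q.Prime] {L : Type*} [Field L] [Algebra (ZMod q) L] (z : L) : Prop :=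
  ∀ a : ZMod q, algebraMap (ZMod q) L a ≠ z

theorem IsRatio.ne_zero {z : L} (hz : IsRatio q z) : z ≠ 0 := fun h => hz 0 (by rw [map_zero, h])

theorem isRatio_div {x y : L} (hx : x ≠ 0) (hy : ∀ c : ZMod q, y ≠ c • x) : IsRatio q (y / x) := by
  intro a h
  apply hy a
  rw [Algebra.smul_def, h, div_mul_cancel₀ _ hx]

theorem IsRatio.ne_smul {x y : L} (hx : x ≠ 0) (h : IsRatio q (y / x)) (c : ZMod q) : y ≠ c • x := by
  rintro rfl
  apply h c
  rw [Algebra.smul_def, mul_div_cancel_right₀ _ hx]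

theorem IsRatio.pow {z : L} (hz : IsRatio q z) (i : ℕ) : IsRatio q (z ^ q ^ i) := by
  intro a h
  apply hz a
  have hch : CharP L q := charP_of_injective_algebraMap' (ZMod q) q
  refine iterateFrobenius_inj L q i ?_
  rw [iterateFrobenius_def, iterateFrobenius_def, pow_q_algebraMap, h]

/-- A colouring of the elements outside the prime field by the orbits of the lines `⟨1, z⟩`: it is
invariant under the Frobenius maps in `I` and the transformations generating `PGL(2, q)`, and elements
of the same colour span equivalent lines. -/
structure IsColouring (I : AddSubmonoid ℕ) (col : L → ℕ) : Prop where
  pow : ∀ i ∈ I, ∀ z, IsRatio q z → col (z ^ q ^ i) = col z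
  add_one : ∀ z, IsRatio q z → col (z + 1) = col z
  inv : ∀ z, IsRatio q z → col z⁻¹ = col z
  smul : ∀ (a : ZMod q) (z : L), a ≠ 0 → IsRatio q z → col (a • z) = col z
  twist : ∀ z w, IsRatio q z → IsRatio q w → col z = col w →
    TwistLE I (Submodule.span (ZMod q) {1, z}) (Submodule.span (ZMod q) {1, w})

theorem IsRatio.add {z : L} (hz : IsRatio q z) (a : ZMod q) :
    IsRatio q (z + algebraMap (ZMod q) L a) := by
  intro b h
  apply hz (b - a)
  rw [map_sub, h, add_sub_cancel_right]

theorem IsRatio.smul {z : L} (hz : IsRatio q z) {a : ZMod q} (ha : a ≠ 0) : IsRatio q (a • z) := by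
  intro b h
  apply hz (a⁻¹ * b)
  rw [map_mul, h, Algebra.smul_def, ← mul_assoc, ← map_mul, inv_mul_cancel₀ ha, map_one, one_mul]

theorem IsRatio.inv {z : L} (hz : IsRatio q z) : IsRatio q z⁻¹ := by
  intro b h
  apply hz b⁻¹
  rw [map_inv₀, h, inv_inv]

variable {I : AddSubmonoid ℕ} {col : L → ℕ}

theorem IsColouring.add_algebraMap (hcol : IsColouring (q := q) I col) (a : ZMod q) {z : L}
    (hz : IsRatio q z) : col (z + algebraMap (ZMod q) L a) = col z := by
  have h : ∀ m : ℕ, col (z + (m : L)) = col z := by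
    intro m
    induction m with
    | zero => simp
    | succ m ih =>
      have := hcol.add_one _ (hz.add (m : ZMod q))
      rw [map_natCast] at this
      rw [Nat.cast_succ, ← add_assoc, this, ih]
  have := h a.val
  rwa [← map_natCast (algebraMap (ZMod q) L), ZMod.natCast_zmod_val] at this

/-- Colours are invariant under fractional linear transformations. -/
theorem IsColouring.fractional (hcol : IsColouring (q := q) I col) {z : L} (hz : IsRatio q z)
    {a b c d : ZMod q} (h0 : algebraMap (ZMod q) L a + b • z ≠ 0)
    (h : IsRatio q ((algebraMap (ZMod q) L c + d • z) / (algebraMap (ZMod q) L a + b • z))) :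
    col ((algebraMap (ZMod q) L c + d • z) / (algebraMap (ZMod q) L a + b • z)) = col z := by
  have haff : ∀ (e f : ZMod q), f ≠ 0 → ∀ w : L, IsRatio q w →
      col (algebraMap (ZMod q) L e + f • w) = col w := by
    intro e f hf w hw
    rw [add_comm, hcol.add_algebraMap e (hw.smul hf), hcol.smul f w hf hw]
  by_cases hb : b = 0
  · subst hb
    simp only [zero_smul, add_zero] at h h0 ⊢
    have ha : a ≠ 0 := fun ha => h0 (by rw [ha, map_zero])
    have e : (algebraMap (ZMod q) L c + d • z) / algebraMap (ZMod q) L a =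
        algebraMap (ZMod q) L (c / a) + (d / a) • z := by
      simp only [Algebra.smul_def, map_div₀]
      ring
    rw [e] at h ⊢
    refine haff _ _ ?_ z hz
    rintro hd
    rw [hd, zero_smul, add_zero] at h
    exact h _ rfl
  · have hb' : algebraMap (ZMod q) L b ≠ 0 := by simpa using hb
    have e : (algebraMap (ZMod q) L c + d • z) / (algebraMap (ZMod q) L a + b • z) =
        algebraMap (ZMod q) L (d / b) +
          (c - a * d / b) • (algebraMap (ZMod q) L a + b • z)⁻¹ := by
      simp only [Algebra.smul_def, map_div₀, map_sub, map_mul] at h0 ⊢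
      rw [div_eq_iff h0, add_mul, mul_assoc, inv_mul_cancel₀ h0, mul_one]
      field_simp
      ring
    have hw : IsRatio q (algebraMap (ZMod q) L a + b • z) := by
      rw [add_comm]
      exact (hz.smul hb).add a
    rw [e] at h ⊢
    rw [haff _ _ ?_ _ hw.inv, hcol.inv _ hw, haff _ _ hb z hz]
    intro hd
    rw [hd, zero_smul, add_zero] at h
    exact h _ rfl

/-- The colour of a line does not depend on its basis. -/
theorem IsColouring.basis_change (hcol : IsColouring (q := q) I col) {x y : L} (hx : x ≠ 0)
    (hxy : IsRatio q (y / x)) {a b c d : ZMod q} (h0 : a • x + b • y ≠ 0)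
    (h : IsRatio q ((c • x + d • y) / (a • x + b • y))) :
    col ((c • x + d • y) / (a • x + b • y)) = col (y / x) := by
  have e1 : ∀ a b : ZMod q, a • x + b • y = x * (algebraMap (ZMod q) L a + b • (y / x)) := by
    intro a b
    simp only [Algebra.smul_def]
    field_simp
  rw [e1] at h0
  have h0' := right_ne_zero_of_mul h0
  rw [e1, e1, mul_div_mul_left _ _ hx] at h ⊢
  exact hcol.fractional hxy h0' h

/-- The colours of the lines of a subspace. -/
def coloursOf (q : ℕ) [Fact q.Prime] {L : Type*} [Field L] [Algebra (ZMod q) L] (col : L → ℕ)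
    (B : Submodule (ZMod q) L) : Set ℕ :=
  {c | ∃ x ∈ B, ∃ y ∈ B, x ≠ 0 ∧ IsRatio q (y / x) ∧ col (y / x) = c}

theorem mem_span_pair_mul {x y w : L} (hx : x ≠ 0) (hw : w ∈ Submodule.span (ZMod q) {1, y / x}) :
    x * w ∈ Submodule.span (ZMod q) {x, y} := by
  rw [Submodule.mem_span_pair] at hw ⊢
  obtain ⟨a, b, rfl⟩ := hw
  refine ⟨a, b, ?_⟩
  simp only [Algebra.smul_def]
  field_simp

/-- Pairs of the same colour are related by a map `x ↦ d x ^ (q ^ i)`. -/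
theorem IsColouring.exists_twist (hcol : IsColouring (q := q) I col) {x y x' y' : L} (hx : x ≠ 0)
    (hxy : IsRatio q (y / x)) (hx' : x' ≠ 0) (hxy' : IsRatio q (y' / x'))
    (h : col (y / x) = col (y' / x')) : ∃ i ∈ I, ∃ d : L, d ≠ 0 ∧
      d * x ^ q ^ i ∈ Submodule.span (ZMod q) {x', y'} ∧
      d * y ^ q ^ i ∈ Submodule.span (ZMod q) {x', y'} := by
  obtain ⟨i, hi, d, hd, hU⟩ := hcol.twist _ _ hxy hxy' h
  have hxi : x ^ q ^ i ≠ 0 := pow_ne_zero _ hx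
  refine ⟨i, hi, x' * d / x ^ q ^ i, div_ne_zero (mul_ne_zero hx' hd) hxi, ?_, ?_⟩
  · have := mem_span_pair_mul hx' (hU 1 (Submodule.subset_span (by simp)))
    rw [one_pow] at this
    convert this using 1
    field_simp
  · have := mem_span_pair_mul hx' (hU (y / x) (Submodule.subset_span (by simp)))
    rw [div_pow] at this
    convert this using 1
    field_simp

variable {S : Set (Submodule (ZMod q) L)} {k n : ℕ}

theorem span_pair_le {B : Submodule (ZMod q) L} {x y : L} (hx : x ∈ B) (hy : y ∈ B) :
    Submodule.span (ZMod q) {x, y} ≤ B := by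
  rw [Submodule.span_le]
  rintro z (rfl | rfl) <;> assumption

/-- Two lines of a block with the same colour are equal. -/
theorem IsColouring.line_unique (hcol : IsColouring (q := q) I col) (hI : TwistInvariant I S)
    (hS : IsDesign 2 k 1 S) (hL : Nat.card L = q ^ n)
    (hn : n.Prime) (hk : 0 < k) (hkn : k < n) (hqn : q ≤ n) (hmod : q < q ^ k % n)
    {B : Submodule (ZMod q) L} (hB : B ∈ S) {x y x' y' : L} (hx : x ≠ 0)
    (hxy : IsRatio q (y / x)) (hx' : x' ≠ 0) (hxy' : IsRatio q (y' / x'))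
    (h : col (y / x) = col (y' / x')) (hxB : x ∈ B) (hyB : y ∈ B) (hxB' : x' ∈ B) (hyB' : y' ∈ B) :
    x ∈ Submodule.span (ZMod q) {x', y'} ∧ y ∈ Submodule.span (ZMod q) {x', y'} := by
  obtain ⟨i, hi, d, hd, h1, h2⟩ := hcol.exists_twist hx hxy hx' hxy' h
  have hle := span_pair_le hxB' hyB'
  obtain ⟨a, ha⟩ := hI.scalar_of_pair hS hL hn hk hkn hqn hmod hB hx (hxy.ne_smul hx) hxB hyB hi hd
    (hle h1) (hle h2)
  have ha0 : a ≠ 0 := by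
    rintro rfl
    have := ha 1
    rw [one_pow, mul_one, zero_smul] at this
    exact hd this
  rw [ha] at h1 h2
  exact ⟨(Submodule.smul_mem_iff _ ha0).1 h1, (Submodule.smul_mem_iff _ ha0).1 h2⟩

/-- Blocks sharing one colour have the same colours. -/
theorem IsColouring.coloursOf_subset (hcol : IsColouring (q := q) I col) (hI : TwistInvariant I S)
    (hS : IsDesign 2 k 1 S) {B B' : Submodule (ZMod q) L} (hB : B ∈ S) (hB' : B' ∈ S) {c : ℕ}
    (hc : c ∈ coloursOf q col B) (hc' : c ∈ coloursOf q col B') :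
    coloursOf q col B ⊆ coloursOf q col B' := by
  obtain ⟨x, hxB, y, hyB, hx, hxy, rfl⟩ := hc
  obtain ⟨x', hxB', y', hyB', hx', hxy', h⟩ := hc'
  obtain ⟨i, hi, d, hd, h1, h2⟩ := hcol.exists_twist hx hxy hx' hxy' h.symm
  have hle := span_pair_le hxB' hyB'
  have hmap := hI.mem_of_pair hS hB hB' hx (hxy.ne_smul hx) hxB hyB hi hd (hle h1) (hle h2)
  rintro _ ⟨u, huB, v, hvB, hu, huv, rfl⟩
  have e : d * v ^ q ^ i / (d * u ^ q ^ i) = (v / u) ^ q ^ i := by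
    rw [mul_div_mul_left _ _ hd, div_pow]
  exact ⟨_, hmap u huB, _, hmap v hvB, mul_ne_zero hd (pow_ne_zero _ hu), e ▸ huv.pow i,
    by rw [e, hcol.pow i hi _ huv]⟩

end Colour

/-! ### Colourings given by a table of discrete logarithms -/

/-- The value at `x` of the polynomial whose coefficients are the digits of `c` in base `q`. -/
def evc {L : Type*} [CommSemiring L] (q : ℕ) (x : L) (c : ℕ) : L := ev x (Nat.digits q c)

/-- Adds one to the last digit in base `q`, without carry. -/
def succ1 (q c : ℕ) : ℕ :=
  Nat.add (Nat.sub c (Nat.mod c q)) (Nat.mod (Nat.add (Nat.mod c q) 1) q)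

section Codes

variable {q : ℕ} {L : Type*} [CommRing L] (x : L)

theorem evc_eq (hq : 1 < q) (c : ℕ) : evc q x c = (c % q : ℕ) + x * evc q x (c / q) := by
  rcases Nat.eq_zero_or_pos c with rfl | hc
  · simp [evc, ev]
  · rw [evc, Nat.digits_def' hq hc, ev, evc]

theorem evc_zero : evc q x 0 = 0 := by simp [evc, ev]

theorem evc_of_lt (hq : 1 < q) {c : ℕ} (hc : c < q) : evc q x c = c := by
  rw [evc_eq x hq, Nat.mod_eq_of_lt hc, Nat.div_eq_of_lt hc, evc_zero, mul_zero, add_zero]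

theorem evc_mul_add (hq : 1 < q) (c : ℕ) {a : ℕ} (ha : a < q) :
    evc q x (q * c + a) = a + x * evc q x c := by
  rw [evc_eq x hq, Nat.mul_add_mod, Nat.mod_eq_of_lt ha, Nat.mul_add_div (by omega),
    Nat.div_eq_of_lt ha, add_zero]

theorem evc_mul (hq : 1 < q) (c : ℕ) : evc q x (q * c) = x * evc q x c := by
  have := evc_mul_add x hq c (a := 0) (by omega)
  simpa using this

theorem succ1_eq (c : ℕ) : succ1 q c = q * (c / q) + (c % q + 1) % q := by
  have h1 : succ1 q c = (c - c % q) + (c % q + 1) % q := rfl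
  have h2 := Nat.div_add_mod c q
  rw [h1]
  omega

theorem evc_succ1 (hq : 1 < q) [CharP L q] (c : ℕ) : evc q x (succ1 q c) = evc q x c + 1 := by
  rw [succ1_eq, evc_mul_add x hq _ (Nat.mod_lt _ (by omega)), evc_eq x hq c, cast_mod]
  push_cast
  ring

/-- The sum of codes in characteristic two is given by bitwise addition. -/
theorem evc_xor [CharP L 2] (a b : ℕ) : evc 2 x (a ^^^ b) = evc 2 x a + evc 2 x b := by
  induction a using Nat.strong_induction_on generalizing b with
  | _ a ih =>
    rcases Nat.eq_zero_or_pos a with rfl | ha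
    · rw [Nat.zero_xor, evc_zero, zero_add]
    · rw [evc_eq x one_lt_two (a ^^^ b), evc_eq x one_lt_two a, evc_eq x one_lt_two b,
        Nat.xor_div_two, ih (a / 2) (by omega), Nat.xor_mod_two_eq, cast_mod]
      rw [cast_mod, cast_mod]
      push_cast
      ring

/-- Changing a digit from zero to `b` adds `b x ^ s`. -/
theorem evc_add_pow (hq : 1 < q) {b : ℕ} (hb : b < q) : ∀ (s c : ℕ), c / q ^ s % q = 0 →
    evc q x (c + b * q ^ s) = evc q x c + b * x ^ s
  | 0, c, h => by
    rw [pow_zero, Nat.div_one] at h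
    have h1 : c + b * q ^ 0 = q * (c / q) + b := by
      have := Nat.div_add_mod c q
      rw [pow_zero, mul_one]
      omega
    rw [h1, evc_mul_add x hq _ hb, evc_eq x hq c, h]
    simp [add_comm]
  | s + 1, c, h => by
    have h1 : c + b * q ^ (s + 1) = q * (c / q + b * q ^ s) + c % q := by
      have := Nat.div_add_mod c q
      rw [pow_succ, mul_add]
      nlinarith
    have h2 : c / q / q ^ s % q = 0 := by
      rwa [Nat.div_div_eq_div_mul, ← pow_succ']
    rw [h1, evc_mul_add x hq _ (Nat.mod_lt _ (by omega)), evc_add_pow hq hb s _ h2, evc_eq x hq c,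
      pow_succ]
    ring

theorem exists_evc_eq_sum (hq : 1 < q) [NeZero q] [Algebra (ZMod q) L] : ∀ (n : ℕ)
    (c : Fin n → ZMod q), ∃ m < q ^ n, evc q x m = ∑ i, c i • x ^ (i : ℕ) ∧ (m = 0 → c = 0)
  | 0, c => ⟨0, by simp, by simp [evc_zero], fun _ => Subsingleton.elim _ _⟩
  | n + 1, c => by
    obtain ⟨m, hm, h, h0⟩ := exists_evc_eq_sum hq n fun i => c i.succ
    have hc := ZMod.val_lt (c 0)
    refine ⟨q * m + (c 0).val, ?_, ?_, fun h' => ?_⟩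
    · rw [pow_succ']
      nlinarith
    · rw [evc_mul_add x hq m hc, h, Fin.sum_univ_succ]
      simp only [Fin.val_zero, pow_zero, Fin.val_succ, pow_succ, Finset.mul_sum]
      congr 1
      · rw [Algebra.smul_def, mul_one, ← map_natCast (algebraMap (ZMod q) L), ZMod.natCast_zmod_val]
      · refine Finset.sum_congr rfl fun i _ => ?_
        simp only [Algebra.smul_def]
        ring
    · have h1 : m = 0 := by
        have : q * m = 0 := by omega
        exact (Nat.mul_eq_zero.1 this).resolve_left (by omega)
      funext i
      refine Fin.cases ?_ (fun i => congrFun (h0 h1) i) i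
      exact (ZMod.val_eq_zero _).1 (by omega)

end Codes

/-- A discrete logarithm of `z` to the base `x`. -/
noncomputable def dlog {L : Type*} [Monoid L] (x z : L) : ℕ :=
  open scoped Classical in if h : ∃ j, x ^ j = z then h.choose else 0

theorem pow_dlog {L : Type*} [Monoid L] {x : L} (j : ℕ) : x ^ dlog x (x ^ j) = x ^ j := by
  have h : ∃ i, x ^ i = x ^ j := ⟨j, rfl⟩
  rw [dlog, dif_pos h]
  exact h.choose_spec

/-- A generator `x` of a finite field with `q ^ n` elements, together with a table `lg` of the
logarithms of the elements, which are given by their codes. -/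
structure IsLogTable (q n : ℕ) {L : Type*} [Field L] (x : L) (lg : ℕ → ℕ) : Prop where
  orderOf_eq : orderOf x = q ^ n - 1
  exists_code : ∀ z : L, ∃ c < q ^ n, evc q x c = z
  pow_lg : ∀ c, 0 < c → c < q ^ n → x ^ lg c = evc q x c

/-- The colour of an element of logarithm `j` is `T j`, where `j` is read modulo `N`. -/
noncomputable def tableCol {L : Type*} [Monoid L] (x : L) (N : ℕ) (T : ℕ → ℕ) (z : L) : ℕ :=
  T (dlog x z % N)

/-- The conditions on the table `T` of colours of logarithms, at the element with code `c`: it is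
invariant under `z ↦ z + 1`, `z ↦ 1 / z` and (when `frob` holds) `z ↦ z ^ q`, and one of these maps
or `z ↦ z + 2` decreases the distance `D` to the representative `R` of the colour, unless it is
reached. -/
def colourCheck (q N : ℕ) (frob : Bool) (lg T D R : ℕ → ℕ) (c : ℕ) : Bool :=
  let j := lg c % N
  let j₁ := lg (succ1 q c) % N
  let j₁' := lg (succ1 q (succ1 q c)) % N
  let j₂ := (N - j) % N
  let j₃ := q * j % N
  Nat.beq (T j₁) (T j) && Nat.beq (T j₂) (T j) && (!frob || Nat.beq (T j₃) (T j)) &&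
    (Nat.blt (D j₁) (D j) || Nat.blt (D j₁') (D j) || Nat.blt (D j₂) (D j) || (frob && Nat.blt (D j₃) (D j)) ||
      Nat.beq j (R (T j)))

/-- The maps `x ↦ x ^ (q ^ i)` that are used as equivalences. -/
def frobExponents : Bool → AddSubmonoid ℕ
  | false => ⊥
  | true => ⊤

section LogTable

variable {q n : ℕ} {L : Type*} [Field L] {x : L} {lg : ℕ → ℕ}

theorem IsLogTable.exists_pow (h : IsLogTable q n x lg) {z : L} (hz : z ≠ 0) :
    ∃ c, 0 < c ∧ c < q ^ n ∧ evc q x c = z ∧ x ^ lg c = z := by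
  obtain ⟨c, hc, rfl⟩ := h.exists_code z
  have hc0 : 0 < c := Nat.pos_of_ne_zero fun h0 => hz (by rw [h0, evc_zero])
  exact ⟨c, hc0, hc, rfl, h.pow_lg c hc0 hc⟩

theorem IsLogTable.ne_zero (h : IsLogTable q n x lg) (hn : 1 < q ^ n) : x ≠ 0 := by
  rintro rfl
  have h1 := h.orderOf_eq
  have h2 := pow_orderOf_eq_one (0 : L)
  rw [h1, zero_pow (by omega)] at h2
  exact zero_ne_one h2

theorem IsLogTable.tableCol_pow (h : IsLogTable q n x lg) {N : ℕ} (hN : N * (q - 1) = q ^ n - 1)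
    (hpos : 1 < q ^ n) (T : ℕ → ℕ) (j : ℕ) : tableCol x N T (x ^ j) = T (j % N) := by
  have h1 := pow_dlog (x := x) j
  have hfo : IsOfFinOrder x := orderOf_pos_iff.1 (by rw [h.orderOf_eq]; omega)
  rw [hfo.pow_eq_pow_iff_modEq, h.orderOf_eq] at h1
  rw [tableCol, (h1.of_dvd ⟨q - 1, hN.symm⟩ : _ ≡ _ [MOD N])]

end LogTable

section Table

variable {q : ℕ} [Fact q.Prime] {n : ℕ} {L : Type*} [Field L] [Algebra (ZMod q) L] {x : L}
  {lg : ℕ → ℕ}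

theorem IsLogTable.pow_eq_algebraMap_iff (h : IsLogTable q n x lg) {N : ℕ}
    (hN : N * (q - 1) = q ^ n - 1) (hpos : 1 < q ^ n) (j : ℕ) :
    (∃ a : ZMod q, algebraMap (ZMod q) L a = x ^ j) ↔ N ∣ j := by
  have hq := (Fact.out : q.Prime).one_lt
  have hx := h.ne_zero hpos
  constructor
  · rintro ⟨a, ha⟩
    have ha0 : a ≠ 0 := by
      rintro rfl
      rw [map_zero] at ha
      exact pow_ne_zero _ hx ha.symm
    have h1 : x ^ (j * (q - 1)) = 1 := by
      rw [pow_mul, ← ha, ← map_pow, ZMod.pow_card_sub_one_eq_one ha0, map_one]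
    have h2 := orderOf_dvd_of_pow_eq_one h1
    rw [h.orderOf_eq, ← hN] at h2
    exact Nat.dvd_of_mul_dvd_mul_right (by omega) h2
  · rintro ⟨m, rfl⟩
    refine mem_range_of_pow_eq ?_
    have h1 : x ^ (N * m * (q - 1)) = 1 := by
      rw [show N * m * (q - 1) = (q ^ n - 1) * m by rw [← hN]; ring, pow_mul, ← h.orderOf_eq,
        pow_orderOf_eq_one, one_pow]
    conv_lhs => rw [show q = (q - 1) + 1 by omega]
    rw [pow_succ, ← pow_mul, h1, one_mul]

theorem finrank_span_ratio {z : L} (hz : IsRatio q z) :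
    Module.finrank (ZMod q) (Submodule.span (ZMod q) {1, z}) = 2 :=
  finrank_span_pair one_ne_zero fun c hc => hz c (by rw [hc, Algebra.smul_def, mul_one])

theorem mem_span_one_pair {z w : L} {a b : ZMod q} (h : algebraMap (ZMod q) L a + b • z = w) :
    w ∈ Submodule.span (ZMod q) {1, z} := by
  rw [Submodule.mem_span_pair]
  exact ⟨a, b, by rw [← h, Algebra.smul_def, mul_one]⟩

theorem TwistLE.of_generators {I : AddSubmonoid ℕ} {z : L} {W : Submodule (ZMod q) L} {i : ℕ}
    (hi : i ∈ I) {d : L} (hd : d ≠ 0) (h1 : d ∈ W) (hz : d * z ^ q ^ i ∈ W) :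
    TwistLE I (Submodule.span (ZMod q) {1, z}) W := by
  refine ⟨i, hi, d, hd, fun y hy => ?_⟩
  obtain ⟨a, b, rfl⟩ := Submodule.mem_span_pair.1 hy
  rw [add_pow_q_pow, Algebra.smul_def, Algebra.smul_def, mul_pow, mul_pow, pow_q_algebraMap,
    pow_q_algebraMap, one_pow, mul_one, mul_add]
  refine W.add_mem ?_ ?_
  · rw [mul_comm, ← Algebra.smul_def]
    exact W.smul_mem _ h1
  · rw [mul_left_comm, ← Algebra.smul_def]
    exact W.smul_mem _ hz

/-- A table passing the checks describes a colouring. -/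
theorem IsLogTable.isColouring (h : IsLogTable q n x lg) (hn : n ≠ 0) (hL : Nat.card L = q ^ n)
    {N : ℕ} (hN : N * (q - 1) = q ^ n - 1) {frob : Bool} {T D R : ℕ → ℕ}
    (hc : ∀ c, q ≤ c → c < q ^ n → colourCheck q N frob lg T D R c = true) :
    IsColouring (q := q) (frobExponents frob) (tableCol x N T) := by
  have hq := (Fact.out : q.Prime).one_lt
  have hpos : 1 < q ^ n := Nat.one_lt_pow hn hq
  have hch : CharP L q := charP_of_injective_algebraMap' (ZMod q) q
  have hx := h.ne_zero hpos
  have hcol := h.tableCol_pow hN hpos T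
  -- the code of an element outside the prime field
  have hcode : ∀ z : L, IsRatio q z → ∃ c, q ≤ c ∧ c < q ^ n ∧ evc q x c = z ∧ x ^ lg c = z := by
    intro z hz
    obtain ⟨c, _, hc1, hc2, hc3⟩ := h.exists_pow hz.ne_zero
    refine ⟨c, ?_, hc1, hc2, hc3⟩
    by_contra hlt
    rw [evc_of_lt x hq (not_le.1 hlt)] at hc2
    exact hz c (by rw [map_natCast, hc2])
  have hN0 : 0 < N := Nat.pos_of_ne_zero fun h0 => by
    rw [h0, zero_mul] at hN
    omega
  -- the effect of the generating transformations on logarithms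
  have hsucc : ∀ c, q ≤ c → c < q ^ n → q ≤ succ1 q c ∧ succ1 q c < q ^ n := by
    intro c hc1 hc2
    have h1 : q * (c / q) ≤ c := Nat.mul_div_le c q
    have h2 : (c % q + 1) % q < q := Nat.mod_lt _ (by omega)
    have h3 : c / q < q ^ (n - 1) := by
      rw [Nat.div_lt_iff_lt_mul (by omega), ← pow_succ, Nat.sub_add_cancel (by omega)]
      exact hc2
    have h4 : 1 ≤ c / q := Nat.div_pos hc1 (by omega)
    have h5 : q ^ n = q * q ^ (n - 1) := by rw [← pow_succ', Nat.sub_add_cancel (by omega)]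
    rw [succ1_eq, h5]
    have h6 := Nat.mul_le_mul_left q h4
    have h7 := Nat.mul_le_mul_left q (Nat.succ_le_of_lt h3)
    rw [Nat.mul_succ] at h7
    constructor <;> omega
  have hadd : ∀ c, q ≤ c → c < q ^ n → x ^ lg (succ1 q c) = x ^ lg c + 1 := by
    intro c hc1 hc2
    obtain ⟨h1, h2⟩ := hsucc c hc1 hc2
    rw [h.pow_lg c (by omega) hc2, ← evc_succ1 x hq]
    exact h.pow_lg _ (by omega) h2
  have hinv : ∀ j, ∃ i, (x ^ j)⁻¹ = x ^ i ∧ i % N = (N - j % N) % N := by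
    intro j
    refine ⟨(q ^ n - 2) * j, ?_, ?_⟩
    · refine inv_eq_of_mul_eq_one_right ?_
      rw [← pow_add,
        show j + (q ^ n - 2) * j = (q ^ n - 1) * j by
          obtain ⟨m, hm⟩ : ∃ m, q ^ n = m + 2 := ⟨q ^ n - 2, by omega⟩
          rw [hm, Nat.add_sub_cancel, show m + 2 - 1 = m + 1 by omega]
          ring, pow_mul, ← h.orderOf_eq, pow_orderOf_eq_one, one_pow]
    · have h1 : (q ^ n - 2) * j + j ≡ (N - j % N) + j [MOD N] := by
        have e1 : (q ^ n - 2) * j + j = N * ((q - 1) * j) := by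
          rw [← mul_assoc, hN]
          obtain ⟨m, hm⟩ : ∃ m, q ^ n = m + 2 := ⟨q ^ n - 2, by omega⟩
          rw [hm, Nat.add_sub_cancel, show m + 2 - 1 = m + 1 by omega]
          ring
        have e2 : (N - j % N) + j = N * (1 + j / N) := by
          have := Nat.mod_add_div j N
          have := Nat.mod_lt j hN0
          rw [mul_add, mul_one]
          omega
        rw [e1, e2]
        exact (Nat.modEq_zero_iff_dvd.2 ⟨_, rfl⟩).trans (Nat.modEq_zero_iff_dvd.2 ⟨_, rfl⟩).symm
      exact Nat.ModEq.add_right_cancel' j h1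
  have hfrob : frob = true → ∀ z, IsRatio q z → tableCol x N T (z ^ q) = tableCol x N T z := by
    intro hf z hz
    obtain ⟨c, hc1, hc2, hc3, hc4⟩ := hcode z hz
    have hk := hc c hc1 hc2
    simp only [colourCheck, Bool.and_eq_true, Nat.beq_eq, hf, Bool.not_true, Bool.false_or] at hk
    rw [← hc4, ← pow_mul, hcol, hcol, ← hk.1.2, mul_comm]
    conv_lhs => rw [Nat.mul_mod]
    conv_rhs => rw [Nat.mul_mod, Nat.mod_mod]
  -- every element is equivalent to the representative of its colour
  have hrep : ∀ (m : ℕ) (z : L), IsRatio q z → D (dlog x z % N) = m →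
      TwistLE (frobExponents frob) (Submodule.span (ZMod q) {1, z})
        (Submodule.span (ZMod q) {1, x ^ R (tableCol x N T z)}) := by
    have hdl : ∀ j, dlog x (x ^ j) % N = j % N := fun j => h.tableCol_pow hN hpos id j
    intro m
    induction m using Nat.strong_induction_on with
    | _ m ih =>
      intro z hz hm
      obtain ⟨c, hc1, hc2, hc3, hc4⟩ := hcode z hz
      have hk := hc c hc1 hc2
      simp only [colourCheck, Bool.and_eq_true, Nat.beq_eq, Bool.or_eq_true] at hk
      obtain ⟨⟨⟨hk1, hk2⟩, hk3⟩, hk4⟩ := hk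
      have ha := hadd c hc1 hc2
      obtain ⟨i, hi1, hi2⟩ := hinv (lg c)
      have hlt : ∀ a b : ℕ, Nat.blt a b = true → a < b := fun a b hab => Nat.le_of_ble_eq_true hab
      rw [← hc4, hdl] at hm
      rcases hk4 with (((hk4 | hk4) | hk4) | hk4) | hk4
      · have hz' : IsRatio q (z + 1) := by simpa using hz.add 1
        have := ih _ (hm ▸ hlt _ _ hk4) (z + 1) hz' (by rw [← hc4, ← ha, hdl])
        rw [← hc4, ← ha, hcol, hk1, ← hcol, hc4] at this
        refine TwistLE.trans (TwistLE.of_le ?_) this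
        rw [ha, hc4]
        exact span_pair_le (Submodule.subset_span (by simp))
          (mem_span_one_pair (a := -1) (b := 1) (by simp))
      · obtain ⟨hs1, hs2⟩ := hsucc c hc1 hc2
        have ha' := hadd _ hs1 hs2
        rw [ha] at ha'
        have hz' : IsRatio q (z + 1 + 1) := by simpa using (hz.add 1).add 1
        have hT : T (lg (succ1 q (succ1 q c)) % N) = T (lg c % N) := by
          have hk' := hc _ hs1 hs2
          simp only [colourCheck, Bool.and_eq_true, Nat.beq_eq] at hk'
          exact hk'.1.1.1.trans hk1
        have := ih _ (hm ▸ hlt _ _ hk4) (z + 1 + 1) hz' (by rw [← hc4, ← ha', hdl])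
        rw [← hc4, ← ha', hcol, hT, ← hcol, hc4] at this
        refine TwistLE.trans (TwistLE.of_le ?_) this
        rw [ha', hc4]
        refine span_pair_le (Submodule.subset_span (by simp))
          (mem_span_one_pair (a := -1 - 1) (b := 1) ?_)
        rw [map_sub, map_neg, map_one, one_smul]
        ring
      · have := ih _ (hm ▸ hlt _ _ hk4) z⁻¹ hz.inv (by rw [← hc4, hi1, hdl, hi2])
        rw [← hc4, hi1, hcol, hi2, hk2, ← hcol, hc4] at this
        refine TwistLE.trans ?_ this
        rw [← hi1, hc4]
        refine TwistLE.of_generators (AddSubmonoid.zero_mem _) (inv_ne_zero hz.ne_zero)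
          (Submodule.subset_span (by simp)) ?_
        rw [pow_zero, pow_one, inv_mul_cancel₀ hz.ne_zero]
        exact Submodule.subset_span (by simp)
      · have e : x ^ (lg c * q) = z ^ q := by rw [pow_mul, hc4]
        have e3 : lg c * q % N = q * (lg c % N) % N := by
          rw [mul_comm]
          conv_lhs => rw [Nat.mul_mod]
          conv_rhs => rw [Nat.mul_mod, Nat.mod_mod]
        have hz' : IsRatio q (z ^ q) := by simpa using hz.pow 1
        have := ih _ (hm ▸ hlt _ _ hk4.2) (z ^ q) hz' (by rw [← e, hdl, e3])
        rw [hfrob hk4.1 z hz] at this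
        refine TwistLE.trans ?_ this
        rw [hk4.1]
        exact TwistLE.of_generators (i := 1) trivial one_ne_zero
          (Submodule.subset_span (by simp)) (Submodule.subset_span (by simp))
      · rw [← hc4, hcol, ← hk4]
        obtain ⟨a, ha⟩ := (h.pow_eq_algebraMap_iff hN hpos (N * (lg c / N))).2 (dvd_mul_right _ _)
        have e : algebraMap (ZMod q) L a * x ^ (lg c % N) = x ^ lg c := by
          rw [ha, ← pow_add, Nat.div_add_mod]
        refine TwistLE.of_le (span_pair_le (Submodule.subset_span (by simp)) ?_)
        exact mem_span_one_pair (a := 0) (b := a) (by rw [map_zero, zero_add, Algebra.smul_def, e])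
  constructor
  · intro i hi z hz
    cases frob with
    | false =>
      have : i = 0 := by simpa [frobExponents] using hi
      rw [this, pow_zero, pow_one]
    | true =>
      clear hi
      induction i with
      | zero => rw [pow_zero, pow_one]
      | succ i ih => rw [pow_succ, pow_mul, hfrob rfl _ (hz.pow i), ih]
  · intro z hz
    obtain ⟨c, hc1, hc2, hc3, hc4⟩ := hcode z hz
    have ha := hadd c hc1 hc2
    have hk := hc c hc1 hc2
    simp only [colourCheck, Bool.and_eq_true, Nat.beq_eq] at hk
    rw [← hc4, ← ha, hcol, hcol, hk.1.1.1]
  · intro z hz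
    obtain ⟨c, hc1, hc2, hc3, hc4⟩ := hcode z hz
    obtain ⟨i, hi1, hi2⟩ := hinv (lg c)
    have hk := hc c hc1 hc2
    simp only [colourCheck, Bool.and_eq_true, Nat.beq_eq] at hk
    rw [← hc4, hi1, hcol, hcol, hi2, hk.1.1.2]
  · intro a z ha hz
    have ha' : algebraMap (ZMod q) L a ≠ 0 := by simpa using ha
    obtain ⟨c, -, -, -, hc4⟩ := h.exists_pow hz.ne_zero
    obtain ⟨c', -, -, -, hc4'⟩ := h.exists_pow ha'
    obtain ⟨m, hm⟩ := (h.pow_eq_algebraMap_iff hN hpos (lg c')).1 ⟨a, hc4'.symm⟩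
    rw [Algebra.smul_def, ← hc4, ← hc4', ← pow_add, hcol, hcol, hm, Nat.mul_add_mod]
  · intro z w hz hw hzw
    have h1 := hrep _ z hz rfl
    have h2 := hrep _ w hw rfl
    rw [hzw] at h1
    have hfin : Finite L := Nat.finite_of_card_ne_zero (by rw [hL]; omega)
    set V := Submodule.span (ZMod q) {1, x ^ R (tableCol x N T w)} with hV
    refine h1.trans (h2.symm hn hL ?_)
    rw [finrank_span_ratio hw]
    refine le_antisymm ?_ ?_
    · obtain ⟨i, -, d, hd, hU⟩ := h2
      have e1 := hU 1 (Submodule.subset_span (by simp))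
      have e2 := hU w (Submodule.subset_span (by simp))
      have e3 : ∀ c : ZMod q, w ≠ c • (1 : L) := fun c hc =>
        hw c (by rw [hc, Algebra.smul_def, mul_one])
      rw [← finrank_span_pair (K := ZMod q) (mul_ne_zero hd (pow_ne_zero _ one_ne_zero))
        (ne_smul_twist hd e3 i)]
      exact Submodule.finrank_mono (span_pair_le e1 e2)
    · classical
      have := finrank_span_finset_le_card (R := ZMod q)
        ({1, x ^ R (tableCol x N T w)} : Finset L)
      rw [Finset.coe_pair] at this
      exact this.trans Finset.card_le_two

end Table

/-! ### Evaluation in the kernel -/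

/-- `forceB f n = f n`; when it is evaluated, `n` is evaluated first. -/
noncomputable def forceB (f : ℕ → Bool) (n : ℕ) : Bool :=
  Nat.rec (motive := fun _ => Bool) (f 0) (fun k _ => f (Nat.succ k)) n

theorem forceB_eq (f : ℕ → Bool) (n : ℕ) : forceB f n = f n := by
  cases n <;> rfl

/-- `allB n p` holds if `p 0, …, p (n - 1)` hold. -/
noncomputable def allB (n : ℕ) (p : ℕ → Bool) : Bool :=
  Nat.rec (motive := fun _ => Bool) true
    (fun k ih => Bool.rec (motive := fun _ => Bool) false ih (p k)) n

theorem bool_rec_eq_and (a b : Bool) :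
    (Bool.rec (motive := fun _ => Bool) false b a : Bool) = (a && b) := by
  cases a <;> rfl

theorem allB_spec {n : ℕ} {p : ℕ → Bool} (h : allB n p = true) {k : ℕ} (hk : k < n) :
    p k = true := by
  induction n with
  | zero => omega
  | succ n ih =>
    have h' : (Bool.rec (motive := fun _ => Bool) false (allB n p) (p n) : Bool) = true := h
    rw [bool_rec_eq_and, Bool.and_eq_true] at h'
    rcases Nat.lt_succ_iff_lt_or_eq.1 hk with hk | rfl
    · exact ih h'.2 hk
    · exact h'.1

/-- `ifZero m a b` is `a` if `m = 0`, and `b` otherwise; when it is evaluated, only one of `a` and `b` is evaluated. -/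
noncomputable def ifZero (m : ℕ) (a b : Bool) : Bool :=
  Nat.rec (motive := fun _ => Bool) a (fun _ _ => b) m

theorem ifZero_eq (m : ℕ) (a b : Bool) : ifZero m a b = if m = 0 then a else b := by
  cases m <;> rfl

/-- The entry number `i` of a table with entries of `w` bits. -/
noncomputable def entry (w t i : ℕ) : ℕ :=
  Nat.mod (Nat.shiftRight t (Nat.mul w i)) (Nat.pow 2 w)

/-- The set with the given elements, as the bits of a number. -/
noncomputable def orBits (l : List ℕ) : ℕ :=
  List.rec (motive := fun _ => ℕ) 0 (fun c _ m => Nat.lor (Nat.shiftLeft 1 c) m) l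

theorem testBit_orBits (l : List ℕ) (c : ℕ) : (orBits l).testBit c = true ↔ c ∈ l := by
  induction l with
  | nil => simp [orBits]
  | cons a l ih =>
    have h : orBits (a :: l) = 1 <<< a ||| orBits l := rfl
    rw [h, Nat.testBit_or, Bool.or_eq_true, ih, Nat.one_shiftLeft, Nat.testBit_two_pow,
      List.mem_cons, decide_eq_true_iff, eq_comm]

theorem exists_testBit_of_land_ne_zero {a b : ℕ} (h : a &&& b ≠ 0) :
    ∃ c, a.testBit c = true ∧ b.testBit c = true := by
  obtain ⟨c, hc⟩ := Nat.exists_testBit_of_ne_zero h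
  rw [Nat.testBit_and, Bool.and_eq_true] at hc
  exact ⟨c, hc⟩

/-- `forceN f n = f n`; when it is evaluated, `n` is evaluated first. -/
noncomputable def forceN (f : ℕ → ℕ) (n : ℕ) : ℕ :=
  Nat.rec (motive := fun _ => ℕ) (f 0) (fun k _ => f (Nat.succ k)) n

theorem forceN_eq (f : ℕ → ℕ) (n : ℕ) : forceN f n = f n := by
  cases n <;> rfl

/-- The number whose digits from the digit `64` on are given by the sum of `term i c` over all `i < n`, where
`c` runs through an orbit of `step` as `i` decreases. The last `64` digits of the partial sums are filled with
multiples of a constant, because numbers that agree in these digits are hard to tell apart for hash tables;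
they are dropped in the end. -/
noncomputable def tableOf (step : ℕ → ℕ) (term : ℕ → ℕ → ℕ) (n : ℕ) : ℕ → ℕ → ℕ :=
  Nat.rec (motive := fun _ => ℕ → ℕ → ℕ) (fun _ m => Nat.shiftRight m 64)
    (fun i ih c m => forceN (fun m => forceN (fun c => ih c m) (step c))
      (Nat.add m (Nat.add (term i c) 1234567890123456))) n

/-! ### Exact cover search -/

/-- A search through families of pairwise equal or disjoint sets, one set for each of the given rows.
Sets are given by the bits of numbers, `rowBit a` is an element that belongs to the set of row `a`,
and `loop a p` checks `p` for all candidates for the set of row `a`. The result is `true` if every branch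
ends with a row whose candidates all meet the union `cov` of the previous sets. -/
noncomputable def coverSearch (rowBit : ℕ → ℕ) (loop : ℕ → (ℕ → Bool) → Bool) (l : List ℕ) :
    ℕ → Bool :=
  List.rec (motive := fun _ => ℕ → Bool) (fun _ => false)
    (fun a _ ih cov => ifZero (Nat.land cov (rowBit a))
      (loop a fun m => ifZero (Nat.land m cov) (forceB ih (Nat.lor m cov)) true) (ih cov)) l

/-- If there are sets `f a` for the rows `a` that are candidates for their rows, contain the elements of their
rows, and are pairwise equal or disjoint, then the search fails: the branch of these sets does not end. -/
theorem coverSearch_sound {rowBit : ℕ → ℕ} {loop : ℕ → (ℕ → Bool) → Bool} {f : ℕ → ℕ}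
    (l : List ℕ) (hbit : ∀ a ∈ l, f a &&& rowBit a ≠ 0)
    (hloop : ∀ a ∈ l, ∀ p : ℕ → Bool, loop a p = true → p (f a) = true)
    (hdisj : ∀ a ∈ l, ∀ b ∈ l, f a &&& f b ≠ 0 → f a = f b) (cov : ℕ)
    (hcov : ∀ a ∈ l, cov &&& rowBit a = 0 → f a &&& cov = 0) :
    coverSearch rowBit loop l cov = false := by
  induction l generalizing cov with
  | nil => rfl
  | cons a l ih =>
    have e : coverSearch rowBit loop (a :: l) cov = ifZero (cov &&& rowBit a)
        (loop a fun m => ifZero (m &&& cov) (forceB (coverSearch rowBit loop l) (m ||| cov)) true)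
        (coverSearch rowBit loop l cov) := rfl
    have ih' := ih (fun b hb => hbit b (by simp [hb])) (fun b hb => hloop b (by simp [hb]))
      (fun b hb c hc => hdisj b (by simp [hb]) c (by simp [hc]))
    rw [e, ifZero_eq]
    split_ifs with h0
    · by_contra hcon
      rw [Bool.not_eq_false] at hcon
      have h1 := hloop a (by simp) _ hcon
      rw [ifZero_eq, if_pos (hcov a (by simp) h0), forceB_eq, ih'] at h1
      · exact absurd h1 (by decide)
      · intro b hb hb0
        rw [Nat.and_or_distrib_right, Nat.or_eq_zero_iff] at hb0
        rw [Nat.and_or_distrib_left, Nat.or_eq_zero_iff]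
        refine ⟨?_, hcov b (by simp [hb]) hb0.2⟩
        by_contra hne
        have := hdisj b (by simp [hb]) a (by simp) hne
        exact hbit b (by simp [hb]) (this ▸ hb0.1)
    · exact ih' cov fun b hb => hcov b (by simp [hb])

/-! ### Tables of logarithms -/

/-- Follows the orbit of `c` under `step`, checking that the `i`-th element has logarithm `j + i`,
and that the orbit returns to `1`. -/
noncomputable def walkB (step lg : ℕ → ℕ) (m : ℕ) : ℕ → ℕ → Bool :=
  Nat.rec (motive := fun _ => ℕ → ℕ → Bool) (fun c _ => Nat.beq c 1)
    (fun _ ih c j => Bool.rec (motive := fun _ => Bool) false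
      (forceB (fun c' => forceB (ih c') (Nat.succ j)) (step c)) (Nat.beq (lg c) j)) m

theorem walkB_succ (step lg : ℕ → ℕ) (m c j : ℕ) :
    walkB step lg (m + 1) c j = (Nat.beq (lg c) j && walkB step lg m (step c) (j + 1)) := by
  have h : walkB step lg (m + 1) c j = (Bool.rec (motive := fun _ => Bool) false
      (forceB (fun c' => forceB (walkB step lg m c') (Nat.succ j)) (step c))
      (Nat.beq (lg c) j) : Bool) := rfl
  rw [h, bool_rec_eq_and, forceB_eq, forceB_eq]

theorem walkB_spec {step lg : ℕ → ℕ} {m : ℕ} : ∀ {c j : ℕ}, walkB step lg m c j = true →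
    step^[m] c = 1 ∧ ∀ i < m, lg (step^[i] c) = j + i := by
  induction m with
  | zero =>
    intro c j h
    exact ⟨Nat.eq_of_beq_eq_true h, by simp⟩
  | succ m ih =>
    intro c j h
    rw [walkB_succ, Bool.and_eq_true, Nat.beq_eq] at h
    obtain ⟨h1, h2⟩ := ih h.2
    refine ⟨by rwa [Function.iterate_succ_apply], fun i hi => ?_⟩
    cases i with
    | zero => simpa using h.1
    | succ i =>
      rw [Function.iterate_succ_apply, h2 i (by omega)]
      omega

/-- `step` describes the multiplication by `x` on codes. -/
def IsStep {R : Type*} [CommRing R] (q n : ℕ) (x : R) (step : ℕ → ℕ) : Prop :=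
  ∀ c, c < q ^ n → step c < q ^ n ∧ evc q x (step c) = x * evc q x c

theorem IsStep.iterate {R : Type*} [CommRing R] {q n : ℕ} {x : R} {step : ℕ → ℕ}
    (h : IsStep q n x step) (hq : 1 < q) (hn : n ≠ 0) (i : ℕ) :
    step^[i] 1 < q ^ n ∧ evc q x (step^[i] 1) = x ^ i := by
  induction i with
  | zero => exact ⟨Nat.one_lt_pow hn hq, by simp [evc_of_lt x hq hq]⟩
  | succ i ih =>
    rw [Function.iterate_succ_apply']
    obtain ⟨h1, h2⟩ := h _ ih.1
    exact ⟨h1, by rw [h2, ih.2, pow_succ']⟩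

theorem IsStep.pow_card {R : Type*} [CommRing R] {q n : ℕ} {x : R} {step lg : ℕ → ℕ}
    (h : IsStep q n x step) (hq : 1 < q) (hn : n ≠ 0)
    (hwalk : walkB step lg (q ^ n - 1) 1 0 = true) : x ^ q ^ n = x := by
  have h1 := (h.iterate hq hn (q ^ n - 1)).2
  rw [(walkB_spec hwalk).1, evc_of_lt x hq hq, Nat.cast_one] at h1
  have : q ^ n = (q ^ n - 1) + 1 := by
    have := Nat.one_lt_pow hn hq
    omega
  rw [this, pow_succ, ← h1, one_mul]

/-- If the orbit of the code `1` under multiplication by `x` passes the check, then `lg` is a table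
of logarithms: the `q ^ n - 1` codes in the orbit are different because their logarithms are. -/
theorem IsStep.isLogTable {q n : ℕ} [Fact q.Prime] {L : Type*} [Field L] [Algebra (ZMod q) L]
    {x : L} {step lg : ℕ → ℕ} (h : IsStep q n x step) (hL : Nat.card L = q ^ n) (hn0 : n ≠ 0)
    (hx0 : x ≠ 0) (hwalk : walkB step lg (q ^ n - 1) 1 0 = true) : IsLogTable q n x lg := by
  have hq := (Fact.out : q.Prime).one_lt
  have hpos : 1 < q ^ n := Nat.one_lt_pow hn0 hq
  have hfin : Finite L := Nat.finite_of_card_ne_zero (by rw [hL]; omega)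
  have hw := (walkB_spec hwalk).2
  -- the orbit contains all nonzero codes
  have horb : ∀ c, 0 < c → c < q ^ n → ∃ i < q ^ n - 1, step^[i] 1 = c := by
    intro c hc0 hc
    have hne : ∀ i, step^[i] 1 ≠ 0 := fun i h0 => by
      have := (h.iterate hq hn0 i).2
      rw [h0, evc_zero] at this
      exact pow_ne_zero i hx0 this.symm
    have hinj : Set.InjOn (fun i => step^[i] 1) (Finset.range (q ^ n - 1)) := by
      intro i hi j hj hij
      have h1 := hw i (by simpa using hi)
      have h2 := hw j (by simpa using hj)
      simp only at hij
      rw [hij, h2] at h1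
      omega
    have hmaps : Set.MapsTo (fun i => step^[i] 1) (Finset.range (q ^ n - 1))
        (Finset.Ico 1 (q ^ n)) := by
      intro i _
      rw [Finset.coe_Ico, Set.mem_Ico]
      exact ⟨Nat.pos_of_ne_zero (hne i), (h.iterate hq hn0 i).1⟩
    have := Finset.surj_on_of_inj_on_of_card_le (s := Finset.range (q ^ n - 1))
      (t := Finset.Ico 1 (q ^ n)) (fun i _ => step^[i] 1) (fun i hi => by
        have := hmaps (show i ∈ (Finset.range (q ^ n - 1) : Set ℕ) from hi)
        exact this) (fun i j hi hj hij => hinj hi hj hij) (by simp) c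
        (Finset.mem_Ico.2 ⟨hc0, hc⟩)
    obtain ⟨i, hi, hci⟩ := this
    exact ⟨i, by simpa using hi, hci.symm⟩
  have hpow : ∀ c, 0 < c → c < q ^ n → x ^ lg c = evc q x c := by
    intro c hc0 hc
    obtain ⟨i, hi, rfl⟩ := horb c hc0 hc
    rw [hw i hi, (h.iterate hq hn0 i).2, zero_add]
  -- the powers `x ^ i`, `i < n`, are independent, because nonzero codes stand for powers of `x`
  have hsurj : ∀ z : L, ∃ c < q ^ n, evc q x c = z := by
    let f : (Fin n → ZMod q) →ₗ[ZMod q] L := Fintype.linearCombination (ZMod q) fun i => x ^ (i : ℕ)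
    have hf : Function.Injective f := by
      rw [injective_iff_map_eq_zero]
      intro c hc
      obtain ⟨m, hm, hmc, h0⟩ := exists_evc_eq_sum x hq n c
      refine h0 (by_contra fun hm0 => ?_)
      rw [← Fintype.linearCombination_apply, show Fintype.linearCombination (ZMod q)
        (fun i : Fin n => x ^ (i : ℕ)) c = 0 from hc, ← hpow m (Nat.pos_of_ne_zero hm0) hm] at hmc
      exact pow_ne_zero _ hx0 hmc
    have hbij := (Nat.bijective_iff_injective_and_card f).2 ⟨hf, by simp [hL]⟩
    intro z
    obtain ⟨c, rfl⟩ := hbij.2 z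
    obtain ⟨m, hm, hmc, -⟩ := exists_evc_eq_sum x hq n c
    exact ⟨m, hm, hmc⟩
  refine ⟨?_, hsurj, hpow⟩
  have hgen : ∀ u : Lˣ, u ∈ Subgroup.zpowers (Units.mk0 x hx0) := by
    intro u
    obtain ⟨c, hc, hcu⟩ := hsurj u
    have hc0 : 0 < c := Nat.pos_of_ne_zero fun h0 => by
      rw [h0, evc_zero] at hcu
      exact u.ne_zero hcu.symm
    refine Subgroup.mem_zpowers_iff.2 ⟨lg c, ?_⟩
    ext
    rw [zpow_natCast, Units.val_pow_eq_pow_val, Units.val_mk0, hpow c hc0 hc, hcu]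
  have h1 := orderOf_eq_card_of_forall_mem_zpowers hgen
  rw [← orderOf_units, Units.val_mk0] at h1
  rw [h1, Nat.card_units, hL]

/-- The colour of a quotient of two elements given by codes. -/
theorem IsLogTable.tableCol_div {q n : ℕ} {L : Type*} [Field L] {x : L} {lg : ℕ → ℕ}
    (h : IsLogTable q n x lg) {N : ℕ} (hN : N * (q - 1) = q ^ n - 1) (hpos : 1 < q ^ n)
    (T : ℕ → ℕ) {c c' : ℕ} (hc0 : 0 < c) (hc : c < q ^ n) (hc0' : 0 < c') (hc' : c' < q ^ n) :
    tableCol x N T (evc q x c / evc q x c') = T ((lg c + (q ^ n - 2) * lg c') % N) := by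
  rw [← h.tableCol_pow hN hpos T, ← h.pow_lg c hc0 hc, ← h.pow_lg c' hc0' hc']
  congr 1
  rw [div_eq_iff (pow_ne_zero _ (h.ne_zero hpos)), ← pow_add,
    show lg c + (q ^ n - 2) * lg c' + lg c' = lg c + (q ^ n - 1) * lg c' by
      obtain ⟨m, hm⟩ : ∃ m, q ^ n = m + 2 := ⟨q ^ n - 2, by omega⟩
      rw [hm, Nat.add_sub_cancel, show m + 2 - 1 = m + 1 by omega]
      ring, pow_add, pow_mul x, ← h.orderOf_eq, pow_orderOf_eq_one, one_pow, mul_one]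

/-! ### The parameters `q = 3`, `t = 2`, `k = 3`, `n = 7` -/

/-- Multiplication by `x` on codes. -/
def step37 (c : ℕ) : ℕ :=
  3 * (3 * (3 * (c / 9 % 81) + (c / 3 % 3 + c / 729) % 3) + c % 3) + 2 * (c / 729) % 3

/-- Logarithms of the elements of the field with `3 ^ 7` elements, to a base `x` with
`x ^ 7 = x ^ 2 + 2`, listed by the codes of the elements. -/
noncomputable def logTable37 : ℕ :=
  tableOf step37 (fun i c => Nat.shiftLeft (Nat.sub 2185 i) (Nat.add 64 (Nat.mul 12 c))) 2186 1 0

/-- The colours of the lines `⟨1, x ^ j⟩`. -/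
def colourTable37 : ℕ :=
  0x2106815204313413138620a562b4c8a12906310c55f0e81f472119d4a45bd24884d915544d2692c5fb0896a73aac52608146d44c3c99b2e24159578e62617880c8d5a6d061a132a7222a1c1000109a478c00003146e02f743112d583a5bc8908ab83d4124c0e585ab58b621a70be60932f10152158441560555441400c9021480d6a94b0d48e851c4c3a7ae7d1e6c8b2f4ea78471ecaa2ccf0b0726338b0762006066bd6852410814e643e1e381989a9a8077364cb9b026d310a88ec36c547a66addd925d3d693629682088c2a5526e2bcb16821959e09b9f507053b2e2255780dd8945441da51c1092408da0a88c0ea904f601426c4db843cc820f4e489b0a2ccf8b7451152674d5451ce06d79024454ab0659a7e88bb3b34e49f645ce3e6a562a8a4da05132f5e4861190ce0f40f4b1475dd528c8b4580fa69a7f691bf7f350c19349ad99481ed47b0cc534a84ea41f3c2d368d6c1746651ceb301d535551cbe8684e415a4193fb4e52a91e2dc52b0925c746325cead154ae5cae046520849834c551b2e9c43c18620baa8b628da49e78d3d2838e2d6a8b486f17cfac5a333281994e68e6b2c5819dd862143125f1d9d75eb83115954dc790dcb0f5144c3c38b48bbb47d59312a26997c098591935a1424148ab082db350ef4d9f9528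f9b7a1dab616115910a48a349a32cb004f8ccd50249ab3f69d915a71e18a2a07966f2239baab08865cbebb38ebc9060ac6c3b0cb165672d27320c519c62d5a7af790da51b45870794786cf4f486c55b51d413031e084e5cdaa6268c0904a634056b97298b5a74b188e3cb4962938163d4a57369fb220b609c430df39a8aa9ba8166723328cbd86ad29859e3d21d429699886f6a3d412acb5a5260a19afdfa3b4fcd4d7d022966452abb3a2a59ea01e7218cc243c7a668c06d494452ad5f1c2ec8fc9a76599744fcd4b8356a081322b8d703a2aaa6ce92228e859f6745813249c784647823726da102b09c85507194416c1121208392bb20a8a316f02bca105dd8a38a0fb7053cac3402e5d7704ead461110504ac49ad9eb893b6ed530f2ada19d44158da1361c99b2e43d04d34c031c3df487228402930ab5732c00443b61c46920c59e674653d390939d7b6644d8ef974f1c98e0a74906964ad46900a06481a082a2a02ae088ac40aa078644cc5ee0d445ab158b2c1e624a079c158511e4b1cb16a218e97c03628180011a3b484000020e5514e9424d0c694ea910710bcc311ebb20a497364c7a628362844c2959d4eb51183f632531aa2a889b42929372294ea3908cfd086be2a1180d4c244995ac5240327988098602a408d080407f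

/-- Distances to the representatives of the colours. -/
def distTable37 : ℕ :=
  0x15765bb9aea95eac7eebbaadd996ae6e817beefac5a01bbb957e5f9af4999ebba7eaaf9fd97ee4916eeab1bb05eabff69d6ed1fefff9e1dbe7dda57b696f6fd17761c1dbba79df7b979e1bf47ddafff6efbda1d6e9f84fd95a6ba7f69f9ee7fdb5eeef57ef9e9e77ffaac17dbb9e5ffb9bdab6659da77a81b91ac367c7a5ec659c6bbba7be1a5fab9b9fff079ff85bff671067f07a786d6d9bf95faa729244bdbbbdba0799daa97ddaaaae1f9e7eaaffeadbbae61fbebc5f67a13b67b166a97bbefeeabdb3e6bf97181baaabefdfb9696aa92aeec16fa85abe79a97beeafb9bfe316efdf7a5bd99df6e91477812b1ff7e85bb7b116bdba86801bff955a65fff9c95eee5ebbbad79f7ea65f01ff71db06800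

/-- The logarithms of the representatives of the colours. -/
def repTable37 : ℕ :=
  0x74cbaa5c4a8984fb88d62c728ffbd2398bb1bd8752ba73c48c26538bb80c8ea1e8e6ccc8642d4838a9a011faea861933494dad7da314d01112d9253dd011211f6432cfc079fe244e9d9e09a5361a00c0f363ae54af89d0c6fd0411b968e1ddf7a6701300d0c094242cec02017728188dc0c17dc020498030c2fb401001

/-- The logarithm of the element with the given code. -/
noncomputable def lg37 : ℕ → ℕ := entry 12 logTable37

/-- The colour of the line `⟨1, x ^ j⟩`. -/
noncomputable def colour37 : ℕ → ℕ := entry 7 colourTable37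

/-- The distance of `x ^ j` to the representative of its colour. -/
noncomputable def dist37 : ℕ → ℕ := entry 2 distTable37

/-- The logarithm of the representative of a colour. -/
noncomputable def rep37 : ℕ → ℕ := entry 11 repTable37

set_option maxRecDepth 100000 in
theorem walkB37 : walkB step37 lg37 2186 1 0 = true := by decide +kernel

set_option maxRecDepth 100000 in
theorem colourCheck37 : allB 2184 (fun k => colourCheck 3 1093 false lg37 colour37 dist37 rep37
    (Nat.add k 3)) = true := by decide +kernel

/-- Digitwise addition modulo `q` of two codes with `k` digits. -/
def addc (q : ℕ) : ℕ → ℕ → ℕ → ℕ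
  | 0, _, _ => 0
  | k + 1, a, b => q * addc q k (a / q) (b / q) + (a % q + b % q) % q

/-- The colour of the line spanned by two elements given by codes. -/
noncomputable def lineColour37 (u v : ℕ) : ℕ := colour37 ((lg37 u + 2185 * lg37 v) % 1093)

/-- The set of colours of the thirteen lines of the plane spanned by `1` and the elements with codes
`a` and `b`, both with last digit zero. -/
noncomputable def mask37 (a b : ℕ) : ℕ :=
  orBits [lineColour37 a 1, lineColour37 b 1, lineColour37 (addc 3 7 b a) 1,
    lineColour37 (addc 3 7 (addc 3 7 b a) a) 1,
    lineColour37 b a, lineColour37 (b + 1) a, lineColour37 (b + 2) a,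
    lineColour37 b (a + 1), lineColour37 (b + 1) (a + 1), lineColour37 (b + 2) (a + 1),
    lineColour37 b (a + 2), lineColour37 (b + 1) (a + 2), lineColour37 (b + 2) (a + 2)]

/-- Inserts zero digits at the positions `0` and `s`. -/
def expand37 (s m : ℕ) : ℕ := 3 * (m % 3 ^ (s - 1) + 3 ^ s * (m / 3 ^ (s - 1)))

/-- Applies `p` to all codes with at most five digits and leading digit one. -/
noncomputable def allMonic37 (p : ℕ → Bool) : Bool :=
  allB 1 (fun i => p (Nat.add 1 i)) && allB 3 (fun i => p (Nat.add 3 i)) &&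
    allB 9 (fun i => p (Nat.add 9 i)) && allB 27 (fun i => p (Nat.add 27 i)) &&
    allB 81 (fun i => p (Nat.add 81 i))

/-- A row `r = 8 a + s` stands for the line `⟨1, a⟩`, where `a` is a code with digit one at `s`. -/
noncomputable def loop37 (r : ℕ) (p : ℕ → Bool) : Bool :=
  allMonic37 fun m => p (mask37 (r / 8) (expand37 (r % 8) m))

/-- The lines through which blocks are considered. -/
def rows37 : List ℕ :=
  [8 * 918 + 6, 8 * 480 + 5, 8 * 36 + 3, 8 * 300 + 5, 8 * 852 + 6, 8 * 420 + 5, 8 * 99 + 4, 8 * 9 + 2,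
    8 * 273 + 5, 8 * 366 + 5, 8 * 813 + 6]

/-- The set consisting of the colour of the line of a row. -/
noncomputable def rowBit37 (r : ℕ) : ℕ := Nat.shiftLeft 1 (lineColour37 (r / 8) 1)

theorem coverSearch37 : coverSearch rowBit37 loop37 rows37 0 = true := by decide +kernel

/-- Removes the digits at the positions `0` and `s`. -/
def contract37 (s b : ℕ) : ℕ := b / 3 % 3 ^ (s - 1) + 3 ^ (s - 1) * (b / 3 / 3 ^ s)

/-- Tells whether `m` has at most five digits and leading digit one. -/
def isMonic37 (m : ℕ) : Bool :=
  m == 1 || m / 3 == 1 || m / 9 == 1 || m / 27 == 1 || m / 81 == 1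

theorem allMonic37_spec {p : ℕ → Bool} (h : allMonic37 p = true) {m : ℕ}
    (hm : isMonic37 m = true) : p m = true := by
  simp only [allMonic37, Bool.and_eq_true] at h
  obtain ⟨⟨⟨⟨e0, e1⟩, e2⟩, e3⟩, e4⟩ := h
  have key : ∀ t i : ℕ, i ≤ m → m - i < t → allB t (fun j => p (Nat.add i j)) = true → p m = true := by
    intro t i hi ht he
    have := allB_spec he ht
    rwa [Nat.add_eq, Nat.add_sub_of_le hi] at this
  simp only [isMonic37, Bool.or_eq_true, beq_iff_eq] at hm
  rcases hm with (((h | h) | h) | h) | h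
  · exact key 1 1 (by omega) (by omega) e0
  · exact key 3 3 (by omega) (by omega) e1
  · exact key 9 9 (by omega) (by omega) e2
  · exact key 27 27 (by omega) (by omega) e3
  · exact key 81 81 (by omega) (by omega) e4

theorem expandCheck37 : (List.range 6).all (fun s => (List.range 729).all fun c =>
    c == 0 || c / 3 ^ s % 3 != 0 ||
      [3 * c, addc 3 7 (3 * c) (3 * c)].any fun b => isMonic37 (contract37 (s + 1) b) &&
        expand37 (s + 1) (contract37 (s + 1) b) == b) = true := by decide +kernel

/-- Up to sign, each nonzero code with zero digits at `0` and `s` is obtained from a code with leading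
digit one by inserting zeros. -/
theorem exists_expand37 {s b : ℕ} (hs : 1 ≤ s) (hs6 : s ≤ 6) (hb0 : b ≠ 0) (hb : b < 3 ^ 7)
    (h0 : b % 3 = 0) (h1 : b / 3 ^ s % 3 = 0) : ∃ m, isMonic37 m = true ∧
      (expand37 s m = b ∨ expand37 s m = addc 3 7 b b) := by
  obtain ⟨c, rfl⟩ : ∃ c, b = 3 * c := ⟨b / 3, by omega⟩
  obtain ⟨s, rfl⟩ := Nat.exists_eq_add_of_le' hs
  have h := List.all_eq_true.1 (List.all_eq_true.1 expandCheck37 s (List.mem_range.2 (by omega))) c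
    (List.mem_range.2 (by omega))
  have h1' : c / 3 ^ s % 3 = 0 := by
    rwa [pow_succ', Nat.mul_div_mul_left _ _ (by omega)] at h1
  have hc0 : c ≠ 0 := by omega
  simp only [Bool.or_eq_true, beq_iff_eq, hc0, bne_iff_ne, h1', ne_eq, not_true_eq_false, false_or,
    List.any_cons, List.any_nil, Bool.and_eq_true, Bool.or_false] at h
  rcases h with h | h
  · exact ⟨_, h.1, Or.inl h.2⟩
  · exact ⟨_, h.1, Or.inr h.2⟩

section Addc

variable {q : ℕ} {R : Type*} [CommRing R] [CharP R q] (x : R)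

theorem addc_lt (hq : 0 < q) (k a b : ℕ) : addc q k a b < q ^ k := by
  induction k generalizing a b with
  | zero => simp [addc]
  | succ k ih =>
    have h1 := ih (a / q) (b / q)
    have h2 := Nat.mod_lt (a % q + b % q) hq
    have h3 := Nat.mul_le_mul_left q (Nat.succ_le_of_lt h1)
    rw [Nat.mul_succ] at h3
    rw [addc, pow_succ']
    omega

theorem evc_addc (hq : 1 < q) (k : ℕ) {a b : ℕ} (ha : a < q ^ k) (hb : b < q ^ k) :
    evc q x (addc q k a b) = evc q x a + evc q x b := by
  induction k generalizing a b with
  | zero =>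
    obtain rfl : a = 0 := by simpa using ha
    obtain rfl : b = 0 := by simpa using hb
    simp [addc, evc_zero]
  | succ k ih =>
    have hlt : ∀ c, c < q ^ (k + 1) → c / q < q ^ k := fun c hc => by
      rw [Nat.div_lt_iff_lt_mul (by omega), ← pow_succ]
      exact hc
    rw [addc, evc_mul_add x hq _ (Nat.mod_lt _ (by omega)), ih (hlt a ha) (hlt b hb), cast_mod,
      evc_eq x hq a, evc_eq x hq b]
    push_cast
    ring

theorem digit_addc (hq : 0 < q) {k i : ℕ} (hi : i < k) (a b : ℕ) :
    addc q k a b / q ^ i % q = (a / q ^ i % q + b / q ^ i % q) % q := by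
  induction k generalizing a b i with
  | zero => omega
  | succ k ih =>
    have hlt := Nat.mod_lt (a % q + b % q) hq
    cases i with
    | zero =>
      rw [addc, pow_zero, Nat.div_one, Nat.div_one, Nat.div_one, Nat.mul_add_mod, Nat.mod_mod]
    | succ i =>
      rw [addc, pow_succ', ← Nat.div_div_eq_div_mul, ← Nat.div_div_eq_div_mul,
        ← Nat.div_div_eq_div_mul, Nat.mul_add_div hq, Nat.div_eq_of_lt hlt, add_zero,
        ih (by omega)]

end Addc

section Plane

variable {L : Type*} [Field L] [Algebra (ZMod 3) L] {col : L → ℕ} {I : AddSubmonoid ℕ}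

/-- The thirteen lines of the plane `⟨1, a, b⟩` over the field with three elements. -/
theorem IsColouring.coloursOf_plane (hcol : IsColouring (q := 3) I col) {a b : L}
    {B : Submodule (ZMod 3) L} (h1 : (1 : L) ∈ B) (ha : a ∈ B) (hb : b ∈ B)
    (hB : ∀ u ∈ B, ∃ u₀ u₁ u₂ : ZMod 3, u = u₀ • (1 : L) + u₁ • a + u₂ • b)
    (hind : ∀ u₀ u₁ u₂ : ZMod 3, u₀ • (1 : L) + u₁ • a + u₂ • b = 0 → u₀ = 0 ∧ u₁ = 0 ∧ u₂ = 0)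
    (c : ℕ) : c ∈ coloursOf 3 col B ↔ c = col a ∨ (∃ β : ZMod 3, c = col (b + β • a)) ∨
      ∃ α β : ZMod 3, c = col ((b + algebraMap (ZMod 3) L β) / (a + algebraMap (ZMod 3) L α)) := by
  have hm : ∀ β : ZMod 3, algebraMap (ZMod 3) L β ∈ B := fun β => by
    rw [Algebra.algebraMap_eq_smul_one]
    exact B.smul_mem _ h1
  have hr : ∀ {x y : L}, x ≠ 0 → (∀ e : ZMod 3, y - e • x ≠ 0) → IsRatio 3 (y / x) := by
    intro x y hx hy
    exact isRatio_div hx fun e he => hy e (sub_eq_zero.2 he)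
  have r1 : IsRatio 3 (a / 1) := hr one_ne_zero fun e he => by
    have := hind (-e) 1 0 (by rw [← he]; module)
    exact one_ne_zero this.2.1
  have r2 : ∀ β : ZMod 3, IsRatio 3 ((b + β • a) / 1) := fun β => hr one_ne_zero fun e he => by
    have := hind (-e) β 1 (by rw [← he]; module)
    exact one_ne_zero this.2.2
  have n3 : ∀ α : ZMod 3, a + algebraMap (ZMod 3) L α ≠ 0 := fun α he => by
    have := hind α 1 0 (by rw [← he, Algebra.algebraMap_eq_smul_one]; module)
    exact one_ne_zero this.2.1
  have r3 : ∀ α β : ZMod 3, IsRatio 3 ((b + algebraMap (ZMod 3) L β) / (a + algebraMap (ZMod 3) L α)) :=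
    fun α β => hr (n3 α) fun e he => by
      have := hind (β - e * α) (-e) 1 (by
        rw [← he, Algebra.algebraMap_eq_smul_one, Algebra.algebraMap_eq_smul_one]; module)
      exact one_ne_zero this.2.2
  constructor
  · rintro ⟨u, hu, v, hv, hu0, huv, rfl⟩
    -- a pair of generators in normal form determines the colour
    have key : ∀ {x y : L} (e f g h : ZMod 3), x ≠ 0 → IsRatio 3 (y / x) → u = e • x + f • y →
        v = g • x + h • y → col (v / u) = col (y / x) := by
      intro x y e f g h hx hxy he hg
      rw [he] at hu0
      rw [he, hg] at huv
      rw [he, hg]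
      exact hcol.basis_change hx hxy hu0 huv
    obtain ⟨u₀, u₁, u₂, hu'⟩ := hB u hu
    obtain ⟨v₀, v₁, v₂, hv'⟩ := hB v hv
    by_cases h2 : u₂ = 0 ∧ v₂ = 0
    · left
      rw [key (x := 1) (y := a) u₀ u₁ v₀ v₁ one_ne_zero r1 (by rw [hu', h2.1]; module)
        (by rw [hv', h2.2]; module), div_one]
    right
    -- the element `v₂ u - u₂ v` of the line lies in `⟨1, a⟩`
    have hdet : ¬ (v₂ * u₁ - u₂ * v₁ = 0 ∧ v₂ * u₀ - u₂ * v₀ = 0) := by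
      rintro ⟨e1, e0⟩
      have hw : v₂ • u = u₂ • v := by
        rw [← sub_eq_zero, hu', hv']
        calc _ = (v₂ * u₀ - u₂ * v₀) • (1 : L) + (v₂ * u₁ - u₂ * v₁) • a := by module
          _ = 0 := by rw [e0, e1]; module
      by_cases hu2 : u₂ = 0
      · rw [hu2, zero_smul, smul_eq_zero] at hw
        exact h2 ⟨hu2, hw.resolve_right hu0⟩
      · refine huv.ne_smul hu0 (u₂⁻¹ * v₂) ?_
        rw [mul_smul, hw, smul_smul, inv_mul_cancel₀ hu2, one_smul]
    by_cases h1 : v₂ * u₁ - u₂ * v₁ = 0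
    · left
      have h0 : v₂ * u₀ - u₂ * v₀ ≠ 0 := fun h0 => hdet ⟨h1, h0⟩
      obtain ⟨β, hβu, hβv⟩ : ∃ β, u₁ = u₂ * β ∧ v₁ = v₂ * β := by
        by_cases hu2 : u₂ = 0
        · have hv2 : v₂ ≠ 0 := fun hv2 => h2 ⟨hu2, hv2⟩
          refine ⟨v₁ / v₂, ?_, by field_simp⟩
          rw [hu2] at h1 ⊢
          have : v₂ * u₁ = 0 := by linear_combination h1
          rw [(mul_eq_zero.1 this).resolve_left hv2, zero_mul]
        · refine ⟨u₁ / u₂, by field_simp, ?_⟩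
          field_simp
          linear_combination -h1
      refine ⟨β, ?_⟩
      rw [key (x := 1) (y := b + β • a) u₀ u₂ v₀ v₂ one_ne_zero (r2 β) (by rw [hu', hβu]; module)
        (by rw [hv', hβv]; module), div_one]
    · right
      -- generators `a + α` and `b + β`
      have hD : v₂ * u₁ - u₂ * v₁ ≠ 0 := h1
      refine ⟨(v₂ * u₀ - u₂ * v₀) / (v₂ * u₁ - u₂ * v₁), (u₁ * v₀ - v₁ * u₀) / (v₂ * u₁ - u₂ * v₁), ?_⟩
      refine key u₁ u₂ v₁ v₂ (n3 _) (r3 _ _) ?_ ?_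
      · have e : u₀ = u₁ * ((v₂ * u₀ - u₂ * v₀) / (v₂ * u₁ - u₂ * v₁)) +
            u₂ * ((u₁ * v₀ - v₁ * u₀) / (v₂ * u₁ - u₂ * v₁)) := by
          rw [← mul_div_assoc, ← mul_div_assoc, ← add_div, eq_div_iff hD]
          ring
        rw [hu', Algebra.algebraMap_eq_smul_one, Algebra.algebraMap_eq_smul_one]
        conv_lhs => rw [e]
        module
      · have e : v₀ = v₁ * ((v₂ * u₀ - u₂ * v₀) / (v₂ * u₁ - u₂ * v₁)) +
            v₂ * ((u₁ * v₀ - v₁ * u₀) / (v₂ * u₁ - u₂ * v₁)) := by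
          rw [← mul_div_assoc, ← mul_div_assoc, ← add_div, eq_div_iff hD]
          ring
        rw [hv', Algebra.algebraMap_eq_smul_one, Algebra.algebraMap_eq_smul_one]
        conv_lhs => rw [e]
        module
  · rintro (rfl | ⟨β, rfl⟩ | ⟨α, β, rfl⟩)
    · exact ⟨1, h1, a, ha, one_ne_zero, r1, by rw [div_one]⟩
    · exact ⟨1, h1, _, B.add_mem hb (B.smul_mem β ha), one_ne_zero, r2 β, by rw [div_one]⟩
    · exact ⟨_, B.add_mem ha (hm α), _, B.add_mem hb (hm β), n3 α, r3 α β, rfl⟩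

end Plane

section Digits

variable {q n : ℕ} {L : Type*} [CommRing L] [CharP L q]

/-- A digit of a code can be made zero by adding multiples of a code with digit one. -/
theorem exists_code_digit_zero (x : L) (hq : 1 < q) {a s : ℕ} (hs : s < n) (ha : a < q ^ n)
    (has : a / q ^ s % q = 1) {c : ℕ} (hc : c < q ^ n) :
    ∃ c' < q ^ n, (∃ m : ℕ, evc q x c' = evc q x c + m * evc q x a) ∧ c' / q ^ s % q = 0 ∧
      ∀ i < n, a / q ^ i % q = 0 → c' / q ^ i % q = c / q ^ i % q := by
  have h : ∀ m : ℕ, ∃ c' < q ^ n, evc q x c' = evc q x c + m * evc q x a ∧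
      c' / q ^ s % q = (c / q ^ s + m) % q ∧
      ∀ i < n, a / q ^ i % q = 0 → c' / q ^ i % q = c / q ^ i % q := by
    intro m
    induction m with
    | zero => exact ⟨c, hc, by simp, by simp, fun _ _ _ => rfl⟩
    | succ m ih =>
      obtain ⟨c', hc', h1, h2, h3⟩ := ih
      refine ⟨addc q n c' a, addc_lt (by omega) _ _ _, ?_, ?_, fun i hi h0 => ?_⟩
      · rw [evc_addc x hq n hc' ha, h1]
        push_cast
        ring
      · rw [digit_addc (by omega) hs, h2, has, Nat.mod_add_mod, add_assoc]
      · rw [digit_addc (by omega) hi, h0, add_zero, Nat.mod_mod, h3 i hi h0]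
  obtain ⟨c', hc', h1, h2, h3⟩ := h (q - c / q ^ s % q)
  refine ⟨c', hc', ⟨_, h1⟩, ?_, h3⟩
  have hlt := Nat.mod_lt (c / q ^ s) (show q > 0 by omega)
  rw [h2, Nat.add_mod, ← Nat.mod_add_mod, Nat.mod_mod, ← Nat.add_mod,
    ← Nat.mod_add_mod, Nat.add_sub_of_le hlt.le, Nat.mod_self]

end Digits

section Rows

theorem exists_zmod_three {P : ZMod 3 → Prop} : (∃ a, P a) ↔ P 0 ∨ P 1 ∨ P 2 := by
  constructor
  · rintro ⟨a, ha⟩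
    fin_cases a
    · exact Or.inl ha
    · exact Or.inr (Or.inl ha)
    · exact Or.inr (Or.inr ha)
  · rintro (h | h | h) <;> exact ⟨_, h⟩

attribute [local irreducible] lg37 colour37

theorem lineColour37_eq {L : Type*} [Field L] {x : L} (h : IsLogTable 3 7 x lg37) {u v : ℕ} (hu : u < 3 ^ 7) (hv : v < 3 ^ 7)
    (hu0 : 0 < u) (hv0 : 0 < v) :
    lineColour37 u v = tableCol x 1093 colour37 (evc 3 x u / evc 3 x v) := by
  rw [h.tableCol_div (by norm_num) (by norm_num) _ hu0 hu hv0 hv]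
  rfl

variable {L : Type*} [Field L] [Algebra (ZMod 3) L] {x : L}

/-- `mask37` lists the colours of the lines of a plane. -/
theorem testBit_mask37 (h : IsLogTable 3 7 x lg37) {I : AddSubmonoid ℕ}
    (hcol : IsColouring (q := 3) I (tableCol x 1093 colour37)) (hL : Nat.card L = 3 ^ 7)
    {B : Submodule (ZMod 3) L} (hB : Module.finrank (ZMod 3) B = 3) (h1 : (1 : L) ∈ B) {a b : ℕ}
    (ha : a < 3 ^ 7) (hb : b < 3 ^ 7) (ha3 : a % 3 = 0) (hb3 : b % 3 = 0)
    (haB : evc 3 x a ∈ B) (hbB : evc 3 x b ∈ B)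
    (hind : ∀ u₀ u₁ u₂ : ZMod 3, u₀ • (1 : L) + u₁ • evc 3 x a + u₂ • evc 3 x b = 0 →
      u₀ = 0 ∧ u₁ = 0 ∧ u₂ = 0) (c : ℕ) :
    (mask37 a b).testBit c = true ↔ c ∈ coloursOf 3 (tableCol x 1093 colour37) B := by
  have hch : CharP L 3 := charP_of_injective_algebraMap' (ZMod 3) 3
  have hli : LinearIndependent (ZMod 3) ![1, evc 3 x a, evc 3 x b] := by
    rw [Fintype.linearIndependent_iff]
    intro g hg
    rw [Fin.sum_univ_three] at hg
    obtain ⟨g0, g1, g2⟩ := hind (g 0) (g 1) (g 2) hg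
    intro i
    fin_cases i <;> assumption
  have hfin : Finite L := Nat.finite_of_card_ne_zero (by rw [hL]; norm_num)
  have hspan : ∀ u ∈ B, ∃ u₀ u₁ u₂ : ZMod 3,
      u = u₀ • (1 : L) + u₁ • evc 3 x a + u₂ • evc 3 x b := by
    have hle : Submodule.span (ZMod 3) (Set.range ![1, evc 3 x a, evc 3 x b]) ≤ B := by
      rw [Submodule.span_le]
      rintro _ ⟨i, rfl⟩
      fin_cases i
      exacts [h1, haB, hbB]
    have hfl : Module.Finite (ZMod 3) L := Module.Finite.of_finite
    have heq := Submodule.eq_of_le_of_finrank_eq hle (by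
      rw [finrank_span_eq_card hli, hB, Fintype.card_fin])
    intro u hu
    rw [← heq, Submodule.mem_span_range_iff_exists_fun] at hu
    obtain ⟨d, hd⟩ := hu
    exact ⟨d 0, d 1, d 2, by rw [← hd, Fin.sum_univ_three]; rfl⟩
  have hne : ∀ u₀ u₁ u₂ : ZMod 3, ¬ (u₀ = 0 ∧ u₁ = 0 ∧ u₂ = 0) →
      ∀ c, evc 3 x c = u₀ • (1 : L) + u₁ • evc 3 x a + u₂ • evc 3 x b → 0 < c := by
    intro u₀ u₁ u₂ hu c hc
    refine Nat.pos_of_ne_zero fun h0 => hu (hind _ _ _ ?_)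
    rw [← hc, h0, evc_zero]
  have e0 : ∀ c, c % 3 = 0 → ∀ i, i < 3 → evc 3 x (c + i) = evc 3 x c + i := by
    intro c hc i hi
    have := evc_add_pow x (by norm_num) hi 0 c (by simpa using hc)
    simpa using this
  have eba := evc_addc x (q := 3) (by norm_num) 7 hb ha
  have hba := addc_lt (q := 3) (by norm_num) 7 b a
  have ebaa := evc_addc x (q := 3) (by norm_num) 7 hba ha
  have hbaa := addc_lt (q := 3) (by norm_num) 7 (addc 3 7 b a) a
  have ha0 : 0 < a := hne 0 1 0 (by decide) a (by simp)
  have hb0 : 0 < b := hne 0 0 1 (by decide) b (by simp)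
  have hba0 : 0 < addc 3 7 b a := hne 0 1 1 (by decide) _ (by rw [eba]; module)
  have hbaa0 : 0 < addc 3 7 (addc 3 7 b a) a := hne 0 2 1 (by decide) _ (by
    rw [ebaa, eba, two_smul]; module)
  have l1 : (1 : ℕ) < 3 ^ 7 := by norm_num
  have hone : evc 3 x 1 = 1 := by rw [evc_of_lt x (by norm_num) (by norm_num)]; simp
  rw [hcol.coloursOf_plane h1 haB hbB hspan hind, mask37, testBit_orBits]
  simp only [exists_zmod_three]
  rw [lineColour37_eq h ha l1 ha0 one_pos, lineColour37_eq h hb l1 hb0 one_pos,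
    lineColour37_eq h hba l1 hba0 one_pos, lineColour37_eq h hbaa l1 hbaa0 one_pos,
    lineColour37_eq h hb ha hb0 ha0, lineColour37_eq h (by omega) ha (by omega) ha0,
    lineColour37_eq h (by omega) ha (by omega) ha0, lineColour37_eq h hb (by omega) hb0 (by omega),
    lineColour37_eq h (by omega) (by omega) (by omega) (by omega),
    lineColour37_eq h (by omega) (by omega) (by omega) (by omega),
    lineColour37_eq h hb (by omega) hb0 (by omega),
    lineColour37_eq h (by omega) (by omega) (by omega) (by omega),
    lineColour37_eq h (by omega) (by omega) (by omega) (by omega), hone, ebaa, eba,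
    e0 a ha3 1 (by norm_num), e0 a ha3 2 (by norm_num), e0 b hb3 1 (by norm_num),
    e0 b hb3 2 (by norm_num)]
  have m2 : algebraMap (ZMod 3) L 2 = 2 := map_ofNat _ 2
  have t2 : evc 3 x b + evc 3 x a + evc 3 x a = evc 3 x b + (2 : ZMod 3) • evc 3 x a := by
    rw [two_smul, add_assoc]
  simp only [map_zero, map_one, m2, t2, zero_smul, one_smul, add_zero, div_one, List.mem_cons,
    List.not_mem_nil, or_false, Nat.cast_one, Nat.cast_ofNat, or_assoc]

theorem loop37_spec {r : ℕ} {p : ℕ → Bool} (h : loop37 r p = true) {m : ℕ}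
    (hm : isMonic37 m = true) : p (mask37 (r / 8) (expand37 (r % 8) m)) = true :=
  allMonic37_spec h hm

theorem rows37_valid : ∀ r ∈ rows37, 1 ≤ r % 8 ∧ r % 8 ≤ 6 ∧ r / 8 < 3 ^ 7 ∧ r / 8 % 3 = 0 ∧
    r / 8 / 3 ^ (r % 8) % 3 = 1 := by decide

/-- A block through a line `⟨1, a⟩` that belongs to the rows is a candidate in the search for this row. -/
theorem exists_mask37 (h : IsLogTable 3 7 x lg37) {I : AddSubmonoid ℕ}
    (hcol : IsColouring (q := 3) I (tableCol x 1093 colour37)) (hL : Nat.card L = 3 ^ 7)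
    {S : Set (Submodule (ZMod 3) L)} (hS : IsDesign 2 3 1 S) {r : ℕ} (hr : r ∈ rows37) :
    ∃ M, ∃ B ∈ S, (∀ c, M.testBit c = true ↔ c ∈ coloursOf 3 (tableCol x 1093 colour37) B) ∧
      M &&& rowBit37 r ≠ 0 ∧ ∀ p : ℕ → Bool, loop37 r p = true → p M = true := by
  have hch : CharP L 3 := charP_of_injective_algebraMap' (ZMod 3) 3
  have hfin : Finite L := Nat.finite_of_card_ne_zero (by rw [hL]; norm_num)
  have hfl : Module.Finite (ZMod 3) L := Module.Finite.of_finite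
  obtain ⟨hs1, hs6, ha, ha3, has⟩ := rows37_valid r hr
  have hloop : ∀ p : ℕ → Bool, loop37 r p = true → ∀ m, isMonic37 m = true →
      p (mask37 (r / 8) (expand37 (r % 8) m)) = true := fun p h m => loop37_spec h
  have hbit : rowBit37 r = 1 <<< lineColour37 (r / 8) 1 := rfl
  generalize r / 8 = a at *
  generalize r % 8 = s at *
  have l1 : (1 : ℕ) < 3 ^ 7 := by norm_num
  have hone : evc 3 x 1 = 1 := by rw [evc_of_lt x (by norm_num) (by norm_num)]; simp
  have ha0 : a ≠ 0 := by
    rintro rfl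
    simp at has
  have hinj : ∀ c < 3 ^ 7, c ≠ 0 → evc 3 x c ≠ 0 := by
    intro c hc hc0
    rw [← h.pow_lg c (Nat.pos_of_ne_zero hc0) hc]
    exact pow_ne_zero _ (h.ne_zero (by norm_num))
  -- the codes of nonzero scalars differ from `a`
  have hnat : ∀ m : ZMod 3, algebraMap (ZMod 3) L m = (m.val : L) := fun m => by
    rw [← map_natCast (algebraMap (ZMod 3) L), ZMod.natCast_zmod_val]
  have hα : IsRatio 3 (evc 3 x a) := by
    intro m hm
    have hlt := ZMod.val_lt (-m)
    refine hinj (a + (-m).val) (by omega) (by omega) ?_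
    have e := evc_add_pow x (by norm_num) hlt 0 a (by simpa using ha3)
    rw [pow_zero, pow_zero, mul_one, mul_one] at e
    rw [e, ← hm, ← hnat, map_neg, add_neg_cancel]
  have hα1 : ∀ m : ZMod 3, evc 3 x a ≠ m • (1 : L) := fun m hm => hα m (by
    rw [hm, Algebra.smul_def, mul_one])
  obtain ⟨B, hB, h1, haB⟩ := hS.exists_block_pair one_ne_zero hα1
  obtain ⟨y, hyB, hy⟩ : ∃ y ∈ B, y ∉ Submodule.span (ZMod 3) {1, evc 3 x a} := by
    by_contra hcon
    push Not at hcon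
    have h2 := Submodule.finrank_mono (show B ≤ _ from hcon)
    rw [hS.1 B hB, finrank_span_pair one_ne_zero hα1] at h2
    omega
  obtain ⟨c, hc, rfl⟩ := h.exists_code y
  obtain ⟨c₁, hc₁, ⟨m₁, e₁⟩, d₁, -⟩ := exists_code_digit_zero x (by norm_num) (by omega) ha has hc
  obtain ⟨c₂, hc₂, ⟨m₂, e₂⟩, d₂, d₂'⟩ := exists_code_digit_zero x (q := 3) (s := 0) (by norm_num)
    (by omega) l1 (by norm_num) hc₁
  rw [pow_zero, Nat.div_one] at d₂
  have d₂s : c₂ / 3 ^ s % 3 = 0 := by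
    rw [d₂' s (by omega), d₁]
    rw [Nat.div_eq_of_lt (Nat.one_lt_pow (by omega) (by norm_num)), Nat.zero_mod]
  rw [hone, mul_one, e₁] at e₂
  have hspan : ∀ m m' : ℕ, (m : L) * evc 3 x a + m' ∈ Submodule.span (ZMod 3) {1, evc 3 x a} := by
    intro m m'
    rw [Submodule.mem_span_pair]
    refine ⟨m', m, ?_⟩
    rw [Algebra.smul_def, Algebra.smul_def, map_natCast, map_natCast]
    ring
  have hnmem : ∀ {z : L}, z = evc 3 x c₂ → z ∉ Submodule.span (ZMod 3) {1, evc 3 x a} := by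
    rintro _ rfl hz
    apply hy
    have := Submodule.sub_mem _ hz (hspan m₁ m₂)
    rwa [e₂, show evc 3 x c + m₁ * evc 3 x a + m₂ - (m₁ * evc 3 x a + m₂) = evc 3 x c by ring] at this
  have hmem : evc 3 x c₂ ∈ B := by
    rw [e₂, add_assoc]
    exact B.add_mem hyB (span_pair_le h1 haB (hspan m₁ m₂))
  have hc₂0 : c₂ ≠ 0 := by
    rintro rfl
    exact hnmem rfl (by rw [evc_zero]; exact Submodule.zero_mem _)
  obtain ⟨m, hm, hexp⟩ := exists_expand37 hs1 hs6 hc₂0 hc₂ d₂ d₂s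
  obtain ⟨b, hb, hb3, hbe, ε, hε, hεb⟩ : ∃ b < 3 ^ 7, b % 3 = 0 ∧ expand37 s m = b ∧
      ∃ ε : ZMod 3, ε ≠ 0 ∧ evc 3 x b = ε • evc 3 x c₂ := by
    rcases hexp with hexp | hexp
    · exact ⟨_, hc₂, d₂, hexp, 1, by decide, by rw [one_smul]⟩
    · refine ⟨_, addc_lt (by norm_num) _ _ _, ?_, hexp, 2, by decide, ?_⟩
      · have := digit_addc (q := 3) (by norm_num) (show 0 < 7 by norm_num) c₂ c₂
        rw [pow_zero, Nat.div_one, Nat.div_one, d₂] at this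
        exact this
      · rw [evc_addc x (by norm_num) 7 hc₂ hc₂, two_smul]
  have hbB : evc 3 x b ∈ B := by
    rw [hεb]
    exact B.smul_mem _ hmem
  have hind : ∀ u₀ u₁ u₂ : ZMod 3, u₀ • (1 : L) + u₁ • evc 3 x a + u₂ • evc 3 x b = 0 →
      u₀ = 0 ∧ u₁ = 0 ∧ u₂ = 0 := by
    intro u₀ u₁ u₂ hu
    have h2 : u₂ = 0 := by
      by_contra h2
      refine hnmem rfl (Submodule.mem_span_pair.2 ⟨-(u₂ * ε)⁻¹ * u₀, -(u₂ * ε)⁻¹ * u₁, ?_⟩)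
      rw [hεb, smul_smul] at hu
      have h3 : (u₂ * ε) • evc 3 x c₂ = -(u₀ • (1 : L) + u₁ • evc 3 x a) := by
        rw [eq_neg_iff_add_eq_zero, add_comm, hu]
      rw [← one_smul (ZMod 3) (evc 3 x c₂), ← inv_mul_cancel₀ (mul_ne_zero h2 hε),
        mul_smul (u₂ * ε)⁻¹ (u₂ * ε), h3]
      module
    subst h2
    have h1 : u₁ = 0 := by
      by_contra h1
      refine hα1 (-u₁⁻¹ * u₀) ?_
      rw [zero_smul, add_zero] at hu
      have h3 : u₁ • evc 3 x a = -(u₀ • (1 : L)) := by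
        rw [eq_neg_iff_add_eq_zero, add_comm, hu]
      rw [← one_smul (ZMod 3) (evc 3 x a), ← inv_mul_cancel₀ h1, mul_smul u₁⁻¹ u₁, h3]
      module
    subst h1
    rw [zero_smul, zero_smul, add_zero, add_zero, smul_eq_zero] at hu
    exact ⟨hu.resolve_right one_ne_zero, rfl, rfl⟩
  have hmask := testBit_mask37 h hcol hL (hS.1 B hB) h1 ha hb ha3 hb3 haB hbB hind
  refine ⟨mask37 a b, B, hB, hmask, ?_, fun p hp => hbe ▸ hloop p hp m hm⟩
  intro h0
  have hc1 : lineColour37 a 1 ∈ coloursOf 3 (tableCol x 1093 colour37) B := by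
    refine ⟨1, h1, _, haB, one_ne_zero, by rwa [div_one], ?_⟩
    rw [lineColour37_eq h ha l1 (Nat.pos_of_ne_zero ha0) one_pos, hone]
  have h2 := congrArg (Nat.testBit · (lineColour37 a 1)) h0
  simp only [Nat.testBit_and, (hmask _).2 hc1, hbit, Nat.one_shiftLeft, Nat.testBit_two_pow_self,
    Nat.zero_testBit, Bool.and_self] at h2
  exact absurd h2 (by decide)

theorem isStep37 {R : Type*} [CommRing R] [CharP R 3] {x : R} (hx : x ^ 7 = ev x [2, 0, 1]) : IsStep 3 7 x step37 := by
  intro c hc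
  have hq : 1 < 3 := by norm_num
  refine ⟨by rw [step37]; omega, ?_⟩
  have e : ∀ c : ℕ, evc 3 x c = (c % 3 : ℕ) + x * evc 3 x (c / 3) := evc_eq x hq
  have hc9 : evc 3 x (c / 9) = evc 3 x (c / 9 % 81) + (c / 729 : ℕ) * x ^ 4 := by
    have h := evc_add_pow x hq (show c / 729 < 3 by omega) 4 (c / 9 % 81) (by omega)
    rw [← h]
    congr 1
    omega
  rw [step37, evc_mul_add x hq _ (by omega), evc_mul_add x hq _ (by omega),
    evc_mul_add x hq _ (by omega), e c, e (c / 3), Nat.div_div_eq_div_mul, hc9]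
  simp only [ev, cast_mod, Nat.cast_add] at hx ⊢
  push_cast at hx ⊢
  linear_combination ((c / 729 : ℕ) : R) * (-hx)

theorem not_admits_3_2_3_7 (C : Subgroup (GLin 7 3)) (hC : IsSingerSubgroup C) :
    ¬ Admits 3 2 3 7 C := by
  intro hA
  obtain ⟨L, _, _, hL, S, hS, hscale, -⟩ := exists_field_design (by norm_num) hC le_rfl hA
  have hI := hscale.twistInvariant_bot
  have hch : CharP L 3 := charP_of_injective_algebraMap' (ZMod 3) 3
  obtain ⟨x, hx⟩ := exists_root_of_card (q := 3) hL (by norm_num) (m := 7) (by norm_num)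
    (r := [2, 0, 1]) (by simp) fun R _ _ x h =>
      (isStep37 h).pow_card (by norm_num) (by norm_num) walkB37
  have hx0 : x ≠ 0 := by
    rintro rfl
    have h2 : (2 : L) = 0 := by simpa [ev] using hx.symm
    have := (CharP.cast_eq_zero_iff L 3 2).1 (by exact_mod_cast h2)
    omega
  have hlog := (isStep37 hx).isLogTable hL (by norm_num) hx0 walkB37
  have hcol : IsColouring (q := 3) ⊥ (tableCol x 1093 colour37) :=
    hlog.isColouring (frob := false) (D := dist37) (R := rep37) (by norm_num) hL (by norm_num)
      fun c hc1 hc2 => by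
        have := allB_spec colourCheck37 (k := c - 3) (by omega)
        rwa [Nat.add_eq, Nat.sub_add_cancel hc1] at this
  choose! f B hB hf hbit hloop using fun r (hr : r ∈ rows37) =>
    exists_mask37 hlog hcol hL hS hr
  have hsound := coverSearch_sound (rowBit := rowBit37) (loop := loop37) (f := f) rows37 hbit hloop
    (fun a ha b hb hab => ?_) 0 (fun a _ _ => by rw [Nat.and_zero])
  · rw [coverSearch37] at hsound
    exact absurd hsound (by decide)
  · obtain ⟨c, hca, hcb⟩ := exists_testBit_of_land_ne_zero hab
    rw [hf a ha] at hca
    rw [hf b hb] at hcb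
    have h1 := hcol.coloursOf_subset hI hS (hB a ha) (hB b hb) hca hcb
    have h2 := hcol.coloursOf_subset hI hS (hB b hb) (hB a ha) hcb hca
    refine Nat.eq_of_testBit_eq fun c => ?_
    rw [Bool.eq_iff_iff, hf a ha, hf b hb]
    exact ⟨fun h => h1 h, fun h => h2 h⟩

end Rows

/-! ### Three-dimensional subspaces in characteristic two -/

section Triple

variable {L : Type*} [Field L]

/-- The coefficient of `u ^ 2` in `u (u + x) (u + y) (u + x + y) = u ^ 4 + A u ^ 2 + B u`. -/
def planeA (x y : L) : L := x ^ 2 + x * y + y ^ 2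

/-- The coefficient of `u` in `u (u + x) (u + y) (u + x + y) = u ^ 4 + A u ^ 2 + B u`. -/
def planeB (x y : L) : L := x * y * (x + y)

/-- The value at `u` of the polynomial with the set of roots `⟨x, y⟩`. -/
def planeEval (x y u : L) : L := u ^ 4 + planeA x y * u ^ 2 + planeB x y * u

/-- The coefficients of `u ^ 4`, `u ^ 2`, `u` in the monic polynomial of degree eight with the set of
roots `⟨x, y, z⟩`. -/
def tripleCoeff (x y z : L) : L × L × L :=
  (planeA x y ^ 2 + planeEval x y z, planeB x y ^ 2 + planeA x y * planeEval x y z,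
    planeB x y * planeEval x y z)

/-- The value at `u` of the polynomial with coefficients `c`. -/
def octicEval (c : L × L × L) (u : L) : L := u ^ 8 + c.1 * u ^ 4 + c.2.1 * u ^ 2 + c.2.2 * u

/-- The independence of three elements over the field with two elements. -/
def IsTriple (x y z : L) : Prop := (tripleCoeff x y z).2.2 ≠ 0

/-- The invariants of a three-dimensional subspace under multiplication by nonzero elements of the
field with `256` elements. Multiplication by `d` multiplies the coefficients by `d ^ 4`, `d ^ 6`, `d ^ 7`; the
exponents are `-4 / 7` and `-6 / 7` modulo `255`. -/
def tripleKey (x y z : L) : L × L :=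
  ((tripleCoeff x y z).1 * (tripleCoeff x y z).2.2 ^ 218,
    (tripleCoeff x y z).2.1 * (tripleCoeff x y z).2.2 ^ 72)

theorem tripleCoeff_mul (d x y z : L) : tripleCoeff (d * x) (d * y) (d * z) =
    (d ^ 4 * (tripleCoeff x y z).1, d ^ 6 * (tripleCoeff x y z).2.1,
      d ^ 7 * (tripleCoeff x y z).2.2) := by
  have hA : planeA (d * x) (d * y) = d ^ 2 * planeA x y := by rw [planeA, planeA]; ring
  have hB : planeB (d * x) (d * y) = d ^ 3 * planeB x y := by rw [planeB, planeB]; ring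
  have hD : planeEval (d * x) (d * y) (d * z) = d ^ 4 * planeEval x y z := by
    rw [planeEval, planeEval, hA, hB]; ring
  simp only [tripleCoeff, hA, hB, hD, Prod.mk.injEq]
  exact ⟨by ring, by ring, by ring⟩

theorem IsTriple.mul {d x y z : L} (h : IsTriple x y z) (hd : d ≠ 0) :
    IsTriple (d * x) (d * y) (d * z) := by
  rw [IsTriple, tripleCoeff_mul]
  exact mul_ne_zero (pow_ne_zero _ hd) h

theorem tripleKey_mul {d : L} (hd : d ^ 255 = 1) (x y z : L) :
    tripleKey (d * x) (d * y) (d * z) = tripleKey x y z := by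
  rw [tripleKey, tripleKey, tripleCoeff_mul]
  simp only [Prod.mk.injEq, mul_pow, ← pow_mul]
  have e : ∀ k, d ^ (255 * k) = 1 := fun k => by rw [pow_mul, hd, one_pow]
  constructor
  · rw [show ∀ a b : L, d ^ 4 * a * (d ^ (7 * 218) * b) = d ^ (255 * 6) * (a * b) from
      fun a b => by ring, e, one_mul]
  · rw [show ∀ a b : L, d ^ 6 * a * (d ^ (7 * 72) * b) = d ^ (255 * 2) * (a * b) from
      fun a b => by ring, e, one_mul]

theorem span_triple_le [Algebra (ZMod 2) L] {B : Submodule (ZMod 2) L} {x y z : L} (hx : x ∈ B) (hy : y ∈ B) (hz : z ∈ B) :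
    Submodule.span (ZMod 2) (Set.range ![x, y, z]) ≤ B := by
  rw [Submodule.span_le]
  rintro _ ⟨i, rfl⟩
  fin_cases i
  exacts [hx, hy, hz]

variable [CharP L 2]

theorem planeEval_eq (x y u : L) : planeEval x y u = u * (u + x) * (u + y) * (u + (x + y)) := by
  have h : (2 : L) = 0 := CharTwo.two_eq_zero
  rw [planeEval, planeA, planeB]
  linear_combination (-(u ^ 3 * (x + y)) - x * y * u ^ 2) * h

theorem planeEval_add (x y u v : L) :
    planeEval x y (u + v) = planeEval x y u + planeEval x y v := by
  have h : (2 : L) = 0 := CharTwo.two_eq_zero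
  rw [planeEval, planeEval, planeEval]
  linear_combination (2 * u ^ 3 * v + 3 * u ^ 2 * v ^ 2 + 2 * u * v ^ 3 + planeA x y * u * v) * h

theorem planeEval_left (x y : L) : planeEval x y x = 0 := by
  rw [planeEval_eq, CharTwo.add_self_eq_zero]; ring

theorem planeEval_right (x y : L) : planeEval x y y = 0 := by
  rw [planeEval_eq, CharTwo.add_self_eq_zero]; ring

theorem octicEval_tripleCoeff (x y z u : L) :
    octicEval (tripleCoeff x y z) u = planeEval x y u * planeEval x y (u + z) := by
  have h : (2 : L) = 0 := CharTwo.two_eq_zero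
  rw [planeEval_add]
  simp only [octicEval, tripleCoeff]
  generalize planeEval x y z = D
  rw [planeEval]
  generalize planeA x y = A
  generalize planeB x y = B
  linear_combination (-(A * u ^ 6) - B * u ^ 5 - A * B * u ^ 3) * h

theorem octicEval_add (c : L × L × L) (u v : L) :
    octicEval c (u + v) = octicEval c u + octicEval c v := by
  simp only [octicEval]
  rw [show (8 : ℕ) = 2 ^ 3 by rfl, show (4 : ℕ) = 2 ^ 2 by rfl, add_pow_char_pow, add_pow_char_pow,
    add_pow_char]
  ring

theorem octicEval_first (x y z : L) : octicEval (tripleCoeff x y z) x = 0 := by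
  rw [octicEval_tripleCoeff, planeEval_left, zero_mul]

theorem octicEval_second (x y z : L) : octicEval (tripleCoeff x y z) y = 0 := by
  rw [octicEval_tripleCoeff, planeEval_right, zero_mul]

theorem octicEval_third (x y z : L) : octicEval (tripleCoeff x y z) z = 0 := by
  have h : planeEval x y 0 = 0 := by rw [planeEval_eq]; ring
  rw [octicEval_tripleCoeff, CharTwo.add_self_eq_zero, h, mul_zero]

theorem mem_of_planeEval_eq_zero {W : AddSubgroup L} {x y u : L} (hx : x ∈ W) (hy : y ∈ W)
    (hu : planeEval x y u = 0) : u ∈ W := by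
  rw [planeEval_eq] at hu
  simp only [mul_eq_zero, CharTwo.add_eq_zero] at hu
  rcases hu with ((rfl | rfl) | rfl) | rfl
  exacts [W.zero_mem, hx, hy, W.add_mem hx hy]

/-- The roots of the polynomial of a triple lie in each subgroup containing the triple. -/
theorem mem_of_octicEval_eq_zero {W : AddSubgroup L} {x y z u : L} (hx : x ∈ W) (hy : y ∈ W)
    (hz : z ∈ W) (hu : octicEval (tripleCoeff x y z) u = 0) : u ∈ W := by
  rw [octicEval_tripleCoeff, mul_eq_zero] at hu
  rcases hu with hu | hu
  · exact mem_of_planeEval_eq_zero hx hy hu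
  · have := mem_of_planeEval_eq_zero hx hy hu
    exact (W.add_mem_cancel_right hz).1 this

/-- A polynomial vanishing on a triple is the polynomial of the triple. -/
theorem IsTriple.coeff_eq {x y z : L} (h : IsTriple x y z) {c : L × L × L} (hx : octicEval c x = 0)
    (hy : octicEval c y = 0) (hz : octicEval c z = 0) : c = tripleCoeff x y z := by
  have hx' := octicEval_first x y z
  have hy' := octicEval_second x y z
  have hz' := octicEval_third x y z
  rw [IsTriple] at h
  have hB : planeB x y ≠ 0 := left_ne_zero_of_mul h
  have hD : planeEval x y z ≠ 0 := right_ne_zero_of_mul h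
  generalize tripleCoeff x y z = c' at hx' hy' hz' ⊢
  obtain ⟨c2, c1, c0⟩ := c
  obtain ⟨c2', c1', c0'⟩ := c'
  simp only [octicEval] at hx hy hz hx' hy' hz'
  have hx0 : x ≠ 0 := fun h0 => hB (by rw [planeB, h0]; ring)
  have hy0 : y ≠ 0 := fun h0 => hB (by rw [planeB, h0]; ring)
  have hxy : x + y ≠ 0 := fun h0 => hB (by rw [planeB, h0]; ring)
  -- modulo the polynomial of `⟨x, y⟩`, the difference is `e₁ u ^ 2 + e₀ u`
  obtain ⟨e1, he1⟩ : ∃ e, e = (c1 - c1') - (c2 - c2') * planeA x y := ⟨_, rfl⟩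
  obtain ⟨e0, he0⟩ : ∃ e, e = (c0 - c0') - (c2 - c2') * planeB x y := ⟨_, rfl⟩
  have key : ∀ u, (u ^ 8 + c2 * u ^ 4 + c1 * u ^ 2 + c0 * u) -
      (u ^ 8 + c2' * u ^ 4 + c1' * u ^ 2 + c0' * u) =
        (c2 - c2') * planeEval x y u + u * (e1 * u + e0) := by
    intro u
    rw [he1, he0, planeEval]
    ring
  have h1 := key x
  have h2 := key y
  have h3 := key z
  rw [hx, hx', planeEval_left, mul_zero, zero_add, sub_zero, eq_comm, mul_eq_zero] at h1
  rw [hy, hy', planeEval_right, mul_zero, zero_add, sub_zero, eq_comm, mul_eq_zero] at h2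
  replace h1 := h1.resolve_left hx0
  replace h2 := h2.resolve_left hy0
  have h4 : e1 * (x + y) = 0 := by
    have h : (2 : L) = 0 := CharTwo.two_eq_zero
    linear_combination h1 + h2 - e0 * h
  have e1z := (mul_eq_zero.1 h4).resolve_right hxy
  rw [e1z, zero_mul, zero_add] at h1
  rw [hz, hz', e1z, h1, zero_mul, add_zero, mul_zero, add_zero, sub_zero, eq_comm, mul_eq_zero] at h3
  have h5 : c2 - c2' = 0 := h3.resolve_right hD
  rw [h5, zero_mul, sub_zero] at he1 he0
  rw [Prod.mk.injEq, Prod.mk.injEq]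
  exact ⟨sub_eq_zero.1 h5, sub_eq_zero.1 (he1 ▸ e1z), sub_eq_zero.1 (he0 ▸ h1)⟩

theorem isTriple_iff {x y z : L} : IsTriple x y z ↔ (x ≠ 0 ∧ y ≠ 0 ∧ x + y ≠ 0) ∧
    z ≠ 0 ∧ z + x ≠ 0 ∧ z + y ≠ 0 ∧ z + (x + y) ≠ 0 := by
  rw [IsTriple, tripleCoeff, planeB, planeEval_eq]
  simp only [ne_eq, mul_eq_zero]
  tauto

/-- Triples with the same invariants span subspaces that differ by a factor. -/
theorem exists_factor_of_tripleKey_eq (hL : ∀ u : L, u ≠ 0 → u ^ 255 = 1) {x y z x' y' z' : L}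
    (h : IsTriple x y z) (h' : IsTriple x' y' z') (hk : tripleKey x y z = tripleKey x' y' z') :
    ∃ d : L, d ≠ 0 ∧ ∀ W : AddSubgroup L, x' ∈ W → y' ∈ W → z' ∈ W →
      d * x ∈ W ∧ d * y ∈ W ∧ d * z ∈ W := by
  rw [tripleKey, tripleKey, Prod.mk.injEq] at hk
  obtain ⟨k1, k2⟩ := hk
  have hx := octicEval_first x y z
  have hy := octicEval_second x y z
  have hz := octicEval_third x y z
  rw [IsTriple] at h h'
  have hroot : ∀ u, octicEval (tripleCoeff x y z) u = 0 →
      octicEval (tripleCoeff x' y' z')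
        (((tripleCoeff x' y' z').2.2 * (tripleCoeff x y z).2.2 ^ 254) ^ 73 * u) = 0 := by
    intro u hu
    generalize tripleCoeff x y z = c at *
    generalize tripleCoeff x' y' z' = c' at *
    obtain ⟨c2, c1, c0⟩ := c
    obtain ⟨c2', c1', c0'⟩ := c'
    simp only [octicEval] at *
    have p := hL c0 h
    have p' := hL c0' h'
    have pk : ∀ k, c0 ^ (255 * k) = 1 := fun k => by rw [pow_mul, p, one_pow]
    have pk' : ∀ k, c0' ^ (255 * k) = 1 := fun k => by rw [pow_mul, p', one_pow]
    -- the factor `d` satisfies `d ^ 7 = c₀' / c₀`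
    obtain ⟨d, hd⟩ : ∃ d, d = (c0' * c0 ^ 254) ^ 73 := ⟨_, rfl⟩
    rw [← hd]
    have d7 : d ^ 7 * c0 = c0' := by
      calc d ^ 7 * c0 = c0 ^ (255 * 509) * c0' ^ (255 * 2) * c0' * (c0 ^ 255) ^ 0 := by
            rw [hd]; ring
        _ = c0' := by rw [pk, pk']; ring
    have d4 : d ^ 4 * c2 = c2' := by
      calc d ^ 4 * c2 = c0 ^ (255 * 290) * c0' ^ 255 * c0' ^ 37 * (c2 * c0 ^ 218) := by
            rw [hd]; ring
        _ = c0' ^ (255 * 2) * c2' := by rw [pk, k1]; ring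
        _ = c2' := by rw [pk', one_mul]
    have d6 : d ^ 6 * c1 = c1' := by
      calc d ^ 6 * c1 = c0 ^ (255 * 436) * c0' ^ 255 * c0' ^ 183 * (c1 * c0 ^ 72) := by
            rw [hd]; ring
        _ = c0' ^ (255 * 2) * c1' := by rw [pk, k2]; ring
        _ = c1' := by rw [pk', one_mul]
    rw [← d4, ← d6, ← d7]
    linear_combination d ^ 8 * hu
  refine ⟨_, pow_ne_zero 73 (mul_ne_zero h' (pow_ne_zero 254 h)), fun W h1 h2 h3 => ?_⟩
  exact ⟨mem_of_octicEval_eq_zero h1 h2 h3 (hroot x hx), mem_of_octicEval_eq_zero h1 h2 h3 (hroot y hy),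
    mem_of_octicEval_eq_zero h1 h2 h3 (hroot z hz)⟩

theorem isTriple_of_span {x y z : L} [Algebra (ZMod 2) L]
    (h : ∀ a b c : ZMod 2, a • x + b • y + c • z = 0 → a = 0 ∧ b = 0 ∧ c = 0) : IsTriple x y z := by
  have key : ∀ (a b c : ZMod 2) (u : L), ¬ (a = 0 ∧ b = 0 ∧ c = 0) → a • x + b • y + c • z = u → u ≠ 0 :=
    fun a b c u hn hu h0 => hn (h a b c (hu.trans h0))
  rw [isTriple_iff]
  refine ⟨⟨key 1 0 0 _ (by decide) ?_, key 0 1 0 _ (by decide) ?_, key 1 1 0 _ (by decide) ?_⟩,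
    key 0 0 1 _ (by decide) ?_, key 1 0 1 _ (by decide) ?_, key 0 1 1 _ (by decide) ?_,
    key 1 1 1 _ (by decide) ?_⟩ <;> simp only [zero_smul, one_smul] <;> ring

section Module

variable [Algebra (ZMod 2) L]

theorem zmod_two_cases (a : ZMod 2) : a = 0 ∨ a = 1 := by
  fin_cases a
  · exact Or.inl rfl
  · exact Or.inr rfl

theorem IsTriple.linearIndependent {x y z : L} (h : IsTriple x y z) :
    LinearIndependent (ZMod 2) ![x, y, z] := by
  rw [isTriple_iff] at h
  obtain ⟨⟨h1, h2, h3⟩, h4, h5, h6, h7⟩ := h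
  rw [Fintype.linearIndependent_iff]
  intro g hg
  rw [Fin.sum_univ_three] at hg
  replace hg : g 0 • x + g 1 • y + g 2 • z = 0 := hg
  have key : g 0 = 0 ∧ g 1 = 0 ∧ g 2 = 0 := by
    rcases zmod_two_cases (g 0) with e0 | e0 <;> rcases zmod_two_cases (g 1) with e1 | e1 <;>
      rcases zmod_two_cases (g 2) with e2 | e2 <;>
      simp only [e0, e1, e2, zero_smul, one_smul, add_zero, zero_add] at hg ⊢
    · exact ⟨trivial, trivial, trivial⟩
    · exact absurd hg h4
    · exact absurd hg h2
    · exact absurd (by rw [← hg]; ring) h6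
    · exact absurd hg h1
    · exact absurd (by rw [← hg]; ring) h5
    · exact absurd hg h3
    · exact absurd (by rw [← hg]; ring) h7
  intro i
  fin_cases i
  exacts [key.1, key.2.1, key.2.2]

theorem IsTriple.finrank_span {x y z : L} (h : IsTriple x y z) :
    Module.finrank (ZMod 2) (Submodule.span (ZMod 2) (Set.range ![x, y, z])) = 3 := by
  rw [finrank_span_eq_card h.linearIndependent, Fintype.card_fin]

/-- The invariants of the three-dimensional subspaces of a subspace. -/
def keysOf (B : Submodule (ZMod 2) L) : Set (L × L) :=
  {k | ∃ x ∈ B, ∃ y ∈ B, ∃ z ∈ B, IsTriple x y z ∧ tripleKey x y z = k}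

variable {S : Set (Submodule (ZMod 2) L)}

/-- Blocks sharing one invariant have the same invariants. -/
theorem IsDesign.keysOf_subset (hS : IsDesign 3 4 1 S) (hscale : ScaleInvariant S)
    (hL : ∀ u : L, u ≠ 0 → u ^ 255 = 1) {B B' : Submodule (ZMod 2) L} (hB : B ∈ S) (hB' : B' ∈ S)
    {k : L × L} (hk : k ∈ keysOf B) (hk' : k ∈ keysOf B') : keysOf B ⊆ keysOf B' := by
  obtain ⟨x, hx, y, hy, z, hz, h, rfl⟩ := hk
  obtain ⟨x', hx', y', hy', z', hz', h', he⟩ := hk'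
  obtain ⟨d, hd, hdW⟩ := exists_factor_of_tripleKey_eq hL h h' he.symm
  obtain ⟨e1, e2, e3⟩ := hdW B'.toAddSubgroup hx' hy' hz'
  obtain ⟨C, hC, hdB⟩ := hscale d hd B hB
  obtain rfl : C = B' := hS.block_unique (h.mul hd).finrank_span hC hB'
    (span_triple_le (hdB x hx) (hdB y hy) (hdB z hz)) (span_triple_le e1 e2 e3)
  rintro _ ⟨u, hu, v, hv, w, hw, hT, rfl⟩
  exact ⟨_, hdB u hu, _, hdB v hv, _, hdB w hw, hT.mul hd, tripleKey_mul (hL d hd) u v w⟩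

/-- The elements of a subspace `B` outside a hyperplane `W` differ by elements of `W`. -/
theorem add_mem_of_not_mem [FiniteDimensional (ZMod 2) L] {W B : Submodule (ZMod 2) L} (hWB : W ≤ B)
    (hdim : Module.finrank (ZMod 2) B = Module.finrank (ZMod 2) W + 1) {u v : L} (hu : u ∈ B) (hv : v ∈ B)
    (huW : u ∉ W) (hvW : v ∉ W) : v + u ∈ W := by
  have hlt : W < W ⊔ Submodule.span (ZMod 2) {u} := by
    refine lt_of_le_of_ne le_sup_left fun h => huW ?_
    rw [h]
    exact Submodule.mem_sup_right (Submodule.mem_span_singleton_self u)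
  have hle : W ⊔ Submodule.span (ZMod 2) {u} ≤ B :=
    sup_le hWB ((Submodule.span_singleton_le_iff_mem u B).2 hu)
  have heq := Submodule.eq_of_le_of_finrank_le hle (by
    have := Submodule.finrank_lt_finrank_of_lt hlt
    omega)
  rw [← heq, Submodule.mem_sup] at hv
  obtain ⟨w, hw, _, hs, rfl⟩ := hv
  obtain ⟨a, rfl⟩ := Submodule.mem_span_singleton.1 hs
  rcases zmod_two_cases a with rfl | rfl
  · rw [zero_smul, add_zero] at hvW
    exact absurd hw hvW
  · rw [one_smul, add_assoc, CharTwo.add_self_eq_zero, add_zero]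
    exact hw

/-- The invariants of the fifteen three-dimensional subspaces of `⟨x, y, z, b⟩`. -/
theorem mem_keysOf_iff [FiniteDimensional (ZMod 2) L] {B : Submodule (ZMod 2) L}
    (hB : Module.finrank (ZMod 2) B = 4) {x y z b : L} (hx : x ∈ B) (hy : y ∈ B) (hz : z ∈ B)
    (hb : b ∈ B) (h : ∀ α β γ δ : ZMod 2, α • x + β • y + γ • z + δ • b = 0 →
      α = 0 ∧ β = 0 ∧ γ = 0 ∧ δ = 0) (k : L × L) :
    k ∈ keysOf B ↔ k = tripleKey x y z ∨ (∃ ε : ZMod 2, k = tripleKey x y (b + ε • z)) ∨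
      (∃ ε ε' : ZMod 2, k = tripleKey x (z + ε • y) (b + ε' • y)) ∨
      ∃ ε ε' ε'' : ZMod 2, k = tripleKey (y + ε • x) (z + ε' • x) (b + ε'' • x) := by
  have t1 : IsTriple x y z := isTriple_of_span fun α β γ h0 => by
    obtain ⟨h1, h2, h3, -⟩ := h α β γ 0 (by rw [← h0]; module)
    exact ⟨h1, h2, h3⟩
  have t2 : ∀ ε : ZMod 2, IsTriple x y (b + ε • z) := fun ε => isTriple_of_span fun α β γ h0 => by
    obtain ⟨h1, h2, -, h3⟩ := h α β (γ * ε) γ (by rw [← h0]; module)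
    exact ⟨h1, h2, h3⟩
  have t3 : ∀ ε ε' : ZMod 2, IsTriple x (z + ε • y) (b + ε' • y) := fun ε ε' =>
    isTriple_of_span fun α β γ h0 => by
      obtain ⟨h1, -, h2, h3⟩ := h α (β * ε + γ * ε') β γ (by rw [← h0]; module)
      exact ⟨h1, h2, h3⟩
  have t4 : ∀ ε ε' ε'' : ZMod 2, IsTriple (y + ε • x) (z + ε' • x) (b + ε'' • x) := fun ε ε' ε'' =>
    isTriple_of_span fun α β γ h0 => by
      obtain ⟨-, h1, h2, h3⟩ := h (α * ε + β * ε' + γ * ε'') α β γ (by rw [← h0]; module)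
      exact ⟨h1, h2, h3⟩
  constructor
  · rintro ⟨p, hp, q, hq, r, hr, ht, rfl⟩
    have hW := ht.finrank_span
    have hWB := span_triple_le hp hq hr
    have hroot : ∀ u, u ∈ Submodule.span (ZMod 2) (Set.range ![p, q, r]) →
        octicEval (tripleCoeff p q r) u = 0 := by
      intro u hu
      obtain ⟨g, rfl⟩ := Submodule.mem_span_range_iff_exists_fun _ |>.1 hu
      have hs : ∀ (a : ZMod 2) (v : L), octicEval (tripleCoeff p q r) v = 0 →
          octicEval (tripleCoeff p q r) (a • v) = 0 := by
        intro a v hv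
        rcases zmod_two_cases a with rfl | rfl
        · rw [zero_smul]; simp [octicEval]
        · rwa [one_smul]
      rw [Fin.sum_univ_three, octicEval_add, octicEval_add, hs _ (![p, q, r] 0) (octicEval_first p q r),
        hs _ (![p, q, r] 1) (octicEval_second p q r), hs _ (![p, q, r] 2) (octicEval_third p q r),
        add_zero, add_zero]
    have hkey : ∀ {p' q' r' : L}, IsTriple p' q' r' →
        p' ∈ Submodule.span (ZMod 2) (Set.range ![p, q, r]) →
        q' ∈ Submodule.span (ZMod 2) (Set.range ![p, q, r]) →
        r' ∈ Submodule.span (ZMod 2) (Set.range ![p, q, r]) → tripleKey p q r = tripleKey p' q' r' := by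
      intro p' q' r' ht' h1 h2 h3
      rw [tripleKey, ht'.coeff_eq (hroot _ h1) (hroot _ h2) (hroot _ h3)]
      rfl
    have hadd : ∀ {u v : L}, u ∈ B → v ∈ B → u ∉ Submodule.span (ZMod 2) (Set.range ![p, q, r]) →
        ∃ ε : ZMod 2, v + ε • u ∈ Submodule.span (ZMod 2) (Set.range ![p, q, r]) := by
      intro u v hu hv huW
      by_cases hvW : v ∈ Submodule.span (ZMod 2) (Set.range ![p, q, r])
      · exact ⟨0, by rwa [zero_smul, add_zero]⟩
      · exact ⟨1, by rw [one_smul]; exact add_mem_of_not_mem hWB (by rw [hB, hW]) hu hv huW hvW⟩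
    by_cases hxW : x ∈ Submodule.span (ZMod 2) (Set.range ![p, q, r])
    · by_cases hyW : y ∈ Submodule.span (ZMod 2) (Set.range ![p, q, r])
      · by_cases hzW : z ∈ Submodule.span (ZMod 2) (Set.range ![p, q, r])
        · exact Or.inl (hkey t1 hxW hyW hzW)
        · obtain ⟨ε, hε⟩ := hadd hz hb hzW
          exact Or.inr (Or.inl ⟨ε, hkey (t2 ε) hxW hyW hε⟩)
      · obtain ⟨ε, hε⟩ := hadd hy hz hyW
        obtain ⟨ε', hε'⟩ := hadd hy hb hyW
        exact Or.inr (Or.inr (Or.inl ⟨ε, ε', hkey (t3 ε ε') hxW hε hε'⟩))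
    · obtain ⟨ε, hε⟩ := hadd hx hy hxW
      obtain ⟨ε', hε'⟩ := hadd hx hz hxW
      obtain ⟨ε'', hε''⟩ := hadd hx hb hxW
      exact Or.inr (Or.inr (Or.inr ⟨ε, ε', ε'', hkey (t4 ε ε' ε'') hε hε' hε''⟩))
  · have hm : ∀ {u v : L}, u ∈ B → v ∈ B → ∀ ε : ZMod 2, v + ε • u ∈ B := fun hu hv ε =>
      B.add_mem hv (B.smul_mem ε hu)
    rintro (rfl | ⟨ε, rfl⟩ | ⟨ε, ε', rfl⟩ | ⟨ε, ε', ε'', rfl⟩)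
    · exact ⟨_, hx, _, hy, _, hz, t1, rfl⟩
    · exact ⟨_, hx, _, hy, _, hm hz hb ε, t2 ε, rfl⟩
    · exact ⟨_, hx, _, hm hy hz ε, _, hm hy hb ε', t3 ε ε', rfl⟩
    · exact ⟨_, hm hx hy ε, _, hm hx hz ε', _, hm hx hb ε'', t4 ε ε' ε'', rfl⟩

end Module

end Triple

/-! ### The parameters `q = 2`, `t = 3`, `k = 4`, `n = 8` -/

/-- Logarithms in the field with `2 ^ 8` elements, to a base `x` with `x ^ 8 = x ^ 4 + x ^ 3 + x ^ 2 + 1`.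
The entry for zero is `510`. -/
def logTable28 : ℕ :=
  0x57960a0a8753d1ac74742b5cee674b555c4f6b8b0ea7a75859ea0b28a81529c5817cb2cb2d0f998bb58a18c0fb551553a29290ed426c7b1bc187f761242ec43b290f6b76c10c5a1f51104da47298e478844f174541455b4cacf230af9f8dc5925d0e9066b3d78952db447e371722440236ca4888113e2d170263ba654ae30c3f98a3176b7894670698d008c7bb00e0072ba9de67356395a84e159e42a0a4fa6cbcca1eae90afa2a0a0746b371f890c351ad8841e2011870832e04da4f15eb6d2c8f67251a0364408922105989530e27e8c1ba663122d7e06531c9c84d3c02534c95cbe44e6a3eb096a1d22a0824f06d23926351083c48e11799514053893010c87c1a5821c40bbd1a3407380c80425b1cd01b770cdbe036306864020c80401fe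

/-- The codes of the powers `x ^ i` for `i < 510`, continued by zeros. -/
def expTable28 : ℕ :=
  0x8e47add86c361b83cfe9fa7db0582c160b8bcbebfbf3f7f5f47a3d90482412098a45ac562b9bc3eff9f279b259a251a653a7dde070381c0e078dc86432198241ae57a5dc6e3795c46231964babdbe3fff1f67bb3d7e5fc7e3f91c663bfd1e673b7d5e472399249aa55a452299a4da8542a158442219e4fa9da6db85c2e1785cc663397c5ec763b93c7edf87c3e1f81ce67bdd068341a0d884422118643afd9e271b65ba3dfe1fe7fb1d66bbbd3e7fdf0783c1e0f89ca65bc5e2f99c261be5fa1de6fb9d269ba5da05028140a058c46239fc1ee77b5d46a35944a259c4e279dc06030180c06038fc9ea75b45a2d984c261387cde8743a1d80402010080402018e47add86c361b83cfe9fa7db0582c160b8bcbebfbf3f7f5f47a3d90482412098a45ac562b9bc3eff9f279b259a251a653a7dde070381c0e078dc86432198241ae57a5dc6e3795c46231964babdbe3fff1f67bb3d7e5fc7e3f91c663bfd1e673b7d5e472399249aa55a452299a4da8542a158442219e4fa9da6db85c2e1785cc663397c5ec763b93c7edf87c3e1f81ce67bdd068341a0d884422118643afd9e271b65ba3dfe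1fe7fb1d66bbbd3e7fdf0783c1e0f89ca65bc5e2f99c261be5fa1de6fb9d269ba5da05028140a058c46239fc1ee77b5d46a35944a259c4e279dc06030180c06038fc9ea75b45a2d984c261387cde8743a1d8040201008040201

/-- Offsets for the numbering of the invariants. -/
def offsetTable28 : ℕ :=
  0x968fd0e1a038040000000002c080044a080171a8974033942a113f04a3cec005003c08000206002040021da230020215c00000147800000004e7b08801a00800000000000320161558d0400006280122b60006c68326e80c3a000a4dc16010100146cb01878001a0000002035704dae0b02001b2c713828d42600001e803383f50a0b00000001a038021e023eb026ebf3a80018000f800ae00010003aa13c03c0008011c136d28389000000d81c92f5000022e5a97805a8816f90c0a82000000e8c2b000240040538029920000ee9e5ab3c040007a50f2f8a3800001885d727a000014c00503c02000001b80e24c800000010889269389d0000d604b37029f4070b0095ae546a10001089c74032b6380160000000849340001818820aa44002b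

/-- The codes of the invariants, in the order of their numbers. -/
def keyTable28 : ℕ :=
  0x21fb0dfa000000000000000000000000000000000000000000000000000000000000000000000000000000000000000000000000000000000000000000000000000000000000000000006b7f0000000000000000000000000fb800000000000000000000edbfae41daf04cdd407d54e816efd9a112546159f16b02dd19c064773a0f08369d9283eb2d55ef8348c75d90fddceec0a8966c8e5cdeea5425c14fdc41e298934e0b28506ee780979161a9b18544b375e5db8dcbe9473f07e80ebe0bbb86ebd8390c49d1b891c27e810e33ccff16467324a41fd295d51d441858b9ab60e117ad5f0a2c70e3979f88100a7493f2215b5358af8e33429b131b3b22271a6d907fb5ccae65df20dc826697fe2fed09ffe693476c34d0bf6e9945fedecdf5c94b79c3d8e973a0b6fc8fa6267b0492da8c911ec2490f4975f2215e54816b05fcf10d5ad55b4991738fdeee51f372f51cfc00d700d67df4c0eabf4d93fd14ecfafaf3fa1be3b1dba0f4b2f3539f37f4f3f39edff0f0b7f0ececd1b2faec9ce1a6cda4d043da4de7b5b30be686e5d6dc88c91cdb15e166d99bdbdddd92dd05d0dcd7b7da5a9645d60bd793d650d5cbc32f9cd0d27ed1c7d0367c06c88cc2dfc8dbcb9cb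fc8c17ba9c3c74b8677c311c3f0c267a705b545bee7b687b7f5a722b907bbd50c6fb71cb1b7b745b4b2b2f4ac66ac7eb286b105a4a0ac149e7cad5eab0cab1aa8a0a6969e7ca751947b86c3a4a7a0aca1758437a00a9dab9cdc99159c869bd29559940b98d7931b8058130a92558c92929b8da672c8876773ad827084727c03756f8715884d86dd8503705084975c4b42b164a77df07e7e7eac7c4d7b077bf472db791177db777267066f0b74ac72ec6f6f6fd0709665dc6a0e6d116b531536176a45a1677c673766035043551e59ab60225e3258445f0c5e0e5d1a5a1e51d11ecb4870505a14f540d250b2510c536737e14d454e934fc143074d924c074b8743d7452e45a146a42cdd444444703bad37553a941a153ff436b40b0c3c7b1ca7375039c12db503fb2f9032c334940ddc2ede195e2faf1bb1113c155927fc11e126df25d028c0127724e71c84228421502288079320c71fdd1da403861c90188c0f9e06e209ab155e15fa147d08d60b9c07db114410220c840cf30d0a0ae107440aec06d60077050a04c305d700d003920201010000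

/-- The logarithm of the element with the given code. -/
noncomputable def lg28 : ℕ → ℕ := entry 9 logTable28

/-- The code of the power `x ^ i`, and `0` for the exponents from `510` on, which come from a factor `0`. -/
noncomputable def exp28 : ℕ → ℕ := entry 8 expTable28

/-- The code of the pair of invariants with the given number. -/
noncomputable def keyEntry28 : ℕ → ℕ := entry 16 keyTable28

/-- Multiplication of codes. -/
noncomputable def mul28 (a b : ℕ) : ℕ := exp28 (Nat.add (lg28 a) (lg28 b))

/-- The code `256 u + v` of the pair `(u, v)` of the invariants of the triple `(x, y, z)`. -/
noncomputable def keyCode28 (x y z : ℕ) : ℕ :=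
  forceN (fun x2 => forceN (fun y2 => forceN (fun z2 => forceN (fun a => forceN (fun b =>
    forceN (fun d => forceN (fun c₀ =>
      Nat.add (Nat.mul 256 (exp28 (Nat.add (lg28 (Nat.xor (mul28 a a) d))
          (Nat.mod (Nat.mul 218 c₀) 255))))
        (exp28 (Nat.add (lg28 (Nat.xor (mul28 b b) (mul28 a d))) (Nat.mod (Nat.mul 72 c₀) 255))))
      (lg28 (mul28 b d)))
      (Nat.xor (mul28 z2 z2) (Nat.xor (mul28 a z2) (mul28 b z))))
      (mul28 (mul28 x y) (Nat.xor x y)))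
      (Nat.xor x2 (Nat.xor (mul28 x y) y2)))
      (mul28 z z)) (mul28 y y)) (mul28 x x)

/-- The number of the pair of invariants with code `k`. -/
noncomputable def keyIndex28 (k : ℕ) : ℕ :=
  Nat.mod (Nat.add (entry 9 offsetTable28 (Nat.div k 256)) (Nat.mod k 256)) 512

/-- The set consisting of the number of a pair of invariants. -/
noncomputable def keyBit28 (k : ℕ) : ℕ :=
  forceN (fun k => forceN (fun i => Bool.rec (motive := fun _ => ℕ) 0 (Nat.shiftLeft 1 i)
    (Nat.beq (keyEntry28 i) k)) (keyIndex28 k)) k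

/-- The set of the numbers of a list of pairs of invariants. -/
noncomputable def keyBits28 (l : List ℕ) : ℕ :=
  List.rec (motive := fun _ => ℕ) 0 (fun k _ m => Nat.lor (keyBit28 k) m) l

/-- The invariants of the fifteen three-dimensional subspaces of `⟨1, y, z, b⟩`. -/
noncomputable def keyList28 (y z b : ℕ) : List ℕ :=
  [keyCode28 1 y z, keyCode28 1 y b, keyCode28 1 y (Nat.xor b z),
    keyCode28 1 z b, keyCode28 1 z (Nat.xor b y),
    keyCode28 1 (Nat.xor z y) b, keyCode28 1 (Nat.xor z y) (Nat.xor b y),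
    keyCode28 y z b, keyCode28 y z (Nat.xor b 1),
    keyCode28 y (Nat.xor z 1) b, keyCode28 y (Nat.xor z 1) (Nat.xor b 1),
    keyCode28 (Nat.xor y 1) z b, keyCode28 (Nat.xor y 1) z (Nat.xor b 1),
    keyCode28 (Nat.xor y 1) (Nat.xor z 1) b, keyCode28 (Nat.xor y 1) (Nat.xor z 1) (Nat.xor b 1)]

/-- The set of the numbers of the invariants of the three-dimensional subspaces of `⟨1, y, z, b⟩`. -/
noncomputable def mask28 (y z b : ℕ) : ℕ := keyBits28 (keyList28 y z b)

/-- Inserts the bit zero at the position `s`. -/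
def insertBit (s c : ℕ) : ℕ :=
  Nat.add (Nat.mod c (Nat.pow 2 s)) (Nat.mul (Nat.pow 2 (Nat.succ s)) (Nat.div c (Nat.pow 2 s)))

/-- A row `r = 64 (256 y + z) + 8 s + t` stands for the subspace `⟨1, y, z⟩`, where `s` and `t` are the
positions of the leading bits of `y` and `z`. -/
noncomputable def loop28 (r : ℕ) (p : ℕ → Bool) : Bool :=
  forceB (fun y => forceB (fun z => allB 31 fun i => forceB p (mask28 y z
    (insertBit (Nat.mod r 8) (insertBit (Nat.mod (Nat.div r 8) 8) (Nat.mul 2 (Nat.succ i))))))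
    (Nat.mod (Nat.div r 64) 256)) (Nat.div r 16384)

/-- The set consisting of the number of the invariants of the subspace of a row. -/
noncomputable def rowBit28 (r : ℕ) : ℕ :=
  keyBit28 (keyCode28 1 (Nat.div r 16384) (Nat.mod (Nat.div r 64) 256))

/-- The subspaces through which blocks are considered. -/
def rows28 : List ℕ :=
  [43279, 33034, 44559, 46095, 39438, 45583, 37902, 41487, 48143, 37134, 33547, 33291, 40462, 35597,
    43535, 34060, 47631, 48655, 35085, 42767, 38158, 40206, 232477]

theorem coverSearch28 : coverSearch rowBit28 loop28 rows28 0 = true := by decide +kernel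

end QSteiner

namespace QSteiner

/-- Multiplication by `x` on codes, where `x ^ 8 = x ^ 4 + x ^ 3 + x ^ 2 + 1`. -/
def step28 (c : ℕ) : ℕ := Nat.xor (Nat.mul 2 (Nat.mod c 128)) (Nat.mul 29 (Nat.div c 128))

set_option maxRecDepth 10000 in
theorem walkB28 : walkB step28 lg28 255 1 0 = true := by decide +kernel

set_option maxRecDepth 10000 in
theorem expCheck28 : allB 510 (fun i => Nat.blt 0 (exp28 i) && Nat.blt (exp28 i) 256 &&
    Nat.beq (lg28 (exp28 i)) (Nat.mod i 255)) = true := by decide +kernel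

set_option maxRecDepth 10000 in
theorem expCheckZero28 : allB 511 (fun i => Nat.beq (exp28 (Nat.add 510 i)) 0) = true := by
  decide +kernel

set_option maxRecDepth 10000 in
theorem lgCheck28 : allB 255 (fun i => Nat.blt (lg28 (Nat.succ i)) 255) = true := by decide +kernel

theorem lgZero28 : lg28 0 = 510 := by decide +kernel

theorem evc_one (q : ℕ) (hq : 1 < q) {L : Type*} [CommRing L] (x : L) : evc q x 1 = 1 := by
  rw [evc_of_lt x hq hq, Nat.cast_one]

theorem isStep28 {R : Type*} [CommRing R] [CharP R 2] {x : R} (hx : x ^ 8 = ev x [1, 0, 1, 1, 1]) :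
    IsStep 2 8 x step28 := by
  intro c hc
  have hq : 1 < 2 := by norm_num
  have e : ∀ c : ℕ, evc 2 x c = (c % 2 : ℕ) + x * evc 2 x (c / 2) := evc_eq x hq
  have h29 : evc 2 x 29 = 1 + x ^ 2 + x ^ 3 + x ^ 4 := by
    rw [e, e, e, e, e]
    norm_num [evc_zero]
    ring
  have hc128 : evc 2 x c = evc 2 x (c % 128) + (c / 128 : ℕ) * x ^ 7 := by
    have h := evc_add_pow x hq (show c / 128 < 2 by omega) 7 (c % 128) (by omega)
    rw [← h]
    congr 1
    omega
  have hs : step28 c = (2 * (c % 128)) ^^^ (29 * (c / 128)) := rfl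
  have hlt : step28 c < 2 ^ 8 := by
    rw [hs]
    exact Nat.xor_lt_two_pow (by omega) (by omega)
  refine ⟨hlt, ?_⟩
  rw [hs, evc_xor, evc_mul x hq, hc128]
  simp only [ev] at hx
  have hcase : c / 128 = 0 ∨ c / 128 = 1 := by omega
  rcases hcase with h0 | h0 <;> rw [h0]
  · simp [evc_zero]
  · rw [mul_one, h29]
    push_cast at hx ⊢
    linear_combination -hx

attribute [local irreducible] lg28 exp28 keyEntry28 keyIndex28 keyCode28

theorem IsLogTable.evc_eq_zero_iff {L : Type*} [Field L] {x : L} {n : ℕ} {lg : ℕ → ℕ} (hn : n ≠ 0) (h : IsLogTable 2 n x lg) {c : ℕ}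
    (hc : c < 2 ^ n) : evc 2 x c = 0 ↔ c = 0 := by
  refine ⟨fun h0 => by_contra fun hc0 => ?_, fun h0 => by rw [h0, evc_zero]⟩
  rw [← h.pow_lg c (Nat.pos_of_ne_zero hc0) hc] at h0
  exact pow_ne_zero _ (h.ne_zero (Nat.one_lt_pow hn one_lt_two)) h0

section Codes

variable {L : Type*} [Field L] [CharP L 2] {x : L}

theorem IsLogTable.evc_exp28 (h : IsLogTable 2 8 x lg28) {i : ℕ} (hi : i < 510) :
    evc 2 x (exp28 i) = x ^ i := by
  have h1 := allB_spec expCheck28 hi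
  simp only [Bool.and_eq_true, Nat.blt_eq] at h1
  obtain ⟨⟨h1, h2⟩, h3⟩ := h1
  have h3 : lg28 (exp28 i) = i % 255 := Nat.eq_of_beq_eq_true h3
  rw [← h.pow_lg _ h1 (by omega), h3]
  rw [← pow_mod_orderOf x i, h.orderOf_eq]
  norm_num

theorem exp28_eq_zero {i : ℕ} (hi : 510 ≤ i) (hi' : i ≤ 1020) : exp28 i = 0 := by
  have := Nat.eq_of_beq_eq_true (allB_spec expCheckZero28 (k := i - 510) (by omega))
  rwa [Nat.add_eq, Nat.add_sub_of_le hi] at this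

theorem exp28_lt {i : ℕ} (hi : i ≤ 1020) : exp28 i < 256 := by
  rcases lt_or_ge i 510 with h | h
  · have h1 := allB_spec expCheck28 h
    simp only [Bool.and_eq_true, Nat.blt_eq] at h1
    exact h1.1.2
  · rw [exp28_eq_zero h hi]
    norm_num

theorem lg28_lt {c : ℕ} (hc0 : 0 < c) (hc : c < 256) : lg28 c < 255 := by
  have h1 := allB_spec lgCheck28 (k := c - 1) (by omega)
  rw [Nat.blt_eq, Nat.succ_eq_add_one, Nat.sub_add_cancel hc0] at h1
  exact h1

theorem lg28_le {c : ℕ} (hc : c < 256) : lg28 c ≤ 510 := by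
  rcases Nat.eq_zero_or_pos c with rfl | h
  · exact lgZero28.le
  · have := lg28_lt h hc
    omega

theorem mul28_lt {a b : ℕ} (ha : a < 256) (hb : b < 256) : mul28 a b < 256 := by
  have h1 := lg28_le ha
  have h2 := lg28_le hb
  exact exp28_lt (show lg28 a + lg28 b ≤ 1020 by omega)

/-- Multiplication of a code by a power of the generator. -/
theorem IsLogTable.evc_exp28_add (h : IsLogTable 2 8 x lg28) {a i : ℕ} (ha : a < 256) (hi : i < 255) :
    evc 2 x (exp28 (lg28 a + i)) = evc 2 x a * x ^ i := by
  rcases Nat.eq_zero_or_pos a with rfl | ha0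
  · rw [lgZero28, exp28_eq_zero (by omega) (by omega), evc_zero, zero_mul]
  · have := lg28_lt ha0 ha
    rw [h.evc_exp28 (by omega), pow_add, h.pow_lg a ha0 ha]

theorem IsLogTable.evc_mul28 (h : IsLogTable 2 8 x lg28) {a b : ℕ} (ha : a < 256) (hb : b < 256) :
    evc 2 x (mul28 a b) = evc 2 x a * evc 2 x b := by
  have e : mul28 a b = exp28 (lg28 a + lg28 b) := rfl
  rcases Nat.eq_zero_or_pos b with rfl | hb0
  · have := lg28_le ha
    rw [e, lgZero28, exp28_eq_zero (by omega) (by omega), evc_zero, mul_zero]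
  · rw [e, h.evc_exp28_add ha (lg28_lt hb0 hb), h.pow_lg b hb0 hb]

theorem IsLogTable.evc_inj {n : ℕ} {lg : ℕ → ℕ} (hn : n ≠ 0) (h : IsLogTable 2 n x lg) {a b : ℕ}
    (ha : a < 2 ^ n) (hb : b < 2 ^ n) (hab : evc 2 x a = evc 2 x b) : a = b := by
  have h1 : evc 2 x (a ^^^ b) = 0 := by rw [evc_xor, hab, CharTwo.add_self_eq_zero]
  rw [h.evc_eq_zero_iff hn (Nat.xor_lt_two_pow ha hb), Nat.xor_eq_zero_iff] at h1
  exact h1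

/-- The pair of field elements with code `k`. -/
def evPair (x : L) (k : ℕ) : L × L := (evc 2 x (k / 256), evc 2 x (k % 256))

/-- The code `keyCode28` encodes the invariants of the triple; the exponents `218` and `72` of the powers are
those of `tripleKey`. -/
theorem IsLogTable.evPair_keyCode28 (h : IsLogTable 2 8 x lg28) {a b c : ℕ} (ha : a < 256)
    (hb : b < 256) (hc : c < 256) (ht : IsTriple (evc 2 x a) (evc 2 x b) (evc 2 x c)) :
    evPair x (keyCode28 a b c) = tripleKey (evc 2 x a) (evc 2 x b) (evc 2 x c) ∧
      keyCode28 a b c < 2 ^ 16 := by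
  have hx : ∀ {a b : ℕ}, a < 256 → b < 256 → a ^^^ b < 256 := fun ha hb =>
    Nat.xor_lt_two_pow (n := 8) ha hb
  have e : ∀ {a b : ℕ}, a < 256 → b < 256 → evc 2 x (mul28 a b) = evc 2 x a * evc 2 x b :=
    h.evc_mul28
  obtain ⟨A, hA⟩ : ∃ A, A = mul28 a a ^^^ (mul28 a b ^^^ mul28 b b) := ⟨_, rfl⟩
  obtain ⟨B, hB⟩ : ∃ B, B = mul28 (mul28 a b) (a ^^^ b) := ⟨_, rfl⟩
  obtain ⟨D, hD⟩ : ∃ D, D = mul28 (mul28 c c) (mul28 c c) ^^^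
    (mul28 A (mul28 c c) ^^^ mul28 B c) := ⟨_, rfl⟩
  have hk : keyCode28 a b c =
      256 * exp28 (lg28 (mul28 A A ^^^ D) + 218 * lg28 (mul28 B D) % 255) +
        exp28 (lg28 (mul28 B B ^^^ mul28 A D) + 72 * lg28 (mul28 B D) % 255) := by
    unfold keyCode28
    simp only [forceN_eq]
    rw [hD, hA, hB]
    rfl
  have lab := mul28_lt ha hb
  have lA : A < 256 := hA ▸ hx (mul28_lt ha ha) (hx lab (mul28_lt hb hb))
  have lB : B < 256 := hB ▸ mul28_lt lab (hx ha hb)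
  have lcc := mul28_lt hc hc
  have lD : D < 256 := hD ▸ hx (mul28_lt lcc lcc) (hx (mul28_lt lA lcc) (mul28_lt lB hc))
  have eA : evc 2 x A = planeA (evc 2 x a) (evc 2 x b) := by
    rw [hA, evc_xor, evc_xor, e ha ha, e ha hb, e hb hb, planeA]
    ring
  have eB : evc 2 x B = planeB (evc 2 x a) (evc 2 x b) := by
    rw [hB, e lab (hx ha hb), evc_xor, e ha hb, planeB]
  have eD : evc 2 x D = planeEval (evc 2 x a) (evc 2 x b) (evc 2 x c) := by
    rw [hD, evc_xor, evc_xor, e lcc lcc, e hc hc, e lA lcc, e hc hc, e lB hc, eA, eB, planeEval]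
    ring
  have lBD := mul28_lt lB lD
  have hBD : 0 < mul28 B D := Nat.pos_of_ne_zero fun h0 => ht (by
    have := e lB lD
    rw [h0, evc_zero, eB, eD] at this
    exact this.symm)
  have p : ∀ m, x ^ (m * lg28 (mul28 B D) % 255) = (evc 2 x B * evc 2 x D) ^ m := by
    intro m
    rw [← e lB lD, ← h.pow_lg _ hBD lBD, ← pow_mul, ← pow_mod_orderOf x (lg28 (mul28 B D) * m),
      h.orderOf_eq, mul_comm]
    norm_num
  have lAA := hx (mul28_lt lA lA) lD
  have lBB := hx (mul28_lt lB lB) (mul28_lt lA lD)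
  have hm : ∀ m, m % 255 < 255 := fun m => Nat.mod_lt _ (by norm_num)
  have bound : ∀ {u m : ℕ}, u < 256 → exp28 (lg28 u + m % 255) < 256 := fun {u m} hu =>
    exp28_lt (by have := lg28_le hu; have := hm m; omega)
  have b1 := bound (m := 218 * lg28 (mul28 B D)) lAA
  have b2 := bound (m := 72 * lg28 (mul28 B D)) lBB
  refine ⟨?_, by rw [hk]; omega⟩
  rw [evPair, hk, Nat.mul_add_div (by norm_num), Nat.div_eq_of_lt b2, add_zero, Nat.mul_add_mod,
    Nat.mod_eq_of_lt b2, h.evc_exp28_add lAA (hm _), h.evc_exp28_add lBB (hm _), p, p, evc_xor, evc_xor,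
    e lA lA, e lB lB, e lA lD, eA, eB, eD]
  simp only [tripleKey, tripleCoeff, Prod.mk.injEq]
  exact ⟨by ring, by ring⟩

theorem testBit_keyBit28 (k i : ℕ) :
    (keyBit28 k).testBit i = true ↔ keyIndex28 k = i ∧ keyEntry28 i = k := by
  have e : keyBit28 k = (Bool.rec (motive := fun _ => ℕ) 0 (1 <<< keyIndex28 k)
      (Nat.beq (keyEntry28 (keyIndex28 k)) k) : ℕ) := by
    unfold keyBit28
    rw [forceN_eq, forceN_eq]
    rfl
  rw [e]
  cases hb : Nat.beq (keyEntry28 (keyIndex28 k)) k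
  · simp only [Nat.zero_testBit]
    refine ⟨fun h => absurd h (by decide), ?_⟩
    rintro ⟨rfl, h⟩
    rw [h, Nat.beq_refl] at hb
    exact absurd hb (by decide)
  · have := Nat.eq_of_beq_eq_true hb
    simp only [Nat.one_shiftLeft, Nat.testBit_two_pow, decide_eq_true_eq]
    constructor
    · rintro rfl
      exact ⟨rfl, this⟩
    · exact fun h => h.1

theorem testBit_keyBits28 (l : List ℕ) (i : ℕ) :
    (keyBits28 l).testBit i = true ↔ keyIndex28 (keyEntry28 i) = i ∧ keyEntry28 i ∈ l := by
  induction l with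
  | nil => simp [keyBits28]
  | cons k l ih =>
    have e : keyBits28 (k :: l) = keyBit28 k ||| keyBits28 l := rfl
    rw [e, Nat.testBit_or, Bool.or_eq_true, ih, testBit_keyBit28, List.mem_cons]
    constructor
    · rintro (⟨h1, h2⟩ | ⟨h1, h2⟩)
      · exact ⟨h2 ▸ h1, Or.inl h2⟩
      · exact ⟨h1, Or.inr h2⟩
    · rintro ⟨h1, h2 | h2⟩
      · exact Or.inl ⟨h2 ▸ h1, h2⟩
      · exact Or.inr ⟨h1, h2⟩

end Codes

theorem exists_zmod_two {P : ZMod 2 → Prop} : (∃ a, P a) ↔ P 0 ∨ P 1 := by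
  constructor
  · rintro ⟨a, ha⟩
    rcases zmod_two_cases a with rfl | rfl
    · exact Or.inl ha
    · exact Or.inr ha
  · rintro (h | h) <;> exact ⟨_, h⟩

section Rows

variable {L : Type*} [Field L] [Algebra (ZMod 2) L] [CharP L 2] {x : L}

theorem mem_keyList28 [FiniteDimensional (ZMod 2) L] (h : IsLogTable 2 8 x lg28)
    {B : Submodule (ZMod 2) L} (hB : Module.finrank (ZMod 2) B = 4) {y z b : ℕ} (hy : y < 256)
    (hz : z < 256) (hb : b < 256) (h1B : (1 : L) ∈ B) (hyB : evc 2 x y ∈ B) (hzB : evc 2 x z ∈ B)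
    (hbB : evc 2 x b ∈ B) (hind : ∀ α β γ δ : ZMod 2,
      α • (1 : L) + β • evc 2 x y + γ • evc 2 x z + δ • evc 2 x b = 0 →
        α = 0 ∧ β = 0 ∧ γ = 0 ∧ δ = 0) {k : ℕ} (hk : k < 2 ^ 16) :
    k ∈ keyList28 y z b ↔ evPair x k ∈ keysOf B := by
  have hx : ∀ {a b : ℕ}, a < 256 → b < 256 → a ^^^ b < 256 := fun ha hb =>
    Nat.xor_lt_two_pow (n := 8) ha hb
  have l1 : 1 < 256 := by norm_num
  have hinj : ∀ {k' : ℕ}, k' < 2 ^ 16 → evPair x k = evPair x k' → k = k' := by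
    intro k' hk' he
    rw [evPair, evPair, Prod.mk.injEq] at he
    have e1 := h.evc_inj (by norm_num) (by omega) (by omega) he.1
    have e2 := h.evc_inj (by norm_num) (by omega) (by omega) he.2
    omega
  have key : ∀ {a b c : ℕ}, a < 256 → b < 256 → c < 256 → IsTriple (evc 2 x a) (evc 2 x b) (evc 2 x c) →
      (k = keyCode28 a b c ↔ evPair x k = tripleKey (evc 2 x a) (evc 2 x b) (evc 2 x c)) := by
    intro a b c ha hb hc ht
    obtain ⟨h1, h2⟩ := h.evPair_keyCode28 ha hb hc ht
    rw [← h1]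
    exact ⟨fun h => by rw [h], hinj h2⟩
  have tr : ∀ {u v w : L} {a b c : ℕ}, evc 2 x a = u → evc 2 x b = v → evc 2 x c = w →
      (∀ α β γ : ZMod 2, α • u + β • v + γ • w = 0 → α = 0 ∧ β = 0 ∧ γ = 0) →
      IsTriple (evc 2 x a) (evc 2 x b) (evc 2 x c) := by
    rintro u v w a b c rfl rfl rfl h
    exact isTriple_of_span h
  have t1 : ∀ α β γ : ZMod 2, α • (1 : L) + β • evc 2 x y + γ • evc 2 x z = 0 →
      α = 0 ∧ β = 0 ∧ γ = 0 := fun α β γ h0 => by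
    obtain ⟨h1, h2, h3, -⟩ := hind α β γ 0 (by rw [← h0]; module)
    exact ⟨h1, h2, h3⟩
  have t2 : ∀ ε α β γ : ZMod 2, α • (1 : L) + β • evc 2 x y + γ • (evc 2 x b + ε • evc 2 x z) = 0 →
      α = 0 ∧ β = 0 ∧ γ = 0 := fun ε α β γ h0 => by
    obtain ⟨h1, h2, -, h3⟩ := hind α β (γ * ε) γ (by rw [← h0]; module)
    exact ⟨h1, h2, h3⟩
  have t3 : ∀ ε ε' α β γ : ZMod 2, α • (1 : L) + β • (evc 2 x z + ε • evc 2 x y) +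
      γ • (evc 2 x b + ε' • evc 2 x y) = 0 → α = 0 ∧ β = 0 ∧ γ = 0 := fun ε ε' α β γ h0 => by
    obtain ⟨h1, -, h2, h3⟩ := hind α (β * ε + γ * ε') β γ (by rw [← h0]; module)
    exact ⟨h1, h2, h3⟩
  have t4 : ∀ ε ε' ε'' α β γ : ZMod 2, α • (evc 2 x y + ε • (1 : L)) +
      β • (evc 2 x z + ε' • (1 : L)) + γ • (evc 2 x b + ε'' • (1 : L)) = 0 →
      α = 0 ∧ β = 0 ∧ γ = 0 := fun ε ε' ε'' α β γ h0 => by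
    obtain ⟨-, h1, h2, h3⟩ := hind (α * ε + β * ε' + γ * ε'') α β γ (by rw [← h0]; module)
    exact ⟨h1, h2, h3⟩
  have c1 : evc 2 x 1 = 1 := evc_one 2 one_lt_two x
  have cx : ∀ a b : ℕ, evc 2 x (a ^^^ b) = evc 2 x a + (1 : ZMod 2) • evc 2 x b := fun a b => by
    rw [evc_xor, one_smul]
  have cx1 : ∀ a : ℕ, evc 2 x (a ^^^ 1) = evc 2 x a + (1 : ZMod 2) • (1 : L) := fun a => by rw [cx, c1]
  have c0 : ∀ (a : ℕ) (u : L), evc 2 x a = evc 2 x a + (0 : ZMod 2) • u := fun a u => by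
    rw [zero_smul, add_zero]
  rw [mem_keysOf_iff hB h1B hyB hzB hbB hind]
  simp only [keyList28, List.mem_cons, List.not_mem_nil, or_false, exists_zmod_two, or_assoc]
  refine or_congr ?_ <| or_congr ?_ <| or_congr ?_ <| or_congr ?_ <| or_congr ?_ <| or_congr ?_ <|
    or_congr ?_ <| or_congr ?_ <| or_congr ?_ <| or_congr ?_ <| or_congr ?_ <| or_congr ?_ <|
    or_congr ?_ <| or_congr ?_ ?_
  · rw [key l1 hy hz (tr c1 rfl rfl t1), c1]
  · rw [key l1 hy hb (tr c1 rfl (c0 _ _) (t2 0)), c1, ← c0]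
  · rw [Nat.xor_eq, key l1 hy (hx hb hz) (tr c1 rfl (cx _ _) (t2 1)), c1, cx]
  · rw [key l1 hz hb (tr c1 (c0 _ _) (c0 _ _) (t3 0 0)), c1, ← c0, ← c0]
  · rw [Nat.xor_eq, key l1 hz (hx hb hy) (tr c1 (c0 _ _) (cx _ _) (t3 0 1)), c1, ← c0, cx]
  · rw [Nat.xor_eq, key l1 (hx hz hy) hb (tr c1 (cx _ _) (c0 _ _) (t3 1 0)), c1, cx, ← c0]
  · rw [Nat.xor_eq, Nat.xor_eq, key l1 (hx hz hy) (hx hb hy) (tr c1 (cx _ _) (cx _ _) (t3 1 1)), c1,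
      cx, cx]
  · rw [key hy hz hb (tr (c0 _ _) (c0 _ _) (c0 _ _) (t4 0 0 0)), ← c0, ← c0, ← c0]
  · rw [Nat.xor_eq, key hy hz (hx hb l1) (tr (c0 _ _) (c0 _ _) (cx1 _) (t4 0 0 1)), ← c0, ← c0, cx1]
  · rw [Nat.xor_eq, key hy (hx hz l1) hb (tr (c0 _ _) (cx1 _) (c0 _ _) (t4 0 1 0)), ← c0, ← c0, cx1]
  · rw [Nat.xor_eq, Nat.xor_eq, key hy (hx hz l1) (hx hb l1) (tr (c0 _ _) (cx1 _) (cx1 _) (t4 0 1 1)),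
      ← c0, cx1, cx1]
  · rw [Nat.xor_eq, key (hx hy l1) hz hb (tr (cx1 _) (c0 _ _) (c0 _ _) (t4 1 0 0)), ← c0, ← c0, cx1]
  · rw [Nat.xor_eq, Nat.xor_eq, key (hx hy l1) hz (hx hb l1) (tr (cx1 _) (c0 _ _) (cx1 _) (t4 1 0 1)),
      ← c0, cx1, cx1]
  · rw [Nat.xor_eq, Nat.xor_eq, key (hx hy l1) (hx hz l1) hb (tr (cx1 _) (cx1 _) (c0 _ _) (t4 1 1 0)),
      ← c0, cx1, cx1]
  · rw [Nat.xor_eq, Nat.xor_eq, Nat.xor_eq, key (hx hy l1) (hx hz l1) (hx hb l1)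
      (tr (cx1 _) (cx1 _) (cx1 _) (t4 1 1 1)), cx1, cx1, cx1]

/-- The validity of a row. -/
def rowCheck28 (r : ℕ) : Bool :=
  let y := r / 16384
  let z := r / 64 % 256
  let s := r / 8 % 8
  let t := r % 8
  y < 256 && 0 < s && s < t && y.testBit s && !y.testBit t && z.testBit t

theorem rowCheck28_rows : rows28.all rowCheck28 = true := by decide +kernel

theorem rowBit28_rows : rows28.all (fun r => Nat.blt 0 (rowBit28 r)) = true := by decide +kernel

theorem insertCheck28 : (List.range 8).all (fun s => (List.range 8).all fun t => (List.range 256).all fun b =>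
    s == 0 || t ≤ s || b == 0 || b.testBit 0 || b.testBit s || b.testBit t ||
      (List.range 31).any fun i => insertBit t (insertBit s (2 * (i + 1))) == b) = true := by
  decide +kernel

end Rows

end QSteiner

namespace QSteiner

attribute [local irreducible] lg28 exp28 keyEntry28 keyIndex28 keyCode28

section Elimination

variable {L : Type*} [Field L] [Algebra (ZMod 2) L] [CharP L 2] {x : L}

theorem xor_mem {B : Submodule (ZMod 2) L} {a b : ℕ} (ha : evc 2 x a ∈ B) (hb : evc 2 x b ∈ B) :
    evc 2 x (a ^^^ b) ∈ B := by
  rw [evc_xor]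
  exact B.add_mem ha hb

/-- A bit of the code of an element can be cleared by adding a code that has this bit. -/
theorem exists_code_clear_bit {n : ℕ} {W : Submodule (ZMod 2) L} {c d i : ℕ} (hc : c < 2 ^ n)
    (hd : d < 2 ^ n) (hi : d.testBit i = true) (hdW : evc 2 x d ∈ W) :
    ∃ c' < 2 ^ n, evc 2 x c' - evc 2 x c ∈ W ∧ c'.testBit i = false ∧
      ∀ j, d.testBit j = false → c'.testBit j = c.testBit j := by
  cases hci : c.testBit i
  · exact ⟨c, hc, by rw [sub_self]; exact W.zero_mem, hci, fun _ _ => rfl⟩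
  · refine ⟨c ^^^ d, Nat.xor_lt_two_pow hc hd, ?_, by rw [Nat.testBit_xor, hci, hi]; rfl, fun j hj => ?_⟩
    · rwa [evc_xor, add_sub_cancel_left]
    · rw [Nat.testBit_xor, hj, Bool.xor_false]

end Elimination

section Rows

variable {L : Type*} [Field L] [Algebra (ZMod 2) L] [CharP L 2] {x : L}

/-- A block through a subspace that belongs to the rows is a candidate in the search for this row. -/
theorem exists_mask28 [FiniteDimensional (ZMod 2) L] (h : IsLogTable 2 8 x lg28)
    {S : Set (Submodule (ZMod 2) L)} (hS : IsDesign 3 4 1 S) {r : ℕ} (hr : r ∈ rows28) :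
    ∃ M, ∃ B ∈ S, (∀ i, M.testBit i = true ↔
        keyIndex28 (keyEntry28 i) = i ∧ evPair x (keyEntry28 i) ∈ keysOf B) ∧
      M &&& rowBit28 r ≠ 0 ∧ ∀ p : ℕ → Bool, loop28 r p = true → p M = true := by
  have hrow := List.all_eq_true.1 rowCheck28_rows r hr
  have hbit : 0 < rowBit28 r := Nat.blt_eq ▸ List.all_eq_true.1 rowBit28_rows r hr
  have hbit' : rowBit28 r = keyBit28 (keyCode28 1 (r / 16384) (r / 64 % 256)) := rfl
  rw [hbit'] at hbit ⊢
  have hloop : ∀ p : ℕ → Bool, loop28 r p = true → ∀ i < 31,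
      p (mask28 (r / 16384) (r / 64 % 256) (insertBit (r % 8) (insertBit (r / 8 % 8) (2 * (i + 1))))) =
        true := by
    intro p hp i hi
    unfold loop28 at hp
    rw [forceB_eq, forceB_eq] at hp
    have := allB_spec hp hi
    rwa [forceB_eq] at this
  simp only [rowCheck28, Bool.and_eq_true, decide_eq_true_eq, Bool.not_eq_true'] at hrow
  have hz : r / 64 % 256 < 256 := Nat.mod_lt _ (by norm_num)
  have hs : r / 8 % 8 < 8 := Nat.mod_lt _ (by norm_num)
  have ht : r % 8 < 8 := Nat.mod_lt _ (by norm_num)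
  generalize r / 16384 = y at *
  generalize r / 64 % 256 = z at *
  generalize r / 8 % 8 = s at *
  generalize r % 8 = t at *
  obtain ⟨⟨⟨⟨⟨hy, hs0⟩, hst⟩, hys⟩, hyt⟩, hzt⟩ := hrow
  have c1 : evc 2 x 1 = 1 := evc_one 2 one_lt_two x
  have hone : ∀ {i}, 0 < i → (1 : ℕ).testBit i = false := fun {i} hi => by
    rw [Nat.testBit_one_eq_true_iff_self_eq_zero.not.2 (by omega) |> Bool.eq_false_iff.2]
  have hx : ∀ {a b : ℕ}, a < 256 → b < 256 → a ^^^ b < 256 := fun ha hb =>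
    Nat.xor_lt_two_pow (n := 8) ha hb
  have hne : ∀ {a i : ℕ}, a < 256 → a.testBit i = true → evc 2 x a ≠ 0 := by
    intro a i ha hi h0
    rw [h.evc_eq_zero_iff (by norm_num) ha] at h0
    rw [h0, Nat.zero_testBit] at hi
    exact absurd hi (by decide)
  have l1 : 1 < 256 := by norm_num
  -- the three codes are in echelon form
  have hT : IsTriple 1 (evc 2 x y) (evc 2 x z) := by
    rw [isTriple_iff, ← c1, ← evc_xor, ← evc_xor, ← evc_xor, ← evc_xor]
    refine ⟨⟨hne l1 (i := 0) rfl, hne hy hys, hne (hx l1 hy) (i := s) ?_⟩, hne hz hzt,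
      hne (hx hz l1) (i := t) ?_, hne (hx hz hy) (i := t) ?_, hne (hx hz (hx l1 hy)) (i := t) ?_⟩ <;>
    simp only [Nat.testBit_xor, hone hs0, hone (hs0.trans hst), hys, hyt, hzt] <;> rfl
  obtain ⟨B, hB, hTB⟩ := hS.exists_block hT.finrank_span
  have h1B : (1 : L) ∈ B := hTB (Submodule.subset_span ⟨0, rfl⟩)
  have hyB : evc 2 x y ∈ B := hTB (Submodule.subset_span ⟨1, rfl⟩)
  have hzB : evc 2 x z ∈ B := hTB (Submodule.subset_span ⟨2, rfl⟩)
  obtain ⟨W, hW⟩ : ∃ W, W = Submodule.span (ZMod 2) (Set.range ![1, evc 2 x y, evc 2 x z]) := ⟨_, rfl⟩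
  have h1W : evc 2 x 1 ∈ W := by rw [c1, hW]; exact Submodule.subset_span ⟨0, rfl⟩
  have hyW : evc 2 x y ∈ W := by rw [hW]; exact Submodule.subset_span ⟨1, rfl⟩
  have hzW : evc 2 x z ∈ W := by rw [hW]; exact Submodule.subset_span ⟨2, rfl⟩
  obtain ⟨w, hwB, hwW⟩ : ∃ w ∈ B, w ∉ W := by
    by_contra hcon
    push Not at hcon
    have h2 := Submodule.finrank_mono (show B ≤ W from hcon)
    rw [hS.1 B hB, hW, hT.finrank_span] at h2
    omega
  obtain ⟨c, hc, rfl⟩ := h.exists_code w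
  obtain ⟨c₁, hc₁, hd₁, b₁, -⟩ := exists_code_clear_bit (x := x) hc hz hzt hzW
  obtain ⟨c₂, hc₂, hd₂, b₂, b₂'⟩ := exists_code_clear_bit (x := x) hc₁ hy hys hyW
  obtain ⟨b, hb, hd₃, b₃, b₃'⟩ := exists_code_clear_bit (x := x) (i := 0) hc₂ l1 rfl h1W
  have hbt : b.testBit t = false := by rw [b₃' t (hone (hs0.trans hst)), b₂' t hyt, b₁]
  have hbs : b.testBit s = false := by rw [b₃' s (hone hs0), b₂]
  have hdW : evc 2 x b - evc 2 x c ∈ W := by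
    have := W.add_mem (W.add_mem hd₃ hd₂) hd₁
    rwa [sub_add_sub_cancel, sub_add_sub_cancel] at this
  have hbW : evc 2 x b ∉ W := fun hb => hwW (by
    have := W.sub_mem hb hdW
    rwa [sub_sub_cancel] at this)
  have hbB : evc 2 x b ∈ B := by
    have := B.add_mem (hTB (hW ▸ hdW)) hwB
    rwa [sub_add_cancel] at this
  have hb0 : b ≠ 0 := by
    rintro rfl
    exact hbW (by rw [evc_zero]; exact W.zero_mem)
  obtain ⟨i, hi, hib⟩ : ∃ i < 31, insertBit t (insertBit s (2 * (i + 1))) = b := by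
    have h1 := List.all_eq_true.1 (List.all_eq_true.1 (List.all_eq_true.1 insertCheck28 s
      (List.mem_range.2 hs)) t (List.mem_range.2 ht)) b (List.mem_range.2 hb)
    simp only [b₃, hbs, hbt, Bool.or_false, Bool.or_eq_true, beq_iff_eq, decide_eq_true_eq, hb0,
      List.any_eq_true, List.mem_range] at h1
    exact h1.resolve_left fun h1 => by simp at h1; omega
  have hli := hT.linearIndependent
  rw [Fintype.linearIndependent_iff] at hli
  have hind : ∀ α β γ δ : ZMod 2, α • (1 : L) + β • evc 2 x y + γ • evc 2 x z + δ • evc 2 x b = 0 →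
      α = 0 ∧ β = 0 ∧ γ = 0 ∧ δ = 0 := by
    intro α β γ δ h0
    rcases zmod_two_cases δ with rfl | rfl
    · have := hli ![α, β, γ] (by
        rw [Fin.sum_univ_three, ← h0, zero_smul, add_zero]
        rfl)
      exact ⟨this 0, this 1, this 2, rfl⟩
    · rw [one_smul] at h0
      refine absurd ?_ hbW
      rw [eq_neg_of_add_eq_zero_right h0]
      rw [c1] at h1W
      exact W.neg_mem (W.add_mem (W.add_mem (W.smul_mem _ h1W) (W.smul_mem _ hyW)) (W.smul_mem _ hzW))
  refine ⟨mask28 y z b, B, hB, fun i => ?_, ?_, fun p hp => hib ▸ hloop p hp i hi⟩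
  · have hlt : keyEntry28 i < 2 ^ 16 := by
      unfold keyEntry28
      exact Nat.mod_lt _ (by norm_num)
    rw [mask28, testBit_keyBits28, mem_keyList28 h (hS.1 B hB) hy hz hb h1B hyB hzB hbB hind hlt]
  · obtain ⟨j, hj⟩ := Nat.exists_testBit_of_ne_zero hbit.ne'
    intro h0
    have h2 := congrArg (Nat.testBit · j) h0
    have h3 : (mask28 y z b).testBit j = true := by
      rw [mask28, testBit_keyBits28]
      obtain ⟨e1, e2⟩ := (testBit_keyBit28 _ _).1 hj
      rw [e2]
      exact ⟨e1, List.mem_cons_self⟩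
    simp only [Nat.testBit_and, hj, h3, Nat.zero_testBit, Bool.and_self] at h2
    exact absurd h2 (by decide)

end Rows

theorem not_admits_2_3_4_8 (C : Subgroup (GLin 8 2)) (hC : IsSingerSubgroup C) :
    ¬ Admits 2 3 4 8 C := by
  intro hA
  obtain ⟨L, _, _, hL, S, hS, hscale, -⟩ := exists_field_design (by norm_num) hC le_rfl hA
  have hch : CharP L 2 := charP_of_injective_algebraMap' (ZMod 2) 2
  have hfin : Finite L := Nat.finite_of_card_ne_zero (by rw [hL]; norm_num)
  have hfl : Module.Finite (ZMod 2) L := Module.Finite.of_finite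
  obtain ⟨x, hx⟩ := exists_root_of_card (q := 2) hL (by norm_num) (m := 8) (by norm_num)
    (r := [1, 0, 1, 1, 1]) (by simp) fun R _ _ x h =>
      (isStep28 h).pow_card (by norm_num) (by norm_num) walkB28
  have hx0 : x ≠ 0 := by
    rintro rfl
    simp [ev] at hx
  have hlog := (isStep28 hx).isLogTable hL (by norm_num) hx0 walkB28
  have h255 : ∀ u : L, u ≠ 0 → u ^ 255 = 1 := by
    intro u hu
    obtain ⟨c, -, -, -, rfl⟩ := hlog.exists_pow hu
    rw [← pow_mul, mul_comm, pow_mul, show 255 = orderOf x from hlog.orderOf_eq.symm,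
      pow_orderOf_eq_one, one_pow]
  choose! f B hB hf hbit hloop using fun r (hr : r ∈ rows28) => exists_mask28 hlog hS hr
  have hsound := coverSearch_sound (rowBit := rowBit28) (loop := loop28) (f := f) rows28 hbit hloop
    (fun a ha b hb hab => ?_) 0 (fun a _ _ => by rw [Nat.and_zero])
  · rw [coverSearch28] at hsound
    exact absurd hsound (by decide)
  · obtain ⟨c, hca, hcb⟩ := exists_testBit_of_land_ne_zero hab
    rw [hf a ha] at hca
    rw [hf b hb] at hcb
    have h1 := hS.keysOf_subset hscale h255 (hB a ha) (hB b hb) hca.2 hcb.2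
    have h2 := hS.keysOf_subset hscale h255 (hB b hb) (hB a ha) hcb.2 hca.2
    refine Nat.eq_of_testBit_eq fun c => ?_
    rw [Bool.eq_iff_iff, hf a ha, hf b hb]
    exact and_congr_right fun _ => ⟨fun h => h1 h, fun h => h2 h⟩

end QSteiner

namespace QSteiner

/-! ### The parameters `q = 2`, `t = 3`, `k = 4`, `n = 10` -/

section Twist

variable {L : Type*} [Field L] [Algebra (ZMod 2) L] [CharP L 2]

theorem IsTriple.pow {x y z : L} (h : IsTriple x y z) (i : ℕ) :
    IsTriple (x ^ 2 ^ i) (y ^ 2 ^ i) (z ^ 2 ^ i) := by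
  rw [isTriple_iff] at h ⊢
  simp only [← add_pow_q_pow (q := 2)]
  obtain ⟨⟨h1, h2, h3⟩, h4, h5, h6, h7⟩ := h
  exact ⟨⟨pow_ne_zero _ h1, pow_ne_zero _ h2, pow_ne_zero _ h3⟩, pow_ne_zero _ h4, pow_ne_zero _ h5,
    pow_ne_zero _ h6, pow_ne_zero _ h7⟩

/-- A map `u ↦ d u ^ (2 ^ i)` sending a triple of one block into another block maps the first block
into the second. -/
theorem TwistInvariant.mem_of_triple {I : AddSubmonoid ℕ} {S : Set (Submodule (ZMod 2) L)} {k : ℕ}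
    (hI : TwistInvariant I S) (hS : IsDesign 3 k 1 S) {B B' : Submodule (ZMod 2) L} (hB : B ∈ S)
    (hB' : B' ∈ S) {x y z : L} (h : IsTriple x y z) (hx : x ∈ B) (hy : y ∈ B) (hz : z ∈ B)
    {i : ℕ} (hi : i ∈ I) {d : L} (hd : d ≠ 0) (hx' : d * x ^ 2 ^ i ∈ B') (hy' : d * y ^ 2 ^ i ∈ B')
    (hz' : d * z ^ 2 ^ i ∈ B') : ∀ w ∈ B, d * w ^ 2 ^ i ∈ B' := by
  obtain ⟨C, hC, hCB⟩ := hI i hi d hd B hB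
  obtain rfl : C = B' := hS.block_unique ((h.pow i).mul hd).finrank_span hC hB'
    (span_triple_le (hCB x hx) (hCB y hy) (hCB z hz)) (span_triple_le hx' hy' hz')
  exact hCB

end Twist

/-- Multiplication by `y` with `y ^ 5 = y ^ 2 + 1` on codes. -/
def step5 (c : ℕ) : ℕ := (2 * (c % 16)) ^^^ (5 * (c / 16))

/-- Squares of codes with at most `n` digits. -/
def sq5 : ℕ → ℕ → ℕ
  | 0, _ => 0
  | n + 1, c => step5 (step5 (sq5 n (c / 2))) ^^^ (c % 2)

/-- Multiplication by `y` on the codes of the field with `2 ^ 10` elements. -/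
def step10 (e : ℕ) : ℕ := step5 (e % 32) + 32 * step5 (e / 32)

/-- Squares of codes of the field with `2 ^ 10` elements. -/
def sq10 (e : ℕ) : ℕ := (sq5 5 (e % 32) ^^^ sq5 5 (e / 32)) + 32 * sq5 5 (e / 32)

section Codes

variable {L : Type*} [Field L] [CharP L 2] {y w : L}

/-- The element of the field with `2 ^ 10` elements with code `e`: elements are written as `a + b w`,
where `w` is a primitive third root of unity and `a`, `b` lie in the field with `32` elements, which
is generated by `y`. -/
def ev10 (y w : L) (e : ℕ) : L := evc 2 y (e % 32) + evc 2 y (e / 32) * w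

theorem ev10_xor (e e' : ℕ) : ev10 y w (e ^^^ e') = ev10 y w e + ev10 y w e' := by
  have h1 : (e ^^^ e') % 32 = e % 32 ^^^ e' % 32 := Nat.xor_mod_two_pow (n := 5)
  have h2 : (e ^^^ e') / 32 = e / 32 ^^^ e' / 32 := Nat.xor_div_two_pow (n := 5)
  rw [ev10, ev10, ev10, h1, h2, evc_xor, evc_xor]
  ring

theorem ev10_zero : ev10 y w 0 = 0 := by simp [ev10, evc_zero]

/-- The generators used for the coordinates. -/
structure IsBasis10 (y w : L) : Prop where
  root : y ^ 5 = ev y [1, 0, 1]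
  omega : w ^ 2 = ev w [1, 1]

theorem isStep5 {R : Type*} [CommRing R] [CharP R 2] {y : R} (hy : y ^ 5 = ev y [1, 0, 1]) :
    IsStep 2 5 y step5 := by
  intro c hc
  have hq : 1 < 2 := by norm_num
  have e : ∀ c : ℕ, evc 2 y c = (c % 2 : ℕ) + y * evc 2 y (c / 2) := evc_eq y hq
  have h5 : evc 2 y 5 = 1 + y ^ 2 := by
    rw [e, e, e]
    norm_num [evc_zero]
    ring
  have hc16 : evc 2 y c = evc 2 y (c % 16) + (c / 16 : ℕ) * y ^ 4 := by
    have h := evc_add_pow y hq (show c / 16 < 2 by omega) 4 (c % 16) (by omega)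
    rw [← h]
    congr 1
    omega
  refine ⟨Nat.xor_lt_two_pow (by omega) (by omega), ?_⟩
  rw [step5, evc_xor, evc_mul y hq, hc16]
  simp only [ev] at hy
  have hcase : c / 16 = 0 ∨ c / 16 = 1 := by omega
  rcases hcase with h0 | h0 <;> rw [h0]
  · simp [evc_zero]
  · rw [mul_one, h5]
    push_cast at hy ⊢
    linear_combination -hy

theorem sq5_spec {R : Type*} [CommRing R] [CharP R 2] {y : R} (hy : y ^ 5 = ev y [1, 0, 1]) (n : ℕ) :
    ∀ c, c < 2 ^ n → sq5 n c < 2 ^ 5 ∧ evc 2 y (sq5 n c) = evc 2 y c ^ 2 := by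
  induction n with
  | zero =>
    intro c hc
    obtain rfl : c = 0 := by omega
    simp [sq5, evc_zero]
  | succ n ih =>
    intro c hc
    obtain ⟨h1, h2⟩ := ih (c / 2) (by rw [pow_succ] at hc; omega)
    obtain ⟨h3, h4⟩ := isStep5 hy _ h1
    obtain ⟨h5, h6⟩ := isStep5 hy _ h3
    have hlt : c % 2 < 2 := Nat.mod_lt _ (by norm_num)
    refine ⟨Nat.xor_lt_two_pow h5 (hlt.trans (by norm_num)), ?_⟩
    rw [sq5, evc_xor, h6, h4, h2, evc_eq y one_lt_two c, evc_of_lt y one_lt_two hlt, CharTwo.add_sq]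
    have : ((c % 2 : ℕ) : R) ^ 2 = (c % 2 : ℕ) := by
      rcases Nat.mod_two_eq_zero_or_one c with h | h <;> rw [h] <;> simp
    rw [this]
    ring

theorem orbit5 : ∀ c < 32, c ≠ 0 → ∃ i < 31, step5^[i] 1 = c := by decide +kernel

theorem pow_32_of_root {R : Type*} [CommRing R] [CharP R 2] {y : R} (hy : y ^ 5 = ev y [1, 0, 1]) :
    y ^ 32 = y := by
  have h := ((isStep5 hy).iterate one_lt_two (by norm_num) 31).2
  rw [show step5^[31] 1 = 1 by decide +kernel, evc_one 2 one_lt_two] at h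
  rw [pow_succ, ← h, one_mul]

theorem pow_4_of_root {R : Type*} [CommRing R] [CharP R 2] {w : R} (hw : w ^ 2 = ev w [1, 1]) :
    w ^ 4 = w := by
  have h : (2 : R) = 0 := CharTwo.two_eq_zero
  simp only [ev] at hw
  push_cast at hw
  linear_combination (w ^ 2 + 2 + w) * hw + (1 + w) * h

theorem IsBasis10.y_ne_zero (h : IsBasis10 y w) : y ≠ 0 := by
  rintro rfl
  have := h.root
  simp [ev] at this

theorem IsBasis10.w_pow (h : IsBasis10 y w) : w ^ 32 = w + 1 := by
  have h4 := pow_4_of_root h.omega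
  have h2 := h.omega
  simp only [ev] at h2
  push_cast at h2
  calc w ^ 32 = ((w ^ 4) ^ 4) ^ 2 := by ring
    _ = w + 1 := by rw [h4, h4, h2]; ring

theorem evc_pow_32 (h : IsBasis10 y w) (c : ℕ) : evc 2 y c ^ 32 = evc 2 y c := by
  have := map_ev (iterateFrobenius L 2 5) y (Nat.digits 2 c)
  rw [iterateFrobenius_def, iterateFrobenius_def] at this
  rw [evc, show (32 : ℕ) = 2 ^ 5 by rfl, this, show 2 ^ 5 = 32 by rfl, pow_32_of_root h.root]

theorem evc_eq_zero_of_lt (h : IsBasis10 y w) {c : ℕ} (hc : c < 32) (h0 : evc 2 y c = 0) : c = 0 := by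
  by_contra hc0
  obtain ⟨i, -, rfl⟩ := orbit5 c hc hc0
  rw [((isStep5 h.root).iterate one_lt_two (by norm_num) i).2] at h0
  exact pow_ne_zero _ h.y_ne_zero h0

/-- The involution `u ↦ u ^ 32` on codes. -/
theorem ev10_pow_32 (h : IsBasis10 y w) {e : ℕ} (he : e < 1024) :
    ev10 y w e ^ 32 = ev10 y w (e ^^^ (e / 32)) := by
  have h1 : (e / 32) % 32 = e / 32 := Nat.mod_eq_of_lt (by omega)
  have h2 : (e / 32) / 32 = 0 := Nat.div_eq_of_lt (by omega)
  rw [ev10_xor, ev10, show (32 : ℕ) = 2 ^ 5 by rfl, add_pow_char_pow, mul_pow]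
  simp only [show 2 ^ 5 = 32 by rfl]
  rw [evc_pow_32 h, evc_pow_32 h, h.w_pow, ev10, h1, h2, evc_zero]
  ring

theorem ev10_eq_zero (h : IsBasis10 y w) {e : ℕ} (he : e < 1024) (h0 : ev10 y w e = 0) : e = 0 := by
  have h1 := ev10_pow_32 h he
  rw [ev10_xor, h0, zero_add, zero_pow (by norm_num), ev10, Nat.mod_eq_of_lt (by omega),
    Nat.div_eq_of_lt (show e / 32 < 32 by omega), evc_zero, zero_mul, add_zero] at h1
  have h2 := evc_eq_zero_of_lt h (by omega) h1.symm
  rw [ev10, h2, evc_zero, zero_mul, add_zero] at h0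
  have h3 := evc_eq_zero_of_lt h (by omega) h0
  omega

theorem exists_ev10 [Finite L] (hL : Nat.card L = 2 ^ 10) (h : IsBasis10 y w) (u : L) :
    ∃ e < 1024, ev10 y w e = u := by
  have hinj : Function.Injective fun e : Fin 1024 => ev10 y w e := by
    intro e e' hee
    have h1 : ev10 y w (e ^^^ e' : ℕ) = 0 := by
      rw [ev10_xor, show ev10 y w e = ev10 y w e' from hee, CharTwo.add_self_eq_zero]
    have h2 := ev10_eq_zero h (Nat.xor_lt_two_pow (n := 10) e.2 e'.2) h1
    exact Fin.ext (Nat.xor_eq_zero_iff.1 h2)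
  obtain ⟨e, he⟩ := ((Nat.bijective_iff_injective_and_card _).2 ⟨hinj, by simp [hL]⟩).2 u
  exact ⟨e, e.2, he⟩

theorem ev10_step10 (h : IsBasis10 y w) {e : ℕ} (he : e < 1024) :
    step10 e < 1024 ∧ ev10 y w (step10 e) = y * ev10 y w e := by
  obtain ⟨h1, h2⟩ := isStep5 h.root (e % 32) (by omega)
  obtain ⟨h3, h4⟩ := isStep5 h.root (e / 32) (by omega)
  have e1 : step10 e % 32 = step5 (e % 32) := by rw [step10]; omega
  have e2 : step10 e / 32 = step5 (e / 32) := by rw [step10]; omega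
  refine ⟨by rw [step10]; omega, ?_⟩
  rw [ev10, ev10, e1, e2, h2, h4]
  ring

theorem ev10_sq10 (h : IsBasis10 y w) {e : ℕ} (he : e < 1024) :
    sq10 e < 1024 ∧ ev10 y w (sq10 e) = ev10 y w e ^ 2 := by
  obtain ⟨h1, h2⟩ := sq5_spec h.root 5 (e % 32) (by omega)
  obtain ⟨h3, h4⟩ := sq5_spec h.root 5 (e / 32) (by omega)
  have h5 : sq5 5 (e % 32) ^^^ sq5 5 (e / 32) < 2 ^ 5 := Nat.xor_lt_two_pow h1 h3
  have e1 : sq10 e % 32 = sq5 5 (e % 32) ^^^ sq5 5 (e / 32) := by rw [sq10]; omega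
  have e2 : sq10 e / 32 = sq5 5 (e / 32) := by rw [sq10]; omega
  refine ⟨by rw [sq10]; omega, ?_⟩
  have hw := h.omega
  simp only [ev] at hw
  push_cast at hw
  rw [ev10, ev10, e1, e2, evc_xor, h2, h4, CharTwo.add_sq, mul_pow, hw]
  ring

/-- The map `u ↦ y ^ k u ^ (2 ^ i)` on codes. -/
def twist10 (k i e : ℕ) : ℕ := step10^[k] (sq10^[i] e)

theorem ev10_twist10 (h : IsBasis10 y w) (k i : ℕ) {e : ℕ} (he : e < 1024) :
    twist10 k i e < 1024 ∧ ev10 y w (twist10 k i e) = y ^ k * ev10 y w e ^ 2 ^ i := by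
  have h1 : sq10^[i] e < 1024 ∧ ev10 y w (sq10^[i] e) = ev10 y w e ^ 2 ^ i := by
    induction i with
    | zero => exact ⟨he, by simp⟩
    | succ i ih =>
      obtain ⟨h2, h3⟩ := ev10_sq10 h ih.1
      rw [Function.iterate_succ_apply']
      exact ⟨h2, by rw [h3, ih.2, ← pow_mul, ← pow_succ]⟩
  rw [twist10]
  induction k with
  | zero => simpa using h1
  | succ k ih =>
    obtain ⟨h2, h3⟩ := ev10_step10 h ih.1
    rw [Function.iterate_succ_apply']
    exact ⟨h2, by rw [h3, ih.2, pow_succ']; ring⟩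

/-- Independence of elements given by codes. -/
def isTriple10 (a b c : ℕ) : Bool :=
  a < 1024 && b < 1024 && c < 1024 && a != 0 && b != 0 && a != b && c != 0 && c != a && c != b &&
    c != a ^^^ b

theorem isTriple_of_isTriple10 (h : IsBasis10 y w) {a b c : ℕ} (ht : isTriple10 a b c = true) :
    IsTriple (ev10 y w a) (ev10 y w b) (ev10 y w c) := by
  simp only [isTriple10, Bool.and_eq_true, decide_eq_true_eq, bne_iff_ne, ne_eq] at ht
  obtain ⟨⟨⟨⟨⟨⟨⟨⟨⟨ha, hb⟩, hc⟩, a0⟩, b0⟩, ab⟩, c0⟩, ca⟩, cb⟩, cab⟩ := ht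
  have key : ∀ {e e' : ℕ}, e < 1024 → e' < 1024 → e ≠ e' → ev10 y w e + ev10 y w e' ≠ 0 := by
    intro e e' he he' hee h0
    rw [← ev10_xor] at h0
    exact hee (Nat.xor_eq_zero_iff.1 (ev10_eq_zero h (Nat.xor_lt_two_pow (n := 10) he he') h0))
  have key0 : ∀ {e : ℕ}, e < 1024 → e ≠ 0 → ev10 y w e ≠ 0 := fun he h1 h0 =>
    h1 (ev10_eq_zero h he h0)
  rw [isTriple_iff]
  refine ⟨⟨key0 ha a0, key0 hb b0, key ha hb ab⟩, key0 hc c0, key hc ha ca, key hc hb cb, ?_⟩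
  rw [← ev10_xor]
  exact key hc (Nat.xor_lt_two_pow (n := 10) ha hb) cab

end Codes

/-- The sums of subsets of three codes. -/
def comb (a b c α : ℕ) : ℕ :=
  (if α.testBit 0 then a else 0) ^^^ (if α.testBit 1 then b else 0) ^^^ (if α.testBit 2 then c else 0)

/-- Numbers `(k, i)` such that `u ↦ y ^ k u ^ (2 ^ i)` maps `⟨1, y, y ^ 2⟩` to the span of the codes
`1`, `2`, `4 c`. -/
def twistTo (c : ℕ) : ℕ × ℕ :=
  ([(0, 0), (0, 0), (27, 1), (23, 3), (30, 0), (18, 2), (0, 4), (13, 0)] : List (ℕ × ℕ)).getD c (0, 0)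

/-- Tells whether the three-dimensional subspace spanned by the codes `1`, `2`, `4 j + 32 d` lies in an image
of the block spanned by `1`, `2`, `4`, `8 m + 32 b`. -/
def isTypeOne (m b d j : ℕ) : Bool :=
  (List.range 8).any fun c => c != 0 &&
    let v := twist10 (twistTo c).1 (twistTo c).2 (8 * m + 32 * b) ^^^ (4 * j + 32 * d)
    v / 4 == 0 || v / 4 == c

/-- The numbers `j` such that the subspace spanned by the codes `1`, `2`, `4 j + 32 d` does not lie in an image of
the block spanned by `1`, `2`, `4`, `8 m + 32 b`. -/
def typeTwo (m b d : ℕ) : Finset ℕ := (Finset.range 8).filter fun j => isTypeOne m b d j = false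

/-- The numbers in `typeTwo m b d` for `d = 1, 2, 3` cannot be grouped into triples with bitwise sum zero: either
their counts differ, or for some binary digit the number of ones is odd. -/
theorem typeTwo_check : ∀ m < 4, ∀ b < 8, b ≠ 0 → ¬ ((typeTwo m b 2).card = (typeTwo m b 1).card ∧
    (typeTwo m b 3).card = (typeTwo m b 1).card ∧ ∀ t < 3,
      ((∑ j ∈ typeTwo m b 1, j / 2 ^ t) + (∑ j ∈ typeTwo m b 2, j / 2 ^ t) +
        ∑ j ∈ typeTwo m b 3, j / 2 ^ t) % 2 = 0) := by decide +kernel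

theorem twistTo_check : ∀ c < 8, c ≠ 0 → ∀ u ∈ [1, 2, 4],
    ∃ α < 8, twist10 (twistTo c).1 (twistTo c).2 u = comb 1 2 (4 * c) α := by decide +kernel

theorem twistTo_check' : ∀ c < 8, c ≠ 0 → ∀ v ∈ [1, 2, 4 * c],
    ∃ α < 8, twist10 (twistTo c).1 (twistTo c).2 (comb 1 2 4 α) = v := by decide +kernel

theorem twistTo_le : ∀ c < 8, c ≠ 0 → ∀ m < 4, ∀ b < 8, b ≠ 0 →
    32 ≤ twist10 (twistTo c).1 (twistTo c).2 (8 * m + 32 * b) := by decide +kernel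

theorem isTriple10_cell : ∀ d < 4, d ≠ 0 → ∀ j < 8, isTriple10 1 2 (4 * j + 32 * d) = true := by
  decide +kernel

theorem xor_cells : ∀ d < 4, ∀ d' < 4, ∀ j < 8, ∀ j' < 8,
    (4 * j + 32 * d) ^^^ (4 * j' + 32 * d') = 4 * (j ^^^ j') + 32 * (d ^^^ d') := by decide +kernel

section Blocks

variable {L : Type*} [Field L] [Algebra (ZMod 2) L] [CharP L 2] {y w : L}
  {S : Set (Submodule (ZMod 2) L)} {B B' : Submodule (ZMod 2) L}

theorem xor_mem10 {e e' : ℕ} (h : ev10 y w e ∈ B) (h' : ev10 y w e' ∈ B) :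
    ev10 y w (e ^^^ e') ∈ B := by
  rw [ev10_xor]
  exact B.add_mem h h'

theorem xor_mem10_iff {e e' : ℕ} (h' : ev10 y w e' ∈ B) :
    ev10 y w (e ^^^ e') ∈ B ↔ ev10 y w e ∈ B := by
  rw [ev10_xor]
  exact B.add_mem_iff_left h'

theorem comb_mem {a b c : ℕ} (ha : ev10 y w a ∈ B) (hb : ev10 y w b ∈ B) (hc : ev10 y w c ∈ B) (α : ℕ) :
    ev10 y w (comb a b c α) ∈ B := by
  have h0 : ev10 y w 0 ∈ B := by rw [ev10_zero]; exact B.zero_mem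
  refine xor_mem10 (xor_mem10 ?_ ?_) ?_ <;> split_ifs <;> assumption

theorem comb_lt {a b c : ℕ} (ha : a < 1024) (hb : b < 1024) (hc : c < 1024) (α : ℕ) :
    comb a b c α < 1024 := by
  refine Nat.xor_lt_two_pow (n := 10) (Nat.xor_lt_two_pow (n := 10) ?_ ?_) ?_ <;> split_ifs <;>
    first | assumption | norm_num

theorem ev10_inj {L : Type*} [Field L] [CharP L 2] {y w : L} (h : IsBasis10 y w) {e e' : ℕ} (he : e < 1024) (he' : e' < 1024)
    (hee : ev10 y w e = ev10 y w e') : e = e' := by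
  refine Nat.xor_eq_zero_iff.1 (ev10_eq_zero h (Nat.xor_lt_two_pow (n := 10) he he') ?_)
  rw [ev10_xor, hee, CharTwo.add_self_eq_zero]

theorem exists_comb_of_mem_span (h : IsBasis10 y w) {a b c e : ℕ} (ht : isTriple10 a b c = true)
    (he : e < 1024)
    (hmem : ev10 y w e ∈ Submodule.span (ZMod 2) (Set.range ![ev10 y w a, ev10 y w b, ev10 y w c])) :
    ∃ α < 8, e = comb a b c α := by
  obtain ⟨g, hg⟩ := (Submodule.mem_span_range_iff_exists_fun _).1 hmem
  rw [Fin.sum_univ_three] at hg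
  replace hg : g 0 • ev10 y w a + g 1 • ev10 y w b + g 2 • ev10 y w c = ev10 y w e := hg
  simp only [isTriple10, Bool.and_eq_true, decide_eq_true_eq] at ht
  obtain ⟨⟨⟨⟨⟨⟨⟨⟨⟨ha, hb⟩, hc⟩, -⟩, -⟩, -⟩, -⟩, -⟩, -⟩, -⟩ := ht
  have key : ∀ α < 8, ev10 y w (comb a b c α) = ev10 y w e → ∃ α < 8, e = comb a b c α :=
    fun α hα h1 => ⟨α, hα, (ev10_inj h (comb_lt ha hb hc α) he h1).symm⟩
  have hcomb : ∀ α, ev10 y w (comb a b c α) = (if α.testBit 0 then ev10 y w a else 0) +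
      (if α.testBit 1 then ev10 y w b else 0) + (if α.testBit 2 then ev10 y w c else 0) := by
    intro α
    rw [comb, ev10_xor, ev10_xor]
    congr 1
    · congr 1 <;> split_ifs <;> simp [ev10_zero]
    · split_ifs <;> simp [ev10_zero]
  rcases zmod_two_cases (g 0) with e0 | e0 <;> rcases zmod_two_cases (g 1) with e1 | e1 <;>
    rcases zmod_two_cases (g 2) with e2 | e2 <;> rw [e0, e1, e2] at hg <;>
    simp only [zero_smul, one_smul] at hg
  · exact key 0 (by norm_num) (by rw [← hg, hcomb]; rfl)
  · exact key 4 (by norm_num) (by rw [← hg, hcomb]; rfl)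
  · exact key 2 (by norm_num) (by rw [← hg, hcomb]; rfl)
  · exact key 6 (by norm_num) (by rw [← hg, hcomb]; rfl)
  · exact key 1 (by norm_num) (by rw [← hg, hcomb]; rfl)
  · exact key 5 (by norm_num) (by rw [← hg, hcomb]; rfl)
  · exact key 3 (by norm_num) (by rw [← hg, hcomb]; rfl)
  · exact key 7 (by norm_num) (by rw [← hg, hcomb]; rfl)

/-- A block is spanned by three independent elements and a further one. -/
theorem eq_comb_or_of_mem [FiniteDimensional (ZMod 2) L] (h : IsBasis10 y w) (hB : Module.finrank (ZMod 2) B = 4) {a b c d e : ℕ}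
    (ht : isTriple10 a b c = true) (ha : ev10 y w a ∈ B) (hb : ev10 y w b ∈ B) (hc : ev10 y w c ∈ B)
    (hd : d < 1024) (hdB : ev10 y w d ∈ B) (hdc : ∀ α < 8, d ≠ comb a b c α) (he : e < 1024)
    (heB : ev10 y w e ∈ B) : ∃ α < 8, e = comb a b c α ∨ e ^^^ d = comb a b c α := by
  by_cases hmem : ev10 y w e ∈ Submodule.span (ZMod 2) (Set.range ![ev10 y w a, ev10 y w b, ev10 y w c])
  · obtain ⟨α, hα, h1⟩ := exists_comb_of_mem_span h ht he hmem
    exact ⟨α, hα, Or.inl h1⟩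
  · have hT := isTriple_of_isTriple10 h ht
    have h2 := add_mem_of_not_mem (span_triple_le ha hb hc) (by rw [hB, hT.finrank_span]) hdB heB
      (fun h1 => by
        obtain ⟨α, hα, h2⟩ := exists_comb_of_mem_span h ht hd h1
        exact hdc α hα h2) hmem
    rw [← ev10_xor] at h2
    obtain ⟨α, hα, h3⟩ := exists_comb_of_mem_span h ht (Nat.xor_lt_two_pow (n := 10) he hd) h2
    exact ⟨α, hα, Or.inr h3⟩

theorem exists_mem_ne_comb [Finite L] [FiniteDimensional (ZMod 2) L] (hL : Nat.card L = 2 ^ 10) (h : IsBasis10 y w)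
    (hB : Module.finrank (ZMod 2) B = 4) {a b c : ℕ}
    (ht : isTriple10 a b c = true) : ∃ e < 1024, ev10 y w e ∈ B ∧
    ∀ α < 8, e ≠ comb a b c α := by
  by_contra hcon
  push Not at hcon
  have hle : B ≤ Submodule.span (ZMod 2) (Set.range ![ev10 y w a, ev10 y w b, ev10 y w c]) := by
    intro u hu
    obtain ⟨e, he, rfl⟩ := exists_ev10 hL h u
    obtain ⟨α, -, rfl⟩ := hcon e he hu
    have hs : ∀ i, ![ev10 y w a, ev10 y w b, ev10 y w c] i ∈
        Submodule.span (ZMod 2) (Set.range ![ev10 y w a, ev10 y w b, ev10 y w c]) :=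
      fun i => Submodule.subset_span ⟨i, rfl⟩
    exact comb_mem (hs 0) (hs 1) (hs 2) α
  have h1 := Submodule.finrank_mono hle
  rw [hB, (isTriple_of_isTriple10 h ht).finrank_span] at h1
  omega

theorem exists_block10 (hS : IsDesign 3 4 1 S) (h : IsBasis10 y w) {a b c : ℕ}
    (ht : isTriple10 a b c = true) : ∃ B ∈ S, ev10 y w a ∈ B ∧ ev10 y w b ∈ B ∧ ev10 y w c ∈ B := by
  obtain ⟨B, hB, hle⟩ := hS.exists_block (isTriple_of_isTriple10 h ht).finrank_span
  exact ⟨B, hB, hle (Submodule.subset_span ⟨0, rfl⟩), hle (Submodule.subset_span ⟨1, rfl⟩),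
    hle (Submodule.subset_span ⟨2, rfl⟩)⟩

theorem block_unique10 (hS : IsDesign 3 4 1 S) (h : IsBasis10 y w) {a b c : ℕ}
    (ht : isTriple10 a b c = true) (hB : B ∈ S) (hB' : B' ∈ S) (ha : ev10 y w a ∈ B)
    (hb : ev10 y w b ∈ B) (hc : ev10 y w c ∈ B) (ha' : ev10 y w a ∈ B') (hb' : ev10 y w b ∈ B')
    (hc' : ev10 y w c ∈ B') : B = B' :=
  hS.block_unique (isTriple_of_isTriple10 h ht).finrank_span hB hB' (span_triple_le ha hb hc)
    (span_triple_le ha' hb' hc')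

/-- A map `u ↦ y ^ k u ^ (2 ^ i)` sending a triple of one block into another one. -/
theorem twist10_mem (hI : TwistInvariant ⊤ S) (hS : IsDesign 3 4 1 S) (h : IsBasis10 y w) (hB : B ∈ S)
    (hB' : B' ∈ S) (k i : ℕ) {a b c : ℕ} (ht : isTriple10 a b c = true) (ha : ev10 y w a ∈ B)
    (hb : ev10 y w b ∈ B) (hc : ev10 y w c ∈ B) (ha' : ev10 y w (twist10 k i a) ∈ B')
    (hb' : ev10 y w (twist10 k i b) ∈ B') (hc' : ev10 y w (twist10 k i c) ∈ B') {e : ℕ} (he : e < 1024)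
    (heB : ev10 y w e ∈ B) : ev10 y w (twist10 k i e) ∈ B' := by
  have hT := isTriple_of_isTriple10 h ht
  simp only [isTriple10, Bool.and_eq_true, decide_eq_true_eq] at ht
  obtain ⟨⟨⟨⟨⟨⟨⟨⟨⟨la, lb⟩, lc⟩, -⟩, -⟩, -⟩, -⟩, -⟩, -⟩, -⟩ := ht
  rw [(ev10_twist10 h k i la).2] at ha'
  rw [(ev10_twist10 h k i lb).2] at hb'
  rw [(ev10_twist10 h k i lc).2] at hc'
  rw [(ev10_twist10 h k i he).2]
  exact hI.mem_of_triple hS hB hB' hT ha hb hc (AddSubmonoid.mem_top i)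
    (pow_ne_zero k h.y_ne_zero) ha' hb' hc' _ heB

/-- A block containing a triple and its image under the involution is invariant, and thus contains the
coefficients of `w` of its elements. -/
theorem div_mem (hI : TwistInvariant ⊤ S) (hS : IsDesign 3 4 1 S) (h : IsBasis10 y w) (hB : B ∈ S)
    {a b c : ℕ} (ht : isTriple10 a b c = true) (ha : ev10 y w a ∈ B) (hb : ev10 y w b ∈ B)
    (hc : ev10 y w c ∈ B) (ha' : ev10 y w (a / 32) ∈ B) (hb' : ev10 y w (b / 32) ∈ B)
    (hc' : ev10 y w (c / 32) ∈ B) {e : ℕ} (he : e < 1024) (heB : ev10 y w e ∈ B) :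
    ev10 y w (e / 32) ∈ B := by
  have hT := isTriple_of_isTriple10 h ht
  simp only [isTriple10, Bool.and_eq_true, decide_eq_true_eq] at ht
  obtain ⟨⟨⟨⟨⟨⟨⟨⟨⟨la, lb⟩, lc⟩, -⟩, -⟩, -⟩, -⟩, -⟩, -⟩, -⟩ := ht
  have key : ∀ {a : ℕ}, a < 1024 → ev10 y w a ∈ B → ev10 y w (a / 32) ∈ B →
      1 * ev10 y w a ^ 2 ^ 5 ∈ B := by
    intro a la h1 h2
    rw [one_mul, show 2 ^ 5 = 32 by rfl, ev10_pow_32 h la]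
    exact xor_mem10 h1 h2
  have h1 := hI.mem_of_triple hS hB hB hT ha hb hc (AddSubmonoid.mem_top 5) one_ne_zero (key la ha ha')
    (key lb hb hb') (key lc hc hc') _ heB
  rw [one_mul, show 2 ^ 5 = 32 by rfl, ev10_pow_32 h he, Nat.xor_comm, xor_mem10_iff heB] at h1
  exact h1

theorem mod_four_mem (h1 : ev10 y w 1 ∈ B) (h2 : ev10 y w 2 ∈ B) {c : ℕ} (hc : c < 4) :
    ev10 y w c ∈ B := by
  interval_cases c
  · rw [ev10_zero]; exact B.zero_mem
  · exact h1
  · exact h2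
  · exact xor_mem10 h1 h2

theorem xor_mod_four : ∀ e < 1024, e ^^^ (e % 4) = 4 * (e / 4) := by decide +kernel

theorem xor_mod_eight : ∀ e < 1024, e ^^^ (e % 8) = 8 * (e / 8) := by decide +kernel

theorem clear_mem_four (h1 : ev10 y w 1 ∈ B) (h2 : ev10 y w 2 ∈ B) {e : ℕ} (he : e < 1024)
    (heB : ev10 y w e ∈ B) : ev10 y w (4 * (e / 4)) ∈ B := by
  rw [← xor_mod_four e he]
  exact xor_mem10 heB (mod_four_mem h1 h2 (Nat.mod_lt _ (by norm_num)))

theorem clear_mem_eight (h1 : ev10 y w 1 ∈ B) (h2 : ev10 y w 2 ∈ B) (h4 : ev10 y w 4 ∈ B) {e : ℕ}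
    (he : e < 1024) (heB : ev10 y w e ∈ B) : ev10 y w (8 * (e / 8)) ∈ B := by
  rw [← xor_mod_eight e he]
  have : ∀ e < 8, ∃ α, e = comb 1 2 4 α := by
    intro e he
    refine ⟨e, ?_⟩
    interval_cases e <;> rfl
  obtain ⟨α, hα⟩ := this (e % 8) (Nat.mod_lt _ (by norm_num))
  rw [hα]
  exact xor_mem10 heB (comb_mem h1 h2 h4 α)

variable [FiniteDimensional (ZMod 2) L]

/-- No block containing `1`, `y`, `y ^ 2` is contained in the field with `32` elements: it would share
three dimensions with its multiple by `y`. -/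
theorem not_mem_of_lt_32 (hI : TwistInvariant ⊤ S) (hS : IsDesign 3 4 1 S) (h : IsBasis10 y w)
    (hB : B ∈ S) (h1 : ev10 y w 1 ∈ B) (h2 : ev10 y w 2 ∈ B) (h4 : ev10 y w 4 ∈ B) {c : ℕ} (hc8 : 8 ≤ c)
    (hc : c < 32) : ev10 y w c ∉ B := by
  intro hcB
  have hcB' := clear_mem_eight h1 h2 h4 (by omega) hcB
  have hq : c / 8 = 1 ∨ c / 8 = 2 ∨ c / 8 = 3 := by omega
  have t1 : ∀ {a b c e : ℕ}, isTriple10 a b c = true → ev10 y w a ∈ B → ev10 y w b ∈ B →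
      ev10 y w c ∈ B → ev10 y w (twist10 1 0 a) ∈ B → ev10 y w (twist10 1 0 b) ∈ B →
      ev10 y w (twist10 1 0 c) ∈ B → e < 1024 → ev10 y w e ∈ B → ev10 y w (twist10 1 0 e) ∈ B :=
    fun ht ha hb hc ha' hb' hc' he heB =>
      twist10_mem hI hS h hB hB 1 0 ht ha hb hc ha' hb' hc' he heB
  have key : ev10 y w 8 ∈ B → ev10 y w 16 ∈ B → False := by
    intro h8 h16
    obtain ⟨α, hα, h0⟩ := eq_comb_or_of_mem h (hS.1 B hB) (a := 1) (b := 2) (c := 4) (by decide) h1 h2 h4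
      (show 8 < 1024 by norm_num) h8 (by decide) (show 16 < 1024 by norm_num) h16
    revert α
    decide
  rcases hq with hq | hq | hq <;> rw [hq] at hcB'
  · exact key hcB' (t1 (a := 1) (b := 2) (c := 4) (e := 8) (by decide) h1 h2 h4 h2 h4 hcB'
      (by norm_num) hcB')
  · have h5 : ev10 y w 5 ∈ B := xor_mem10 h4 h1
    exact key (t1 (a := 1) (b := 2) (c := 16) (e := 4) (by decide) h1 h2 hcB' h2 h4 h5
      (by norm_num) h4) hcB'
  · have h28 : ev10 y w 28 ∈ B := xor_mem10 hcB' h4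
    have h29 : ev10 y w 29 ∈ B := xor_mem10 h28 h1
    have h8 : ev10 y w 8 ∈ B := t1 (a := 1) (b := 2) (c := 28) (e := 4) (by decide) h1 h2 h28 h2 h4 h29
      (by norm_num) h4
    exact key h8 (xor_mem10 hcB' h8)

/-- The block containing `1`, `y`, `y ^ 2`. -/
theorem exists_base_block [Finite L] (hL : Nat.card L = 2 ^ 10) (hI : TwistInvariant ⊤ S)
    (hS : IsDesign 3 4 1 S) (h : IsBasis10 y w) : ∃ B ∈ S, ev10 y w 1 ∈ B ∧ ev10 y w 2 ∈ B ∧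
      ev10 y w 4 ∈ B ∧ ∃ m < 4, ∃ b < 8, b ≠ 0 ∧ ev10 y w (8 * m + 32 * b) ∈ B := by
  obtain ⟨B, hB, h1, h2, h4⟩ := exists_block10 hS h (a := 1) (b := 2) (c := 4) (by decide)
  refine ⟨B, hB, h1, h2, h4, ?_⟩
  obtain ⟨e, he, heB, hne⟩ := exists_mem_ne_comb hL h (hS.1 B hB) (a := 1) (b := 2) (c := 4) (by decide)
  have h0 : ev10 y w 0 ∈ B := by rw [ev10_zero]; exact B.zero_mem
  have he8 : 8 ≤ e := by
    by_contra hlt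
    refine hne e (by omega) ?_
    interval_cases e <;> rfl
  have he32 : 32 ≤ e := by
    by_contra hlt
    exact not_mem_of_lt_32 hI hS h hB h1 h2 h4 he8 (by omega) heB
  have hdiv := div_mem hI hS h hB (a := 1) (b := 2) (c := 4) (by decide) h1 h2 h4 h0 h0 h0 he heB
  have hlt : e / 32 < 8 := by
    by_contra hge
    exact not_mem_of_lt_32 hI hS h hB h1 h2 h4 (by omega) (by omega) hdiv
  refine ⟨e / 8 % 4, by omega, e / 32, hlt, by omega, ?_⟩
  have := clear_mem_eight h1 h2 h4 he heB
  rwa [show 8 * (e / 8) = 8 * (e / 8 % 4) + 32 * (e / 32) by omega] at this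

end Blocks

theorem comb_four : ∀ c < 8, ∀ α < 8, comb 1 2 (4 * c) α < 32 ∧
    (comb 1 2 (4 * c) α / 4 = 0 ∨ comb 1 2 (4 * c) α / 4 = c) := by decide +kernel

theorem isTriple10_four : ∀ c < 8, c ≠ 0 → isTriple10 1 2 (4 * c) = true := by decide +kernel

theorem lt_four_eq_comb : ∀ e < 4, ∀ d < 4, ∀ j < 8, ∃ α < 8, e = comb 1 2 (4 * j + 32 * d) α := by
  decide +kernel

theorem xor_eq_comb : ∀ c < 4, ∀ d < 4, ∀ j < 8,
    ∃ α < 8, c ^^^ (4 * j + 32 * d) = comb 1 2 (4 * j + 32 * d) α := by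
  decide +kernel

theorem xor_digits : ∀ j < 8, ∀ j' < 8, j ^^^ j' < 8 ∧ ∀ t < 3,
    (j / 2 ^ t + j' / 2 ^ t + (j ^^^ j') / 2 ^ t) % 2 = 0 := by decide +kernel

theorem xor_eq_third : ∀ d < 4, ∀ d' < 4, ∀ a < 4,
    d ≠ d' ∧ d ≠ 0 ∧ d' ≠ 0 ∧ a ≠ 0 ∧ a ≠ d ∧ a ≠ d' → a ^^^ d = d' := by
  intro d hd d' hd' a ha
  interval_cases d <;> interval_cases d' <;> interval_cases a <;> decide

section Good

variable {L : Type*} [Field L] [Algebra (ZMod 2) L] [CharP L 2] {y w : L}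
  {S : Set (Submodule (ZMod 2) L)} {B B₀ : Submodule (ZMod 2) L}

/-- A subspace meeting the field with `32` elements in `⟨1, y⟩` only. -/
def IsGood (y w : L) (B : Submodule (ZMod 2) L) : Prop := ∀ c < 32, ev10 y w c ∈ B → c < 4

/-- Both elements with the codes `4 j + 32 d` and `4 j' + 32 d'` lie in one good block through `1`, `y`. -/
def Joined (y w : L) (S : Set (Submodule (ZMod 2) L)) (d j d' j' : ℕ) : Prop :=
  ∃ B ∈ S, IsGood y w B ∧ ev10 y w 1 ∈ B ∧ ev10 y w 2 ∈ B ∧ ev10 y w (4 * j + 32 * d) ∈ B ∧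
    ev10 y w (4 * j' + 32 * d') ∈ B

theorem Joined.symm {L : Type*} [Field L] [Algebra (ZMod 2) L] {y w : L}
    {S : Set (Submodule (ZMod 2) L)} {d j d' j' : ℕ} (h : Joined y w S d j d' j') : Joined y w S d' j' d j := by
  obtain ⟨B, hB, hg, h1, h2, h3, h4⟩ := h
  exact ⟨B, hB, hg, h1, h2, h4, h3⟩

theorem IsGood.unique (hg : IsGood y w B) {d j j' : ℕ} (hd : d < 4) (hj : j < 8) (hj' : j' < 8)
    (h : ev10 y w (4 * j + 32 * d) ∈ B) (h' : ev10 y w (4 * j' + 32 * d) ∈ B) : j = j' := by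
  have h1 := xor_mem10 h h'
  have hlt := (xor_digits j hj j' hj').1
  rw [xor_cells d hd d hd j hj j' hj', Nat.xor_self, mul_zero, add_zero] at h1
  have := hg _ (by omega) h1
  exact Nat.xor_eq_zero_iff.1 (by omega)

theorem Joined.unique (hS : IsDesign 3 4 1 S) (h : IsBasis10 y w) {d j d' j' j'' : ℕ} (hd : d < 4)
    (hd0 : d ≠ 0) (hd' : d' < 4) (hj : j < 8) (hj' : j' < 8) (hj'' : j'' < 8)
    (h1 : Joined y w S d j d' j') (h2 : Joined y w S d j d' j'') : j' = j'' := by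
  obtain ⟨B, hB, hg, a1, a2, a3, a4⟩ := h1
  obtain ⟨B', hB', -, b1, b2, b3, b4⟩ := h2
  obtain rfl := block_unique10 hS h (isTriple10_cell d hd hd0 j hj) hB hB' a1 a2 a3 b1 b2 b3
  exact hg.unique hd' hj' hj'' a4 b4

variable [FiniteDimensional (ZMod 2) L]

/-- The good blocks through `1`, `y` are those not containing an image of the base block which meets the
field with `32` elements in a space containing `1` and `y`. -/
theorem isGood_iff (hI : TwistInvariant ⊤ S) (hS : IsDesign 3 4 1 S) (h : IsBasis10 y w) (hB₀ : B₀ ∈ S)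
    (b1 : ev10 y w 1 ∈ B₀) (b2 : ev10 y w 2 ∈ B₀) (b4 : ev10 y w 4 ∈ B₀) {m b : ℕ} (hm : m < 4)
    (hb : b < 8) (hb0 : b ≠ 0) (hmb : ev10 y w (8 * m + 32 * b) ∈ B₀) (hB : B ∈ S) {d j : ℕ}
    (hd : d < 4) (hd0 : d ≠ 0) (hj : j < 8) (h1 : ev10 y w 1 ∈ B) (h2 : ev10 y w 2 ∈ B)
    (hdj : ev10 y w (4 * j + 32 * d) ∈ B) : IsGood y w B ↔ isTypeOne m b d j = false := by
  have hmb' : 8 * m + 32 * b < 1024 := by omega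
  have ht := isTriple10_cell d hd hd0 j hj
  rw [← not_iff_not, Bool.not_eq_false]
  constructor
  · intro hg
    simp only [IsGood, not_forall, not_lt] at hg
    obtain ⟨e, he, heB, he4⟩ := hg
    have hcB := clear_mem_four h1 h2 (by omega) heB
    have hc8 : e / 4 < 8 := by omega
    have hc0 : e / 4 ≠ 0 := by omega
    generalize e / 4 = c at *
    have htc := isTriple10_four c hc8 hc0
    have himg : ∀ u ∈ [1, 2, 4], ev10 y w (twist10 (twistTo c).1 (twistTo c).2 u) ∈ B := by
      intro u hu
      obtain ⟨α, -, hα⟩ := twistTo_check c hc8 hc0 u hu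
      rw [hα]
      exact comb_mem h1 h2 hcB α
    have hv := twist10_mem hI hS h hB₀ hB (twistTo c).1 (twistTo c).2 (a := 1) (b := 2) (c := 4)
      (by decide) b1 b2 b4 (himg 1 (by simp)) (himg 2 (by simp)) (himg 4 (by simp)) hmb' hmb
    have hle := twistTo_le c hc8 hc0 m hm b hb hb0
    have hlt := (ev10_twist10 h (twistTo c).1 (twistTo c).2 hmb').1
    obtain ⟨α, hα, h3⟩ := eq_comb_or_of_mem h (hS.1 B hB) htc h1 h2 hcB hlt hv
      (fun α hα h0 => by have := (comb_four c hc8 α hα).1; omega)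
      (show 4 * j + 32 * d < 1024 by omega) hdj
    have h4 := comb_four c hc8 α hα
    rcases h3 with h3 | h3
    · omega
    · rw [isTypeOne, List.any_eq_true]
      refine ⟨c, by simpa using hc8, ?_⟩
      rw [Nat.xor_comm] at h3
      simp only [h3, Bool.and_eq_true, Bool.or_eq_true, bne_iff_ne, beq_iff_eq]
      exact ⟨hc0, h4.2⟩
  · intro hty hg
    rw [isTypeOne, List.any_eq_true] at hty
    obtain ⟨c, hc8, hc⟩ := hty
    rw [List.mem_range] at hc8
    simp only [Bool.and_eq_true, Bool.or_eq_true, bne_iff_ne, beq_iff_eq] at hc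
    obtain ⟨hc0, hc⟩ := hc
    obtain ⟨B', hB', hBB'⟩ := hI (twistTo c).2 (AddSubmonoid.mem_top _) (y ^ (twistTo c).1)
      (pow_ne_zero _ h.y_ne_zero) B₀ hB₀
    have himg : ∀ e < 1024, ev10 y w e ∈ B₀ →
        ev10 y w (twist10 (twistTo c).1 (twistTo c).2 e) ∈ B' := by
      intro e he heB
      rw [(ev10_twist10 h _ _ he).2]
      exact hBB' _ heB
    have himg' : ∀ v ∈ [1, 2, 4 * c], ev10 y w v ∈ B' := by
      intro v hv
      obtain ⟨α, hα, h3⟩ := twistTo_check' c hc8 hc0 v hv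
      rw [← h3]
      exact himg _ (comb_lt (by norm_num) (by norm_num) (by norm_num) α) (comb_mem b1 b2 b4 α)
    have c1 := himg' 1 (by simp)
    have c2 := himg' 2 (by simp)
    have cc := himg' (4 * c) (by simp)
    have hv := himg _ hmb' hmb
    have hlt := (ev10_twist10 h (twistTo c).1 (twistTo c).2 hmb').1
    have hcell : ev10 y w (4 * j + 32 * d) ∈ B' := by
      rw [← xor_mem10_iff hv, Nat.xor_comm,
        ← xor_mem10_iff (mod_four_mem c1 c2 (Nat.mod_lt _ (by norm_num : 0 < 4))),
        xor_mod_four _ (Nat.xor_lt_two_pow (n := 10) hlt (by omega))]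
      rcases hc with hc | hc <;> rw [hc]
      · rw [mul_zero, ev10_zero]; exact B'.zero_mem
      · exact cc
    obtain rfl := block_unique10 hS h ht hB' hB c1 c2 hcell h1 h2 hdj
    have := hg (4 * c) (by omega) cc
    omega

/-- A good block through `1`, `y` and one of the elements `4 j + 32 d` with `d = 1, 2, 3` contains one for
each value of `d`. -/
theorem IsGood.exists_cell [Finite L] (hL : Nat.card L = 2 ^ 10) (hI : TwistInvariant ⊤ S)
    (hS : IsDesign 3 4 1 S) (h : IsBasis10 y w) (hB : B ∈ S) (hg : IsGood y w B) {d j d' : ℕ}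
    (hd : d < 4) (hd0 : d ≠ 0) (hj : j < 8) (h1 : ev10 y w 1 ∈ B) (h2 : ev10 y w 2 ∈ B)
    (hdj : ev10 y w (4 * j + 32 * d) ∈ B) (hd' : d' < 4) (hd0' : d' ≠ 0) :
    ∃ j' < 8, ev10 y w (4 * j' + 32 * d') ∈ B := by
  have ht := isTriple10_cell d hd hd0 j hj
  have h0 : ev10 y w 0 ∈ B := by rw [ev10_zero]; exact B.zero_mem
  -- every element of `B` has its coefficient of `w` in `⟨1, y⟩`
  have hdiv : ∀ e < 1024, ev10 y w e ∈ B → e / 32 < 4 := fun e he heB =>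
    hg _ (by omega) (div_mem hI hS h hB ht h1 h2 hdj h0 h0
      (by rw [show (4 * j + 32 * d) / 32 = d by omega]; exact mod_four_mem h1 h2 hd) he heB)
  have hclear : ∀ e < 1024, ev10 y w e ∈ B → e / 32 = d' →
      ∃ j' < 8, ev10 y w (4 * j' + 32 * d') ∈ B := by
    intro e he heB hed
    refine ⟨e / 4 % 8, by omega, ?_⟩
    have := clear_mem_four h1 h2 he heB
    rwa [show 4 * (e / 4) = 4 * (e / 4 % 8) + 32 * d' by omega] at this
  by_cases hdd : d = d'
  · subst hdd
    exact ⟨j, hj, hdj⟩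
  obtain ⟨e, he, heB, hne⟩ := exists_mem_ne_comb hL h (hS.1 B hB) ht
  have hxor := xor_mem10 heB hdj
  have hxlt : e ^^^ (4 * j + 32 * d) < 1024 := Nat.xor_lt_two_pow (n := 10) he (by omega)
  have hxd : (e ^^^ (4 * j + 32 * d)) / 32 = e / 32 ^^^ d := by
    rw [show 32 = 2 ^ 5 by rfl, Nat.xor_div_two_pow]
    congr 1
    omega
  have hed := hdiv e he heB
  by_cases he0 : e / 32 = 0
  · obtain ⟨α, hα, h3⟩ := lt_four_eq_comb e (hg e (by omega) heB) d hd j hj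
    exact absurd h3 (hne α hα)
  by_cases he1 : e / 32 = d
  · rw [he1, Nat.xor_self] at hxd
    obtain ⟨α, hα, h3⟩ := xor_eq_comb _ (hg _ (by omega) hxor) d hd j hj
    rw [Nat.xor_assoc, Nat.xor_self, Nat.xor_zero] at h3
    exact absurd h3 (hne α hα)
  by_cases he2 : e / 32 = d'
  · exact hclear e he heB he2
  · refine hclear _ hxlt hxor (hxd.trans ?_)
    generalize e / 32 = a at *
    exact xor_eq_third d hd d' hd' a hed ⟨hdd, hd0, hd0', he0, he1, he2⟩

end Good

theorem not_admits_2_3_4_10 (C : Subgroup (GLin 10 2)) (hC : IsSingerSubgroup C) :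
    ¬ Admits 2 3 4 10 (Subgroup.normalizer (C : Set (GLin 10 2))) := by
  intro hA
  obtain ⟨L, _, _, hL, S, hS, hscale, hfrob⟩ :=
    exists_field_design (by norm_num) hC Subgroup.le_normalizer hA
  have hI := hscale.twistInvariant_top (hfrob le_rfl)
  have hch : CharP L 2 := charP_of_injective_algebraMap' (ZMod 2) 2
  have hfin : Finite L := Nat.finite_of_card_ne_zero (by rw [hL]; norm_num)
  have hfl : Module.Finite (ZMod 2) L := Module.Finite.of_finite
  obtain ⟨y, hy⟩ := exists_root_of_card (q := 2) hL (by norm_num) (m := 5) (by norm_num)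
    (r := [1, 0, 1]) (by simp) fun R _ _ y hy => by
      have h := pow_32_of_root hy
      rw [show 2 ^ 10 = 32 * 32 by rfl, pow_mul, h, h]
  obtain ⟨w, hw⟩ := exists_root_of_card (q := 2) hL (by norm_num) (m := 2) (by norm_num)
    (r := [1, 1]) (by simp) fun R _ _ w hw => by
      have h := pow_4_of_root hw
      rw [show 2 ^ 10 = 4 * 4 * 4 * 4 * 4 by rfl, pow_mul, pow_mul, pow_mul, pow_mul, h, h, h, h, h]
  have h : IsBasis10 y w := ⟨hy, hw⟩
  obtain ⟨B₀, hB₀, b1, b2, b4, m, hm, b, hb, hb0, hmb⟩ := exists_base_block hL hI hS h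
  have hgood := fun {B} (hB : B ∈ S) {d j : ℕ} => isGood_iff (B := B) (d := d) (j := j) hI hS h hB₀ b1 b2 b4
    hm hb hb0 hmb hB
  have hmem : ∀ {d j}, j ∈ typeTwo m b d ↔ j < 8 ∧ isTypeOne m b d j = false := by
    intro d j
    rw [typeTwo, Finset.mem_filter, Finset.mem_range]
  -- the good blocks match the elements of the three sets `typeTwo m b d`
  have htotal : ∀ d < 4, d ≠ 0 → ∀ d' < 4, d' ≠ 0 → ∀ j ∈ typeTwo m b d,
      ∃ j' ∈ typeTwo m b d', Joined y w S d j d' j' := by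
    intro d hd hd0 d' hd' hd0' j hj
    obtain ⟨hj8, hj1⟩ := hmem.1 hj
    obtain ⟨B, hB, h1, h2, h3⟩ := exists_block10 hS h (isTriple10_cell d hd hd0 j hj8)
    have hg := (hgood hB hd hd0 hj8 h1 h2 h3).2 hj1
    obtain ⟨j', hj8', h4⟩ := hg.exists_cell hL hI hS h hB hd hd0 hj8 h1 h2 h3 hd' hd0'
    exact ⟨j', hmem.2 ⟨hj8', (hgood hB hd' hd0' hj8' h1 h2 h4).1 hg⟩, B, hB, hg, h1, h2, h3, h4⟩
  have huniq : ∀ {d d' d'' : ℕ}, d < 4 → d ≠ 0 → d' < 4 → ∀ {j j' j''}, j ∈ typeTwo m b d →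
      j' ∈ typeTwo m b d' → j'' ∈ typeTwo m b d' → Joined y w S d j d' j' →
      Joined y w S d j d' j'' → j' = j'' := fun hd hd0 hd' _ _ _ hj hj' hj'' h1 h2 =>
    Joined.unique hS h hd hd0 hd' (hmem.1 hj).1 (hmem.1 hj').1 (hmem.1 hj'').1 h1 h2
  have hsum : ∀ d < 4, d ≠ 0 → ∀ f : ℕ → ℕ,
      (∀ j ∈ typeTwo m b 1, f j ∈ typeTwo m b d ∧ Joined y w S 1 j d (f j)) → ∀ g : ℕ → ℕ,
      ∑ j ∈ typeTwo m b d, g j = ∑ j ∈ typeTwo m b 1, g (f j) := by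
    intro d hd hd0 f hf g
    symm
    refine Finset.sum_nbij f (fun j hj => (hf j hj).1) ?_ ?_ fun _ _ => rfl
    · intro j hj j' hj' hff
      have h1 := (hf j hj).2.symm
      have h2 := (hf j' hj').2.symm
      rw [← hff] at h2
      exact huniq (d'' := 0) hd hd0 (by norm_num) (hf j hj).1 hj hj' h1 h2
    · intro j hj
      obtain ⟨j', hj', hjj⟩ := htotal d hd hd0 1 (by norm_num) one_ne_zero j hj
      exact ⟨j', hj', huniq (d'' := 0) (by norm_num) one_ne_zero hd hj' (hf j' hj').1 hj (hf j' hj').2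
        hjj.symm⟩
  choose! f hf hfj using htotal 1 (by norm_num) one_ne_zero 2 (by norm_num) (by norm_num)
  have h3 : ∀ j ∈ typeTwo m b 1, j ^^^ f j ∈ typeTwo m b 3 ∧ Joined y w S 1 j 3 (j ^^^ f j) := by
    intro j hj
    have hj8 := (hmem.1 hj).1
    have hj8' := (hmem.1 (hf j hj)).1
    have hx8 := (xor_digits j hj8 _ hj8').1
    obtain ⟨B, hB, hg, h1, h2, h3, h4⟩ := hfj j hj
    have h5 := xor_mem10 h3 h4
    rw [xor_cells 1 (by norm_num) 2 (by norm_num) j hj8 _ hj8', show 1 ^^^ 2 = 3 by rfl] at h5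
    exact ⟨hmem.2 ⟨hx8, (hgood hB (by norm_num) (by norm_num) hx8 h1 h2 h5).1 hg⟩,
      B, hB, hg, h1, h2, h3, h5⟩
  have hs2 := hsum 2 (by norm_num) (by norm_num) f fun j hj => ⟨hf j hj, hfj j hj⟩
  have hs3 := hsum 3 (by norm_num) (by norm_num) _ h3
  refine typeTwo_check m hm b hb hb0 ⟨?_, ?_, fun t ht => ?_⟩
  · simpa using hs2 fun _ => 1
  · simpa using hs3 fun _ => 1
  · rw [hs2 (fun j => j / 2 ^ t), hs3 (fun j => j / 2 ^ t), ← Finset.sum_add_distrib,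
      ← Finset.sum_add_distrib]
    rw [← Nat.dvd_iff_mod_eq_zero]
    exact Finset.dvd_sum fun j hj => Nat.dvd_of_mod_eq_zero
      ((xor_digits j (hmem.1 hj).1 _ (hmem.1 (hf j hj)).1).2 t ht)

/-! ### The parameters `q = 2`, `t = 2`, `k = 4`, `n = 13` -/

/-- Multiplication by `x` on codes, where `x ^ 13 = x ^ 4 + x ^ 3 + x + 1`. -/
def step213 (c : ℕ) : ℕ := (2 * (c % 4096)) ^^^ (27 * (c / 4096))

/-- Logarithms to the base `x` in the field with `2 ^ 13` elements. -/
noncomputable def logTable213 : ℕ :=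
  tableOf step213 (fun i c => Nat.shiftLeft (Nat.sub 8190 i) (Nat.add 64 (Nat.mul 13 c))) 8191 1 0

/-- The logarithm of the element with the given code. -/
noncomputable def lg213 : ℕ → ℕ := entry 13 logTable213

/-- Codes of representatives of the colours. -/
def repTable213 : ℕ :=
  0x4581d00bb051426812f092848021e10e08083d01bc0d6069032c1900bd05c02dc1600af05702b01520a7051828413c09804a82500f407703981c80e207003701b40d6067033018c0c406002f81700b605a02b01540a2050027813809804b024812007e03e01e80e807203801b80c806002e01680a404e026012809004602100f007403801b00d006403001700b0054028013009004402000f007003401800b004801c00c005002000c002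

/-- The logarithm of the representative of a colour. -/
noncomputable def rep213 (c : ℕ) : ℕ := lg213 (entry 13 repTable213 c)

/-- The table with entries of `w` binary digits that are given by `f` for the six images, with logarithms
`a`, `b`, `-a`, `-b`, `b - a`, `a - b`, of the representative of each colour under `GL(2, 2)`, and for their images
under powers of the Frobenius map. The first argument of `f` is the number of steps from the image to the
representative. -/
noncomputable def orbitTable213 (w : ℕ) (f : ℕ → ℕ → ℕ) : ℕ :=
  tableOf (fun c => c) (fun i _ => forceN (fun r => forceN (fun s => forceN (fun a => forceN (fun b =>
    List.rec (motive := fun _ => ℕ) 0 (fun p _ m => Nat.add m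
      (Nat.shiftLeft (f (Nat.add p.1 (Nat.mod (Nat.sub 13 (Nat.mod i 13)) 13)) (Nat.div i 13))
        (Nat.add 64 (Nat.mul w (Nat.mod (Nat.mul p.2 s) 8191)))))
      [(0, a), (1, b), (1, Nat.sub 8191 a), (2, Nat.sub 8191 b), (2, Nat.add b (Nat.sub 8191 a)),
        (3, Nat.add a (Nat.sub 8191 b))]) (lg213 (Nat.xor r 1))) (lg213 r)) (Nat.pow 2 (Nat.mod i 13)))
    (entry 13 repTable213 (Nat.div i 13))) 1365 0 0

/-- The colours of the powers of `x`. -/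
noncomputable def colourTable213 : ℕ := orbitTable213 7 fun _ c => c

/-- The distances of the powers of `x` to the representatives of their colours. -/
noncomputable def distTable213 : ℕ := orbitTable213 4 fun d _ => d

/-- The numbers `2 ^ (64 + t)` for `t < 2048` have different residues `r` modulo `2053`; the entry number
`r` is `t`. -/
noncomputable def bitTable : ℕ :=
  tableOf (fun r => Nat.mod (Nat.mul 2 r) 2053)
    (fun i r => Nat.shiftLeft (Nat.sub 2047 i) (Nat.add 64 (Nat.mul 11 r))) 2048 (Nat.mod (Nat.pow 2 64) 2053) 0

/-- The colour of the line `⟨1, x ^ j⟩`. -/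
noncomputable def colour213 : ℕ → ℕ := entry 7 colourTable213

/-- The distance of `x ^ j` to the representative of its colour. -/
noncomputable def dist213 : ℕ → ℕ := entry 4 distTable213

set_option maxRecDepth 100000 in
theorem walkB213 : walkB step213 lg213 8191 1 0 = true := by decide +kernel

set_option maxRecDepth 100000 in
/-- The checks for the codes `c ≥ 2`. The two nested loops keep the depth of the recursion small. -/
theorem colourCheck213 : allB 91 (fun i => allB 90 fun k => colourCheck 2 8191 true lg213 colour213 dist213
    rep213 (Nat.add (Nat.add (Nat.mul 90 i) k) 2)) = true := by decide +kernel

/-- `ifZeroN m a b` is `a` if `m = 0`, and `b` otherwise. -/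
noncomputable def ifZeroN (m a b : ℕ) : ℕ := Nat.rec (motive := fun _ => ℕ) a (fun _ _ => b) m

/-- The set consisting of the colour of `x ^ d`. -/
noncomputable def colourBit213 (d : ℕ) : ℕ := Nat.shiftLeft 1 (colour213 d)

/-- The logarithm of a quotient modulo `2 ^ 13 - 1`, from the logarithms of numerator and denominator. -/
noncomputable def quot213 (j j' : ℕ) : ℕ := Nat.mod (Nat.add j (Nat.mul 8190 j')) 8191

/-- The logarithm of the element with code `4 e + y`, where the sum is taken bitwise. -/
noncomputable def logE213 (y e : ℕ) : ℕ := lg213 (Nat.xor (Nat.mul 4 e) y)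

/-- Adds the colour of `x ^ d` to the set `m` and continues with `k`, unless the colour belongs to `m`. -/
noncomputable def addColourB (d : ℕ) (k : ℕ → Bool) (m : ℕ) : Bool :=
  forceB (fun d => ifZero (Nat.land m (colourBit213 d)) (forceB k (Nat.lor m (colourBit213 d))) true) d

/-- Adds the colour of `x ^ d` to the set `m` and continues with `k`, unless the colour belongs to `m`. -/
noncomputable def addColourN (d : ℕ) (k : ℕ → ℕ) (m : ℕ) : ℕ :=
  forceN (fun d => ifZeroN (Nat.land m (colourBit213 d)) (forceN k (Nat.lor m (colourBit213 d)))
    (Nat.pow 2 105)) d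

/-- The logarithms of the quotients describing the six lines other than `⟨1, a⟩` in the space spanned
by `1`, `a`, `4 e`. -/
noncomputable def planeLogs213 (a e : ℕ) : List ℕ :=
  [quot213 (logE213 0 e) (lg213 1), quot213 (logE213 a e) (lg213 1),
    quot213 (logE213 0 e) (lg213 a), quot213 (logE213 1 e) (lg213 a),
    quot213 (logE213 0 e) (lg213 (Nat.xor a 1)), quot213 (logE213 1 e) (lg213 (Nat.xor a 1))]

/-- The set of colours of the lines described by `planeLogs213`, if these colours are different;
otherwise the set consisting of `105`, which is not a colour. -/
noncomputable def planeMask213 (a e : ℕ) : ℕ :=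
  List.rec (motive := fun _ => ℕ → ℕ) (fun m => m) (fun d _ k => addColourN d k) (planeLogs213 a e) 0

/-- The union of the sets `planeMask213 a e` for `lo ≤ e < lo + 2 ^ d`. -/
noncomputable def planeUnion213 (a d : ℕ) : ℕ → ℕ :=
  Nat.rec (motive := fun _ => ℕ → ℕ) (planeMask213 a)
    (fun d ih lo => Nat.lor (forceN ih lo) (forceN ih (Nat.add lo (Nat.pow 2 d)))) d

/-- The numbers `e` with `lo ≤ e < lo + 2 ^ d` such that `planeMask213 a e` contains `c`. -/
noncomputable def planesThrough213 (a c d : ℕ) : ℕ → ℕ :=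
  Nat.rec (motive := fun _ => ℕ → ℕ)
    (fun lo => ifZeroN (Nat.land (planeMask213 a lo) (Nat.shiftLeft 1 c)) 0 (Nat.shiftLeft 1 lo))
    (fun d ih lo => ifZeroN (Nat.land (planeUnion213 a (Nat.succ d) lo) (Nat.shiftLeft 1 c)) 0
      (Nat.lor (forceN ih lo) (forceN ih (Nat.add lo (Nat.pow 2 d))))) d

/-- The numbers `e < 2048` such that `planeMask213 a e` meets `m`. -/
noncomputable def planesMeeting213 (a m : ℕ) : ℕ :=
  Nat.rec (motive := fun _ => ℕ) 0 (fun c ih => ifZeroN (Nat.mod (Nat.shiftRight m c) 2) ih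
    (Nat.lor (forceN (fun c => planesThrough213 a c 11 0) c) ih)) 106

/-- The set of all numbers less than `2048`. -/
noncomputable def full213 : ℕ := Nat.sub (Nat.pow 2 2048) 1

/-- The numbers `e < 2048` such that `planeMask213 a e` is disjoint from `m`. -/
noncomputable def planesAvoiding213 (a m : ℕ) : ℕ := Nat.xor full213 (planesMeeting213 a m)

/-- The numbers `e < 2048` such that `planeMask213 a e` is disjoint from `planeMask213 a i`. -/
noncomputable def compatible213 (a i : ℕ) : ℕ := planesAvoiding213 a (planeMask213 a i)

/-- The set of all numbers less than `2048` whose binary digit `t` vanishes. -/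
noncomputable def digitZero (t : ℕ) : ℕ := Nat.div full213 (Nat.add (Nat.pow 2 (Nat.pow 2 t)) 1)

/-- The numbers less than `2048` that are at least `2 ^ (t + 1)` and whose binary digit `t` vanishes. -/
noncomputable def digitZeroAbove (t : ℕ) : ℕ :=
  Nat.shiftLeft (Nat.shiftRight (digitZero t) (Nat.pow 2 (Nat.succ t))) (Nat.pow 2 (Nat.succ t))

/-- The image of a set of numbers less than `2048` under changing the binary digit `t`. -/
noncomputable def flipDigit (t m : ℕ) : ℕ :=
  Nat.lor (Nat.land (Nat.shiftRight m (Nat.pow 2 t)) (digitZero t))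
    (Nat.shiftLeft (Nat.land m (digitZero t)) (Nat.pow 2 t))

/-- The image of a set of numbers less than `2048` under changing those of the first `n` binary digits
where `i` has the digit `1`. -/
noncomputable def translate (i n : ℕ) : ℕ → ℕ :=
  Nat.rec (motive := fun _ => ℕ → ℕ) (fun m => m)
    (fun t ih m => ih (ifZeroN (Nat.mod (Nat.shiftRight i t) 2) m (flipDigit t m))) n

/-- Moves a set by `64` digits, and fills these with digits depending on `s`. This makes the evaluation
faster, because numbers that agree in the last `64` digits are hard to tell apart for hash tables. -/
noncomputable def salted (s m : ℕ) : ℕ :=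
  Nat.add (Nat.shiftLeft m 64) (Nat.mod (Nat.mul s 1234567890123456789) 18446744073709551616)

/-- The number `m` without the last digit `1` among those from the digit `64` on. -/
noncomputable def dropBit (m : ℕ) : ℕ := Nat.land m (Nat.sub m 18446744073709551616)

/-- Checks `f` for the elements of a set with at most `n` elements, which is given by the digits of a
number from the digit `64` on. -/
noncomputable def bitsB (f : ℕ → Bool) (n : ℕ) : ℕ → Bool :=
  Nat.rec (motive := fun _ => ℕ → Bool) (fun m => Nat.beq (Nat.shiftRight m 64) 0)
    (fun _ ih m => ifZero (Nat.shiftRight m 64) true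
      (forceB (fun t => Bool.rec (motive := fun _ => Bool) false
          (Bool.rec (motive := fun _ => Bool) false (forceB ih (Nat.xor (dropBit m) t)) (f t))
          (Nat.beq (Nat.shiftLeft 1 (Nat.add 64 t)) (Nat.xor m (dropBit m))))
        (forceN (fun r => Nat.mod (entry 11 bitTable r) 2048) (Nat.mod (Nat.xor m (dropBit m)) 2053)))) n

/-- Adds the colours of the quotients of the elements with codes `4 j`, `4 j + 1`, `4 j + a`, `4 j + a + 1`
by an element with logarithm `l`. -/
noncomputable def addSkew213 (a j l : ℕ) (k : ℕ → Bool) : ℕ → Bool :=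
  addColourB (quot213 (logE213 0 j) l) (addColourB (quot213 (logE213 1 j) l)
    (addColourB (quot213 (logE213 a j) l) (addColourB (quot213 (logE213 (Nat.xor a 1) j) l) k)))

/-- Continues with `fin i j` if the colours of the lines spanned by `1`, `a`, `4 i`, `4 j` other than those
in the space spanned by `1`, `a`, `4 i` are different and do not belong to `m`. -/
noncomputable def pairB213 (a m : ℕ) (fin : ℕ → ℕ → Bool) (i j : ℕ) : Bool :=
  forceB (fun pj => forceB (fun pk => ifZero (Nat.land pj pk)
    (forceB (addSkew213 a j (logE213 0 i) (addSkew213 a j (logE213 1 i) (addSkew213 a j (logE213 a i)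
      (addSkew213 a j (logE213 (Nat.xor a 1) i) fun _ => fin i j)))) (Nat.lor m (Nat.lor pj pk))) true)
      (forceN (planeMask213 a) (Nat.xor i j))) (planeMask213 a j)

/-- The numbers `j` such that the planes of `j` and of its bitwise sum with `i` belong to `A` and are
compatible with the plane of `i`. The binary digit `t` of `i` is the first one, and that of `j` is zero. -/
noncomputable def partners213 (a A t i : ℕ) : ℕ :=
  Nat.land (digitZeroAbove t) (Nat.land (Nat.land A (compatible213 a i))
    (translate i 11 (Nat.land A (compatible213 a i))))

/-- Checks `fin i j` for all `j` in `partners213 a A t i` such that the lines of the space spanned by `1`, `a`, `4 i`,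
`4 j` have different colours that do not belong to `m`. -/
noncomputable def leafB213 (a m A : ℕ) (fin : ℕ → ℕ → Bool) (t i : ℕ) : Bool :=
  forceB (fun m => forceB (bitsB (pairB213 a m fin i) 2048)
    (salted (Nat.add (Nat.mul m 2048) i) (partners213 a A t i))) (Nat.lor m (planeMask213 a i))

/-- Checks `fin i j` for all spaces spanned by `1`, `a`, `4 i`, `4 j` whose lines have different colours that
do not belong to `m`, where `lo ≤ i < hi`, the number `i` has `t + 1` binary digits, `j` has more, and the binary
digit `t` of `j` is zero. -/
noncomputable def searchB213 (a : ℕ) (fin : ℕ → ℕ → Bool) (t lo hi m : ℕ) : Bool :=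
  forceB (fun A => forceB (bitsB (leafB213 a (Nat.lor m (colourBit213 (lg213 a))) A fin t) 2048)
    (salted (Nat.add (Nat.mul m 2048) t) (Nat.land A (Nat.sub (Nat.pow 2 hi) (Nat.pow 2 lo)))))
    (planesAvoiding213 a (Nat.lor (Nat.lor m (colourBit213 (lg213 a))) (Nat.pow 2 105)))

/-- The codes `2048 i + j` of the spaces spanned by `1`, `x`, `4 i`, `4 j`, where `x` has the code `174`, whose lines
have different colours, with `512 ≤ i`. -/
def blocks213_nine : List ℕ :=
  [1049809, 1049917, 1053801, 1060351, 1061958, 1063954, 1068158, 1070347, 1070378, 1072146, 1074472,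
    1078418, 1078682, 1078714, 1084785, 1086867, 1088722, 1088779, 1090688, 1090958, 1091036, 1092706,
    1092802, 1092840, 1093044, 1094923, 1098945, 1101130, 1105056, 1107165, 1107239, 1111505, 1113239,
    1113360, 1115190, 1115251, 1115626, 1117515, 1119258, 1119341, 1119408, 1119411, 1119472, 1121372,
    1123343, 1125633, 1125863, 1127778, 1129532, 1129553, 1135679, 1135907, 1135947, 1143936, 1147913,
    1147917, 1148309, 1152343, 1154428, 1156242, 1156248, 1158411, 1158568, 1160201, 1162693, 1166596,
    1166675, 1166739, 1166778, 1170577, 1170801, 1172674, 1172704, 1176736, 1176852, 1178629, 1178737,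
    1179099, 1181002, 1183187, 1184960, 1184997, 1186853, 1187320, 1191127, 1195507, 1199373, 1203642,
    1205460, 1211550, 1211575, 1211843, 1213558, 1213846, 1213896, 1215634, 1217655, 1219757, 1221637,
    1221682, 1221750, 1221901, 1225730, 1226216, 1230088, 1230201, 1230243, 1230310, 1232099, 1232218,
    1232265, 1232272, 1232348, 1233998, 1238347, 1240548, 1242261, 1242286, 1242455, 1244516, 1244630,
    1246439, 1246567, 1248345, 1248666, 1250310, 1250384, 1250557, 1250582, 1250772, 1254639, 1256556,
    1260707, 1260769, 1265111, 1266843, 1267075, 1271236, 1271238, 1275124, 1275214, 1275343, 1281487,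
    1283411, 1285164, 1285183, 1289679, 1291315, 1291326, 1291475, 1295465, 1295491, 1297518, 1301722,
    1303560, 1303698, 1303766, 1305791, 1306045, 1307931, 1310044, 1311823, 1312214, 1314303, 1316037,
    1319973, 1320070, 1330230, 1330513, 1330611, 1330638, 1332455, 1334510, 1336463, 1336617, 1336827,
    1340878, 1342529, 1342807, 1344787, 1344949, 1346846, 1348884, 1350887, 1352805, 1352873, 1354778,
    1354886, 1355200, 1356860, 1356955, 1363131, 1365043, 1367329, 1367341, 1375522, 1375672, 1379613,
    1379645, 1379688, 1381832, 1385568, 1385682, 1385819, 1387890, 1397760, 1397814, 1397822, 1397917,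
    1398034, 1398134, 1400179, 1403955, 1406130, 1406145, 1406235, 1414473, 1416572, 1416635, 1418282,
    1418748, 1422505, 1426538, 1426558, 1426695, 1426874, 1428645, 1434670, 1435036, 1436754, 1436832,
    1438988, 1443159, 1445021, 1447302, 1453510, 1455138, 1455416, 1457196, 1459495, 1459501, 1459642,
    1459701, 1461284, 1463591, 1463605, 1467422, 1467589, 1467667, 1467702, 1467715, 1469446, 1471577,
    1471603, 1473790, 1477930, 1477949, 1479684, 1480067, 1481742, 1482086, 1482203, 1483973, 1486126,
    1486215, 1486302, 1488196, 1488205, 1492026, 1492050, 1492445, 1494316, 1498175, 1498239, 1500653,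
    1506440, 1506631, 1508414, 1508526, 1508736, 1510649, 1510829, 1510831, 1512882, 1514971, 1518909,
    1519075, 1524788, 1527094, 1527161, 1528924, 1529109, 1530990, 1531218, 1535343, 1537043, 1539217,
    1545669, 1547461, 1547520, 1551465, 1551737, 1553648, 1553691, 1555765, 1555828, 1555915, 1557606,
    1557850, 1559579, 1559582, 1561886, 1564123, 1567823, 1568178, 1572170, 1574003, 1574089, 1574199,
    1578108, 1580068, 1582226, 1584258, 1586415, 1586492, 1588343, 1588355, 1588371, 1588615, 1598758,
    1598930, 1603070, 1611114, 1614999, 1615138, 1615357, 1619182, 1625097, 1625262, 1625567, 1627283,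
    1627645, 1631294, 1631379, 1633692, 1633778, 1635581, 1637867, 1643976, 1643977, 1645761, 1645844,
    1647740, 1647755, 1647907, 1648078, 1651803, 1652196, 1656032, 1656079, 1658209, 1660213, 1660266,
    1674277, 1676451, 1676728, 1678554, 1678593, 1686602, 1688605, 1692675, 1693137, 1693159, 1694850,
    1698870, 1698932, 1699117, 1699221, 1700987, 1701287, 1702941, 1703406, 1711140, 1711196, 1711244,
    1711555, 1713372, 1713382, 1713485, 1713600, 1715477, 1723657, 1725635, 1725829, 1730036, 1731851,
    1733953, 1734049, 1737946, 1739899, 1740083, 1740138, 1744270, 1748368, 1754380, 1754503, 1756253,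
    1758443, 1760703, 1760710, 1762404, 1762578, 1764534, 1766496, 1766626, 1768520, 1768780, 1770557,
    1770647, 1770756, 1772836, 1774812, 1779049, 1780897, 1781165, 1782802, 1786917, 1787026, 1787143,
    1789264, 1791274, 1795300, 1797550, 1801358, 1803561, 1805427, 1809690, 1811585, 1811752, 1811870,
    1815809, 1817719, 1817912, 1819656, 1819659, 1819707, 1819776, 1819933, 1823891, 1826182, 1826218,
    1826272, 1830050, 1830232, 1832098, 1836253, 1836297, 1836338, 1840280, 1840311, 1840467, 1846512,
    1848356, 1848667, 1848811, 1852607, 1858651, 1860742, 1860905, 1861089, 1867055, 1867081, 1867193,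
    1868859, 1877108, 1879069, 1879303, 1881200, 1881519, 1887262, 1889748, 1893867, 1895533, 1895733,
    1897636, 1899628, 1899887, 1903637, 1909951, 1910237, 1911859, 1913974, 1920109, 1920406, 1924397,
    1924476, 1926206, 1926218, 1930312, 1940611, 1940878, 1944635, 1944926, 1944936, 1946889, 1947060,
    1948937, 1949103, 1957108, 1958912, 1963015, 1963042, 1965505, 1969192, 1969349, 1969404, 1975306,
    1975388, 1975550, 1975617, 1977705, 1983801, 1983852, 1985623, 1987901, 1988019, 1989704, 1989872,
    1989877, 1994152, 1994167, 1995895, 1997880, 2000005, 2000019, 2000082, 2000243, 2008094, 2008219,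
    2008301, 2010261, 2016351, 2016368, 2016493, 2016765, 2018382, 2018500, 2018583, 2024645, 2035011,
    2042888, 2044949, 2045094, 2045202, 2046998, 2047031, 2047356, 2047391, 2049074, 2049483, 2051084,
    2051494, 2055672, 2059391, 2059654, 2059762, 2059773, 2065644, 2073952, 2077758, 2078078, 2078193,
    2081985, 2082289, 2086195, 2086219, 2086275, 2090109, 2090463]

/-- The codes `2048 i + j` of the spaces spanned by `1`, `x`, `4 i`, `4 j`, where `x` has the code `174`, whose lines
have different colours, with `256 ≤ i < 512`. -/
def blocks213_eight : List ℕ :=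
  [525873, 525938, 526011, 527944, 527950, 531505, 532134, 533045, 533225, 534162, 535714, 535749,
    536079, 539291, 543352, 543376, 544418, 544488, 545891, 546382, 546552, 549627, 550073, 552172,
    553634, 557676, 559660, 559777, 560362, 560806, 562257, 570492, 572028, 574469, 574514, 575035,
    575227, 576075, 576076, 577104, 582190, 582291, 583302, 584238, 584882, 590506, 591054, 591447,
    594530, 595462, 596525, 596569, 597005, 599155, 600718, 601739, 601784, 605300, 608819, 609019,
    609499, 612004, 613463, 614978, 615446, 617563, 618045, 620199, 620227, 621792, 622099, 623728,
    624318, 626219, 626272, 627366, 627719, 627752, 627949, 628319, 631470, 633862, 635399, 638093,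
    641758, 643672, 644168, 644230, 644826, 646856, 646910, 647896, 648258, 648328, 648384, 658578,
    659044, 659170, 663167, 664589, 664747, 666364, 666720, 669313, 672386, 672890, 674971, 676505,
    677401, 684554, 686603, 686734, 687246, 688813, 689308, 689406, 689903, 697071, 697478, 697518,
    697869, 698080, 702172, 702995, 703203, 703630, 707187, 707609, 708286, 708343, 709242, 710296,
    710338, 711783, 714260, 715361, 715952, 719413, 719571, 722030, 722495, 726043, 726749, 727781,
    728200, 728309, 728734, 731659, 732269, 732926, 734399, 736298, 736302, 738843, 739862, 740049,
    742003, 742976, 743007, 744058, 744657, 746067, 746511, 746541, 747158, 748669, 748765, 750232,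
    750626, 750738, 752221, 755252, 755303, 755374, 755420, 756447, 758348, 758410, 758492, 760968,
    762558, 763440, 764572, 765094, 765117, 765608, 767127, 768637, 769562, 770666, 771137, 771237,
    773204, 773687, 773800, 775206, 775910, 777402, 778760, 778836, 780883, 781007, 781563, 786140,
    790250, 791717, 795262, 795384, 795671, 799299, 802466, 803470, 803549, 803962, 805398, 805449,
    805963, 808189, 808567, 808625, 810007, 810646, 815861, 817770, 818416, 820350, 820478, 821833,
    821898, 821937, 822492, 822496, 822902, 823022, 823823, 823926, 824961, 826607, 827993, 828046,
    830523, 830538, 830563, 832538, 832585, 832737, 835225, 836648, 845494, 847410, 848438, 849542,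
    857625, 857713, 865900, 866032, 870980, 871483, 871600, 872025, 872172, 875260, 876051, 879630,
    879676, 880128, 880220, 881158, 881237, 881298, 881301, 881714, 881844, 883342, 884243, 887890,
    888453, 889496, 890074, 891645, 892609, 895497, 896203, 896230, 896571, 898200, 898213, 898636,
    900142, 900162, 900678, 905973, 907930, 908310, 908328, 908986, 912407, 914062, 914085, 914617,
    914985, 915197, 916123, 917035, 917150, 919266, 921240, 922112, 923232, 924278, 924369, 926322,
    926823, 928270, 929288, 929378, 930520, 930523, 931412, 931421, 933079, 939092, 939747, 941056,
    945248, 945699, 945903, 950008, 952981, 953009, 953393, 953882, 953890, 955595, 956068, 957112,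
    957670, 958172, 959116, 959524, 961234, 962148, 965350, 967367, 967857, 973374, 973509, 977655,
    978173, 978452, 978574, 980156, 980683, 981597, 982210, 983611, 984077, 984102, 984668, 984740,
    984755, 985742, 986139, 986858, 990426, 990462, 993947, 996481, 996936, 999060, 999093, 1000031,
    1000085, 1001111, 1001200, 1002150, 1004210, 1004259, 1005093, 1005135, 1006627, 1006754, 1007344,
    1010249, 1010383, 1010833, 1011286, 1012450, 1014476, 1014987, 1015502, 1015540, 1016368, 1016898,
    1019056, 1019594, 1019630, 1020642, 1021021, 1023148, 1023167, 1023533, 1024639, 1025082, 1025608,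
    1026702, 1027225, 1027284, 1027709, 1027750, 1028735, 1031284, 1031908, 1033978, 1035484, 1036994,
    1037433, 1037452, 1043092, 1044105]

/-- The codes `2048 i + j` of the spaces spanned by `1`, `x`, `4 i`, `4 j`, where `x` has the code `174`, whose lines
have different colours, with `128 ≤ i < 256`. -/
def blocks213_seven : List ℕ :=
  [262678, 262995, 263521, 263806, 270631, 271361, 271887, 272161, 275065, 275459, 275466, 276745,
    278064, 279387, 280397, 280402, 281701, 286987, 287529, 288082, 289348, 290062, 290376, 291083,
    292623, 293421, 294265, 298297, 298773, 299593, 299804, 300821, 302668, 305488, 306531, 308340,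
    308576, 310282, 310391, 311581, 312638, 312926, 316222, 316530, 317814, 318755, 319781, 320512,
    322121, 322836, 322917, 324138, 326003, 326951, 327000, 327276, 327284, 328564, 329219, 330607,
    330754, 333086, 334719, 335631, 336498, 338198, 338749, 342293, 342346, 346896, 347005, 347165,
    347399, 347729, 348001, 349215, 349274, 350477, 352054, 352058, 353115, 353348, 354653, 354846,
    355959, 356901, 356939, 357652, 359185, 359981, 363549, 364362, 365095, 365409, 366126, 367638,
    367734, 369208, 369276, 369720, 370294, 371206, 371217, 371284, 372565, 372999, 374341, 375159,
    376422, 377384, 379402, 379704, 379710, 379913, 379974, 381763, 382293, 382823, 387373, 387682,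
    387928, 388671, 388735, 390234, 391543, 394081, 394333, 394754, 394794, 396362, 397114, 397644,
    398927, 401180, 402812, 403778, 404546, 404821, 405053, 405366, 406817, 407370, 410165, 410192,
    411004, 412270, 413238, 414028, 414838, 416536, 418579, 419613, 421137, 421640, 422738, 423229,
    426300, 426833, 429093, 431168, 432676, 432899, 433162, 433679, 433985, 434442, 434464, 437075,
    437298, 437353, 443169, 443513, 446243, 447314, 447500, 453432, 453496, 454201, 454491, 455227,
    456561, 457014, 457770, 459017, 460055, 460105, 460402, 460622, 462412, 464482, 465928, 467237,
    467535, 468483, 468585, 469358, 471308, 471625, 471885, 472079, 473359, 475740, 475981, 476506,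
    476767, 476793, 477714, 479575, 480345, 481654, 482083, 482589, 482927, 483611, 484873, 484918,
    486207, 486401, 487745, 487777, 490830, 490867, 492312, 492915, 493110, 493405, 494944, 495193,
    495205, 496138, 496471, 498516, 498964, 499513, 500278, 501074, 504128, 504389, 505127, 506424,
    507499, 508262, 509214, 510264, 510572, 511034, 511038, 511577, 511755, 512558, 512884, 513615,
    513871, 514832, 514926, 515439, 515663, 519687, 519769, 520043, 523106, 523293]

/-- The codes `2048 i + j` of the spaces spanned by `1`, `x`, `4 i`, `4 j`, where `x` has the code `174`, whose lines
have different colours, with `i < 128`. -/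
def blocks213_small : List ℕ :=
  [2550, 2922, 3586, 3770, 4557, 4981, 5456, 7673, 7725, 8052, 8537, 9914, 10825, 11392, 13137, 13363,
    14032, 14155, 18980, 19009, 19207, 20208, 21556, 21744, 23238, 23732, 23767, 23812, 26643, 26773,
    26978, 28177, 34176, 34185, 39847, 40866, 41447, 42378, 42723, 43431, 45415, 46761, 47333, 47621,
    47625, 47950, 48780, 48970, 49920, 50470, 50919, 51535, 51694, 51936, 52362, 52719, 53871, 55119,
    55149, 57376, 57796, 58026, 58496, 58722, 59982, 60390, 60558, 61795, 62181, 62473, 65820, 66509,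
    66638, 66757, 66908, 68504, 68626, 68674, 70288, 73873, 74186, 74973, 75664, 76936, 77579, 78033,
    78224, 78751, 79253, 79696, 79965, 81664, 83025, 83077, 83598, 83728, 86864, 87040, 87966, 88331,
    88898, 90630, 91219, 92059, 92126, 92619, 92879, 93324, 93599, 93902, 96513, 96728, 100563, 101198,
    101381, 101516, 101636, 102103, 103496, 103758, 104274, 104328, 104542, 105550, 107421, 112705,
    114432, 117850, 118490, 119385, 119510, 124096, 124683, 134025, 134412, 135591, 135815, 137136,
    137731, 137910, 138912, 141881, 142720, 142987, 144920, 148653, 149029, 149155, 152577, 154030,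
    154427, 155067, 155452, 155784, 155920, 155943, 156853, 156939, 157363, 157611, 160137, 160417,
    161933, 162061, 162233, 162729, 163716, 165155, 167174, 168454, 171701, 172438, 172572, 172817,
    173468, 173877, 174003, 176566, 178701, 179376, 180395, 181806, 182812, 184126, 185524, 186896,
    191413, 192926, 193069, 193815, 193962, 194341, 194968, 195510, 195750, 199712, 200115, 200586,
    204599, 208164, 208421, 209582, 209833, 213543, 213546, 215213, 220214, 224432, 224789, 225414,
    227096, 227217, 227240, 229551, 229654, 229666, 230023, 230170, 233002, 233095, 233242, 233634,
    233775, 233993, 234252, 235142, 236551, 236800, 237497, 238857, 239886, 240028, 240420, 240549,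
    240698, 242706, 243072, 243132, 243353, 246586, 246802, 247607, 247993, 248578, 248882, 249095,
    255777, 257295, 258475, 259514, 259593]

/-- Tells whether `c` belongs to the list. -/
noncomputable def memB (c : ℕ) (l : List ℕ) : Bool :=
  List.rec (motive := fun _ => Bool) false
    (fun d _ ih => Bool.rec (motive := fun _ => Bool) ih true (Nat.beq d c)) l

/-- Checks `p` for all elements of the list. -/
noncomputable def allListB (p : ℕ → Bool) (l : List ℕ) : Bool :=
  List.rec (motive := fun _ => Bool) true
    (fun d _ ih => Bool.rec (motive := fun _ => Bool) false ih (forceB p d)) l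

/-- The logarithms of the quotients describing the 16 lines in the space spanned by `1`, `a`, `4 i`, `4 j` that
meet the planes through `⟨1, a⟩` in points. -/
noncomputable def skewLogs213 (a i j : ℕ) : List ℕ :=
  let l := logE213
  [quot213 (l 0 j) (l 0 i), quot213 (l 1 j) (l 0 i), quot213 (l a j) (l 0 i),
    quot213 (l (Nat.xor a 1) j) (l 0 i), quot213 (l 0 j) (l 1 i), quot213 (l 1 j) (l 1 i),
    quot213 (l a j) (l 1 i), quot213 (l (Nat.xor a 1) j) (l 1 i), quot213 (l 0 j) (l a i),
    quot213 (l 1 j) (l a i), quot213 (l a j) (l a i), quot213 (l (Nat.xor a 1) j) (l a i),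
    quot213 (l 0 j) (l (Nat.xor a 1) i), quot213 (l 1 j) (l (Nat.xor a 1) i),
    quot213 (l a j) (l (Nat.xor a 1) i), quot213 (l (Nat.xor a 1) j) (l (Nat.xor a 1) i)]

/-- The logarithms of the quotients describing the 35 lines of the space spanned by `1`, `a`, `4 i`, `4 j`. -/
noncomputable def blockLogs213 (a i j : ℕ) : List ℕ :=
  lg213 a :: (planeLogs213 a i ++ planeLogs213 a j ++ planeLogs213 a (Nat.xor i j) ++ skewLogs213 a i j)

/-- The set of colours of the lines of the space spanned by `1`, `a`, `4 i`, `4 j`. -/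
noncomputable def blockMask213 (a i j : ℕ) : ℕ :=
  List.rec (motive := fun _ => ℕ) 0 (fun d _ m => Nat.lor (forceN colourBit213 d) m) (blockLogs213 a i j)

/-- The first of the given elements `a` such that the colour of the line `⟨1, a⟩` does not belong to `m`. -/
noncomputable def firstRow213 (rows : List ℕ) (m : ℕ) : ℕ :=
  List.rec (motive := fun _ => ℕ) 0
    (fun a _ ih => ifZeroN (Nat.land m (forceN colourBit213 (lg213 a))) a ih) rows

/-- Elements `a` such that the set of colours of a block through `⟨1, x⟩`, where `x` has the code `174`, does not
contain all colours of the lines `⟨1, a⟩`. -/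
def rows213 : List ℕ := [1126, 38, 454, 94, 6]

/-- Checks that no space through `⟨1, a⟩` has lines with different colours that do not belong to `m`. -/
noncomputable def noBlockB213 (a m : ℕ) : Bool :=
  allB 10 fun t => forceB (fun t =>
    searchB213 a (fun _ _ => false) t (Nat.pow 2 t) (Nat.pow 2 (Nat.succ t)) m) t

/-- For the set `m` of colours of the space with the given code, and the first row `a` whose colour does not belong
to `m`: if `a` is one of the given rows, then `noBlockB213` holds. -/
noncomputable def secondB213 (rows : List ℕ) (code : ℕ) : Bool :=
  forceB (fun m => forceB (fun a => Bool.rec (motive := fun _ => Bool) true (noBlockB213 a m) (memB a rows))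
    (firstRow213 rows213 m)) (forceN (fun i => forceN (blockMask213 174 i) (Nat.mod code 2048)) (Nat.div code 2048))

/-- Whether all colours of the rows belong to the set of colours of the space with the given code. -/
noncomputable def rowExistsB213 (code : ℕ) : Bool :=
  Nat.ble 1 (firstRow213 rows213
    (forceN (fun i => forceN (blockMask213 174 i) (Nat.mod code 2048)) (Nat.div code 2048)))

/-- The check used for the first block: its code belongs to the list. -/
noncomputable def listedB213 (l : List ℕ) (i j : ℕ) : Bool :=
  forceB (fun c => memB c l) (Nat.add (Nat.mul 2048 i) j)

set_option maxRecDepth 100000 in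
theorem search213_nine : searchB213 174 (listedB213 blocks213_nine) 9 512 1024 0 = true := by decide +kernel

set_option maxRecDepth 100000 in
theorem search213_eight : searchB213 174 (listedB213 blocks213_eight) 8 256 512 0 = true := by decide +kernel

set_option maxRecDepth 100000 in
theorem search213_seven : searchB213 174 (listedB213 blocks213_seven) 7 128 256 0 = true := by decide +kernel

set_option maxRecDepth 100000 in
theorem search213_small : allB 7 (fun t => forceB (fun t => searchB213 174 (listedB213 blocks213_small) t
    (Nat.pow 2 t) (Nat.pow 2 (Nat.succ t)) 0) t) = true := by decide +kernel

set_option maxRecDepth 100000 in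
theorem second213_first_row_nine : allListB (secondB213 [1126]) blocks213_nine = true := by decide +kernel

set_option maxRecDepth 100000 in
theorem second213_first_row : allListB (secondB213 [1126]) (blocks213_eight ++ blocks213_seven ++ blocks213_small) = true := by
  decide +kernel

set_option maxRecDepth 100000 in
theorem second213_second_row : allListB (secondB213 [38])
    (blocks213_nine ++ blocks213_eight ++ blocks213_seven ++ blocks213_small) = true := by decide +kernel

set_option maxRecDepth 100000 in
theorem second213_other_rows : allListB (secondB213 [454, 94, 6])
    (blocks213_nine ++ blocks213_eight ++ blocks213_seven ++ blocks213_small) = true := by decide +kernel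

set_option maxRecDepth 100000 in
theorem rowExists213 : allListB rowExistsB213
    (blocks213_nine ++ blocks213_eight ++ blocks213_seven ++ blocks213_small) = true := by decide +kernel

end QSteiner

namespace QSteiner

/-! ### Soundness of the search for blocks -/

set_option maxRecDepth 100000 in
theorem colour213_ne : allB 8191 (fun d => Bool.not (Nat.beq (colour213 d) 105)) = true := by decide +kernel

set_option exponentiation.threshold 2048 in
theorem full213_eq {n : ℕ} (hn : n = 2048) : full213 = Nat.sub (Nat.pow 2 n) 1 := by
  delta full213
  exact congrArg (fun n => Nat.sub (Nat.pow 2 n) 1) hn.symm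

attribute [local irreducible] lg213 colour213 full213

theorem ifZeroN_eq (m a b : ℕ) : ifZeroN m a b = if m = 0 then a else b := by
  cases m <;> rfl

theorem land_colourBit_eq_zero {m d : ℕ} :
    m &&& colourBit213 d = 0 ↔ m.testBit (colour213 d) = false := by
  rw [show colourBit213 d = 1 <<< colour213 d from rfl, Nat.one_shiftLeft, Nat.and_two_pow]
  cases m.testBit (colour213 d) <;> simp

theorem testBit_lor_colourBit (m d c : ℕ) : (m ||| colourBit213 d).testBit c = true ↔
    m.testBit c = true ∨ colour213 d = c := by
  rw [show colourBit213 d = 1 <<< colour213 d from rfl, Nat.testBit_or, Nat.one_shiftLeft,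
    Nat.testBit_two_pow, Bool.or_eq_true, decide_eq_true_iff]

/-- The logarithms in `l` have different colours, which do not belong to `m`. -/
def IsRainbow (m : ℕ) (l : List ℕ) : Prop :=
  (l.map colour213).Nodup ∧ ∀ d ∈ l, m.testBit (colour213 d) = false

theorem IsRainbow.cons {m d : ℕ} {l : List ℕ} (h : IsRainbow m (d :: l)) :
    m.testBit (colour213 d) = false ∧ IsRainbow (m ||| colourBit213 d) l := by
  obtain ⟨h1, h2⟩ := h
  rw [List.map_cons, List.nodup_cons] at h1
  refine ⟨h2 d (by simp), h1.2, fun e he => ?_⟩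
  rw [← Bool.not_eq_true, testBit_lor_colourBit, h2 e (by simp [he])]
  rintro (h | h)
  · exact absurd h (by decide)
  · exact h1.1 (h ▸ List.mem_map_of_mem he)

theorem IsRainbow.of_sublist {m : ℕ} {l l' : List ℕ} (h : IsRainbow m l) (hl : l'.Sublist l) :
    IsRainbow m l' :=
  ⟨h.1.sublist (hl.map _), fun d hd => h.2 d (hl.subset hd)⟩

theorem foldr_addColourB {l : List ℕ} {b : Bool} {m : ℕ}
    (h : l.foldr addColourB (fun _ => b) m = true) (hl : IsRainbow m l) : b = true := by
  induction l generalizing m with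
  | nil => exact h
  | cons d l ih =>
    obtain ⟨h0, hl⟩ := hl.cons
    rw [List.foldr_cons, addColourB, forceB_eq, ifZero_eq, forceB_eq] at h
    rw [if_pos (show m.land _ = 0 from land_colourBit_eq_zero.2 h0)] at h
    exact ih h hl

theorem foldr_addColourN {l : List ℕ} {m : ℕ} (hl : IsRainbow m l) (c : ℕ) :
    (l.foldr addColourN (fun m => m) m).testBit c = true ↔
      m.testBit c = true ∨ ∃ d ∈ l, colour213 d = c := by
  induction l generalizing m with
  | nil => simp
  | cons d l ih =>
    obtain ⟨h0, hl⟩ := hl.cons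
    rw [List.foldr_cons, addColourN, forceN_eq, ifZeroN_eq, forceN_eq,
      if_pos (show m.land _ = 0 from land_colourBit_eq_zero.2 h0)]
    refine (ih hl).trans ?_
    rw [testBit_lor_colourBit]
    simp [or_assoc]

theorem testBit_planeMask213 {a e m : ℕ} (h : IsRainbow m (planeLogs213 a e)) (c : ℕ) :
    (planeMask213 a e).testBit c = true ↔ ∃ d ∈ planeLogs213 a e, colour213 d = c := by
  have h0 : IsRainbow 0 (planeLogs213 a e) := ⟨h.1, fun d _ => Nat.zero_testBit _⟩
  have := foldr_addColourN h0 c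
  rw [Nat.zero_testBit] at this
  refine Iff.trans ?_ (this.trans (by simp))
  rfl

theorem land_eq_zero_of_testBit {a b : ℕ} (h : ∀ c, a.testBit c = true → b.testBit c = false) :
    a &&& b = 0 := by
  by_contra h0
  obtain ⟨c, h1, h2⟩ := exists_testBit_of_land_ne_zero h0
  rw [h c h1] at h2
  exact absurd h2 (by decide)

theorem testBit_one_shiftLeft {c e : ℕ} : (Nat.shiftLeft 1 c).testBit e = true ↔ c = e := by
  rw [show Nat.shiftLeft 1 c = 1 <<< c from rfl, Nat.one_shiftLeft, Nat.testBit_two_pow,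
    decide_eq_true_iff]

theorem testBit_of_planesThrough213 {a c e : ℕ} : ∀ {d lo : ℕ},
    (planesThrough213 a c d lo).testBit e = true → (planeMask213 a e).testBit c = true
  | 0, lo, h => by
    have h' : (ifZeroN (Nat.land (planeMask213 a lo) (Nat.shiftLeft 1 c)) 0
      (Nat.shiftLeft 1 lo)).testBit e = true := h
    rw [ifZeroN_eq] at h'
    split_ifs at h' with h0
    · rw [Nat.zero_testBit] at h'
      exact absurd h' (by decide)
    · obtain rfl := testBit_one_shiftLeft.1 h'
      obtain ⟨c', h1, h2⟩ := exists_testBit_of_land_ne_zero h0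
      rwa [← testBit_one_shiftLeft.1 h2] at h1
  | d + 1, lo, h => by
    have h' : (ifZeroN (Nat.land (planeUnion213 a (Nat.succ d) lo) (Nat.shiftLeft 1 c)) 0
      (Nat.lor (forceN (planesThrough213 a c d) lo)
        (forceN (planesThrough213 a c d) (Nat.add lo (Nat.pow 2 d))))).testBit e = true := h
    rw [ifZeroN_eq, forceN_eq, forceN_eq] at h'
    split_ifs at h' with h0
    · rw [Nat.zero_testBit] at h'
      exact absurd h' (by decide)
    · change Nat.testBit (_ ||| _) e = true at h'
      rw [Nat.testBit_or, Bool.or_eq_true] at h'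
      exact h'.elim testBit_of_planesThrough213 testBit_of_planesThrough213

theorem testBit_of_planesMeeting213 {a m e : ℕ} (h : (planesMeeting213 a m).testBit e = true) :
    ∃ c, m.testBit c = true ∧ (planeMask213 a e).testBit c = true := by
  rw [planesMeeting213] at h
  generalize 106 = n at h
  induction n with
  | zero => exact absurd ((Nat.zero_testBit e).symm.trans h) (by decide)
  | succ c ih =>
    dsimp only at h
    rw [ifZeroN_eq, forceN_eq] at h
    split_ifs at h with h0
    · exact ih h
    · change Nat.testBit (_ ||| _) e = true at h
      rw [Nat.testBit_or, Bool.or_eq_true] at h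
      refine h.elim (fun h => ⟨c, ?_, testBit_of_planesThrough213 h⟩) ih
      have h1 : (m >>> c) % 2 ≠ 0 := h0
      rw [Nat.testBit_eq_decide_div_mod_eq, decide_eq_true_iff, ← Nat.shiftRight_eq_div_pow]
      omega

theorem testBit_ones (n i : ℕ) : (Nat.sub (Nat.pow 2 n) 1).testBit i = decide (i < n) := by
  rw [Nat.sub_eq, Nat.pow_eq, Nat.testBit_two_pow_sub_one]

theorem testBit_planesAvoiding213 {a m e : ℕ} (he : e < 2048)
    (h : ∀ c, (planeMask213 a e).testBit c = true → m.testBit c = false) :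
    (planesAvoiding213 a m).testBit e = true := by
  change Nat.testBit (_ ^^^ _) e = true
  obtain ⟨n, hn⟩ : ∃ n, n = 2048 := ⟨_, rfl⟩
  rw [full213_eq hn, Nat.testBit_xor, testBit_ones, decide_eq_true (hn.symm ▸ he), Bool.true_xor, Bool.not_eq_true',
    ← Bool.not_eq_true]
  intro h1
  obtain ⟨c, h2, h3⟩ := testBit_of_planesMeeting213 h1
  rw [h c h3] at h2
  exact absurd h2 (by decide)

/-- The number with `K` blocks of `2 ^ (t + 1)` binary digits, in each of which the lower half consists of
ones. -/
def halfBlocks (t : ℕ) : ℕ → ℕ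
  | 0 => 0
  | K + 1 => 2 ^ 2 ^ (t + 1) * halfBlocks t K + (2 ^ 2 ^ t - 1)

theorem halfBlocks_mul (t K : ℕ) : (2 ^ 2 ^ t + 1) * halfBlocks t K + 1 = 2 ^ (2 ^ (t + 1) * K) := by
  induction K with
  | zero => simp [halfBlocks]
  | succ K ih =>
    obtain ⟨s, hs⟩ : ∃ s, 2 ^ 2 ^ t = s + 1 := ⟨_, (Nat.succ_pred_eq_of_pos (by positivity)).symm⟩
    have h2 : 2 ^ 2 ^ (t + 1) = (s + 1) * (s + 1) := by rw [pow_succ, pow_mul, hs, sq]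
    rw [mul_add, mul_one, pow_add, ← ih, halfBlocks, h2, hs, Nat.add_sub_cancel]
    ring

theorem testBit_halfBlocks {t : ℕ} : ∀ {K j : ℕ}, j < 2 ^ (t + 1) * K →
    (halfBlocks t K).testBit j = !j.testBit t
  | 0, j, h => by simp at h
  | K + 1, j, h => by
    have h2 : 2 ^ (t + 1) = 2 * 2 ^ t := pow_succ' 2 t
    have hp := Nat.two_pow_pos t
    have hlt : 2 ^ 2 ^ t - 1 < 2 ^ 2 ^ (t + 1) := lt_of_lt_of_le
      (Nat.sub_lt (by positivity) one_pos) (Nat.pow_le_pow_right (by norm_num) (by omega))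
    rw [halfBlocks, Nat.testBit_two_pow_mul_add _ hlt, Nat.testBit_two_pow_sub_one]
    have hdiv : ∀ j, j.testBit t = decide (j / 2 ^ t % 2 = 1) := fun j =>
      Nat.testBit_eq_decide_div_mod_eq
    split_ifs with hj
    · rw [hdiv, ← decide_not, decide_eq_decide, Nat.mod_eq_of_lt (by
        rw [Nat.div_lt_iff_lt_mul hp]
        omega), ← Nat.div_eq_zero_iff_lt hp]
      have : j / 2 ^ t < 2 := by
        rw [Nat.div_lt_iff_lt_mul hp]
        omega
      generalize j / 2 ^ t = r at *
      omega
    · rw [mul_add, mul_one] at h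
      rw [testBit_halfBlocks (by omega), hdiv, hdiv]
      obtain ⟨i, rfl⟩ := Nat.exists_eq_add_of_le (not_lt.1 hj)
      rw [Nat.add_sub_cancel_left, h2, mul_comm 2, Nat.mul_add_div hp, Nat.add_mod]
      simp

theorem ones_div {n t K : ℕ} (h : 2 ^ (t + 1) * K = n) :
    Nat.div (Nat.sub (Nat.pow 2 n) 1) (Nat.add (Nat.pow 2 (Nat.pow 2 t)) 1) = halfBlocks t K := by
  have h2 := halfBlocks_mul t K
  rw [h] at h2
  rw [Nat.sub_eq, Nat.pow_eq, ← h2, Nat.add_sub_cancel]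
  exact Nat.mul_div_cancel_left _ (Nat.succ_pos _)

theorem testBit_digitZero {t j : ℕ} (ht : t < 11) (hj : j < 2048) :
    (digitZero t).testBit j = !j.testBit t := by
  have h1 : 2 ^ (t + 1) * 2 ^ (10 - t) = 2048 := by
    rw [← pow_add, show t + 1 + (10 - t) = 11 by omega]
    rfl
  rw [digitZero, full213_eq h1, ones_div rfl, testBit_halfBlocks (by rwa [h1])]

theorem xor_two_pow {t e : ℕ} (h : e.testBit t = false) : e ^^^ 2 ^ t = 2 ^ t + e := by
  induction t generalizing e with
  | zero =>
    have h1 := Nat.xor_div_two (a := e) (b := 1)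
    have h2 := Nat.xor_mod_two_eq (m := e) (n := 1)
    rw [Nat.testBit_zero, decide_eq_false_iff_not] at h
    rw [show 1 / 2 = 0 by rfl, Nat.xor_zero] at h1
    rw [pow_zero]
    omega
  | succ t ih =>
    rw [Nat.testBit_succ] at h
    have h1 := Nat.xor_div_two (a := e) (b := 2 ^ (t + 1))
    have h2 := Nat.xor_mod_two_eq (m := e) (n := 2 ^ (t + 1))
    have h3 : 2 ^ (t + 1) = 2 * 2 ^ t := pow_succ' 2 t
    rw [h3, Nat.mul_div_cancel_left _ (by norm_num), ih h] at h1
    rw [h3] at h2 ⊢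
    omega

theorem testBit_digitZeroAbove {t j : ℕ} (ht : t < 11) (hj : j < 2048) (htj : 2 ^ (t + 1) ≤ j)
    (h : j.testBit t = false) : (digitZeroAbove t).testBit j = true := by
  change ((digitZero t >>> 2 ^ (t + 1)) <<< 2 ^ (t + 1)).testBit j = true
  rw [Nat.testBit_shiftLeft, Nat.testBit_shiftRight, Nat.add_sub_of_le htj, testBit_digitZero ht hj, h,
    decide_eq_true htj]
  rfl

theorem testBit_flipDigit {t m e : ℕ} (ht : t < 11) (he : e < 2048)
    (h : m.testBit (e ^^^ 2 ^ t) = true) : (flipDigit t m).testBit e = true := by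
  change (((m >>> 2 ^ t) &&& digitZero t) ||| ((m &&& digitZero t) <<< 2 ^ t)).testBit e = true
  rw [Nat.testBit_or, Nat.testBit_and, Nat.testBit_shiftLeft, Nat.testBit_and, Nat.testBit_shiftRight,
    testBit_digitZero ht he]
  cases h1 : e.testBit t
  · rw [← xor_two_pow h1, h]
    rfl
  · have h4 : (e ^^^ 2 ^ t).testBit t = false := by
      rw [Nat.testBit_xor, h1, Nat.testBit_two_pow_self]
      rfl
    have h2 := xor_two_pow h4
    rw [Nat.xor_assoc, Nat.xor_self, Nat.xor_zero] at h2
    have h3 : e - 2 ^ t = e ^^^ 2 ^ t := by omega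
    rw [h3, h, testBit_digitZero ht (h3 ▸ (Nat.sub_le _ _).trans_lt he), h4, decide_eq_true (show e ≥ 2 ^ t by omega)]
    simp

theorem testBit_translate {i e : ℕ} (hi : i < 2048) (he : e < 2048) : ∀ {n m : ℕ}, n ≤ 11 →
    m.testBit (e ^^^ (i % 2 ^ n)) = true → (translate i n m).testBit e = true
  | 0, m, _, h => by
    rw [pow_zero, Nat.mod_one, Nat.xor_zero] at h
    exact h
  | n + 1, m, hn, h => by
    refine testBit_translate hi he (n := n)
      (m := ifZeroN (Nat.mod (Nat.shiftRight i n) 2) m (flipDigit n m)) (by omega) ?_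
    have h1 := Nat.mod_pow_succ (x := i) (b := 2) (k := n)
    have h2 : i / 2 ^ n % 2 < 2 := Nat.mod_lt _ (by norm_num)
    rw [ifZeroN_eq, show Nat.mod (Nat.shiftRight i n) 2 = (i >>> n) % 2 from rfl,
      Nat.shiftRight_eq_div_pow]
    split_ifs with h0
    · rwa [h1, h0, mul_zero, add_zero] at h
    · rw [h1, show i / 2 ^ n % 2 = 1 by omega, mul_one, add_comm, ← xor_two_pow
        (Nat.testBit_lt_two_pow (Nat.mod_lt _ (by positivity))), ← Nat.xor_assoc] at h
      exact testBit_flipDigit (by omega) (Nat.xor_lt_two_pow (n := 11) he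
        (lt_of_le_of_lt (Nat.mod_le _ _) hi)) h

theorem testBit_salted (s m p : ℕ) : (salted s m).testBit (64 + p) = m.testBit p := by
  have hlt : Nat.mod (Nat.mul s 1234567890123456789) 18446744073709551616 < 2 ^ 64 :=
    Nat.mod_lt _ (by norm_num)
  rw [salted, Nat.add_eq, show m.shiftLeft 64 = m <<< 64 from rfl, Nat.shiftLeft_eq, mul_comm m,
    Nat.testBit_two_pow_mul_add _ hlt, if_neg (by omega), Nat.add_sub_cancel_left]

theorem bitsB_spec {f : ℕ → Bool} {p : ℕ} : ∀ {n m : ℕ}, bitsB f n m = true →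
    m.testBit (64 + p) = true → f p = true
  | 0, m, h, hp => by
    have h0 : m >>> 64 = 0 := Nat.eq_of_beq_eq_true h
    rw [← Nat.testBit_shiftRight, h0, Nat.zero_testBit] at hp
    exact absurd hp (by decide)
  | n + 1, m, h, hp => by
    obtain ⟨t, ht, h⟩ : ∃ t < 2048, ifZero (m >>> 64) true
        (forceB (fun t => Bool.rec (motive := fun _ => Bool) false
          (Bool.rec (motive := fun _ => Bool) false (forceB (bitsB f n) (Nat.xor (dropBit m) t)) (f t))
          (Nat.beq (Nat.shiftLeft 1 (Nat.add 64 t)) (Nat.xor m (dropBit m)))) t) = true := by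
      refine ⟨forceN (fun r => Nat.mod (entry 11 bitTable r) 2048)
        (Nat.mod (Nat.xor m (dropBit m)) 2053), ?_, h⟩
      rw [forceN_eq]
      exact Nat.mod_lt _ (by norm_num)
    rw [ifZero_eq, forceB_eq, forceB_eq, bool_rec_eq_and, bool_rec_eq_and] at h
    split_ifs at h with h0
    · rw [← Nat.testBit_shiftRight, h0, Nat.zero_testBit] at hp
      exact absurd hp (by decide)
    · rw [Bool.and_eq_true, Bool.and_eq_true, Nat.beq_eq] at h
      obtain ⟨h1, h2, h3⟩ := h
      by_cases hpt : t = p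
      · rwa [← hpt]
      refine bitsB_spec h3 ?_
      have h4 := congrArg (Nat.testBit · (64 + p)) h1
      change (1 <<< (64 + t)).testBit (64 + p) = (m ^^^ dropBit m).testBit (64 + p) at h4
      rw [Nat.one_shiftLeft, Nat.testBit_two_pow, decide_eq_false (by omega), Nat.testBit_xor, hp] at h4
      change (dropBit m ^^^ t).testBit (64 + p) = true
      rw [Nat.testBit_xor, Nat.testBit_lt_two_pow (x := t) (i := 64 + p) (ht.trans_le ?_), Bool.xor_false]
      · simpa using h4.symm
      · exact (show 2048 ≤ 2 ^ 64 by norm_num).trans (Nat.pow_le_pow_right (by norm_num) (by omega))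

theorem testBit_two_pow_sub {lo hi i : ℕ} (h1 : lo ≤ i) (h2 : i < hi) :
    (2 ^ hi - 2 ^ lo).testBit i = true := by
  have h : 2 ^ hi - 2 ^ lo = 2 ^ lo * (2 ^ (hi - lo) - 1) := by
    rw [Nat.mul_sub, ← pow_add, Nat.add_sub_of_le (h1.trans h2.le), mul_one]
  rw [h, Nat.testBit_two_pow_mul, Nat.testBit_two_pow_sub_one]
  simp [h1]
  omega

theorem colour213_planeLogs213 {a e d : ℕ} (hd : d ∈ planeLogs213 a e) : colour213 d ≠ 105 := by
  have hlt : ∀ j j', colour213 (quot213 j j') ≠ 105 := fun j j' => by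
    have := allB_spec colour213_ne (k := quot213 j j') (Nat.mod_lt _ (by norm_num))
    rwa [Bool.not_eq_true', ← Bool.not_eq_true, Nat.beq_eq] at this
  simp only [planeLogs213, List.mem_cons, List.not_mem_nil, or_false] at hd
  rcases hd with rfl | rfl | rfl | rfl | rfl | rfl <;> exact hlt _ _

attribute [local irreducible] planesAvoiding213 digitZeroAbove translate salted planeMask213 bitsB in
/-- If the search succeeds, then `fin i j` holds for all admissible spaces in the range of the search. -/
theorem searchB213_spec {a t lo hi m i j : ℕ} {fin : ℕ → ℕ → Bool}
    (h : searchB213 a fin t lo hi m = true) (hr : IsRainbow m (blockLogs213 a i j)) (ht : t < 11)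
    (hlo : lo ≤ i) (hhi : i < hi) (hi2 : i < 2048) (hj : j < 2048) (hjt : 2 ^ (t + 1) ≤ j)
    (hjt0 : j.testBit t = false) : fin i j = true := by
  obtain ⟨-, hr⟩ := id hr.cons
  set k := i ^^^ j with hk
  have hk2 : k < 2048 := Nat.xor_lt_two_pow (n := 11) hi2 hj
  set m₀ := m ||| colourBit213 (lg213 a) with hm₀
  -- the three planes through `⟨1, a⟩`
  have hri : IsRainbow m₀ (planeLogs213 a i) := hr.of_sublist (by simp)
  have hrj : IsRainbow m₀ (planeLogs213 a j) := hr.of_sublist (by simp [List.append_assoc])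
  have hrk : IsRainbow m₀ (planeLogs213 a k) := hr.of_sublist (by
    rw [show Nat.xor i j = k from rfl, List.append_assoc]
    exact (List.sublist_append_left _ _).trans (List.sublist_append_right _ _))
  have hmi := testBit_planeMask213 hri
  have hmj := testBit_planeMask213 hrj
  have hmk := testBit_planeMask213 hrk
  have hdis : ∀ {l₁ l₂ : List ℕ}, (l₁ ++ l₂).Sublist (planeLogs213 a i ++ planeLogs213 a j ++
      planeLogs213 a k ++ skewLogs213 a i j) → ∀ {d d' : ℕ}, d ∈ l₁ → d' ∈ l₂ →
      colour213 d ≠ colour213 d' := by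
    intro l₁ l₂ hsub d d' hd hd'
    have := (hr.of_sublist hsub).1
    rw [List.map_append, List.nodup_append] at this
    exact this.2.2 _ (List.mem_map_of_mem hd) _ (List.mem_map_of_mem hd')
  have hij : (planeLogs213 a i ++ planeLogs213 a j).Sublist (planeLogs213 a i ++ planeLogs213 a j ++
      planeLogs213 a k ++ skewLogs213 a i j) := by simp [List.append_assoc]
  have hik : (planeLogs213 a i ++ planeLogs213 a k).Sublist (planeLogs213 a i ++ planeLogs213 a j ++
      planeLogs213 a k ++ skewLogs213 a i j) := by
    rw [List.append_assoc, List.append_assoc]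
    exact (List.Sublist.refl _).append ((List.sublist_append_left _ _).trans
      (List.sublist_append_right _ _))
  have hjk : (planeLogs213 a j ++ planeLogs213 a k).Sublist (planeLogs213 a i ++ planeLogs213 a j ++
      planeLogs213 a k ++ skewLogs213 a i j) := by
    rw [List.append_assoc, List.append_assoc, ← List.append_assoc (planeLogs213 a j)]
    exact (List.sublist_append_left _ _).trans (List.sublist_append_right _ _)
  -- they avoid the colours in `m₀`, and the second and third one avoid those of the first one
  have hA : ∀ e < 2048, IsRainbow m₀ (planeLogs213 a e) →
      (planesAvoiding213 a (m₀ ||| 2 ^ 105)).testBit e = true := by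
    intro e he hre
    refine testBit_planesAvoiding213 he fun c hc => ?_
    obtain ⟨d, hd, rfl⟩ := (testBit_planeMask213 hre c).1 hc
    rw [Nat.testBit_or, hre.2 d hd, Nat.testBit_two_pow,
      decide_eq_false (colour213_planeLogs213 hd).symm]
    rfl
  have hcomp : ∀ e < 2048, IsRainbow m₀ (planeLogs213 a e) → (∀ {d d' : ℕ}, d ∈ planeLogs213 a i →
      d' ∈ planeLogs213 a e → colour213 d ≠ colour213 d') → (compatible213 a i).testBit e = true := by
    intro e he hre hie
    refine testBit_planesAvoiding213 he fun c hc => ?_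
    obtain ⟨d', hd', rfl⟩ := (testBit_planeMask213 hre c).1 hc
    rw [← Bool.not_eq_true, hmi]
    rintro ⟨d, hd, hdd⟩
    exact hie hd hd' hdd
  rw [searchB213, forceB_eq, forceB_eq] at h
  obtain ⟨A, hAe⟩ : ∃ A, A = planesAvoiding213 a (Nat.lor (Nat.lor m (colourBit213 (lg213 a)))
    (Nat.pow 2 105)) := ⟨_, rfl⟩
  have hA' : ∀ e < 2048, IsRainbow m₀ (planeLogs213 a e) → A.testBit e = true := fun e he hre => by
    rw [hAe]
    exact hA e he hre
  rw [← hAe] at h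
  have hleaf := bitsB_spec (p := i) h (by
    rw [testBit_salted]
    change Nat.testBit (A &&& (2 ^ hi - 2 ^ lo)) i = true
    rw [Nat.testBit_and, hA' i hi2 hri, testBit_two_pow_sub hlo hhi]
    rfl)
  rw [leafB213, forceB_eq, forceB_eq] at hleaf
  have hpair := bitsB_spec (p := j) hleaf (by
    rw [testBit_salted]
    change Nat.testBit (digitZeroAbove t &&& ((A &&& compatible213 a i) &&&
      translate i 11 (A &&& compatible213 a i))) j = true
    rw [Nat.testBit_and, Nat.testBit_and, Nat.testBit_and, testBit_digitZeroAbove ht hj hjt hjt0,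
      hA' j hj hrj, hcomp j hj hrj (hdis hij), testBit_translate hi2 hj le_rfl]
    · rfl
    · rw [Nat.mod_eq_of_lt (show i < 2 ^ 11 from hi2), Nat.xor_comm, ← hk, Nat.testBit_and, hA' k hk2 hrk,
        hcomp k hk2 hrk (hdis hik)]
      rfl)
  rw [pairB213, forceB_eq, forceB_eq, forceN_eq, ifZero_eq, forceB_eq] at hpair
  have hjk0 : planeMask213 a j &&& planeMask213 a k = 0 := land_eq_zero_of_testBit fun c hc => by
    obtain ⟨d, hd, rfl⟩ := (hmj c).1 hc
    rw [← Bool.not_eq_true, hmk]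
    rintro ⟨d', hd', hdd⟩
    exact hdis hjk hd hd' hdd.symm
  rw [if_pos (show (planeMask213 a j).land (planeMask213 a (i.xor j)) = 0 from hjk0)] at hpair
  refine foldr_addColourB (l := skewLogs213 a i j) hpair ⟨(hr.of_sublist
    (List.sublist_append_right _ _)).1, fun d hd => ?_⟩
  have hm : (m₀ ||| planeMask213 a i ||| (planeMask213 a j ||| planeMask213 a k)).testBit
      (colour213 d) = false := by
    rw [← Bool.not_eq_true]
    simp only [Nat.testBit_or, Bool.or_eq_true, hmi, hmj, hmk]
    have hd2 : ∀ {d' : ℕ}, d' ∈ planeLogs213 a i ++ planeLogs213 a j ++ planeLogs213 a k →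
        colour213 d' ≠ colour213 d := fun hd' => hdis (List.Sublist.refl _) hd' hd
    rintro ((h | ⟨d', hd', hdd⟩) | ⟨d', hd', hdd⟩ | ⟨d', hd', hdd⟩)
    · rw [hr.2 d (by simp [hd])] at h
      exact absurd h (by decide)
    all_goals exact hd2 (by simp [hd']) hdd
  exact hm

end QSteiner

namespace QSteiner

/-! ### Blocks of a design with the parameters `q = 2`, `t = 2`, `k = 4`, `n = 13` -/

theorem rows213_valid : ∀ a ∈ 174 :: rows213, a < 2 ^ 13 ∧ a % 4 = 2 ∧ lg213 a < 8191 := by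
  decide +kernel

theorem lg213_one : lg213 1 = 0 := by decide +kernel

attribute [local irreducible] lg213 colour213 dist213 rep213

theorem isStep213 {R : Type*} [CommRing R] [CharP R 2] {x : R} (hx : x ^ 13 = ev x [1, 1, 0, 1, 1]) :
    IsStep 2 13 x step213 := by
  intro c hc
  have hq : 1 < 2 := by norm_num
  have e : ∀ c : ℕ, evc 2 x c = (c % 2 : ℕ) + x * evc 2 x (c / 2) := evc_eq x hq
  have h27 : evc 2 x 27 = 1 + x + x ^ 3 + x ^ 4 := by
    rw [e, e, e, e, e]
    norm_num [evc_zero]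
    ring
  have hc0 : evc 2 x c = evc 2 x (c % 4096) + (c / 4096 : ℕ) * x ^ 12 := by
    have h := evc_add_pow x hq (show c / 4096 < 2 by omega) 12 (c % 4096) (by omega)
    rw [← h]
    congr 1
    omega
  have hlt : step213 c < 2 ^ 13 := by
    rw [step213]
    exact Nat.xor_lt_two_pow (by omega) (by omega)
  refine ⟨hlt, ?_⟩
  rw [step213, evc_xor, evc_mul x hq, hc0]
  simp only [ev] at hx
  have hcase : c / 4096 = 0 ∨ c / 4096 = 1 := by omega
  rcases hcase with h0 | h0 <;> rw [h0]
  · simp [evc_zero]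
  · rw [mul_one, h27]
    push_cast at hx ⊢
    linear_combination -hx

/-- The sums of subsets of two codes. -/
def pick (a b p : ℕ) : ℕ := ([0, a, b, a ^^^ b] : List ℕ).getD p 0

theorem pick_xor (a b : ℕ) {p q : ℕ} (hp : p < 4) (hq : q < 4) :
    pick a b (p ^^^ q) = pick a b p ^^^ pick a b q := by
  have h1 : ∀ a b : ℕ, a ^^^ (a ^^^ b) = b := fun a b => by
    rw [← Nat.xor_assoc, Nat.xor_self, Nat.zero_xor]
  have h2 : ∀ a b : ℕ, b ^^^ (a ^^^ b) = a := fun a b => by rw [Nat.xor_comm a, h1]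
  have h3 : ∀ a b : ℕ, (a ^^^ b) ^^^ a = b := fun a b => by rw [Nat.xor_comm _ a, h1]
  have h4 : ∀ a b : ℕ, (a ^^^ b) ^^^ b = a := fun a b => by rw [Nat.xor_comm _ b, h2]
  interval_cases p <;> interval_cases q <;> simp [pick, h1, h2, h3, h4, Nat.xor_comm b a]

theorem pick_induction {P : ℕ → Prop} {a b : ℕ} (h0 : P 0) (ha : P a) (hb : P b)
    (hab : P (a ^^^ b)) (p : ℕ) : P (pick a b p) := by
  rcases p with _ | _ | _ | _ | p
  exacts [h0, ha, hb, hab, h0]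

/-- The elements of the space spanned by `1`, `a`, `4 i`, `4 j`. -/
def blockCode (a i j α : ℕ) : ℕ := (4 * pick i j (α / 4)) ^^^ pick 1 a (α % 4)

theorem four_mul_xor (u v : ℕ) : 4 * (u ^^^ v) = (4 * u) ^^^ (4 * v) := by
  have := Nat.shiftLeft_xor_distrib (a := u) (b := v) (i := 2)
  rw [show 4 = 2 ^ 2 by rfl]
  simpa only [Nat.shiftLeft_eq, mul_comm _ (2 ^ 2)] using this

theorem blockCode_xor (a i j : ℕ) {α β : ℕ} (hα : α < 16) (hβ : β < 16) :
    blockCode a i j (α ^^^ β) = blockCode a i j α ^^^ blockCode a i j β := by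
  have h1 : (α ^^^ β) / 4 = α / 4 ^^^ β / 4 := Nat.xor_div_two_pow (n := 2)
  have h2 : (α ^^^ β) % 4 = (α % 4) ^^^ (β % 4) := Nat.xor_mod_two_pow (n := 2)
  rw [blockCode, blockCode, blockCode, h1, h2, pick_xor _ _ (by omega) (by omega),
    pick_xor _ _ (by omega) (by omega), four_mul_xor, Nat.xor_assoc, Nat.xor_assoc]
  congr 1
  rw [← Nat.xor_assoc, ← Nat.xor_assoc, Nat.xor_comm (4 * _)]

/-- Pairs of indices of `blockCode`, giving bases of the lines in the order of `blockLogs213`. -/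
def lines35 : List (ℕ × ℕ) :=
  (2, 1) :: ([4, 8, 12].flatMap (fun e => [(e, 1), (e + 2, 1), (e, 2), (e + 1, 2), (e, 3), (e + 1, 3)]) ++
    [4, 5, 6, 7].flatMap fun e => [(8, e), (9, e), (10, e), (11, e)])

theorem lines35_valid : lines35.Nodup ∧ ∀ l ∈ lines35, l.1 < 16 ∧ l.2 < 16 ∧ l.1 ≠ 0 ∧ l.2 ≠ 0 ∧
    l.1 ≠ l.2 := by decide +kernel

/-- Different pairs in `lines35` span different lines. -/
theorem lines35_separated : ∀ l ∈ lines35, ∀ l' ∈ lines35,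
    (l.1 = l'.1 ∨ l.1 = l'.2 ∨ l.1 = l'.1 ^^^ l'.2) → (l.2 = l'.1 ∨ l.2 = l'.2 ∨ l.2 = l'.1 ^^^ l'.2) →
    l = l' := by decide +kernel

/-- Every line is spanned by one of the pairs in `lines35`, up to a change of basis of one of six kinds. -/
theorem lines35_complete : ∀ α < 16, α ≠ 0 → ∀ β < 16, β ≠ 0 → α ≠ β →
    [(α, β), (α ^^^ β, β), (β ^^^ α, α), (β, α), (β, α ^^^ β), (α, β ^^^ α)].any
      (lines35.contains ·) = true := by decide +kernel

theorem blockCode_zero (a i j : ℕ) : blockCode a i j 0 = 0 := by simp [blockCode, pick]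

theorem map_colour_blockLogs213 {a : ℕ} (ha : lg213 a < 8191) (i j : ℕ) :
    (blockLogs213 a i j).map colour213 = lines35.map fun l =>
      colour213 (quot213 (lg213 (blockCode a i j l.1)) (lg213 (blockCode a i j l.2))) := by
  have hx : Nat.xor a 1 = Nat.xor 1 a := Nat.xor_comm _ _
  have h1 : blockCode a i j 1 = 1 := by simp [blockCode, pick]
  have h2 : blockCode a i j 2 = a := by simp [blockCode, pick]
  have h3 : blockCode a i j 3 = Nat.xor 1 a := Nat.zero_xor _
  have h0 : lg213 a = quot213 (lg213 (blockCode a i j 2)) (lg213 (blockCode a i j 1)) := by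
    rw [h1, h2, lg213_one]
    exact (Nat.mod_eq_of_lt ha).symm
  rw [h1, h2] at h0
  simp only [blockLogs213, planeLogs213, skewLogs213, logE213, hx, lines35, List.map_cons,
    List.map_nil, List.flatMap_cons, List.flatMap_nil, List.cons_append,
    List.nil_append, List.append_nil, ← h0, h1, h2, h3]
  rfl

section Block

variable {L : Type*} [Field L] [Algebra (ZMod 2) L] [CharP L 2] {x : L}
  {B : Submodule (ZMod 2) L} {a i j : ℕ}

theorem eq_of_mem_span_pair (h : IsLogTable 2 13 x lg213) {u v w : ℕ} (hu : u < 2 ^ 13) (hu0 : u ≠ 0)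
    (hv : v < 2 ^ 13) (hw : w < 2 ^ 13)
    (huv : evc 2 x u ∈ Submodule.span (ZMod 2) {evc 2 x v, evc 2 x w}) :
    u = v ∨ u = w ∨ u = v ^^^ w := by
  obtain ⟨b, c, hbc⟩ := Submodule.mem_span_pair.1 huv
  rcases zmod_two_cases b with rfl | rfl <;> rcases zmod_two_cases c with rfl | rfl <;>
    simp only [zero_smul, one_smul, zero_add, add_zero] at hbc
  · exact absurd ((h.evc_eq_zero_iff (by norm_num) hu).1 hbc.symm) hu0
  · exact Or.inr (Or.inl (h.evc_inj (by norm_num) hu hw hbc.symm))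
  · exact Or.inl (h.evc_inj (by norm_num) hu hv hbc.symm)
  · rw [← evc_xor] at hbc
    exact Or.inr (Or.inr (h.evc_inj (by norm_num) hu (Nat.xor_lt_two_pow hv hw) hbc.symm))

theorem isRatio_evc (h : IsLogTable 2 13 x lg213) {u v : ℕ} (hu : u < 2 ^ 13) (hv : v < 2 ^ 13)
    (hu0 : u ≠ 0) (hv0 : v ≠ 0) (huv : u ≠ v) : IsRatio 2 (evc 2 x u / evc 2 x v) := by
  have hv' : evc 2 x v ≠ 0 := fun h0 => hv0 ((h.evc_eq_zero_iff (by norm_num) hv).1 h0)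
  refine isRatio_div hv' fun c hc => ?_
  rcases zmod_two_cases c with rfl | rfl
  · rw [zero_smul] at hc
    exact hu0 ((h.evc_eq_zero_iff (by norm_num) hu).1 hc)
  · rw [one_smul] at hc
    exact huv (h.evc_inj (by norm_num) hu hv hc)

theorem tableCol213_div (h : IsLogTable 2 13 x lg213) {u v : ℕ} (hu : u < 2 ^ 13) (hv : v < 2 ^ 13)
    (hu0 : u ≠ 0) (hv0 : v ≠ 0) : tableCol x 8191 colour213 (evc 2 x u / evc 2 x v) =
      colour213 (quot213 (lg213 u) (lg213 v)) :=
  h.tableCol_div (by norm_num) (by norm_num) _ (Nat.pos_of_ne_zero hu0) hu (Nat.pos_of_ne_zero hv0) hv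

/-- The subspace `B` contains `1` and the independent elements with codes `a`, `4 i`, `4 j`. -/
structure IsBlockBasis (x : L) (B : Submodule (ZMod 2) L) (a i j : ℕ) : Prop where
  mem_rows : a ∈ 174 :: rows213
  i_lt : i < 2048
  j_lt : j < 2048
  i_ne_zero : i ≠ 0
  j_ne_zero : j ≠ 0
  i_ne_j : i ≠ j
  one_mem : (1 : L) ∈ B
  a_mem : evc 2 x a ∈ B
  i_mem : evc 2 x (4 * i) ∈ B
  j_mem : evc 2 x (4 * j) ∈ B

namespace IsBlockBasis

theorem code_lt (hb : IsBlockBasis x B a i j) (α : ℕ) : blockCode a i j α < 2 ^ 13 := by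
  have ha := (rows213_valid a hb.mem_rows).1
  have h1 : pick i j (α / 4) < 2 ^ 11 := pick_induction (P := (· < 2 ^ 11)) (by norm_num) hb.i_lt hb.j_lt
    (Nat.xor_lt_two_pow hb.i_lt hb.j_lt) _
  have h2 : pick 1 a (α % 4) < 2 ^ 13 := pick_induction (P := (· < 2 ^ 13)) (by norm_num) (by norm_num) ha
    (Nat.xor_lt_two_pow (by norm_num) ha) _
  exact Nat.xor_lt_two_pow (by omega) h2

theorem code_mem (hb : IsBlockBasis x B a i j) (α : ℕ) : evc 2 x (blockCode a i j α) ∈ B := by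
  have h0 : evc 2 x 0 ∈ B := by rw [evc_zero]; exact B.zero_mem
  have h1 : evc 2 x 1 ∈ B := by rw [evc_one 2 one_lt_two]; exact hb.one_mem
  exact xor_mem (pick_induction (P := fun e => evc 2 x (4 * e) ∈ B) h0 hb.i_mem hb.j_mem (by
      rw [four_mul_xor]
      exact xor_mem hb.i_mem hb.j_mem) _)
    (pick_induction (P := fun e => evc 2 x e ∈ B) h0 h1 hb.a_mem (xor_mem h1 hb.a_mem) _)

theorem code_ne_zero (hb : IsBlockBasis x B a i j) {α : ℕ} (hα : α < 16) (hα0 : α ≠ 0) :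
    blockCode a i j α ≠ 0 := by
  intro h
  rw [blockCode, Nat.xor_eq_zero_iff] at h
  have ha := (rows213_valid a hb.mem_rows).2.1
  have h1 : pick 1 a (α % 4) % 4 = α % 4 := by
    have hlt : α % 4 < 4 := Nat.mod_lt _ (by norm_num)
    have h3 : (1 ^^^ a) % 4 = (1 % 4) ^^^ (a % 4) := Nat.xor_mod_two_pow (n := 2)
    rw [ha] at h3
    generalize α % 4 = p at *
    interval_cases p
    exacts [rfl, rfl, ha, h3]
  rw [← h, Nat.mul_mod_right] at h1
  have h2 : α / 4 < 4 := by omega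
  have h3 : pick i j (α / 4) = 0 := by
    rw [← h1] at h
    have : pick 1 a 0 = 0 := rfl
    omega
  have h4 : α / 4 ≠ 0 := by omega
  generalize α / 4 = p at h2 h3 h4
  interval_cases p
  · exact h4 rfl
  · exact hb.i_ne_zero h3
  · exact hb.j_ne_zero h3
  · exact hb.i_ne_j (Nat.xor_eq_zero_iff.1 h3)

theorem code_inj (hb : IsBlockBasis x B a i j) {α β : ℕ} (hα : α < 16) (hβ : β < 16)
    (h : blockCode a i j α = blockCode a i j β) : α = β := by
  by_contra hne
  refine hb.code_ne_zero (Nat.xor_lt_two_pow (n := 4) hα hβ) (fun h0 => hne (Nat.xor_eq_zero_iff.1 h0)) ?_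
  rw [blockCode_xor a i j hα hβ, h, Nat.xor_self]

theorem exists_code (hb : IsBlockBasis x B a i j) (h : IsLogTable 2 13 x lg213)
    [FiniteDimensional (ZMod 2) L] (hB : Module.finrank (ZMod 2) B = 4) {u : L} (hu : u ∈ B) :
    ∃ α < 16, evc 2 x (blockCode a i j α) = u := by
  have hfin : Finite B := Module.finite_of_finite (ZMod 2)
  let f : Fin 16 → B := fun α => ⟨_, hb.code_mem α⟩
  have hf : Function.Bijective f := by
    rw [Nat.bijective_iff_injective_and_card]
    refine ⟨fun α β hαβ => Fin.ext (hb.code_inj α.2 β.2 (h.evc_inj (by norm_num) (hb.code_lt _)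
      (hb.code_lt _) (congrArg Subtype.val hαβ))), ?_⟩
    rw [Module.natCard_eq_pow_finrank (K := ZMod 2) (V := B), hB, Nat.card_zmod, Nat.card_eq_fintype_card,
      Fintype.card_fin]
    rfl
  obtain ⟨α, hα⟩ := hf.2 ⟨u, hu⟩
  exact ⟨α, α.2, congrArg Subtype.val hα⟩

theorem mem_coloursOf (hb : IsBlockBasis x B a i j) (h : IsLogTable 2 13 x lg213) {α β : ℕ} (hα : α < 16)
    (hβ : β < 16) (hα0 : α ≠ 0) (hβ0 : β ≠ 0) (hαβ : α ≠ β) :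
    colour213 (quot213 (lg213 (blockCode a i j α)) (lg213 (blockCode a i j β))) ∈
      coloursOf 2 (tableCol x 8191 colour213) B :=
  ⟨_, hb.code_mem β, _, hb.code_mem α,
    fun h0 => hb.code_ne_zero hβ hβ0 ((h.evc_eq_zero_iff (by norm_num) (hb.code_lt β)).1 h0),
    isRatio_evc h (hb.code_lt α) (hb.code_lt β) (hb.code_ne_zero hα hα0) (hb.code_ne_zero hβ hβ0)
      fun h0 => hαβ (hb.code_inj hα hβ h0),
    tableCol213_div h (hb.code_lt α) (hb.code_lt β) (hb.code_ne_zero hα hα0) (hb.code_ne_zero hβ hβ0)⟩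

theorem mem_coloursOf_of_mem (hb : IsBlockBasis x B a i j) (h : IsLogTable 2 13 x lg213) {d : ℕ}
    (hd : d ∈ blockLogs213 a i j) : colour213 d ∈ coloursOf 2 (tableCol x 8191 colour213) B := by
  have h1 := List.mem_map_of_mem (f := colour213) hd
  rw [map_colour_blockLogs213 (rows213_valid a hb.mem_rows).2.2, List.mem_map] at h1
  obtain ⟨l, hl, hld⟩ := h1
  obtain ⟨v1, v2, v3, v4, v5⟩ := lines35_valid.2 l hl
  rw [← hld]
  exact hb.mem_coloursOf h v1 v2 v3 v4 v5

/-- Every colour of a line of a block belongs to the list for the 35 lines. -/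
theorem mem_of_mem_coloursOf (hb : IsBlockBasis x B a i j) (h : IsLogTable 2 13 x lg213)
    {I : AddSubmonoid ℕ} (hcol : IsColouring (q := 2) I (tableCol x 8191 colour213))
    [FiniteDimensional (ZMod 2) L] (hB : Module.finrank (ZMod 2) B = 4) {c : ℕ}
    (hc : c ∈ coloursOf 2 (tableCol x 8191 colour213) B) :
    ∃ d ∈ blockLogs213 a i j, colour213 d = c := by
  obtain ⟨u, hu, v, hv, hu0, huv, hc⟩ := hc
  obtain ⟨β, hβ, rfl⟩ := hb.exists_code h hB hu
  obtain ⟨α, hα, rfl⟩ := hb.exists_code h hB hv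
  have hz : ∀ γ < 16, evc 2 x (blockCode a i j γ) ≠ 0 → γ ≠ 0 := by
    rintro _ - h0 rfl
    exact h0 (by rw [blockCode_zero, evc_zero])
  have hβ0 := hz β hβ hu0
  have hα0 := hz α hα fun h0 => huv.ne_zero (by rw [h0, zero_div])
  have hαβ : α ≠ β := fun h0 => huv 1 (by rw [map_one, h0, div_self hu0])
  have hxor := fun {γ δ : ℕ} (hγ : γ < 16) (hδ : δ < 16) =>
    (congrArg (evc 2 x) (blockCode_xor a i j hγ hδ)).trans (evc_xor x _ _)
  have hne : ∀ {γ δ : ℕ}, γ < 16 → δ < 16 → γ ≠ 0 → δ ≠ 0 → γ ≠ δ → evc 2 x (blockCode a i j γ) ≠ 0 ∧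
      IsRatio 2 (evc 2 x (blockCode a i j γ) / evc 2 x (blockCode a i j δ)) := fun hγ hδ hγ0 hδ0 hγδ =>
    ⟨fun h0 => hb.code_ne_zero hγ hγ0 ((h.evc_eq_zero_iff (by norm_num) (hb.code_lt _)).1 h0),
      isRatio_evc h (hb.code_lt _) (hb.code_lt _) (hb.code_ne_zero hγ hγ0) (hb.code_ne_zero hδ hδ0)
        fun h0 => hγδ (hb.code_inj hγ hδ h0)⟩
  -- the colour does not change under the transformations that lead to one of the given bases
  have hadd : ∀ {γ δ : ℕ}, γ < 16 → δ < 16 → γ ≠ 0 → δ ≠ 0 → γ ≠ δ →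
      tableCol x 8191 colour213 (evc 2 x (blockCode a i j (γ ^^^ δ)) / evc 2 x (blockCode a i j δ)) =
        tableCol x 8191 colour213 (evc 2 x (blockCode a i j γ) / evc 2 x (blockCode a i j δ)) := by
    intro γ δ hγ hδ hγ0 hδ0 hγδ
    rw [hxor hγ hδ, add_div, div_self (hne hδ hγ hδ0 hγ0 hγδ.symm).1]
    exact hcol.add_one _ (hne hγ hδ hγ0 hδ0 hγδ).2
  have hinv : ∀ {γ δ : ℕ}, γ < 16 → δ < 16 → γ ≠ 0 → δ ≠ 0 → γ ≠ δ →
      tableCol x 8191 colour213 (evc 2 x (blockCode a i j γ) / evc 2 x (blockCode a i j δ)) =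
        tableCol x 8191 colour213 (evc 2 x (blockCode a i j δ) / evc 2 x (blockCode a i j γ)) := by
    intro γ δ hγ hδ hγ0 hδ0 hγδ
    rw [← inv_div]
    exact hcol.inv _ (hne hδ hγ hδ0 hγ0 hγδ.symm).2
  obtain ⟨l, hl, hlc⟩ : ∃ l ∈ lines35, tableCol x 8191 colour213
      (evc 2 x (blockCode a i j l.1) / evc 2 x (blockCode a i j l.2)) = c := by
    have hlt := Nat.xor_lt_two_pow (n := 4) hα hβ
    have hx0 : α ^^^ β ≠ 0 := fun h0 => hαβ (Nat.xor_eq_zero_iff.1 h0)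
    have hlt' := Nat.xor_lt_two_pow (n := 4) hβ hα
    have hx0' : β ^^^ α ≠ 0 := fun h0 => hαβ (Nat.xor_eq_zero_iff.1 h0).symm
    have hxb : α ^^^ β ≠ β := fun h0 => hα0 (by
      have := congrArg (· ^^^ β) h0
      simpa [Nat.xor_assoc] using this)
    have hxa : β ^^^ α ≠ α := fun h0 => hβ0 (by
      have := congrArg (· ^^^ α) h0
      simpa [Nat.xor_assoc] using this)
    have e1 := hinv hβ hα hβ0 hα0 hαβ.symm
    have e2 := hadd hα hβ hα0 hβ0 hαβ
    have e3 := hadd hβ hα hβ0 hα0 hαβ.symm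
    obtain ⟨l, hl', hl⟩ := List.any_eq_true.1 (lines35_complete α hα hα0 β hβ hβ0 hαβ)
    rw [List.contains_iff_mem] at hl
    simp only [List.mem_cons, List.not_mem_nil, or_false] at hl'
    refine ⟨l, hl, ?_⟩
    rcases hl' with rfl | rfl | rfl | rfl | rfl | rfl <;> dsimp only
    · exact hc
    · rw [e2, hc]
    · rw [e3, e1, hc]
    · rw [e1, hc]
    · rw [hinv hβ hlt hβ0 hx0 hxb.symm, e2, hc]
    · rw [hinv hα hlt' hα0 hx0' hxa.symm, e3, e1, hc]
  obtain ⟨v1, v2, v3, v4, v5⟩ := lines35_valid.2 l hl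
  rw [tableCol213_div h (hb.code_lt _) (hb.code_lt _) (hb.code_ne_zero v1 v3) (hb.code_ne_zero v2 v4)]
    at hlc
  have h1 : c ∈ (blockLogs213 a i j).map colour213 := by
    rw [map_colour_blockLogs213 (rows213_valid a hb.mem_rows).2.2, List.mem_map]
    exact ⟨l, hl, hlc⟩
  exact List.mem_map.1 h1

/-- The lines of a block have different colours. -/
theorem isRainbow (hb : IsBlockBasis x B a i j) (h : IsLogTable 2 13 x lg213)
    {I : AddSubmonoid ℕ} (hcol : IsColouring (q := 2) I (tableCol x 8191 colour213))
    (hL : Nat.card L = 2 ^ 13) {S : Set (Submodule (ZMod 2) L)} (hI : TwistInvariant I S)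
    (hS : IsDesign 2 4 1 S) (hB : B ∈ S) {m : ℕ}
    (hm : ∀ c ∈ coloursOf 2 (tableCol x 8191 colour213) B, m.testBit c = false) :
    IsRainbow m (blockLogs213 a i j) := by
  refine ⟨?_, fun d hd => hm _ (hb.mem_coloursOf_of_mem h hd)⟩
  rw [map_colour_blockLogs213 (rows213_valid a hb.mem_rows).2.2]
  refine List.Nodup.map_on (fun l hl l' hl' hll => ?_) lines35_valid.1
  obtain ⟨v1, v2, v3, v4, v5⟩ := lines35_valid.2 l hl
  obtain ⟨w1, w2, w3, w4, w5⟩ := lines35_valid.2 l' hl'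
  rw [← tableCol213_div h (hb.code_lt _) (hb.code_lt _) (hb.code_ne_zero v1 v3) (hb.code_ne_zero v2 v4),
    ← tableCol213_div h (hb.code_lt _) (hb.code_lt _) (hb.code_ne_zero w1 w3) (hb.code_ne_zero w2 w4)]
    at hll
  have hne : ∀ {γ : ℕ}, γ < 16 → γ ≠ 0 → evc 2 x (blockCode a i j γ) ≠ 0 := fun hγ hγ0 h0 =>
    hb.code_ne_zero hγ hγ0 ((h.evc_eq_zero_iff (by norm_num) (hb.code_lt _)).1 h0)
  have hrat : ∀ {γ δ : ℕ}, γ < 16 → δ < 16 → γ ≠ 0 → δ ≠ 0 → γ ≠ δ →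
      IsRatio 2 (evc 2 x (blockCode a i j γ) / evc 2 x (blockCode a i j δ)) := fun hγ hδ hγ0 hδ0 hγδ =>
    isRatio_evc h (hb.code_lt _) (hb.code_lt _) (hb.code_ne_zero hγ hγ0) (hb.code_ne_zero hδ hδ0)
      fun h0 => hγδ (hb.code_inj hγ hδ h0)
  obtain ⟨h1, h2⟩ := hcol.line_unique hI hS hL (by norm_num) (by norm_num) (by norm_num) (by norm_num)
    (by norm_num) hB (hne v2 v4) (hrat v1 v2 v3 v4 v5) (hne w2 w4) (hrat w1 w2 w3 w4 w5) hll
    (hb.code_mem _) (hb.code_mem _) (hb.code_mem _) (hb.code_mem _)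
  have hspan : ∀ {γ : ℕ}, γ < 16 → γ ≠ 0 → evc 2 x (blockCode a i j γ) ∈ Submodule.span (ZMod 2)
      {evc 2 x (blockCode a i j l'.2), evc 2 x (blockCode a i j l'.1)} →
      γ = l'.1 ∨ γ = l'.2 ∨ γ = l'.1 ^^^ l'.2 := by
    intro γ hγ hγ0 hγs
    rcases eq_of_mem_span_pair h (hb.code_lt _) (hb.code_ne_zero hγ hγ0) (hb.code_lt _) (hb.code_lt _) hγs
      with h0 | h0 | h0
    · exact Or.inr (Or.inl (hb.code_inj hγ w2 h0))
    · exact Or.inl (hb.code_inj hγ w1 h0)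
    · rw [Nat.xor_comm, ← blockCode_xor a i j w1 w2] at h0
      exact Or.inr (Or.inr (hb.code_inj hγ (Nat.xor_lt_two_pow (n := 4) w1 w2) h0))
  exact lines35_separated l hl l' hl' (hspan v1 v3 h2) (hspan v2 v4 h1)

end IsBlockBasis

/-- A set of numbers that is closed under bitwise addition and has two different nonzero elements
contains numbers `i`, `j` in the range of the search. -/
theorem exists_pair_of_xor_closed {P : ℕ → Prop} (hP : ∀ e e', P e → P e' → P (e ^^^ e'))
    (hlt : ∀ e, P e → e < 2048) {e e' : ℕ} (he : P e) (he' : P e') (h0 : e ≠ 0) (h0' : e' ≠ 0)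
    (hne : e ≠ e') : ∃ t < 10, ∃ i j, P i ∧ P j ∧ 2 ^ t ≤ i ∧ i < 2 ^ (t + 1) ∧ 2 ^ (t + 1) ≤ j ∧
      j.testBit t = false := by
  obtain ⟨i, j, hi, hj, hi0, hij⟩ : ∃ i j, P i ∧ P j ∧ i ≠ 0 ∧ i.log2 < j.log2 := by
    rcases lt_trichotomy e.log2 e'.log2 with h | h | h
    · exact ⟨e, e', he, he', h0, h⟩
    · have hx0 : e ^^^ e' ≠ 0 := fun hx => hne (Nat.xor_eq_zero_iff.1 hx)
      refine ⟨e ^^^ e', e, hP _ _ he he', he, hx0, ?_⟩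
      rw [Nat.log2_lt hx0]
      have h1 : e < 2 ^ (e.log2 + 1) := (Nat.log2_lt h0).1 (Nat.lt_succ_self _)
      have h2 : e' < 2 ^ (e.log2 + 1) := (Nat.log2_lt h0').1 (h ▸ Nat.lt_succ_self _)
      have h3 : 2 ^ e.log2 ≤ e := Nat.log2_self_le h0
      have h4 : 2 ^ e.log2 ≤ e' := h ▸ Nat.log2_self_le h0'
      have hdiv : ∀ u, 2 ^ e.log2 ≤ u → u < 2 ^ (e.log2 + 1) → u / 2 ^ e.log2 = 1 := by
        intro u hu1 hu2
        rw [pow_succ'] at hu2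
        exact Nat.div_eq_of_lt_le (by omega) (by omega)
      refine Nat.lt_of_div_eq_zero (by positivity) ?_
      rw [Nat.xor_div_two_pow, hdiv e h3 h1, hdiv e' h4 h2]
      rfl
    · exact ⟨e', e, he', he, h0', h⟩
  have h1 : i < 2 ^ (i.log2 + 1) := (Nat.log2_lt hi0).1 (Nat.lt_succ_self _)
  have h2 : 2 ^ i.log2 ≤ i := Nat.log2_self_le hi0
  have hj0 : j ≠ 0 := by
    rintro rfl
    simp at hij
  have h3 : 2 ^ (i.log2 + 1) ≤ j := (Nat.pow_le_pow_right (by norm_num) hij).trans (Nat.log2_self_le hj0)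
  have ht : i.log2 < 10 := by
    have h4 : 2 ^ (i.log2 + 1) < 2 ^ 11 := h3.trans_lt (hlt j hj)
    have := (Nat.pow_lt_pow_iff_right (by norm_num)).1 h4
    omega
  refine ⟨i.log2, ht, ?_⟩
  cases hjt : j.testBit i.log2
  · exact ⟨i, j, hi, hj, h2, h1, h3, hjt⟩
  · refine ⟨i, j ^^^ i, hi, hP _ _ hj hi, h2, h1, ?_, ?_⟩
    · have h4 : (j ^^^ i) / 2 ^ (i.log2 + 1) = j / 2 ^ (i.log2 + 1) := by
        rw [Nat.xor_div_two_pow, Nat.div_eq_of_lt h1, Nat.xor_zero]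
      have h5 := Nat.div_pos h3 (Nat.two_pow_pos _)
      rw [← h4] at h5
      exact (Nat.div_pos_iff.1 h5).2
    · rw [Nat.testBit_xor, hjt, Nat.testBit_log2 hi0]
      rfl

/-- A block through `⟨1, a⟩` has a basis `1`, `a`, `4 i`, `4 j` with `i` and `j` in the range of the search: the last two
binary digits of a code can be cleared with the codes `1` and `a`, as `a` ends with `10`. -/
theorem exists_isBlockBasis [FiniteDimensional (ZMod 2) L] (h : IsLogTable 2 13 x lg213)
    (ha : a ∈ 174 :: rows213) (hB : Module.finrank (ZMod 2) B = 4) (h1 : (1 : L) ∈ B)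
    (haB : evc 2 x a ∈ B) : ∃ t < 10, ∃ i j, IsBlockBasis x B a i j ∧ 2 ^ t ≤ i ∧ i < 2 ^ (t + 1) ∧
      2 ^ (t + 1) ≤ j ∧ j.testBit t = false := by
  obtain ⟨ha1, ha2, -⟩ := rows213_valid a ha
  have h1' : evc 2 x 1 ∈ B := by rwa [evc_one 2 one_lt_two]
  -- every element differs from one of the form `4 e` by an element of `⟨1, a⟩`
  have hex : ∀ e : ℕ, ∃ e' < 2048, evc 2 x (4 * e') ∈ B ∧ e' ≠ 0 ∧ e' ≠ e := by
    intro e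
    by_contra! hcon
    have hle : B ≤ Submodule.span (ZMod 2) (Set.range ![1, evc 2 x a, evc 2 x (4 * e)]) := by
      intro u hu
      obtain ⟨c, hc, rfl⟩ := h.exists_code u
      have hs : ∀ k, ![1, evc 2 x a, evc 2 x (4 * e)] k ∈ Submodule.span (ZMod 2)
          (Set.range ![1, evc 2 x a, evc 2 x (4 * e)]) := fun k => Submodule.subset_span ⟨k, rfl⟩
      have hs0 : evc 2 x 1 ∈ Submodule.span (ZMod 2)
          (Set.range ![1, evc 2 x a, evc 2 x (4 * e)]) := by
        rw [evc_one 2 one_lt_two]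
        exact hs 0
      generalize Submodule.span (ZMod 2) (Set.range ![1, evc 2 x a, evc 2 x (4 * e)]) = W at hs hs0
      have hmod : ∀ b c : ℕ, (b ^^^ c) % 4 = (b % 4) ^^^ (c % 4) := fun b c => Nat.xor_mod_two_pow (n := 2)
      have hlt4 : c % 4 < 4 := Nat.mod_lt _ (by norm_num)
      obtain ⟨b, hb, hbB, hbW, hbc⟩ : ∃ b < 2 ^ 13, evc 2 x b ∈ B ∧ evc 2 x b ∈ W ∧ b % 4 = c % 4 := by
        generalize c % 4 = r at hlt4
        interval_cases r
        · exact ⟨0, by norm_num, by rw [evc_zero]; exact B.zero_mem, by rw [evc_zero]; exact W.zero_mem, rfl⟩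
        · exact ⟨1, by norm_num, h1', hs0, rfl⟩
        · exact ⟨a, ha1, haB, hs 1, ha2⟩
        · refine ⟨1 ^^^ a, Nat.xor_lt_two_pow (by norm_num) ha1, xor_mem h1' haB, xor_mem hs0 (hs 1), ?_⟩
          rw [hmod, ha2]
          rfl
      have h4 : (c ^^^ b) % 4 = 0 := by rw [hmod, hbc, Nat.xor_self]
      obtain ⟨e', he'⟩ := Nat.dvd_of_mod_eq_zero h4
      have hlt := Nat.xor_lt_two_pow hc hb
      have hmem : evc 2 x (c ^^^ b) ∈ B := xor_mem hu hbB
      have hcb : c = (c ^^^ b) ^^^ b := by rw [Nat.xor_assoc, Nat.xor_self, Nat.xor_zero]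
      rw [hcb]
      refine xor_mem ?_ hbW
      rw [he'] at hlt hmem ⊢
      by_cases he0 : e' = 0
      · rw [he0, mul_zero, evc_zero]
        exact W.zero_mem
      · rw [hcon e' (by omega) hmem he0]
        exact hs 2
    have hdim := Submodule.finrank_mono hle
    have := finrank_range_le_card (R := ZMod 2) ![1, evc 2 x a, evc 2 x (4 * e)]
    rw [Set.finrank] at this
    simp only [Fintype.card_fin] at this
    omega
  obtain ⟨e, he, heB, he0, -⟩ := hex 0
  obtain ⟨e', he', heB', he0', hne⟩ := hex e
  obtain ⟨t, ht, i, j, ⟨hi, hiB⟩, ⟨hj, hjB⟩, h2, h3, h4, h5⟩ := exists_pair_of_xor_closed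
    (P := fun e => e < 2048 ∧ evc 2 x (4 * e) ∈ B)
    (fun e e' he he' => ⟨Nat.xor_lt_two_pow (n := 11) he.1 he'.1, by
      rw [four_mul_xor]
      exact xor_mem he.2 he'.2⟩) (fun e he => he.1) ⟨he, heB⟩ ⟨he', heB'⟩ he0 he0' hne.symm
  have hp := Nat.two_pow_pos t
  exact ⟨t, ht, i, j, ⟨ha, hi, hj, by omega, by omega, by omega, h1, haB, hiB, hjB⟩, h2, h3, h4, h5⟩

end Block

theorem memB_eq {c : ℕ} {l : List ℕ} : memB c l = true ↔ c ∈ l := by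
  induction l with
  | nil => simp [memB]
  | cons d l ih =>
    have e : memB c (d :: l) = Bool.rec (motive := fun _ => Bool) (memB c l) true (Nat.beq d c) := rfl
    rw [e, List.mem_cons, ← ih, eq_comm (a := c), ← Nat.beq_eq]
    cases Nat.beq d c <;> simp

theorem allListB_spec {p : ℕ → Bool} {l : List ℕ} (h : allListB p l = true) {c : ℕ} (hc : c ∈ l) :
    p c = true := by
  induction l with
  | nil => simp at hc
  | cons d l ih =>
    have e : allListB p (d :: l) = Bool.rec (motive := fun _ => Bool) false (allListB p l)
      (forceB p d) := rfl
    rw [e, bool_rec_eq_and, forceB_eq, Bool.and_eq_true] at h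
    rcases List.mem_cons.1 hc with rfl | hc
    exacts [h.1, ih h.2 hc]

theorem testBit_blockMask213 (a i j c : ℕ) : (blockMask213 a i j).testBit c = true ↔
    ∃ d ∈ blockLogs213 a i j, colour213 d = c := by
  rw [blockMask213]
  generalize blockLogs213 a i j = l
  induction l with
  | nil => simp
  | cons d l ih =>
    dsimp only
    rw [forceN_eq]
    change Nat.testBit (_ ||| _) c = true ↔ _
    rw [Nat.testBit_or, Bool.or_eq_true, ih, show colourBit213 d = 1 <<< colour213 d from rfl,
      Nat.one_shiftLeft, Nat.testBit_two_pow, decide_eq_true_iff, List.exists_mem_cons_iff]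

theorem firstRow213_spec {m : ℕ} {rows : List ℕ} (h : firstRow213 rows m ≠ 0) :
    firstRow213 rows m ∈ rows ∧ m.testBit (colour213 (lg213 (firstRow213 rows m))) = false := by
  induction rows with
  | nil => exact absurd rfl h
  | cons a rows ih =>
    have e : firstRow213 (a :: rows) m = ifZeroN (m &&& forceN colourBit213 (lg213 a)) a
      (firstRow213 rows m) := rfl
    rw [forceN_eq, ifZeroN_eq] at e
    split_ifs at e with h0
    · rw [e]
      exact ⟨by simp, land_colourBit_eq_zero.1 h0⟩
    · rw [e] at h ⊢
      exact ⟨List.mem_cons_of_mem _ (ih h).1, (ih h).2⟩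

/-- The codes of all spaces found by the searches for the first block. -/
theorem mem_blocks213 {t i j : ℕ} (hr : IsRainbow 0 (blockLogs213 174 i j)) (ht : t < 10)
    (hi : 2 ^ t ≤ i) (hit : i < 2 ^ (t + 1)) (hj : j < 2048) (hjt : 2 ^ (t + 1) ≤ j)
    (hjt0 : j.testBit t = false) :
    2048 * i + j ∈ blocks213_nine ++ blocks213_eight ++ blocks213_seven ++ blocks213_small := by
  have hlist : ∀ l, searchB213 174 (listedB213 l) t (2 ^ t) (2 ^ (t + 1)) 0 = true →
      2048 * i + j ∈ l := by
    intro l hl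
    have h1 := searchB213_spec hl hr (by omega) hi hit (by omega) hj hjt hjt0
    rwa [listedB213, forceB_eq, memB_eq] at h1
  simp only [List.mem_append]
  have hcase : t = 9 ∨ t = 8 ∨ t = 7 ∨ t < 7 := by omega
  rcases hcase with rfl | rfl | rfl | h7
  · exact Or.inl (Or.inl (Or.inl (hlist _ search213_nine)))
  · exact Or.inl (Or.inl (Or.inr (hlist _ search213_eight)))
  · exact Or.inl (Or.inr (hlist _ search213_seven))
  · have h1 := allB_spec search213_small h7
    rw [forceB_eq] at h1
    exact Or.inr (hlist _ h1)

/-- For each of the spaces found by the first search, one of the lines `⟨1, a⟩` with `a` in `rows213` has none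
of its colours, and no space through this line has different colours that all differ from those. -/
theorem exists_row213 {i j : ℕ} (hj : j < 2048)
    (h : 2048 * i + j ∈ blocks213_nine ++ blocks213_eight ++ blocks213_seven ++ blocks213_small) :
    ∃ a ∈ rows213, (blockMask213 174 i j).testBit (colour213 (lg213 a)) = false ∧
      noBlockB213 a (blockMask213 174 i j) = true := by
  have hdiv : Nat.div (2048 * i + j) 2048 = i := by
    change (2048 * i + j) / 2048 = i
    omega
  have hmod : Nat.mod (2048 * i + j) 2048 = j := by
    change (2048 * i + j) % 2048 = j
    omega
  have h1 := allListB_spec rowExists213 h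
  rw [rowExistsB213, hdiv, hmod, forceN_eq, forceN_eq, Nat.ble_eq] at h1
  obtain ⟨ha, hbit⟩ := firstRow213_spec (show firstRow213 rows213 (blockMask213 174 i j) ≠ 0 by omega)
  refine ⟨_, ha, hbit, ?_⟩
  have hsec : ∀ rows l, allListB (secondB213 rows) l = true → 2048 * i + j ∈ l →
      firstRow213 rows213 (blockMask213 174 i j) ∈ rows →
      noBlockB213 (firstRow213 rows213 (blockMask213 174 i j)) (blockMask213 174 i j) = true := by
    intro rows l hl hmem hrow
    have h2 := allListB_spec hl hmem
    rw [secondB213, hdiv, hmod, forceN_eq, forceN_eq, forceB_eq, forceB_eq, memB_eq.2 hrow] at h2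
    exact h2
  have hcase : firstRow213 rows213 (blockMask213 174 i j) ∈ [1126] ∨
      firstRow213 rows213 (blockMask213 174 i j) ∈ [38] ∨
      firstRow213 rows213 (blockMask213 174 i j) ∈ [454, 94, 6] := by
    generalize firstRow213 rows213 (blockMask213 174 i j) = a at ha
    simpa [rows213] using ha
  rcases hcase with hc | hc | hc
  · rw [List.append_assoc, List.append_assoc, List.mem_append] at h
    rcases h with h | h
    · exact hsec _ _ second213_first_row_nine h hc
    · rw [← List.append_assoc] at h
      exact hsec _ _ second213_first_row h hc
  · exact hsec _ _ second213_second_row h hc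
  · exact hsec _ _ second213_other_rows h hc

theorem not_admits_2_2_4_13 (C : Subgroup (GLin 13 2)) (hC : IsSingerSubgroup C) :
    ¬ Admits 2 2 4 13 (Subgroup.normalizer (C : Set (GLin 13 2))) := by
  intro hA
  obtain ⟨L, _, _, hL, S, hS, hscale, hfrob⟩ :=
    exists_field_design (by norm_num) hC Subgroup.le_normalizer hA
  have hI := hscale.twistInvariant_top (hfrob le_rfl)
  have hch : CharP L 2 := charP_of_injective_algebraMap' (ZMod 2) 2
  have hfin : Finite L := Nat.finite_of_card_ne_zero (by rw [hL]; norm_num)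
  have hfl : Module.Finite (ZMod 2) L := Module.Finite.of_finite
  obtain ⟨x, hx⟩ := exists_root_of_card (q := 2) hL (by norm_num) (m := 13) (by norm_num)
    (r := [1, 1, 0, 1, 1]) (by simp) fun R _ _ x h =>
      (isStep213 h).pow_card (by norm_num) (by norm_num) walkB213
  have hx0 : x ≠ 0 := by
    rintro rfl
    simp [ev] at hx
  have hlog := (isStep213 hx).isLogTable hL (by norm_num) hx0 walkB213
  have hcol : IsColouring (q := 2) ⊤ (tableCol x 8191 colour213) :=
    hlog.isColouring (frob := true) (D := dist213) (R := rep213) (by norm_num) hL (by norm_num)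
      fun c hc1 hc2 => by
        have h1 := allB_spec (allB_spec colourCheck213 (k := (c - 2) / 90) (by omega))
          (k := (c - 2) % 90) (by omega)
        have e : Nat.add (Nat.add (Nat.mul 90 ((c - 2) / 90)) ((c - 2) % 90)) 2 = c := by
          change 90 * ((c - 2) / 90) + (c - 2) % 90 + 2 = c
          omega
        rwa [e] at h1
  -- a block through a line `⟨1, a⟩`
  have hblock : ∀ a ∈ 174 :: rows213, ∃ B ∈ S, ∃ t < 10, ∃ i j, IsBlockBasis x B a i j ∧ 2 ^ t ≤ i ∧
      i < 2 ^ (t + 1) ∧ 2 ^ (t + 1) ≤ j ∧ j.testBit t = false := by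
    intro a ha
    obtain ⟨ha1, ha2, -⟩ := rows213_valid a ha
    have hr := isRatio_evc hlog ha1 (show 1 < 2 ^ 13 by norm_num) (by omega) one_ne_zero (by omega)
    rw [evc_one 2 one_lt_two, div_one] at hr
    obtain ⟨B, hB, h1, haB⟩ := hS.exists_block_pair (one_ne_zero (α := L)) (y := evc 2 x a)
      (IsRatio.ne_smul one_ne_zero (by rwa [div_one]))
    exact ⟨B, hB, exists_isBlockBasis hlog ha (hS.1 B hB) h1 haB⟩
  obtain ⟨B, hB, t, ht, i, j, hb, h1, h2, h3, h4⟩ := hblock 174 (by simp)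
  obtain ⟨a, ha, hbit, hno⟩ := exists_row213 hb.j_lt (mem_blocks213
    (hb.isRainbow hlog hcol hL hI hS hB fun c _ => Nat.zero_testBit c) ht h1 h2 hb.j_lt h3 h4)
  obtain ⟨B', hB', t', ht', i', j', hb', h1', h2', h3', h4'⟩ := hblock a (List.mem_cons_of_mem _ ha)
  -- the blocks have no common colour
  have hr' : IsRainbow (blockMask213 174 i j) (blockLogs213 a i' j') := by
    refine hb'.isRainbow hlog hcol hL hI hS hB' fun c hc => ?_
    rw [← Bool.not_eq_true, testBit_blockMask213]
    rintro ⟨d, hd, rfl⟩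
    have hsub := hcol.coloursOf_subset hI hS hB' hB hc (hb.mem_coloursOf_of_mem hlog hd)
    obtain ⟨d', hd', hdd⟩ := hb.mem_of_mem_coloursOf hlog hcol (hS.1 B hB)
      (hsub (hb'.mem_coloursOf_of_mem hlog (d := lg213 a) (by simp [blockLogs213])))
    rw [← Bool.not_eq_true, testBit_blockMask213] at hbit
    exact hbit ⟨d', hd', hdd⟩
  have hs := allB_spec hno ht'
  rw [forceB_eq] at hs
  have := searchB213_spec hs hr' (by omega) h1' h2' hb'.i_lt hb'.j_lt h3' h4'
  exact absurd this (by decide)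

end QSteiner

theorem mainTheorem4 :
    (∀ e : (Fin 7 → ZMod 2) ≃ₗ[ZMod 2] GaloisField 2 7,
      ¬ QSteiner.Admits 2 2 3 7 (QSteiner.galoisSubgroup e)) ∧
    (∀ C : Subgroup (QSteiner.GLin 8 2), QSteiner.IsSingerSubgroup C →
      ¬ QSteiner.Admits 2 3 4 8 C) ∧
    (∀ C : Subgroup (QSteiner.GLin 10 2), QSteiner.IsSingerSubgroup C →
      ¬ QSteiner.Admits 2 2 4 10 (Subgroup.normalizer (C : Set (QSteiner.GLin 10 2)))) ∧
    (∀ C : Subgroup (QSteiner.GLin 13 2), QSteiner.IsSingerSubgroup C →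
      ¬ QSteiner.Admits 2 2 4 13 (Subgroup.normalizer (C : Set (QSteiner.GLin 13 2)))) ∧
    (∀ C : Subgroup (QSteiner.GLin 10 2), QSteiner.IsSingerSubgroup C →
      ¬ QSteiner.Admits 2 3 4 10 (Subgroup.normalizer (C : Set (QSteiner.GLin 10 2)))) ∧
    (∀ C : Subgroup (QSteiner.GLin 7 3), QSteiner.IsSingerSubgroup C →
      ¬ QSteiner.Admits 3 2 3 7 C) ∧
    (∀ C : Subgroup (QSteiner.GLin 7 5), QSteiner.IsSingerSubgroup C →
      ¬ QSteiner.Admits 5 2 3 7 (Subgroup.normalizer (C : Set (QSteiner.GLin 7 5)))) := by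
  refine ⟨QSteiner.not_admits_2_2_3_7, ?_, ?_, ?_, ?_, QSteiner.not_admits_3_2_3_7,
    QSteiner.not_admits_5_2_3_7⟩
  · exact fun C hC => QSteiner.not_admits_2_3_4_8 C hC
  · rintro C - ⟨S, hS, -⟩
    exact QSteiner.not_isSteinerSystem_2_2_4_10 S hS
  · exact fun C hC => QSteiner.not_admits_2_2_4_13 C hC
  · exact fun C hC => QSteiner.not_admits_2_3_4_10 C hC
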